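/- Let $n=2m$ with $m\ge 1$, let $b,c\in\mathbb C$ with $c\neq 0$, and put $\tau=2(1+b/c)$. **Algebras.** For parameters $a,\epsilon,\tau$ the Birman–Wenzl–Murakami (BMW) algebra is generated by invertible $t_i$ and by $e_i$ ($1\le i\le n-1$) with relations $t_it_{j}t_i=t_{j}t_it_{j}$, $e_ie_{j}e_i=e_i$, $e_it_je_i=a^{-1}e_i$, $t_jt_ie_j=e_it_jt_i=e_ie_j$ for $|i-j|=1$; $t_it_j=t_jt_i$, $e_ie_j=e_je_i$, $t_ie_j=e_jt_i$ for $|i-j|\ge2$; $t_i-t_i^{-1}=\epsilon(1-e_i)$, $e_it_i=t_ie_i=ae_i$, $e_i^2=\tau e_i$. The Brauer algebra with loop weight $\tau$ has generators $t_i,e_i$ and the same relations with $a=1$ and with the skein relation replaced by $t_i^2=1$. **(1) Rational limit.** Put $q=e^{hb}$, $p=e^{hc}$, $a=p^{-1}q^{-2}$, $\epsilon=p-p^{-1}$, $\tau_h=1-(a-a^{-1})/\epsilon$. As $h\to0$, $h\ne0$, one has $a\to1$, $\epsilon\to0$, $\tau_h\to\tau$. For every number of strands, the BMW algebra with parameters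 $(1,0,\tau)$ is isomorphic to the Brauer algebra with loop weight $\tau$, with $t_i\mapsto t_i$, $e_i\mapsto e_i$; and if representations of the BMW algebras with parameters $(a,\epsilon,\tau_h)$ in a Hausdorff topological algebra are such that the images of all $t_i,e_i$ converge as $h\to 0$, then the limits define a representation of the Brauer algebra. The left ideal of the Brauer algebra on $n$ strands generated by $\alpha=e_1e_3\cdots e_{n-1}$ is isomorphic, as a module, to the space with basis the link patterns (perfect matchings) of $\{1,\dots,n\}$, with $\alpha$ corresponding to the pattern linking $2k-1$ to $2k$. There $t_i$ exchanges the points $i,i+1$. If $i,i+1$ are linked in $\pi$ then $e_i\pi=\tau\pi$; otherwise $e_i\pi$ is the pattern obtained by linking $i$ to $i+1$ and linking their former partners to each other. **(2) Vanishing conditions.** Property (P) for a polynomial $\psi(z_1,\dots,z_n)$ says that $\psi$ vanishes whenever $z_j=q^2z_i$ and $z_k=q^4z_i$ for some integers $i<j<k<i+n$, where $z_{i+n}=a^{-2}z_i$. Property (P') for $\psi(u_1,\dots,u_n)$ says that $\psi$ vanishes whenever $u_j=u_i+b$ and $u_k=u_i+2b$ for some integers $i<j<k<i+n$, where $u_{i+n}=u_i+c+2b$.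 A point $u$ satisfies the condition of (P') if and only if $z=(e^{2hu_i})_i$ satisfies the condition of (P) with $q=e^{hb}$, $p=e^{hc}$ for all sufficiently small $h\neq0$. If $\psi_h$ has (P) for all sufficiently small $h\ne0$ and, for some scalars $g(h)$, $g(h)\psi_h(e^{2hu_1},\dots,e^{2hu_n})\to\varphi(u)$ for all $u$ as $h\to0$, with $\varphi$ a polynomial, then $\varphi$ has (P'). Moreover, (P') means vanishing whenever $(u_i,u_j,u_k)$ is of one of the forms $(u,u+b,u+2b)$, $(u,u+c,u+c+b)$, $(u,u+b,u+c+b)$ for some $1\le i<j<k\le n$. **Notation.** $\mathcal M_n$ is the space of polynomials of minimal total degree with (P'), together with $0$. $b_{ij}=u_i-u_j+b$ for all integers $i,j$. $k_{i\,i+1}$ exchanges $u_i$ and $u_{i+1}$, and "symmetric" means invariant under it. Operators on rational functions act to the right (in a product the leftmost factor acts first). For $1\le i\le n-1$ define $$\bar t_i+1=b_{i\,i+1}^{-1}(1-k_{i\,i+1})\frac{u_i-u_{i+1}+c}{u_i-u_{i+1}}\,b_{i\,i+1},\qquad \bar e_i=\frac1c\,b_{i+1\,i}\,\frac{u_{i+1}-u_i+c}{u_{i+1}-u_i}(1+k_{i\,i+1}).$$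 **(3) Decomposition.** Suppose moreover $b\neq0$, $b\ne c$, $b+c\ne0$. The nonzero elements of $\mathcal M_n$ have degree $n(\frac n2-1)$. For every $1\le i\le n-1$, every $\psi\in\mathcal M_n$ can be written in exactly one way as $\psi=S_0+b_{i\,i+1}\bigl(S_1+(u_i-u_{i+1}+c)S_2\bigr)$ with $S_0,S_1,S_2$ symmetric polynomials and $S_0$, $b_{i\,i+1}S_1$, $b_{i\,i+1}(u_i-u_{i+1}+c)S_2$ all in $\mathcal M_n$. This gives $\mathcal M_n=\mathcal M_n^0\oplus\mathcal M_n^1\oplus\mathcal M_n^2$. The elements of $\mathcal M_n$ divisible by $b_{i\,i+1}$ have such an expression with $S_0=0$, and $\bar t_i$ maps them to elements of $\mathcal M_n$ divisible by $b_{i\,i+1}$. **(4) Projectors.** On all rational functions, $\bar t_i-1=-b_{i\,i+1}^{-1}\frac{u_{i+1}-u_i+c}{u_{i+1}-u_i}(1+k_{i\,i+1})b_{i\,i+1}$ and $\bar t_i^2=1$; also $\tau-\bar e_i=\frac1c(1-k_{i\,i+1})\frac{u_i-u_{i+1}+c}{u_i-u_{i+1}}b_{i\,i+1}$ and $\bar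 e_i^2=\tau\bar e_i$, and the image of $\bar e_i$ consists of symmetric functions. For symmetric polynomials $S_0,S_1,S_2$: on $b_{i\,i+1}(S_1+(u_i-u_{i+1}+c)S_2)$ the operator $\bar t_i+1$ gives $2b_{i\,i+1}(u_i-u_{i+1}+c)S_2$ and $\bar t_i-1$ gives $-2b_{i\,i+1}S_1$; on $S_0+b_{i\,i+1}(u_i-u_{i+1}+c)S_2$ the operator $\bar e_i$ gives $\tau S_0$ and $\tau-\bar e_i$ gives $\tau b_{i\,i+1}(u_i-u_{i+1}+c)S_2$. **(5) Dual polynomials.** Let $\rho$ be the link pattern linking $k$ to $k+\frac n2$, and $\bar\rho=\prod_{i=1}^n\prod_{0<k<n/2}b_{i\,i+k}$. There is exactly one family of polynomials $\bar\pi$, indexed by the link patterns $\pi$, that has the value $\bar\rho$ at $\rho$ and satisfies $\overline{t_i\pi}=\bar\pi\,\bar t_i$ whenever $i,i+1$ are not linked in $\pi$ ($1\le i\le n-1$). In that case $b_{i\,i+1}$ divides $\bar\pi$. If $b\neq0$, $b\ne c$, $b+c\ne0$, the $\bar\pi$ form a basis of $\mathcal M_n$, and $\bar\pi\in\mathcal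 M_n^0\oplus\mathcal M_n^2$ (for the index $i$) if $i,i+1$ are linked in $\pi$. **(6) Duality relation.** Let $\pi_0=t_2t_3\cdots t_{n/2}\rho$, the pattern linking $1$ to $2$ and $k$ to $k+\frac n2-1$ for $3\le k\le\frac n2+1$. Then $\bar\pi_0=\bar\rho\,\bar t_{n/2}\cdots\bar t_3\bar t_2$ and $$\bar\pi_0\,\bar e_1=\sum_\pi (e_1)_{\pi_0\pi}\,\bar\pi ,$$ where $(e_1)_{\pi_0\pi}$ are the matrix elements of $e_1$ in the basis of link patterns. Equivalently, $$\bar\rho\,\bar t_{n/2}\cdots\bar t_2(\tau-\bar e_1)+\sum_{i=2}^{n/2}\bar\rho\,\bar t_{n/2}\cdots\bar t_{i+1}\bar t_{i-1}\cdots\bar t_2(1+\bar t_1)=0 .$$ Moreover, $$S_n=\bar\rho\Bigl(\bar t_{n/2}\cdots\bar t_2+\sum_{i=2}^{n/2}\bar t_{n/2}\cdots\bar t_{i+1}\bar t_{i-1}\cdots\bar t_2\,c\,b_{12}^{-1}\Bigr)=\bar\rho_{n-2}\Bigl(\prod_{k=3}^{n/2+1}b_{1k}b_{2k}\Bigr)\Bigl(\prod_{k=n/2+2}^{n}b_{k\,n+1}b_{k\,n+2}\Bigr),$$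 where $\bar\rho_{n-2}=\prod_{i}\prod_{0<k<n/2-1}b_{i\,i+k}$ is formed with the $n-2$ variables $u_3,\dots,u_n$, renumbered consecutively and continued with the same shift $c+2b$; this polynomial is symmetric in $u_1,u_2$. -/

import Mathlib

open Filter Topology

universe u

noncomputable section

namespace BrauerLimit

/-! ### The two algebras, by generators and relations

The generators are numbered by `Fin (n - 1)`, starting from `0`. -/

/-- `|i - j| = 1`. -/
def Adj {N : ℕ} (i j : Fin N) : Prop := i.val + 1 = j.val ∨ j.val + 1 = i.val

/-- `|i - j| ≥ 2`. -/
def Far {N : ℕ} (i j : Fin N) : Prop := i.val + 2 ≤ j.val ∨ j.val + 2 ≤ i.val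

/-- Generators `t_i`, `t_i⁻¹`, `e_i` of the Birman-Wenzl-Murakami algebra. -/
inductive BMWGen (n : ℕ) : Type
  | t (i : Fin (n - 1)) : BMWGen n
  | tinv (i : Fin (n - 1)) : BMWGen n
  | e (i : Fin (n - 1)) : BMWGen n

namespace BMWGen
variable {n : ℕ}
/-- The free generator `t_i`. -/
abbrev T (i : Fin (n - 1)) : FreeAlgebra ℂ (BMWGen n) := FreeAlgebra.ι ℂ (BMWGen.t i)
/-- The free generator `t_i⁻¹`. -/
abbrev T' (i : Fin (n - 1)) : FreeAlgebra ℂ (BMWGen n) := FreeAlgebra.ι ℂ (BMWGen.tinv i)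
/-- The free generator `e_i`. -/
abbrev E (i : Fin (n - 1)) : FreeAlgebra ℂ (BMWGen n) := FreeAlgebra.ι ℂ (BMWGen.e i)
end BMWGen

open BMWGen in
/-- The relations of the Birman-Wenzl-Murakami algebra with parameters `a, ε, τ`. -/
inductive BMWRel (n : ℕ) (a ε τ : ℂ) :
    FreeAlgebra ℂ (BMWGen n) → FreeAlgebra ℂ (BMWGen n) → Prop
  | mul_inv (i) : BMWRel n a ε τ (T i * T' i) 1
  | inv_mul (i) : BMWRel n a ε τ (T' i * T i) 1
  | braid (i j) : Adj i j → BMWRel n a ε τ (T i * T j * T i) (T j * T i * T j)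
  | tt_comm (i j) : Far i j → BMWRel n a ε τ (T i * T j) (T j * T i)
  | ee_comm (i j) : Far i j → BMWRel n a ε τ (E i * E j) (E j * E i)
  | te_comm (i j) : Far i j → BMWRel n a ε τ (T i * E j) (E j * T i)
  | eee (i j) : Adj i j → BMWRel n a ε τ (E i * E j * E i) (E i)
  | skein (i) : BMWRel n a ε τ (T i - T' i) (ε • (1 - E i))
  | e_mul_t (i) : BMWRel n a ε τ (E i * T i) (a • E i)
  | t_mul_e (i) : BMWRel n a ε τ (T i * E i) (a • E i)
  | e_sq (i) : BMWRel n a ε τ (E i * E i) (τ • E i)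
  | ete (i j) : Adj i j → BMWRel n a ε τ (E i * T j * E i) (a⁻¹ • E i)
  | tte (i j) : Adj i j → BMWRel n a ε τ (T j * T i * E j) (E i * E j)
  | ett (i j) : Adj i j → BMWRel n a ε τ (E i * T j * T i) (E i * E j)

/-- The Birman-Wenzl-Murakami algebra on `n` strands with parameters `a, ε, τ`. -/
abbrev BMW (n : ℕ) (a ε τ : ℂ) : Type := RingQuot (BMWRel n a ε τ)

/-- The generator `t_i` of the Birman-Wenzl-Murakami algebra. -/
def BMW.t {n : ℕ} (a ε τ : ℂ) (i : Fin (n - 1)) : BMW n a ε τ :=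
  RingQuot.mkAlgHom ℂ (BMWRel n a ε τ) (BMWGen.T i)

/-- The generator `e_i` of the Birman-Wenzl-Murakami algebra. -/
def BMW.e {n : ℕ} (a ε τ : ℂ) (i : Fin (n - 1)) : BMW n a ε τ :=
  RingQuot.mkAlgHom ℂ (BMWRel n a ε τ) (BMWGen.E i)

/-- `a = p⁻¹ q⁻²`. -/
def parA (q p : ℂ) : ℂ := p⁻¹ * (q ^ 2)⁻¹

/-- `ε = p - p⁻¹`. -/
def parEps (p : ℂ) : ℂ := p - p⁻¹

/-- `τ = 1 - (a - a⁻¹) / ε`. -/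
def parTau (q p : ℂ) : ℂ := 1 - (parA q p - (parA q p)⁻¹) / parEps p

/-- Generators `t_i`, `e_i` of the Brauer algebra. -/
inductive BrauerGen (n : ℕ) : Type
  | t (i : Fin (n - 1)) : BrauerGen n
  | e (i : Fin (n - 1)) : BrauerGen n

namespace BrauerGen
variable {n : ℕ}
/-- The free generator `t_i`. -/
abbrev T (i : Fin (n - 1)) : FreeAlgebra ℂ (BrauerGen n) := FreeAlgebra.ι ℂ (BrauerGen.t i)
/-- The free generator `e_i`. -/
abbrev E (i : Fin (n - 1)) : FreeAlgebra ℂ (BrauerGen n) := FreeAlgebra.ι ℂ (BrauerGen.e i)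
end BrauerGen

open BrauerGen in
/-- The relations of the Brauer algebra with loop weight `τ`. -/
inductive BrauerRel (n : ℕ) (τ : ℂ) :
    FreeAlgebra ℂ (BrauerGen n) → FreeAlgebra ℂ (BrauerGen n) → Prop
  | braid (i j) : Adj i j → BrauerRel n τ (T i * T j * T i) (T j * T i * T j)
  | tt_comm (i j) : Far i j → BrauerRel n τ (T i * T j) (T j * T i)
  | ee_comm (i j) : Far i j → BrauerRel n τ (E i * E j) (E j * E i)
  | te_comm (i j) : Far i j → BrauerRel n τ (T i * E j) (E j * T i)
  | eee (i j) : Adj i j → BrauerRel n τ (E i * E j * E i) (E i)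
  | t_sq (i) : BrauerRel n τ (T i * T i) 1
  | e_mul_t (i) : BrauerRel n τ (E i * T i) (E i)
  | t_mul_e (i) : BrauerRel n τ (T i * E i) (E i)
  | e_sq (i) : BrauerRel n τ (E i * E i) (τ • E i)
  | ete (i j) : Adj i j → BrauerRel n τ (E i * T j * E i) (E i)
  | tte (i j) : Adj i j → BrauerRel n τ (T j * T i * E j) (E i * E j)
  | ett (i j) : Adj i j → BrauerRel n τ (E i * T j * T i) (E i * E j)

/-- The Brauer algebra on `n` strands with loop weight `τ`. -/
abbrev Brauer (n : ℕ) (τ : ℂ) : Type := RingQuot (BrauerRel n τ)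

/-- The generator `t_i` of the Brauer algebra. -/
def Brauer.t {n : ℕ} (τ : ℂ) (i : Fin (n - 1)) : Brauer n τ :=
  RingQuot.mkAlgHom ℂ (BrauerRel n τ) (BrauerGen.T i)

/-- The generator `e_i` of the Brauer algebra. -/
def Brauer.e {n : ℕ} (τ : ℂ) (i : Fin (n - 1)) : Brauer n τ :=
  RingQuot.mkAlgHom ℂ (BrauerRel n τ) (BrauerGen.E i)

/-- The element `α = e_1 e_3 ⋯ e_{n-1}` (in the numbering from `0`: the even indices). -/
def Brauer.alpha (n : ℕ) (τ : ℂ) : Brauer n τ :=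
  (((List.finRange (n - 1)).filter fun i => i.val % 2 = 0).map (Brauer.e τ)).prod

/-! ### Link patterns

`n = 2 m` points `0, …, 2 m - 1`; the generator with index `i` acts at the points `i, i + 1`. -/

/-- The left point `i` of the generator with index `i`. -/
def lo {m : ℕ} (i : Fin (2 * m - 1)) : Fin (2 * m) := ⟨i.val, by omega⟩

/-- The right point `i + 1` of the generator with index `i`. -/
def hi {m : ℕ} (i : Fin (2 * m - 1)) : Fin (2 * m) := ⟨i.val + 1, by omega⟩

/-- Link patterns: fixed-point-free involutions of the `2 m` points. -/
abbrev Pattern (m : ℕ) : Type :=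
  {f : Fin (2 * m) → Fin (2 * m) // (∀ x, f (f x) = x) ∧ ∀ x, f x ≠ x}

/-- Relabelling the points of a link pattern. -/
def Pattern.conj {m : ℕ} (g : Equiv.Perm (Fin (2 * m))) (f : Pattern m) : Pattern m :=
  ⟨fun x => g (f.1 (g.symm x)), fun x => by simp [f.2.1], fun x h =>
    f.2.2 (g.symm x) (by rw [Equiv.eq_symm_apply]; exact h)⟩

/-- The action of `t_i`: the points `i` and `i + 1` are exchanged. -/
def Pattern.actT {m : ℕ} (i : Fin (2 * m - 1)) (f : Pattern m) : Pattern m :=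
  f.conj (Equiv.swap (lo i) (hi i))

/-- The link pattern of `e_i f`: the points `i`, `i + 1` are linked to each other, their former
partners are linked to each other, and the other links are kept
(`f` is unchanged if `i` and `i + 1` are already linked). -/
def Pattern.actE {m : ℕ} (i : Fin (2 * m - 1)) (f : Pattern m) : Pattern m :=
  f.conj (Equiv.swap (hi i) (f.1 (lo i)))

/-- The maximally crossed pattern `ρ`: `k` is linked to `k + m`. -/
def Pattern.rho (m : ℕ) : Pattern m :=
  ⟨fun x => ⟨(x.val + m) % (2 * m), Nat.mod_lt _ (by have := x.isLt; omega)⟩, fun x => by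
    have := x.isLt
    ext
    simp only
    rcases lt_or_ge x.val m with h | h
    · rw [Nat.mod_eq_of_lt (by omega : x.val + m < 2 * m),
        show x.val + m + m = x.val + 2 * m by omega, Nat.add_mod_right,
        Nat.mod_eq_of_lt this]
    · rw [show x.val + m = (x.val - m) + 2 * m by omega, Nat.add_mod_right,
        Nat.mod_eq_of_lt (by omega : x.val - m < 2 * m),
        Nat.mod_eq_of_lt (by omega : x.val - m + m < 2 * m)]
      omega, fun x h => by
    have := x.isLt
    have h' := congrArg Fin.val h
    simp only at h'
    rcases lt_or_ge x.val m with h1 | h1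
    · rw [Nat.mod_eq_of_lt (by omega : x.val + m < 2 * m)] at h'
      omega
    · rw [show x.val + m = (x.val - m) + 2 * m by omega, Nat.add_mod_right,
        Nat.mod_eq_of_lt (by omega : x.val - m < 2 * m)] at h'
      omega⟩

/-- The pattern of `α`: `2 k` is linked to `2 k + 1` (in the numbering from `0`). -/
def Pattern.alpha (m : ℕ) : Pattern m :=
  ⟨fun x => if h : x.val % 2 = 0 then ⟨x.val + 1, by omega⟩ else ⟨x.val - 1, by omega⟩,
    fun x => by
      have := x.isLt
      ext
      by_cases h : x.val % 2 = 0
      · have h2 : (x.val + 1) % 2 ≠ 0 := by omega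
        simp [h, h2]
      · have h2 : (x.val - 1) % 2 = 0 := by omega
        simp [h, h2]
        omega,
    fun x hx => by
      have := congrArg Fin.val hx
      by_cases h : x.val % 2 = 0
      · simp [h] at this
      · simp [h] at this
        omega⟩

/-- The matrix of `t_i` in the basis of link patterns. -/
def matT {m : ℕ} (i : Fin (2 * m - 1)) : Matrix (Pattern m) (Pattern m) ℂ :=
  Matrix.of fun σ π => if π.actT i = σ then 1 else 0

/-- The matrix of `e_i` in the basis of link patterns; a closed loop has weight `τ`. -/
def matE {m : ℕ} (τ : ℂ) (i : Fin (2 * m - 1)) : Matrix (Pattern m) (Pattern m) ℂ :=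
  Matrix.of fun σ π => if π.actE i = σ then (if π.1 (lo i) = hi i then τ else 1) else 0

/-! ### Cyclic identifications and the vanishing conditions -/

/-- The finite sequence `x` of length `n`, continued by zero. -/
def toSeq {R : Type*} [Zero R] {n : ℕ} (x : Fin n → R) (k : ℕ) : R :=
  if h : k < n then x ⟨k, h⟩ else 0

/-- The two-sided sequence with `u_{j + n} = u_j + s` and with `u_k = x k` for `0 ≤ k < n`. -/
def addExt {R : Type*} [Ring R] (n : ℕ) (s : R) (x : ℕ → R) (j : ℤ) : R :=
  x (j % (n : ℤ)).toNat + ((j / (n : ℤ) : ℤ) : R) * s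

/-- The two-sided sequence with `z_{j + n} = s z_j` and with `z_k = x k` for `0 ≤ k < n`. -/
def mulExt (n : ℕ) (s : ℂ) (x : ℕ → ℂ) (j : ℤ) : ℂ :=
  x (j % (n : ℤ)).toNat * s ^ (j / (n : ℤ))

/-- Points at which (P) requires vanishing: `z_j = q² z_i`, `z_k = q⁴ z_i` for some cyclically
ordered `i, j, k`, where `z_{i + n} = a⁻² z_i`. -/
def IsMulWheel (n : ℕ) (q p : ℂ) (x : Fin n → ℂ) : Prop :=
  ∃ i j k : ℤ, i < j ∧ j < k ∧ k < i + n ∧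
    mulExt n ((parA q p ^ 2)⁻¹) (toSeq x) j = q ^ 2 * mulExt n ((parA q p ^ 2)⁻¹) (toSeq x) i ∧
    mulExt n ((parA q p ^ 2)⁻¹) (toSeq x) k = q ^ 4 * mulExt n ((parA q p ^ 2)⁻¹) (toSeq x) i

/-- The property (P). -/
def PropP (n : ℕ) (q p : ℂ) (ψ : MvPolynomial (Fin n) ℂ) : Prop :=
  ∀ x, IsMulWheel n q p x → MvPolynomial.eval x ψ = 0

/-- Points at which (P') requires vanishing: `u_j = u_i + b`, `u_k = u_i + 2 b` for some cyclically
ordered `i, j, k`, where `u_{i + n} = u_i + c + 2 b`. -/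
def IsAddWheel (n : ℕ) (b c : ℂ) (x : Fin n → ℂ) : Prop :=
  ∃ i j k : ℤ, i < j ∧ j < k ∧ k < i + n ∧
    addExt n (c + 2 * b) (toSeq x) j = addExt n (c + 2 * b) (toSeq x) i + b ∧
    addExt n (c + 2 * b) (toSeq x) k = addExt n (c + 2 * b) (toSeq x) i + 2 * b

/-- The property (P'). -/
def PropP' (n : ℕ) (b c : ℂ) (ψ : MvPolynomial (Fin n) ℂ) : Prop :=
  ∀ x, IsAddWheel n b c x → MvPolynomial.eval x ψ = 0

/-- The degrees of the nonzero polynomials with the property (P'). -/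
def degrees (n : ℕ) (b c : ℂ) : Set ℕ :=
  {d | ∃ ψ : MvPolynomial (Fin n) ℂ, PropP' n b c ψ ∧ ψ ≠ 0 ∧ ψ.totalDegree = d}

/-- The space `M_n` of the polynomials of minimal degree with the property (P')
(together with zero). -/
def spaceM (n : ℕ) (b c : ℂ) : Submodule ℂ (MvPolynomial (Fin n) ℂ) where
  carrier := {ψ | PropP' n b c ψ ∧ ψ.totalDegree ≤ sInf (degrees n b c)}
  add_mem' := fun {f g} hf hg => ⟨fun x hx => by rw [map_add, hf.1 x hx, hg.1 x hx, add_zero],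
    (MvPolynomial.totalDegree_add f g).trans (max_le hf.2 hg.2)⟩
  zero_mem' := ⟨fun x _ => map_zero _, by simp⟩
  smul_mem' := fun r f hf => ⟨fun x hx => by rw [MvPolynomial.smul_eval, hf.1 x hx, mul_zero],
    (MvPolynomial.totalDegree_smul_le r f).trans hf.2⟩

/-! ### Polynomials, rational functions and the operators -/

/-- Polynomials in `u_0, …, u_{2 m - 1}`. -/
abbrev Poly (m : ℕ) : Type := MvPolynomial (Fin (2 * m)) ℂ

/-- Rational functions in `u_0, …, u_{2 m - 1}`. -/
abbrev RatFun (m : ℕ) : Type := FractionRing (Poly m)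

/-- A polynomial as a rational function. -/
abbrev toRat {m : ℕ} (ψ : Poly m) : RatFun m := algebraMap (Poly m) (RatFun m) ψ

/-- The exchange `k_{i i+1}` of the variables `u_i, u_{i+1}` in polynomials. -/
def swapPoly {m : ℕ} (i : Fin (2 * m - 1)) : Poly m ≃ₐ[ℂ] Poly m :=
  MvPolynomial.renameEquiv ℂ (Equiv.swap (lo i) (hi i))

/-- The exchange `k_{i i+1}` of the variables `u_i, u_{i+1}` in rational functions. -/
def swapRat {m : ℕ} (i : Fin (2 * m - 1)) : RatFun m ≃+* RatFun m :=
  IsFractionRing.ringEquivOfRingEquiv (swapPoly i).toRingEquiv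

/-- The difference `u_i - u_{i+1}`. -/
def dP {m : ℕ} (i : Fin (2 * m - 1)) : Poly m := MvPolynomial.X (lo i) - MvPolynomial.X (hi i)

/-- `b_{i i+1} = u_i - u_{i+1} + b`. -/
def bP {m : ℕ} (b : ℂ) (i : Fin (2 * m - 1)) : Poly m := dP i + MvPolynomial.C b

/-- `u_i - u_{i+1} + c`. -/
def cP {m : ℕ} (c : ℂ) (i : Fin (2 * m - 1)) : Poly m := dP i + MvPolynomial.C c

/-- `b_{i+1 i} = u_{i+1} - u_i + b`. -/
def bP' {m : ℕ} (b : ℂ) (i : Fin (2 * m - 1)) : Poly m := -dP i + MvPolynomial.C b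

/-- `u_{i+1} - u_i + c`. -/
def cP' {m : ℕ} (c : ℂ) (i : Fin (2 * m - 1)) : Poly m := -dP i + MvPolynomial.C c

/-- The operator `t̄_i + 1`, which acts to the right:
`b_{i i+1}⁻¹ (1 - k_{i i+1}) ((u_i - u_{i+1} + c) / (u_i - u_{i+1})) b_{i i+1}`. -/
def tPlus {m : ℕ} (b c : ℂ) (i : Fin (2 * m - 1)) (f : RatFun m) : RatFun m :=
  (f / toRat (bP b i) - swapRat i (f / toRat (bP b i))) *
    (toRat (cP c i) / toRat (dP i)) * toRat (bP b i)

/-- The operator `t̄_i - 1`, which acts to the right: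
`- b_{i i+1}⁻¹ ((u_{i+1} - u_i + c) / (u_{i+1} - u_i)) (1 + k_{i i+1}) b_{i i+1}`. -/
def tMinus {m : ℕ} (b c : ℂ) (i : Fin (2 * m - 1)) (f : RatFun m) : RatFun m :=
  -((f / toRat (bP b i) * (toRat (cP' c i) / toRat (-dP i)) +
    swapRat i (f / toRat (bP b i) * (toRat (cP' c i) / toRat (-dP i)))) * toRat (bP b i))

/-- The operator `t̄_i`. -/
def tBar {m : ℕ} (b c : ℂ) (i : Fin (2 * m - 1)) (f : RatFun m) : RatFun m :=
  tPlus b c i f - f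

/-- The operator `ē_i`, which acts to the right:
`c⁻¹ b_{i+1 i} ((u_{i+1} - u_i + c) / (u_{i+1} - u_i)) (1 + k_{i i+1})`. -/
def eBar {m : ℕ} (b c : ℂ) (i : Fin (2 * m - 1)) (f : RatFun m) : RatFun m :=
  c⁻¹ • (f * toRat (bP' b i) * (toRat (cP' c i) / toRat (-dP i)) +
    swapRat i (f * toRat (bP' b i) * (toRat (cP' c i) / toRat (-dP i))))

/-- The operator `τ - ē_i`, which acts to the right:
`c⁻¹ (1 - k_{i i+1}) ((u_i - u_{i+1} + c) / (u_i - u_{i+1})) b_{i i+1}`. -/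
def eBarCompl {m : ℕ} (b c : ℂ) (i : Fin (2 * m - 1)) (f : RatFun m) : RatFun m :=
  c⁻¹ • ((f - swapRat i f) * (toRat (cP c i) / toRat (dP i)) * toRat (bP b i))

/-- `f t̄_{i_1} t̄_{i_2} ⋯` for the list `i_1, i_2, …`. -/
def tWord {m : ℕ} (b c : ℂ) (l : List (Fin (2 * m - 1))) (f : RatFun m) : RatFun m :=
  l.foldl (fun g i => tBar b c i g) f

/-! ### The polynomials of the duality relation -/

/-- The sequence of the variables `u_0, …, u_{2 m - 1}`. -/
def uSeq (m : ℕ) : ℕ → Poly m := toSeq MvPolynomial.X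

/-- `b_{ij} = u_i - u_j + b` for the sequence with `u_{i + 2 N} = u_i + c + 2 b` that starts
with `x 0, …, x (2 N - 1)`. -/
def bExt {m : ℕ} (N : ℕ) (b c : ℂ) (x : ℕ → Poly m) (i j : ℤ) : Poly m :=
  addExt (2 * N) (MvPolynomial.C (c + 2 * b)) x i - addExt (2 * N) (MvPolynomial.C (c + 2 * b)) x j
    + MvPolynomial.C b

/-- The maximally crossed polynomial `∏_i ∏_{0 < k < N} b_{i i+k}` in the `2 N` variables
`x 0, …, x (2 N - 1)`. -/
def crossed {m : ℕ} (N : ℕ) (b c : ℂ) (x : ℕ → Poly m) : Poly m :=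
  ∏ i ∈ Finset.range (2 * N), ∏ k ∈ Finset.Ico 1 N, bExt N b c x i (i + k)

/-- The polynomial `ρ̄`. -/
def rhoBar (m : ℕ) (b c : ℂ) : Poly m := crossed m b c (uSeq m)

/-- The polynomials dual to the link patterns: the family starts with `ρ̄` at `ρ`, and
`t̄_i` takes the polynomial of `π` to the one of `t_i π` if `i` and `i + 1` are not linked in `π`. -/
def IsDualFamily (m : ℕ) (b c : ℂ) (F : Pattern m → Poly m) : Prop :=
  F (Pattern.rho m) = rhoBar m b c ∧
    ∀ (i : Fin (2 * m - 1)) (π : Pattern m), π.1 (lo i) ≠ hi i →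
      tBar b c i (toRat (F π)) = toRat (F (π.actT i))

/-- The indices of the generators `t_{n/2}, …, t_3, t_2`, in this order
(in the numbering from `0`: `m - 1, …, 2, 1`). -/
def descList (m : ℕ) : List (Fin (2 * m - 1)) :=
  (List.finRange (2 * m - 1)).reverse.filter fun j => 1 ≤ j.val ∧ j.val < m

/-- The link pattern `π_0 = t_2 t_3 ⋯ t_{n/2} ρ`. -/
def piZero (m : ℕ) : Pattern m :=
  (descList m).foldl (fun π i => π.actT i) (Pattern.rho m)

/-- `ρ̄ t̄_{n/2} ⋯ t̄_3 t̄_2`. -/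
def fullWord (m : ℕ) (b c : ℂ) : RatFun m := tWord b c (descList m) (toRat (rhoBar m b c))

/-- `∑_{i = 2}^{n/2} ρ̄ t̄_{n/2} ⋯ t̄_{i+1} t̄_{i-1} ⋯ t̄_2`. -/
def omitSum (m : ℕ) (b c : ℂ) : RatFun m :=
  ((descList m).map fun i => tWord b c ((descList m).erase i) (toRat (rhoBar m b c))).sum

/-- `S_n`; the argument `o` is the index of the first generator. -/
def polyS (m : ℕ) (b c : ℂ) (o : Fin (2 * m - 1)) : RatFun m :=
  fullWord m b c + c • (omitSum m b c / toRat (bP b o))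

/-- The factorized expression of `S_n`. In the numbering of the variables from `1` it is
`ρ̄_{n-2}(u_3, …, u_n) ∏_{k=3}^{n/2+1} b_{1k} b_{2k} ∏_{k=n/2+2}^{n} b_{k n+1} b_{k n+2}`. -/
def factS (m : ℕ) (b c : ℂ) : Poly m :=
  crossed (m - 1) b c (fun k => uSeq m (k + 2)) *
    (∏ k ∈ Finset.Icc 2 m, bExt m b c (uSeq m) 0 k * bExt m b c (uSeq m) 1 k) *
    ∏ k ∈ Finset.Ico (m + 1) (2 * m),
      bExt m b c (uSeq m) k (2 * m) * bExt m b c (uSeq m) k (2 * m + 1)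

end BrauerLimit

end

/-! Transport. On multiples of b_{i i+1} the operator t̄_i is a divided difference: it sends
polynomials to polynomials, does not raise the degree, acts on top homogeneous parts as the plain
exchange of u_i and u_{i+1}, and preserves (P'). The relation `Step` expresses this without
denominators (`Step.pv`, `Step.homogeneousComponent_eq`).

Minimal degree. Let t̄_1, t̄_2, ... carry the first variable of a polynomial with (P') to the right.
If this stops, at a polynomial not divisible by b_{i i+1}, then the restriction of that polynomial
to u_{i+1} = u_i + b is nonzero; (P') forces two linear factors of it for each remaining variable,
and the coefficients of the cofactor have (P') in n - 2 variables. If it never stops, the top part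
is divisible by every u_1 - u_k, so the degree in u_1 is at least n - 1, and the leading coefficient
in u_1 has (P') in n - 1 variables. Induction gives the bound ⌊(n-1)²/2⌋ (`minDeg_le`), which for n
= 2m equals n(m-1), the degree of ρ̄. In that degree the second case is impossible for even n
(`eq_zero_of_chain`), and in the first case the cofactor does not involve u_i
(`exists_restriction`).

Dual polynomials. The t̄_i are involutions that satisfy the braid and the commutation relations
(`tBar_braid`, `tBar_comm`). Every link pattern descends to ρ by exchanges that decrease a sum of
squared link lengths. The value obtained along such a path is independent of the path by a diamond
argument (`dualRat_eq_of_desc`). The one confluence not covered by the relations, where t_j and t_k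
act equally on a pattern, is reduced to ρ, where t̄_j and t̄_{j+m} give the same image of ρ̄
(`exists_step_rhoBar`). The values are polynomials because b_{xy} divides them for all x < y in an
interval without inner links (`exists_dualPoly`).

Basis. If i, i+1 are linked in π, the restriction of π̄ to u_{i+1} = u_i + b is, up to the forced
factors, the dual polynomial of the pattern with this link removed (`restr_dualPoly_ins`). Combined
with transport, this gives spanning and linear independence by induction on m (`mem_span_dualSucc`,
`linearIndependent_dualSucc`).

Decomposition. A multiple of b_{i i+1} splits into the two eigenparts of t̄_i. If i, i+1 are linked,
the square of the top part of π̄ is a constant times the product of the differences over unlinked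
pairs, and this makes the top part symmetric; the antisymmetric part of π̄ then has lower degree, so
a correction by b_{i i+1}(u_i - u_{i+1} + c)S_2 stays in the space. Since the π̄ span, all elements
decompose; a second decomposition would give an element below the minimal degree.

Duality. Products `hookProd` in which the first point is linked to p interpolate between ρ̄ (p = m)
and the factorized polynomial (p = 1), and t̄_p + c/b_{0p} takes each one to the next
(`hookProd_succ`). Summed up, this is the formula for S_n (`tWord_add_omitWords`). The symmetry of
S_n in its first two variables, cleared of denominators, is the duality relation; the line π_0 of
e_1 consists of π_0 with weight τ, the patterns of the words with one omitted letter, and the images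
of these under t_1.

Algebras. The defining relations pass to limits, and the skein relation expresses t_i⁻¹ by t_i and
e_i, so that no convergence of inverses has to be assumed. The left ideal of α is spanned by at most
1·3·5⋯(2m-1) words, which does not exceed the number of link patterns; it remains to map it onto the
span of the patterns. The map xα ↦ xπ_α is well defined for every τ, also τ = 0, because α, acting
on the first half of a pattern with 4m points that joins the two halves, produces π_α without
closing a loop (`exists_linearMap`). -/

noncomputable section

namespace BrauerLimit

open MvPolynomial

/-! ### Linear factors -/

section Linear
variable {σ : Type*}

/-- The linear polynomial `u_i - u_j + α`. -/
def lin (i j : σ) (α : ℂ) : MvPolynomial σ ℂ := X i - X j + C α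

@[simp] theorem eval_lin (x : σ → ℂ) (i j : σ) (α : ℂ) :
    eval x (lin i j α) = x i - x j + α := by simp [lin]

/-- Substitution of `u_j - α` for `u_i`. -/
def linSub [DecidableEq σ] (i j : σ) (α : ℂ) : MvPolynomial σ ℂ →ₐ[ℂ] MvPolynomial σ ℂ :=
  aeval (Function.update X i (X j - C α))

/-- Modulo the linear polynomial, `X i` and `X j - α` coincide, so the substitution induces the
identity on the quotient. -/
theorem lin_dvd_sub_linSub [DecidableEq σ] (i j : σ) (α : ℂ) (f : MvPolynomial σ ℂ) :
    lin i j α ∣ f - linSub i j α f := by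
  rw [← Ideal.mem_span_singleton, ← Ideal.Quotient.mk_eq_mk_iff_sub_mem]
  have : (Ideal.Quotient.mkₐ ℂ (Ideal.span {lin i j α})).comp (linSub i j α) =
      Ideal.Quotient.mkₐ ℂ (Ideal.span {lin i j α}) := by
    apply MvPolynomial.algHom_ext
    intro k
    by_cases h : k = i
    · subst h
      simp only [AlgHom.comp_apply, linSub, aeval_X, Function.update_self,
        Ideal.Quotient.mkₐ_eq_mk]
      rw [Ideal.Quotient.mk_eq_mk_iff_sub_mem, Ideal.mem_span_singleton]
      exact ⟨-1, by simp only [lin]; ring⟩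
    · simp [linSub, h]
  exact (DFunLike.congr_fun this f).symm

theorem lin_dvd_iff_linSub [DecidableEq σ] {i j : σ} (hij : i ≠ j) (α : ℂ)
    (f : MvPolynomial σ ℂ) : lin i j α ∣ f ↔ linSub i j α f = 0 := by
  constructor
  · rintro ⟨g, rfl⟩
    have : linSub i j α (lin i j α) = 0 := by
      simp [linSub, lin, hij.symm]
    rw [map_mul, this, zero_mul]
  · intro h
    simpa [h] using lin_dvd_sub_linSub i j α f

/-- The hyperplane is a graph over the other coordinates, so vanishing on it is vanishing of the
substituted polynomial everywhere. This is the bridge between the pointwise wheel conditions and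
divisibility. -/
theorem lin_dvd_iff {i j : σ} (hij : i ≠ j) (α : ℂ) (f : MvPolynomial σ ℂ) :
    lin i j α ∣ f ↔ ∀ x : σ → ℂ, x i - x j + α = 0 → eval x f = 0 := by
  classical
  constructor
  · rintro ⟨g, rfl⟩ x hx
    rw [map_mul, eval_lin, hx, zero_mul]
  · intro h
    rw [lin_dvd_iff_linSub hij]
    apply MvPolynomial.funext
    intro x
    have : eval x (linSub i j α f) = eval (Function.update x i (x j - α)) f := by
      rw [linSub, aeval_def, ← coe_eval₂Hom, ← RingHom.comp_apply]
      refine RingHom.congr_fun (MvPolynomial.ringHom_ext (fun r => by simp) fun k => ?_) f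
      by_cases hk : k = i
      · subst hk; simp
      · simp [hk]
    rw [map_zero, this]
    apply h
    simp [hij.symm]

theorem lin_ne_zero {i j : σ} (hij : i ≠ j) (α : ℂ) : lin i j α ≠ 0 := by
  classical
  intro h
  have := congrArg (eval (Function.update 0 i (1 - α))) h
  simp [hij.symm] at this

/-- The substitution is a homomorphism into a domain, and its kernel consists of the multiples of
the linear polynomial. -/
theorem lin_prime {i j : σ} (hij : i ≠ j) (α : ℂ) : Prime (lin i j α) := by
  classical
  refine ⟨lin_ne_zero hij α, fun h => ?_, fun p q h => ?_⟩
  · have := (lin_dvd_iff hij α 1).1 h.dvd (Function.update 0 i (- α)) (by simp [hij.symm])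
    simp at this
  · rw [lin_dvd_iff_linSub hij, map_mul, mul_eq_zero] at h
    rwa [lin_dvd_iff_linSub hij, lin_dvd_iff_linSub hij]

theorem totalDegree_lin {i j : σ} (hij : i ≠ j) (α : ℂ) : (lin i j α).totalDegree = 1 := by
  classical
  apply le_antisymm
  · refine (totalDegree_add _ _).trans (max_le ((totalDegree_sub _ _).trans ?_) ?_) <;> simp
  · have : (Finsupp.single i 1) ∈ (lin i j α).support := by
      rw [mem_support_iff, lin, coeff_add, coeff_sub, coeff_X, coeff_X, coeff_C]
      have h1 : ¬ (Finsupp.single j 1 = Finsupp.single i 1) := fun h => by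
        have := DFunLike.congr_fun h i
        simp [hij.symm] at this
      have h2 : ¬ ((0 : σ →₀ ℕ) = Finsupp.single i 1) := fun h => by
        have := DFunLike.congr_fun h i
        simp at this
      simp [h1, h2]
    simpa using le_totalDegree this

theorem totalDegree_lin_mul {i j : σ} (hij : i ≠ j) (α : ℂ) {g : MvPolynomial σ ℂ}
    (hg : g ≠ 0) : (lin i j α * g).totalDegree = g.totalDegree + 1 := by
  rw [totalDegree_mul_of_isDomain (lin_ne_zero hij α) hg, totalDegree_lin hij, add_comm]

/-- Bounds instead of exact degrees allow either component to be zero. In the antidiagonal sum,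
every other pair of degrees exceeds one of the bounds. -/
theorem homogeneousComponent_mul_of_le {p q : MvPolynomial σ ℂ} {a b : ℕ}
    (hp : p.totalDegree ≤ a) (hq : q.totalDegree ≤ b) :
    homogeneousComponent (a + b) (p * q) =
      homogeneousComponent a p * homogeneousComponent b q := by
  classical
  ext d
  rw [coeff_homogeneousComponent]
  split_ifs with hd
  · rw [coeff_mul, coeff_mul]
    refine Finset.sum_congr rfl fun x hx => ?_
    rw [Finset.HasAntidiagonal.mem_antidiagonal] at hx
    rw [coeff_homogeneousComponent, coeff_homogeneousComponent]
    have hs : x.1.degree + x.2.degree = a + b := by rw [← hd, ← hx, map_add]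
    by_cases h1 : x.1.degree = a
    · rw [if_pos h1, if_pos (by omega)]
    · rw [if_neg h1, zero_mul]
      rcases lt_or_gt_of_ne h1 with h1 | h1
      · rw [coeff_eq_zero_of_totalDegree_lt (f := q), mul_zero]
        have : x.2.degree = ∑ i ∈ x.2.support, x.2 i := rfl
        omega
      · rw [coeff_eq_zero_of_totalDegree_lt (f := p), zero_mul]
        have : x.1.degree = ∑ i ∈ x.1.support, x.1 i := rfl
        omega
  · symm
    apply ((homogeneousComponent_isHomogeneous a p).mul
      (homogeneousComponent_isHomogeneous b q)).coeff_eq_zero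
    simpa [Finsupp.degree] using hd

theorem homogeneousComponent_one_lin (i j : σ) (α : ℂ) :
    homogeneousComponent 1 (lin i j α) = X i - X j := by
  rw [lin, map_add, map_sub, homogeneousComponent_of_mem (isHomogeneous_X ℂ i),
    homogeneousComponent_of_mem (isHomogeneous_X ℂ j), homogeneousComponent_of_mem
    (isHomogeneous_C σ α)]
  simp

end Linear

/-- Continuous functions of a complex variable that agree outside a finite set are equal. -/
theorem eq_of_eq_off_finite {F G : ℂ → ℂ} (hF : Continuous F) (hG : Continuous G) {S : Set ℂ}
    (hS : S.Finite) (h : ∀ t ∉ S, F t = G t) : F = G :=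
  Continuous.ext_on (hS.countable.dense_compl ℂ) hF hG fun t ht => h t ht

theorem continuous_eval_comp {σ : Type*} [Finite σ] (f : MvPolynomial σ ℂ) {p : ℂ → σ → ℂ}
    (hp : Continuous p) : Continuous fun t => eval (p t) f :=
  (MvPolynomial.continuous_eval f).comp hp

/-! ### The exchange of neighbouring variables -/

section Exchange
variable {N : ℕ}

/-- The left point of a pair of neighbours. -/
def lp (i : Fin (N - 1)) : Fin N := ⟨i.val, by omega⟩

/-- The right point of a pair of neighbours. -/
def rp (i : Fin (N - 1)) : Fin N := ⟨i.val + 1, by omega⟩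

@[simp] theorem lp_val (i : Fin (N - 1)) : (lp i).val = i.val := rfl
@[simp] theorem rp_val (i : Fin (N - 1)) : (rp i).val = i.val + 1 := rfl

theorem lp_ne_rp (i : Fin (N - 1)) : lp i ≠ rp i := by
  simp [Fin.ext_iff]

/-- The transposition of two neighbours. -/
abbrev nswap (i : Fin (N - 1)) : Equiv.Perm (Fin N) := Equiv.swap (lp i) (rp i)

/-- The exchange of two neighbouring variables. -/
def sw (i : Fin (N - 1)) : MvPolynomial (Fin N) ℂ →ₐ[ℂ] MvPolynomial (Fin N) ℂ :=
  rename (nswap i)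

theorem eval_sw (i : Fin (N - 1)) (f : MvPolynomial (Fin N) ℂ) (x : Fin N → ℂ) :
    eval x (sw i f) = eval (x ∘ nswap i) f := by
  rw [sw, eval_rename]

theorem sw_sw (i : Fin (N - 1)) (f : MvPolynomial (Fin N) ℂ) : sw i (sw i f) = f := by
  apply MvPolynomial.funext
  intro x
  rw [eval_sw, eval_sw]
  congr 2
  ext k
  simp

/-- `u_i - u_{i+1}`. -/
abbrev dl (i : Fin (N - 1)) : MvPolynomial (Fin N) ℂ := lin (lp i) (rp i) 0

theorem lin_eq_dl_add (i : Fin (N - 1)) (α : ℂ) : lin (lp i) (rp i) α = dl i + C α := by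
  simp [lin]

theorem sw_lin (i : Fin (N - 1)) (j k : Fin N) (α : ℂ) :
    sw i (lin j k α) = lin (nswap i j) (nswap i k) α := by
  simp [sw, lin]

theorem sw_dl (i : Fin (N - 1)) : sw i (dl i) = - dl i := by
  rw [dl, sw_lin, nswap, Equiv.swap_apply_left, Equiv.swap_apply_right]
  simp [lin]

theorem dl_dvd_sub_sw (i : Fin (N - 1)) (g : MvPolynomial (Fin N) ℂ) : dl i ∣ g - sw i g := by
  rw [lin_dvd_iff (lp_ne_rp i)]
  intro x hx
  rw [map_sub, eval_sw, sub_eq_zero]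
  congr 2
  ext k
  simp only [Function.comp_apply, nswap, Equiv.swap_apply_def]
  have : x (lp i) = x (rp i) := by linear_combination hx
  split_ifs with h1 h2
  · rw [h1, this]
  · rw [h2, this]
  · rfl

/-- `f'` is the image of `f` under `t̄_i`, both being divisible by `b_{i i+1}`. -/
def Step (b c : ℂ) (i : Fin (N - 1)) (f f' : MvPolynomial (Fin N) ℂ) : Prop :=
  ∃ g g', f = lin (lp i) (rp i) b * g ∧ f' = lin (lp i) (rp i) b * g' ∧
    dl i * g' = C c * g - (dl i + C c) * sw i g

variable {b c : ℂ} {i : Fin (N - 1)} {f f' h h' : MvPolynomial (Fin N) ℂ}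

theorem Step.dvd_left (s : Step b c i f f') : lin (lp i) (rp i) b ∣ f := by
  obtain ⟨g, _, h, _⟩ := s
  exact ⟨g, h⟩

theorem Step.dvd_right (s : Step b c i f f') : lin (lp i) (rp i) b ∣ f' := by
  obtain ⟨_, g, _, h, _⟩ := s
  exact ⟨g, h⟩

/-- Writing `c g - (d + c) s g` as `c (g - s g) - d s g` shows that it is divisible by `d`. -/
theorem Step.exists_of_dvd (c : ℂ) (hf : lin (lp i) (rp i) b ∣ f) : ∃ f', Step b c i f f' := by
  obtain ⟨g, rfl⟩ := hf
  obtain ⟨k, hk⟩ := dl_dvd_sub_sw i g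
  exact ⟨_, g, C c * k - sw i g, rfl, rfl, by linear_combination - C c * hk⟩

theorem Step.add (s : Step b c i f f') (t : Step b c i h h') : Step b c i (f + h) (f' + h') := by
  obtain ⟨g, g', rfl, rfl, e⟩ := s
  obtain ⟨k, k', rfl, rfl, e'⟩ := t
  exact ⟨g + k, g' + k', by ring, by ring, by rw [map_add]; linear_combination e + e'⟩

theorem Step.smul (r : ℂ) (s : Step b c i f f') : Step b c i (r • f) (r • f') := by
  obtain ⟨g, g', rfl, rfl, e⟩ := s
  refine ⟨C r * g, C r * g', by rw [smul_eq_C_mul]; ring, by rw [smul_eq_C_mul]; ring, ?_⟩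
  rw [map_mul, sw, rename_C, ← sw]
  linear_combination C r * e

theorem Step.sub (s : Step b c i f f') (t : Step b c i h h') : Step b c i (f - h) (f' - h') := by
  have := s.add (t.smul (-1))
  simpa [sub_eq_add_neg] using this

theorem Step.zero (b c : ℂ) (i : Fin (N - 1)) : Step b c i 0 0 := ⟨0, 0, by simp⟩

/-- The polynomial form of the involution t̄_i² = 1: applying the exchange to the defining equation
gives a second one, and the two determine `g` from `g'`. -/
theorem Step.symm (s : Step b c i f f') : Step b c i f' f := by
  obtain ⟨g, g', rfl, rfl, e⟩ := s
  refine ⟨g', g, rfl, rfl, ?_⟩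
  have e' := congrArg (sw i) e
  simp only [map_mul, map_sub, map_add, sw_dl, sw_sw] at e'
  rw [show sw i (C c) = C c by rw [sw, rename_C]] at e'
  apply mul_left_cancel₀ (lin_ne_zero (lp_ne_rp i) 0)
  linear_combination -C c * e - (dl i + C c) * e'

theorem Step.unique (s : Step b c i f f') (t : Step b c i f h') : f' = h' := by
  obtain ⟨g, g', rfl, rfl, e⟩ := s
  obtain ⟨k, k', hk, rfl, e'⟩ := t
  have := mul_left_cancel₀ (lin_ne_zero (lp_ne_rp i) b) hk
  subst this
  rw [mul_left_cancel₀ (lin_ne_zero (lp_ne_rp i) 0) (e.trans e'.symm)]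

/-- The degree gained from the factor `d + c` on the right is lost again on division by `d`. -/
theorem Step.totalDegree_le (s : Step b c i f f') : f'.totalDegree ≤ f.totalDegree := by
  obtain ⟨g, g', rfl, rfl, e⟩ := s
  by_cases hg' : g' = 0
  · simp [hg']
  by_cases hg : g = 0
  · subst hg
    simp only [map_zero, mul_zero, sub_zero, mul_eq_zero] at e
    exact absurd (e.resolve_left (lin_ne_zero (lp_ne_rp i) 0)) hg'
  rw [totalDegree_lin_mul (lp_ne_rp i) b hg, totalDegree_lin_mul (lp_ne_rp i) b hg']
  have h1 := totalDegree_lin_mul (lp_ne_rp i) 0 hg'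
  rw [e] at h1
  have h2 := totalDegree_sub (C c * g) ((dl i + C c) * sw i g)
  have h3 := totalDegree_mul (C c) g
  have h4 := totalDegree_mul (dl i + C c) (sw i g)
  rw [← lin_eq_dl_add, totalDegree_lin (lp_ne_rp i)] at h4
  have h5 : (sw i g).totalDegree ≤ g.totalDegree := totalDegree_rename_le _ _
  rw [totalDegree_C] at h3
  rw [← lin_eq_dl_add] at h1 h2
  omega

theorem Step.ne_zero (s : Step b c i f f') (hf : f ≠ 0) : f' ≠ 0 := by
  rintro rfl
  exact hf (s.symm.unique (Step.zero b c i))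

theorem homogeneousComponent_sw (n : ℕ) (i : Fin (N - 1)) (f : MvPolynomial (Fin N) ℂ) :
    homogeneousComponent n (sw i f) = sw i (homogeneousComponent n f) :=
  (rename_homogeneousComponent n f).symm

/-- In top degree the terms with `c` disappear, and the equation becomes `g' = - s g`; the factor
`d` in front also changes sign under the exchange, which absorbs the minus sign. -/
theorem Step.homogeneousComponent_eq (s : Step b c i f f') {n : ℕ} (hn : f.totalDegree ≤ n) :
    homogeneousComponent n f' = sw i (homogeneousComponent n f) := by
  have hn' := s.totalDegree_le.trans hn
  obtain ⟨g, g', rfl, rfl, e⟩ := s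
  by_cases hg : g = 0
  · subst hg
    simp only [map_zero, mul_zero, sub_zero, mul_eq_zero] at e
    simp [e.resolve_left (lin_ne_zero (lp_ne_rp i) 0)]
  have hg'n : g'.totalDegree + 1 ≤ n ∨ g' = 0 := by
    by_cases h : g' = 0
    · exact Or.inr h
    · rw [totalDegree_lin_mul (lp_ne_rp i) b h] at hn'
      exact Or.inl hn'
  rw [totalDegree_lin_mul (lp_ne_rp i) b hg] at hn
  obtain ⟨k, rfl⟩ : ∃ k, n = 1 + k := ⟨n - 1, by omega⟩
  have hg'k : g'.totalDegree ≤ k := by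
    rcases hg'n with h | h
    · omega
    · simp [h]
  have hgk : g.totalDegree ≤ k := by omega
  have hsk : (sw i g).totalDegree ≤ k := (totalDegree_rename_le _ _).trans hgk
  have hl : ∀ α, (lin (lp i) (rp i) α).totalDegree ≤ 1 := fun α =>
    (totalDegree_lin (lp_ne_rp i) α).le
  have hX : (X (lp i) - X (rp i) : MvPolynomial (Fin N) ℂ) = dl i := by simp [lin]
  have e1 := congrArg (homogeneousComponent (1 + k)) e
  rw [map_sub, homogeneousComponent_C_mul, homogeneousComponent_eq_zero (1 + k) g (by omega),
    mul_zero, zero_sub, ← lin_eq_dl_add, homogeneousComponent_mul_of_le (hl _) hg'k,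
    homogeneousComponent_mul_of_le (hl _) hsk, homogeneousComponent_one_lin,
    homogeneousComponent_one_lin, homogeneousComponent_sw, hX] at e1
  rw [homogeneousComponent_mul_of_le (hl _) hg'k, homogeneousComponent_mul_of_le (hl _) hgk,
    homogeneousComponent_one_lin, map_mul, hX, sw_dl, e1]
  ring

/-- The value of the image under `t̄_i` at a point. -/
theorem Step.eval_eq (s : Step b c i f f') (x : Fin N → ℂ) :
    (x (lp i) - x (rp i)) * (x (rp i) - x (lp i) + b) * eval x f' =
      c * (x (rp i) - x (lp i) + b) * eval x f -
        (x (lp i) - x (rp i) + c) * (x (lp i) - x (rp i) + b) * eval (x ∘ nswap i) f := by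
  obtain ⟨g, g', rfl, rfl, e⟩ := s
  have e' := congrArg (eval x) e
  simp only [map_mul, map_sub, map_add, eval_lin, eval_C, eval_sw] at e'
  simp only [map_mul, eval_lin, Function.comp_apply, nswap, Equiv.swap_apply_left,
    Equiv.swap_apply_right]
  linear_combination (x (lp i) - x (rp i) + b) * (x (rp i) - x (lp i) + b) * e'

/-! ### The vanishing condition on finitely many variables -/

/-- The points at which polynomials are required to vanish. -/
def Wheel (b c : ℂ) (x : Fin N → ℂ) : Prop :=
  ∃ i j k : Fin N, i < j ∧ j < k ∧
    ((x j = x i + b ∧ x k = x i + 2 * b) ∨ (x j = x i + c ∧ x k = x i + c + b) ∨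
      (x j = x i + b ∧ x k = x i + c + b))

/-- Vanishing at all the wheel points. -/
def PV (b c : ℂ) (f : MvPolynomial (Fin N) ℂ) : Prop := ∀ x, Wheel b c x → eval x f = 0

theorem finite_setOf_affine_eq_zero {α β : ℂ} (hα : α ≠ 0) : {t : ℂ | α * t + β = 0}.Finite := by
  refine (Set.finite_singleton (-β / α)).subset fun t ht => ?_
  rw [Set.mem_singleton_iff, eq_div_iff hα]
  have ht' : α * t + β = 0 := ht
  linear_combination ht'

theorem continuous_update_add (x : Fin N → ℂ) (v : Fin N) :
    Continuous fun t : ℂ => Function.update x v (x v + t) := by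
  exact continuous_const.update v (continuous_const.add continuous_id)

theorem nswap_lt_nswap {j k : Fin N} (hjk : j < k) (h : ¬ (j = lp i ∧ k = rp i)) :
    nswap i j < nswap i k := by
  have hl := lp_val i
  have hr := rp_val i
  rw [Equiv.swap_apply_def, Equiv.swap_apply_def]
  simp only [Fin.lt_def, Fin.ext_iff] at hjk h ⊢
  split_ifs <;> omega

/-- Under the exchange a wheel remains a wheel unless its members at the two places are neighbours
in the wheel; those cases are settled by the factors `d + b` and `d + c` of the operator. -/
theorem Step.pv (s : Step b c i f f') (hf : PV b c f) (hc : c ≠ 0) : PV b c f' := by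
  rintro x ⟨p, q, r, hpq, hqr, hx⟩
  -- If the exchanged places carry consecutive members of the wheel, these differ by `b` or by `c`.
  -- Otherwise at least one of the two places is not used by the wheel.
  by_cases hin : (lp i = p ∧ rp i = q) ∨ (lp i = q ∧ rp i = r)
  · have h0 : eval x f = 0 := hf x ⟨p, q, r, hpq, hqr, hx⟩
    have hd : x (lp i) - x (rp i) + b = 0 ∨ x (lp i) - x (rp i) + c = 0 := by
      rcases hin with ⟨h1, h2⟩ | ⟨h1, h2⟩ <;> rw [h1, h2] <;>
        rcases hx with ⟨h3, h4⟩ | ⟨h3, h4⟩ | ⟨h3, h4⟩ <;> rw [h3] <;> try rw [h4]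
      all_goals first | (left; ring1) | (right; ring1)
    obtain ⟨g, g', rfl, rfl, e⟩ := s
    rw [map_mul, eval_lin] at h0 ⊢
    by_cases hb : x (lp i) - x (rp i) + b = 0
    · rw [hb, zero_mul]
    have hcc := hd.resolve_left hb
    have hg := (mul_eq_zero.1 h0).resolve_left hb
    -- Where `d = -c`, the exchanged term drops out and `-c g' = c g = 0` remains; this is the place
    -- where `c ≠ 0` is needed.
    have e' := congrArg (eval x) e
    simp only [map_mul, map_sub, map_add, eval_lin, eval_C, add_zero, hg, hcc] at e'
    have : eval x g' = 0 := by
      rw [mul_zero, zero_mul, sub_zero, mul_eq_zero] at e'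
      refine e'.resolve_left fun h => hc ?_
      linear_combination hcc - h
    rw [this, mul_zero]
  -- Moving the unused coordinate keeps the point and its exchange on wheels, while the denominators
  -- `d` and `-d + b` vanish for finitely many values only; continuity gives the original point.
  · obtain ⟨v, hv, hvp, hvq, hvr⟩ : ∃ v, (v = lp i ∨ v = rp i) ∧ v ≠ p ∧ v ≠ q ∧ v ≠ r := by
      by_contra! hcon
      have h1 := hcon (lp i) (Or.inl rfl)
      have h2 := hcon (rp i) (Or.inr rfl)
      simp only [Fin.lt_def, Fin.ext_iff, lp_val, rp_val, ne_eq] at *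
      omega
    have hnot : ∀ j k, (j = p ∧ k = q) ∨ (j = q ∧ k = r) → ¬ (j = lp i ∧ k = rp i) := by
      rintro j k h ⟨rfl, rfl⟩
      exact hin h
    have w : ∀ t, Wheel b c (Function.update x v (x v + t)) := fun t =>
      ⟨p, q, r, hpq, hqr, by simpa [hvp.symm, hvq.symm, hvr.symm] using hx⟩
    have w' : ∀ t, Wheel b c (Function.update x v (x v + t) ∘ nswap i) := fun t =>
      ⟨nswap i p, nswap i q, nswap i r, nswap_lt_nswap hpq (hnot _ _ (Or.inl ⟨rfl, rfl⟩)),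
        nswap_lt_nswap hqr (hnot _ _ (Or.inr ⟨rfl, rfl⟩)), by
        simpa [hvp.symm, hvq.symm, hvr.symm] using hx⟩
    obtain ⟨ε, hε, e1⟩ : ∃ ε : ℂ, ε ≠ 0 ∧ ∀ t, (Function.update x v (x v + t)) (lp i) -
        (Function.update x v (x v + t)) (rp i) = ε * t + (x (lp i) - x (rp i)) := by
      rcases hv with rfl | rfl
      · exact ⟨1, one_ne_zero, fun t => by simp [(lp_ne_rp i).symm]; ring⟩
      · exact ⟨-1, by simp, fun t => by simp [lp_ne_rp i]; ring⟩
    have hfin := (finite_setOf_affine_eq_zero (β := x (lp i) - x (rp i)) hε).union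
      (finite_setOf_affine_eq_zero (β := -(x (lp i) - x (rp i)) + b) (neg_ne_zero.2 hε))
    have := eq_of_eq_off_finite (continuous_eval_comp f' (continuous_update_add x v))
      (continuous_const (y := (0 : ℂ))) hfin (fun t ht => by
        have h1 := s.eval_eq (Function.update x v (x v + t))
        rw [hf _ (w t), hf _ (w' t), mul_zero, mul_zero, sub_zero, mul_eq_zero] at h1
        simp only [Set.mem_union, Set.mem_ofPred_eq, not_or] at ht
        refine h1.resolve_left (mul_ne_zero ?_ ?_)
        · rw [e1]; exact ht.1
        · intro h; apply ht.2; linear_combination h + e1 t)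
    have h0 := congrFun this 0
    simpa using h0

end Exchange

/-! ### Coprimality of linear factors and degrees of substitutions and products. -/

section Coprime
variable {σ : Type*}

/-- A prime linear factor is coprime to anything that is nonzero at a single point of its
hyperplane. -/
theorem lin_isRelPrime {i j k l : σ} {α β : ℂ} (hij : i ≠ j) (x : σ → ℂ)
    (h0 : x i - x j + α = 0) (h1 : x k - x l + β ≠ 0) :
    IsRelPrime (lin i j α) (lin k l β) := by
  rw [(lin_prime hij α).irreducible.isRelPrime_iff_not_dvd, lin_dvd_iff hij]
  intro h
  exact h1 (by simpa using h x h0)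

theorem totalDegree_aeval_le_of_le_one {τ : Type*} (g : σ → MvPolynomial τ ℂ)
    (hg : ∀ k, (g k).totalDegree ≤ 1) (f : MvPolynomial σ ℂ) :
    (aeval g f).totalDegree ≤ f.totalDegree := by
  rw [aeval_def, eval₂_eq]
  refine totalDegree_finsetSum_le fun d hd => ?_
  refine (totalDegree_mul _ _).trans ?_
  rw [algebraMap_eq, totalDegree_C, zero_add]
  refine (totalDegree_finsetProd _ _).trans ?_
  refine le_trans ?_ (le_totalDegree hd)
  refine Finset.sum_le_sum fun k _ => ?_
  refine (totalDegree_pow _ _).trans ?_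
  exact (Nat.mul_le_mul_left _ (hg k)).trans (by simp)

theorem totalDegree_prod_mul {ι : Type*} (s : Finset ι) (p : ι → MvPolynomial σ ℂ) (d : ℕ)
    (hp : ∀ k ∈ s, p k ≠ 0 ∧ (p k).totalDegree = d) {χ : MvPolynomial σ ℂ} (hχ : χ ≠ 0) :
    ((∏ k ∈ s, p k) * χ).totalDegree = d * s.card + χ.totalDegree := by
  classical
  induction s using Finset.induction_on with
  | empty => simp
  | insert a s ha ih =>
    have h := hp a (by simp)
    have h' : ∀ k ∈ s, p k ≠ 0 ∧ (p k).totalDegree = d := fun k hk => hp k (by simp [hk])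
    rw [Finset.prod_insert ha, mul_assoc, totalDegree_mul_of_isDomain h.1, ih h', h.2,
      Finset.card_insert_of_notMem ha]
    · ring
    · exact mul_ne_zero (Finset.prod_ne_zero_iff.2 fun k hk => (h' k hk).1) hχ

end Coprime

/-! ### Moving the first variable to the right -/

section Chain
variable {M : ℕ} {b c : ℂ}

/-- `φ` is the image of `f` under `t̄_1 ⋯ t̄_k`, every intermediate polynomial being divisible by
the linear factor of the next operator. -/
def Chain (b c : ℂ) : ℕ → MvPolynomial (Fin (M + 1)) ℂ → MvPolynomial (Fin (M + 1)) ℂ → Prop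
  | 0, f, φ => φ = f
  | k + 1, f, φ => ∃ (h : k < M) (φ' : MvPolynomial (Fin (M + 1)) ℂ),
      Chain b c k f φ' ∧ Step b c (N := M + 1) ⟨k, h⟩ φ' φ

variable {f φ h χ : MvPolynomial (Fin (M + 1)) ℂ} {k : ℕ}

theorem Chain.sub (s : Chain b c k f φ) (t : Chain b c k h χ) :
    Chain b c k (f - h) (φ - χ) := by
  induction k generalizing φ χ with
  | zero => rw [Chain] at *; rw [s, t]
  | succ k ih =>
    obtain ⟨hk, φ', s1, s2⟩ := s
    obtain ⟨_, χ', t1, t2⟩ := t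
    exact ⟨hk, φ' - χ', ih s1 t1, s2.sub t2⟩

theorem Chain.smul (r : ℂ) (s : Chain b c k f φ) : Chain b c k (r • f) (r • φ) := by
  induction k generalizing φ with
  | zero => rw [Chain] at *; rw [s]
  | succ k ih =>
    obtain ⟨hk, φ', s1, s2⟩ := s
    exact ⟨hk, r • φ', ih s1, s2.smul r⟩

theorem Chain.zero (hk : k ≤ M) : Chain b c k (0 : MvPolynomial (Fin (M + 1)) ℂ) 0 := by
  induction k with
  | zero => rfl
  | succ k ih => exact ⟨by omega, 0, ih (by omega), Step.zero _ _ _⟩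

theorem Chain.unique (s : Chain b c k f φ) (t : Chain b c k f χ) : φ = χ := by
  induction k generalizing φ χ with
  | zero => rw [Chain] at *; rw [s, t]
  | succ k ih =>
    obtain ⟨hk, φ', s1, s2⟩ := s
    obtain ⟨_, χ', t1, t2⟩ := t
    obtain rfl := ih s1 t1
    exact s2.unique t2

theorem Chain.sum {ι : Type*} (S : Finset ι) {F G : ι → MvPolynomial (Fin (M + 1)) ℂ}
    (hk : k ≤ M) (hs : ∀ a ∈ S, Chain b c k (F a) (G a)) :
    Chain b c k (∑ a ∈ S, F a) (∑ a ∈ S, G a) := by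
  classical
  induction S using Finset.induction_on with
  | empty => exact Chain.zero hk
  | insert a S ha ih =>
    rw [Finset.sum_insert ha, Finset.sum_insert ha]
    have h1 := hs a (by simp)
    have h2 := (ih fun e he => hs e (by simp [he])).smul (-1)
    simpa [sub_eq_add_neg] using h1.sub h2

theorem Chain.pv (s : Chain b c k f φ) (hf : PV b c f) (hc : c ≠ 0) : PV b c φ := by
  induction k generalizing φ with
  | zero => rw [Chain] at s; rwa [s]
  | succ k ih =>
    obtain ⟨hk, φ', s1, s2⟩ := s
    exact s2.pv (ih s1) hc

theorem Chain.totalDegree_le (s : Chain b c k f φ) : φ.totalDegree ≤ f.totalDegree := by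
  induction k generalizing φ with
  | zero => rw [Chain] at s; rw [s]
  | succ k ih =>
    obtain ⟨hk, φ', s1, s2⟩ := s
    exact s2.totalDegree_le.trans (ih s1)

/-- Each step acts on top parts by its transposition; the composite carries the first place to `k`
and does not touch the places beyond. -/
theorem Chain.homogeneousComponent_eq (s : Chain b c k f φ) {n : ℕ} (hn : f.totalDegree ≤ n) :
    ∃ e : Equiv.Perm (Fin (M + 1)), (e 0).val = k ∧ (∀ j, k < j.val → e j = j) ∧
      homogeneousComponent n φ = rename e (homogeneousComponent n f) := by
  induction k generalizing φ with
  | zero =>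
    rw [Chain] at s
    exact ⟨Equiv.refl _, by simp, by simp, by simp [s]⟩
  | succ k ih =>
    obtain ⟨hk, φ', s1, s2⟩ := s
    obtain ⟨e, e0, e1, e2⟩ := ih s1
    refine ⟨e.trans (nswap (N := M + 1) ⟨k, hk⟩), ?_, ?_, ?_⟩
    · have : e 0 = lp (N := M + 1) ⟨k, hk⟩ := Fin.ext e0
      simp [this]
    · intro j hj
      rw [Equiv.trans_apply, e1 j (by omega), nswap, Equiv.swap_apply_of_ne_of_ne] <;>
        simp only [ne_eq, Fin.ext_iff, lp_val, rp_val] <;> omega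
    · rw [s2.homogeneousComponent_eq (s1.totalDegree_le.trans hn), e2, sw, rename_rename]
      rfl

/-- If `f` can be moved all the way, then the degree in the first variable is large. -/
theorem le_degreeOf_of_chain (hf : f ≠ 0)
    (hs : ∀ (k : ℕ) (hk : k < M), ∃ φ, Chain b c k f φ ∧
      lin (lp (N := M + 1) ⟨k, hk⟩) (rp (N := M + 1) ⟨k, hk⟩) b ∣ φ) : M ≤ degreeOf 0 f := by
  classical
  set P := homogeneousComponent f.totalDegree f with hP
  have hP0 : P ≠ 0 := by
    intro h
    obtain ⟨d, hd, hd'⟩ := Finset.exists_mem_eq_sup f.support (support_nonempty.2 hf)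
      fun s => s.sum fun _ e => e
    have : coeff d P = coeff d f := by
      rw [hP, coeff_homogeneousComponent, if_pos (show Finsupp.degree d = f.totalDegree from hd'.symm)]
    rw [h, coeff_zero] at this
    exact (mem_support_iff.1 hd) this.symm
  -- The moved polynomial has the top part of `f` with permuted variables. Its divisibility by `u_k
  -- - u_{k+1} + b` therefore becomes divisibility of `P` by `u_0 - u_{k+1}` when the permutation is
  -- undone.
  have hdiv : ∀ k ∈ (Finset.univ : Finset (Fin M)), lin (0 : Fin (M + 1)) k.succ 0 ∣ P := by
    intro k _
    obtain ⟨φ, s, g, hg⟩ := hs k k.2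
    obtain ⟨e, e0, e1, e2⟩ := s.homogeneousComponent_eq le_rfl
    have h1 : lin (lp (N := M + 1) k) (rp (N := M + 1) k) 0 ∣ rename e P := by
      rw [← e2]
      by_cases hg0 : g = 0
      · simp [hg, hg0]
      have hd : g.totalDegree + 1 ≤ f.totalDegree := by
        rw [← totalDegree_lin_mul (lp_ne_rp _) b hg0, ← hg]
        exact s.totalDegree_le
      obtain ⟨n, hn⟩ : ∃ n, f.totalDegree = 1 + n := ⟨f.totalDegree - 1, by omega⟩
      rw [hn, hg, homogeneousComponent_mul_of_le (totalDegree_lin (lp_ne_rp _) b).le (by omega),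
        homogeneousComponent_one_lin]
      refine ⟨homogeneousComponent n g, ?_⟩
      rw [lin, C_0, add_zero]
      rfl
    obtain ⟨g', hg'⟩ := h1
    refine ⟨rename e.symm g', ?_⟩
    have h2 := congrArg (rename e.symm) hg'
    rw [rename_rename, map_mul] at h2
    have h3 : (e.symm ∘ e : Fin (M + 1) → Fin (M + 1)) = id := by ext; simp
    have h4 : e.symm (lp (N := M + 1) k) = 0 := by
      rw [Equiv.symm_apply_eq]; exact (Fin.ext e0).symm
    have h5 : e.symm (rp (N := M + 1) k) = k.succ := by
      rw [Equiv.symm_apply_eq, e1 k.succ (by simp)]; rfl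
    rw [h3, rename_id_apply] at h2
    rw [h2]
    congr 1
    simp only [lin, map_add, map_sub, rename_X, rename_C, h4, h5]
  have hprod : ∏ k : Fin M, lin (0 : Fin (M + 1)) k.succ 0 ∣ P := by
    refine Finset.prod_dvd_of_isRelPrime ?_ hdiv
    intro j _ k _ hjk
    refine lin_isRelPrime (Fin.succ_ne_zero j).symm (fun a => if a = k.succ then 1 else 0) ?_ ?_
    · simp [(Fin.succ_ne_zero k).symm, hjk]
    · simp [(Fin.succ_ne_zero k).symm]
  obtain ⟨Q, hQ⟩ := hprod
  have hQ0 : Q ≠ 0 := by rintro rfl; exact hP0 (by rw [hQ, mul_zero])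
  -- Each of the coprime factors contributes at least one to the degree in the first variable; the
  -- lower bound is enough.
  have key : ∀ S : Finset (Fin M),
      S.card ≤ degreeOf 0 ((∏ k ∈ S, lin (0 : Fin (M + 1)) k.succ 0)) := by
    intro S
    induction S using Finset.induction_on with
    | empty => simp
    | insert a S ha ih =>
      rw [Finset.prod_insert ha, degreeOf_mul_eq (lin_ne_zero (Fin.succ_ne_zero a).symm 0)
        (Finset.prod_ne_zero_iff.2 fun k _ => lin_ne_zero (Fin.succ_ne_zero k).symm 0),
        Finset.card_insert_of_notMem ha]
      have : 1 ≤ degreeOf 0 (lin (0 : Fin (M + 1)) a.succ 0) := by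
        rw [degreeOf_eq_sup]
        have : Finsupp.single 0 1 ∈ (lin (0 : Fin (M + 1)) a.succ 0).support := by
          rw [mem_support_iff, lin, coeff_add, coeff_sub, coeff_X, coeff_X, coeff_C]
          have h1 : ¬ (Finsupp.single a.succ 1 = Finsupp.single (0 : Fin (M + 1)) 1) :=
            fun h => by
              have := DFunLike.congr_fun h 0
              simp [Fin.succ_ne_zero] at this
          simp [h1]
        simpa using Finset.le_sup (f := fun m : Fin (M + 1) →₀ ℕ => m 0) this
      omega
  have h1 : M ≤ degreeOf 0 P := by
    rw [hQ, degreeOf_mul_eq (Finset.prod_ne_zero_iff.2 fun k _ =>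
      lin_ne_zero (Fin.succ_ne_zero k).symm 0) hQ0]
    have := key Finset.univ
    rw [Finset.card_univ, Fintype.card_fin] at this
    omega
  refine h1.trans ?_
  rw [degreeOf_eq_sup, degreeOf_eq_sup]
  apply Finset.sup_mono
  rw [hP, support_homogeneousComponent]
  exact Finset.filter_subset _ _

/-- The leading coefficient in the first variable. -/
theorem exists_leadingCoeff (hf : f ≠ 0) (hpv : PV b c f) :
    ∃ A : MvPolynomial (Fin M) ℂ, A ≠ 0 ∧ PV b c A ∧
      A.totalDegree + degreeOf 0 f ≤ f.totalDegree := by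
  have h0 : finSuccEquiv ℂ M f ≠ 0 := by simpa using hf
  have hA : (finSuccEquiv ℂ M f).leadingCoeff ≠ 0 := Polynomial.leadingCoeff_ne_zero.2 h0
  refine ⟨(finSuccEquiv ℂ M f).leadingCoeff, hA, ?_, ?_⟩
  · rintro y ⟨i, j, k, hij, hjk, hy⟩
    -- A wheel in the remaining variables stays a wheel for every value of the first one, so all
    -- coefficients in the first variable vanish at `y`.
    have : Polynomial.map (eval y) (finSuccEquiv ℂ M f) = 0 := by
      apply Polynomial.funext
      intro u
      rw [← eval_eq_eval_mv_eval', Polynomial.eval_zero]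
      exact hpv _ ⟨i.succ, j.succ, k.succ, by simpa, by simpa, by simpa using hy⟩
    have h2 := congrArg (fun p => Polynomial.coeff p (finSuccEquiv ℂ M f).natDegree) this
    simpa [Polynomial.coeff_map] using h2
  · rw [← natDegree_finSuccEquiv]
    exact totalDegree_coeff_finSuccEquiv_add_le f _ hA

end Chain

/-! ### Restriction to the hyperplane `u_{i+1} = u_i + b` -/

section Restriction
variable {M : ℕ} {R : Type*}

/-- The sequence `y` with the entries `u, v` inserted at the places `i, i + 1`. -/
def insPair (i : Fin (M + 1)) (u v : R) (y : Fin M → R) (k : Fin (M + 2)) : R :=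
  if h : k.val < i.val then y ⟨k.val, by omega⟩
  else if h₁ : k.val = i.val then u
  else if h₂ : k.val = i.val + 1 then v else y ⟨k.val - 2, by omega⟩

/-- The places of the other entries. -/
def other (i : Fin (M + 1)) (k : Fin M) : Fin (M + 2) :=
  if k.val < i.val then ⟨k.val, by omega⟩ else ⟨k.val + 2, by omega⟩

/-- The left one of the two places. -/
abbrev lpi (i : Fin (M + 1)) : Fin (M + 2) := lp (N := M + 2) i
/-- The right one of the two places. -/
abbrev rpi (i : Fin (M + 1)) : Fin (M + 2) := rp (N := M + 2) i

@[simp] theorem insPair_lp (i : Fin (M + 1)) (u v : R) (y : Fin M → R) :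
    insPair i u v y (lp (N := M + 2) i) = u := by simp [insPair]

@[simp] theorem insPair_rp (i : Fin (M + 1)) (u v : R) (y : Fin M → R) :
    insPair i u v y (rp (N := M + 2) i) = v := by simp [insPair]

theorem other_val (i : Fin (M + 1)) (k : Fin M) :
    (other i k).val = if k.val < i.val then k.val else k.val + 2 := by
  unfold other; split_ifs <;> rfl

@[simp] theorem insPair_other (i : Fin (M + 1)) (u v : R) (y : Fin M → R) (k : Fin M) :
    insPair i u v y (other i k) = y k := by
  unfold insPair
  have := other_val i k
  split_ifs at this <;> simp only [this]
  · simp [*]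
  · rw [dif_neg (by omega), dif_neg (by omega), dif_neg (by omega)]
    rfl

theorem other_lt_other {i : Fin (M + 1)} {j k : Fin M} (h : j < k) : other i j < other i k := by
  rw [Fin.lt_def] at *
  rw [other_val, other_val]
  split_ifs <;> omega

theorem eq_other_of_ne {i : Fin (M + 1)} {k : Fin (M + 2)} (h1 : k ≠ lp (N := M + 2) i)
    (h2 : k ≠ rp (N := M + 2) i) : ∃ j, k = other i j := by
  simp only [ne_eq, Fin.ext_iff, lp_val, rp_val] at h1 h2
  rcases lt_or_ge k.val i.val with h | h
  · exact ⟨⟨k, by omega⟩, Fin.ext (by rw [other_val, if_pos h])⟩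
  · refine ⟨⟨k - 2, by omega⟩, Fin.ext ?_⟩
    rw [other_val, if_neg (by simp only; omega)]
    simp only; omega

theorem insPair_self (i : Fin (M + 1)) (x : Fin (M + 2) → R) :
    insPair i (x (lp (N := M + 2) i)) (x (rp (N := M + 2) i)) (x ∘ other i) = x := by
  ext k
  by_cases h1 : k = lp (N := M + 2) i
  · subst h1; simp
  by_cases h2 : k = rp (N := M + 2) i
  · subst h2; simp
  obtain ⟨j, rfl⟩ := eq_other_of_ne h1 h2
  simp

theorem map_insPair {S : Type*} (F : R → S) (i : Fin (M + 1)) (u v : R) (y : Fin M → R)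
    (k : Fin (M + 2)) : F (insPair i u v y k) = insPair i (F u) (F v) (F ∘ y) k := by
  unfold insPair; split_ifs <;> rfl

variable (b c : ℂ)

/-- The linear factors of the restriction to `u_{i+1} = u_i + b`. -/
def wheelFactor (i : Fin (M + 1)) (u : ℂ) (y : Fin M → ℂ) : ℂ :=
  ∏ k : Fin M, if k.val < i.val then (y k - u + b) * (y k - u + c)
    else (y k - u - 2 * b) * (y k - u - (b + c))

/-- The linear factors as a polynomial; the first variable is `u_i`. -/
def wheelFactorP (i : Fin (M + 1)) : MvPolynomial (Fin (M + 1)) ℂ :=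
  ∏ k : Fin M, if k.val < i.val then lin k.succ 0 b * lin k.succ 0 c
    else lin k.succ 0 (-(2 * b)) * lin k.succ 0 (-(b + c))

theorem eval_wheelFactorP (i : Fin (M + 1)) (u : ℂ) (y : Fin M → ℂ) :
    eval (Fin.cons u y : Fin (M + 1) → ℂ) (wheelFactorP b c i) = wheelFactor b c i u y := by
  rw [wheelFactorP, map_prod, wheelFactor]
  refine Finset.prod_congr rfl fun k _ => ?_
  split_ifs <;> simp [sub_eq_add_neg]

theorem finite_wheelFactor_eq_zero (i : Fin (M + 1)) (y : Fin M → ℂ) :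
    {u | wheelFactor b c i u y = 0}.Finite := by
  have : {u | wheelFactor b c i u y = 0} ⊆
      ⋃ k : Fin M, {y k + b, y k + c, y k - 2 * b, y k - (b + c)} := by
    intro u hu
    rw [Set.mem_ofPred_eq, wheelFactor, Finset.prod_eq_zero_iff] at hu
    obtain ⟨k, _, hk⟩ := hu
    rw [Set.mem_iUnion]
    refine ⟨k, ?_⟩
    simp only [Set.mem_insert_iff, Set.mem_singleton_iff]
    split_ifs at hk <;> rcases mul_eq_zero.1 hk with h | h
    · left; linear_combination -h
    · right; left; linear_combination -h
    · right; right; left; linear_combination -h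
    · right; right; right; linear_combination -h
  exact (Set.finite_iUnion fun k => by simp).subset this

theorem wheel_insPair_left {y : Fin M → ℂ} (hy : Wheel b c y) (i : Fin (M + 1)) (u v : ℂ) :
    Wheel b c (insPair i u v y) := by
  obtain ⟨p, q, r, hpq, hqr, h⟩ := hy
  exact ⟨other i p, other i q, other i r, other_lt_other hpq, other_lt_other hqr, by simpa using h⟩

/-- Neighbours `u, u + b` are completed to a wheel by an entry `u - b` or `u - c` on the left, or by
`u + 2 b` or `u + b + c` on the right. These are the zeros of the four kinds of factors. -/
theorem wheel_insPair_right {i : Fin (M + 1)} {u : ℂ} {y : Fin M → ℂ}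
    (h : wheelFactor b c i u y = 0) : Wheel b c (insPair i u (u + b) y) := by
  rw [wheelFactor, Finset.prod_eq_zero_iff] at h
  obtain ⟨k, _, hk⟩ := h
  have hv := other_val i k
  split_ifs at hk with hki
  · rw [if_pos hki] at hv
    refine ⟨other i k, lp (N := M + 2) i, rp (N := M + 2) i, ?_, ?_, ?_⟩
    · rw [Fin.lt_def, hv]; exact hki
    · rw [Fin.lt_def]; simp
    · rw [insPair_other, insPair_lp, insPair_rp]
      rcases mul_eq_zero.1 hk with h | h
      · left; constructor <;> linear_combination -h
      · right; left; constructor <;> linear_combination -h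
  · rw [if_neg hki] at hv
    refine ⟨lp (N := M + 2) i, rp (N := M + 2) i, other i k, ?_, ?_, ?_⟩
    · rw [Fin.lt_def]; simp
    · rw [Fin.lt_def, hv]; simp only [rp_val]; omega
    · rw [insPair_other, insPair_lp, insPair_rp]
      rcases mul_eq_zero.1 hk with h | h
      · left; exact ⟨rfl, by linear_combination h⟩
      · right; right; exact ⟨rfl, by linear_combination h⟩

/-- Restriction to `u_{i+1} = u_i + b`; the first variable is `u_i`. -/
def restrP (i : Fin (M + 1)) : MvPolynomial (Fin (M + 2)) ℂ →ₐ[ℂ] MvPolynomial (Fin (M + 1)) ℂ :=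
  aeval (insPair i (X 0) (X 0 + C b) fun k => X k.succ)

theorem eval_restrP (i : Fin (M + 1)) (u : ℂ) (y : Fin M → ℂ) (f : MvPolynomial (Fin (M + 2)) ℂ) :
    eval (Fin.cons u y : Fin (M + 1) → ℂ) (restrP b i f) = eval (insPair i u (u + b) y) f := by
  rw [restrP, aeval_def, ← coe_eval₂Hom, ← RingHom.comp_apply]
  refine RingHom.congr_fun (MvPolynomial.ringHom_ext (fun r => by simp) fun k => ?_) f
  simp only [RingHom.comp_apply, coe_eval₂Hom, eval₂_X, eval_X]
  rw [map_insPair (eval (Fin.cons u y : Fin (M + 1) → ℂ))]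
  have hy : (eval (Fin.cons u y : Fin (M + 1) → ℂ)) ∘ (fun k => X k.succ) = y := by
    ext k
    simp
  rw [hy]
  simp

theorem totalDegree_restrP_le (i : Fin (M + 1)) (f : MvPolynomial (Fin (M + 2)) ℂ) :
    (restrP b i f).totalDegree ≤ f.totalDegree := by
  refine totalDegree_aeval_le_of_le_one _ (fun k => ?_) f
  rw [map_insPair totalDegree]
  unfold insPair
  split_ifs
  · simp
  · simp
  · exact (totalDegree_add _ _).trans (by simp)
  · simp

variable {b c}
variable {i : Fin (M + 1)} {f : MvPolynomial (Fin (M + 2)) ℂ}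

theorem lin_dvd_iff_insPair : lin (lp (N := M + 2) i) (rp (N := M + 2) i) b ∣ f ↔
    ∀ u y, eval (insPair i u (u + b) y) f = 0 := by
  rw [lin_dvd_iff (lp_ne_rp _)]
  constructor
  · intro h u y
    apply h
    simp
  · intro h x hx
    rw [← insPair_self i x, show x (rp (N := M + 2) i) = x (lp (N := M + 2) i) + b by
      linear_combination -hx]
    exact h _ _

theorem restrP_ne_zero (h : ¬ lin (lp (N := M + 2) i) (rp (N := M + 2) i) b ∣ f) :
    restrP b i f ≠ 0 := by
  intro h0
  apply h
  rw [lin_dvd_iff_insPair]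
  intro u y
  rw [← eval_restrP, h0, map_zero]

/-- Each linear factor divides because its hyperplane consists of wheels. The factors are pairwise
coprime, for the same variable because `b ≠ c`, so their product divides. -/
theorem wheelFactorP_dvd (hbc : b ≠ c) (hf : PV b c f) : wheelFactorP b c i ∣ restrP b i f := by
  classical
  have rel : ∀ (j k : Fin M) (α β : ℂ), (j ≠ k ∨ α ≠ β) →
      IsRelPrime (lin j.succ (0 : Fin (M + 1)) α) (lin k.succ 0 β) := by
    intro j k α β h
    by_cases hjk : j = k
    · subst hjk
      refine lin_isRelPrime (Fin.succ_ne_zero j) (Fin.cons α 0) (by simp) ?_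
      simp only [Fin.cons_succ, Fin.cons_zero, Pi.zero_apply]
      intro h'
      exact h.resolve_left (by simp) (by linear_combination -h')
    · refine lin_isRelPrime (Fin.succ_ne_zero j)
        (Fin.cons α (Function.update 0 k (α - β + 1))) (by simp [hjk]) ?_
      simp only [Fin.cons_succ, Fin.cons_zero, Function.update_self]
      intro h'
      exact one_ne_zero (α := ℂ) (by linear_combination h')
  refine Finset.prod_dvd_of_isRelPrime ?_ fun k _ => ?_
  · intro j _ k _ hjk
    simp only [Function.onFun]
    split_ifs <;> refine IsRelPrime.mul_left (IsRelPrime.mul_right ?_ ?_)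
      (IsRelPrime.mul_right ?_ ?_) <;> exact rel _ _ _ _ (Or.inl hjk)
  · have van : ∀ x : Fin (M + 1) → ℂ, (if k.val < i.val then (x k.succ - x 0 + b) *
        (x k.succ - x 0 + c) else (x k.succ - x 0 - 2 * b) * (x k.succ - x 0 - (b + c))) = 0 →
        eval x (restrP b i f) = 0 := by
      intro x hx
      have := eval_restrP b i (x 0) (Fin.tail x) f
      rw [Fin.cons_self_tail] at this
      rw [this]
      apply hf
      apply wheel_insPair_right
      exact Finset.prod_eq_zero (Finset.mem_univ k) hx
    split_ifs with hki
    · simp only [if_pos hki, mul_eq_zero] at van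
      refine IsRelPrime.mul_dvd (rel _ _ _ _ (Or.inr hbc)) ?_ ?_ <;>
        rw [lin_dvd_iff (Fin.succ_ne_zero k)] <;> intro x hx
      · exact van x (Or.inl hx)
      · exact van x (Or.inr hx)
    · simp only [if_neg hki, mul_eq_zero] at van
      refine IsRelPrime.mul_dvd (rel _ _ _ _ (Or.inr fun h => hbc ?_)) ?_ ?_
      · linear_combination -h
      all_goals rw [lin_dvd_iff (Fin.succ_ne_zero k)]; intro x hx
      · exact van x (Or.inl hx)
      · exact van x (Or.inr hx)

/-- Splitting off two factors for each of the `M` variables costs degree `2 M`. At a wheel `y` the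
restriction is zero for all `u` and the split factors are nonzero for almost all `u`, so the
cofactor vanishes identically in `u`, that is, coefficient by coefficient. -/
theorem exists_restrP_eq (hbc : b ≠ c) (hf : PV b c f) :
    ∃ χ : MvPolynomial (Fin (M + 1)) ℂ, restrP b i f = wheelFactorP b c i * χ ∧
      (χ ≠ 0 → 2 * M + χ.totalDegree ≤ f.totalDegree) ∧
      ∀ e, PV b c ((finSuccEquiv ℂ M χ).coeff e) := by
  obtain ⟨χ, hχ⟩ := wheelFactorP_dvd (i := i) hbc hf
  refine ⟨χ, hχ, fun h => ?_, fun e y hy => ?_⟩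
  · have h1 := totalDegree_restrP_le b i f
    rw [hχ, wheelFactorP, totalDegree_prod_mul _ _ 2 ?_ h, Finset.card_univ,
      Fintype.card_fin] at h1
    · exact h1
    · intro k _
      split_ifs <;> exact ⟨mul_ne_zero (lin_ne_zero (Fin.succ_ne_zero k) _)
        (lin_ne_zero (Fin.succ_ne_zero k) _), by
          rw [totalDegree_lin_mul (Fin.succ_ne_zero k) _ (lin_ne_zero (Fin.succ_ne_zero k) _),
            totalDegree_lin (Fin.succ_ne_zero k)]⟩
  -- The finitely many `u` at which a split factor vanishes are recovered by continuity.
  · have key : ∀ u, eval (Fin.cons u y : Fin (M + 1) → ℂ) χ = 0 := by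
      refine congrFun (eq_of_eq_off_finite (continuous_eval_comp χ ?_)
        (continuous_const (y := (0 : ℂ))) (finite_wheelFactor_eq_zero b c i y) fun u hu => ?_)
      · refine continuous_pi fun k => ?_
        refine Fin.cases ?_ (fun k => ?_) k
        · exact continuous_id
        · simpa using continuous_const
      · have h1 := eval_restrP b i u y f
        rw [hf _ (wheel_insPair_left b c hy i u (u + b)), hχ, map_mul, eval_wheelFactorP,
          mul_eq_zero] at h1
        exact h1.resolve_left hu
    have : Polynomial.map (eval y) (finSuccEquiv ℂ M χ) = 0 := by
      apply Polynomial.funext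
      intro u
      rw [← eval_eq_eval_mv_eval', Polynomial.eval_zero, key]
    have h2 := congrArg (fun p => Polynomial.coeff p e) this
    simpa [Polynomial.coeff_map] using h2

end Restriction

/-! ### The minimal degree -/

/-- The minimal degree of the nonzero polynomials in `N` variables with the vanishing property. -/
def minDeg (N : ℕ) : ℕ := (N - 1) ^ 2 / 2

/-- The recursion that corresponds to restriction: two variables disappear and `2 M` forced factors
are split off. -/
theorem minDeg_add_two (M : ℕ) : minDeg (M + 2) = minDeg M + 2 * M := by
  unfold minDeg
  rcases M with _ | M
  · rfl
  · have : (M + 1 + 2 - 1) ^ 2 = (M + 1 - 1) ^ 2 + 2 * (2 * (M + 1)) := by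
      simp only [Nat.add_sub_cancel, show M + 1 + 2 - 1 = M + 2 by omega]; ring
    rw [this, Nat.add_mul_div_left _ _ (by norm_num)]

/-- For an even number of variables the inequality is strict, and this excludes unlimited transport
in the minimal degree. -/
theorem minDeg_succ_lt (N : ℕ) : minDeg (2 * N + 2) < minDeg (2 * N + 1) + (2 * N + 1) := by
  unfold minDeg
  have h1 : (2 * N + 2 - 1) ^ 2 = 1 + 2 * (2 * N * N + 2 * N) := by
    simp only [show 2 * N + 2 - 1 = 2 * N + 1 by omega]; ring
  have h2 : (2 * N + 1 - 1) ^ 2 = 2 * (2 * N * N) := by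
    simp only [show 2 * N + 1 - 1 = 2 * N by omega]; ring
  rw [h1, h2, Nat.add_mul_div_left _ _ (by norm_num), Nat.mul_div_cancel_left _ (by norm_num)]
  omega

theorem minDeg_even (m : ℕ) : minDeg (2 * m) = 2 * m * (m - 1) := by
  unfold minDeg
  rcases m with _ | m
  · rfl
  · have h1 : (2 * (m + 1) - 1) ^ 2 = 1 + 2 * (2 * (m + 1) * m) := by
      simp only [show 2 * (m + 1) - 1 = 2 * m + 1 by omega]; ring
    rw [h1, Nat.add_mul_div_left _ _ (by norm_num)]
    simp

theorem minDeg_le_succ (M : ℕ) : minDeg (M + 1) ≤ minDeg M + M := by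
  unfold minDeg
  rcases M with _ | M
  · simp
  · have h1 : (M + 1 + 1 - 1) ^ 2 ≤ (M + 1 - 1) ^ 2 + 2 * (M + 1) := by
      simp only [Nat.add_sub_cancel]; ring_nf; omega
    exact (Nat.div_le_div_right h1).trans (by
      rw [Nat.add_mul_div_left _ _ (by norm_num)])

section MinDeg
variable {b c : ℂ}

/-- Either the polynomial can be moved to some place where its restriction does not vanish, or it
can be moved all the way. -/
theorem chain_alternative {M : ℕ} (f : MvPolynomial (Fin (M + 1)) ℂ) :
    (∃ (k : ℕ) (hk : k < M) (φ : _), Chain b c k f φ ∧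
      ¬ lin (lp (N := M + 1) ⟨k, hk⟩) (rp (N := M + 1) ⟨k, hk⟩) b ∣ φ) ∨
    ∀ (k : ℕ) (hk : k < M), ∃ φ, Chain b c k f φ ∧
      lin (lp (N := M + 1) ⟨k, hk⟩) (rp (N := M + 1) ⟨k, hk⟩) b ∣ φ := by
  by_contra! hcon
  obtain ⟨h1, k, hk, h2⟩ := hcon
  have : ∀ j ≤ k, ∃ φ, Chain b c j f φ := by
    intro j hj
    induction j with
    | zero => exact ⟨f, rfl⟩
    | succ j ih =>
      obtain ⟨φ, hφ⟩ := ih (by omega)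
      obtain ⟨φ', h'⟩ := Step.exists_of_dvd c (h1 j (by omega) φ hφ)
      exact ⟨φ', by omega, φ, hφ, h'⟩
  obtain ⟨φ, hφ⟩ := this k le_rfl
  exact h2 φ hφ (h1 k hk φ hφ)

/-- Strong induction over the two alternatives of transport. If it stops, the restriction has `M`
forced pairs of factors and a nonzero coefficient with the vanishing property in two variables
fewer. If it does not, the leading coefficient in the first variable has the property in one
variable fewer. The second case changes the parity, so odd numbers of variables must be included. -/
theorem minDeg_le (hbc : b ≠ c) (hc : c ≠ 0) {N : ℕ} (f : MvPolynomial (Fin N) ℂ)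
    (hf : f ≠ 0) (hpv : PV b c f) : minDeg N ≤ f.totalDegree := by
  induction N using Nat.strong_induction_on with
  | _ N ih =>
    rcases N with _ | M
    · simp [minDeg]
    rcases chain_alternative (b := b) (c := c) f with ⟨k, hk, φ, s, hφ⟩ | hs
    · obtain ⟨M, rfl⟩ : ∃ K, M = K + 1 := ⟨M - 1, by omega⟩
      obtain ⟨χ, h1, h2, h3⟩ := exists_restrP_eq (i := ⟨k, hk⟩) hbc (s.pv hpv hc)
      have hχ : χ ≠ 0 := by
        rintro rfl
        exact restrP_ne_zero hφ (by rw [h1, mul_zero])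
      have h4 := h2 hχ
      have h5 : (finSuccEquiv ℂ M χ).leadingCoeff ≠ 0 :=
        Polynomial.leadingCoeff_ne_zero.2 (by simpa using hχ)
      have h6 := ih M (by omega) _ h5 (h3 _)
      have h7 := totalDegree_coeff_finSuccEquiv_add_le χ _ h5
      have h8 := s.totalDegree_le
      have h9 : minDeg (M + 1 + 1) = minDeg M + 2 * M := minDeg_add_two M
      rw [Polynomial.leadingCoeff] at h6
      omega
    · obtain ⟨A, hA, hAp, hAd⟩ := exists_leadingCoeff hf hpv
      have h1 := le_degreeOf_of_chain hf hs
      have h2 := ih M (by omega) A hA hAp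
      have h3 := minDeg_le_succ M
      omega

/-- The restriction of a polynomial of minimal degree. -/
theorem exists_restriction {M : ℕ} (hbc : b ≠ c) (hc : c ≠ 0) (i : Fin (M + 1))
    {f : MvPolynomial (Fin (M + 2)) ℂ} (hpv : PV b c f) (hd : f.totalDegree ≤ minDeg (M + 2)) :
    ∃ χ : MvPolynomial (Fin M) ℂ, PV b c χ ∧ χ.totalDegree ≤ minDeg M ∧
      ∀ u y, eval (insPair i u (u + b) y) f = wheelFactor b c i u y * eval y χ := by
  obtain ⟨χ, h1, h2, h3⟩ := exists_restrP_eq (i := i) hbc hpv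
  rw [minDeg_add_two] at hd
  have hχ : χ.totalDegree ≤ minDeg M := by
    by_cases h : χ = 0
    · simp [h]
    · have := h2 h; omega
  -- A nonzero coefficient of `u ^ e` has degree at least `minDeg M`, while its degree plus `e` is
  -- at most `minDeg M`. Only `e = 0` is possible, so the cofactor does not depend on `u`.
  have h4 : ∀ e, (finSuccEquiv ℂ M χ).coeff e ≠ 0 →
      minDeg M + e ≤ ((finSuccEquiv ℂ M χ).coeff e).totalDegree + e ∧
      ((finSuccEquiv ℂ M χ).coeff e).totalDegree + e ≤ minDeg M := fun e he =>
    ⟨Nat.add_le_add_right (minDeg_le hbc hc _ he (h3 e)) _,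
      (totalDegree_coeff_finSuccEquiv_add_le χ e he).trans hχ⟩
  refine ⟨(finSuccEquiv ℂ M χ).coeff 0, h3 0, ?_, fun u y => ?_⟩
  · by_cases h : (finSuccEquiv ℂ M χ).coeff 0 = 0
    · simp [h]
    · exact (h4 0 h).2
  · rw [← eval_restrP, h1, map_mul, eval_wheelFactorP, eval_eq_eval_mv_eval']
    congr 1
    have : finSuccEquiv ℂ M χ = Polynomial.C ((finSuccEquiv ℂ M χ).coeff 0) := by
      ext1 e
      rw [Polynomial.coeff_C]
      split_ifs with he
      · rw [he]
      · by_contra h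
        have := h4 e h
        omega
    conv_lhs => rw [this]
    simp

/-- Unlimited transport would require degree `2 m + 1` in the first variable and, in addition, a
leading coefficient of degree at least `minDeg (2 m + 1)`; together this exceeds the minimal degree.
-/
theorem eq_zero_of_chain (hbc : b ≠ c) (hc : c ≠ 0) {m : ℕ}
    {f : MvPolynomial (Fin (2 * m + 2)) ℂ} (hpv : PV b c f)
    (hd : f.totalDegree ≤ minDeg (2 * m + 2))
    (hs : ∀ (k : ℕ) (hk : k < 2 * m + 1), ∃ φ, Chain b c k f φ ∧
      lin (lp (N := 2 * m + 2) ⟨k, hk⟩) (rp (N := 2 * m + 2) ⟨k, hk⟩) b ∣ φ) : f = 0 := by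
  by_contra hf
  obtain ⟨A, hA, hAp, hAd⟩ := exists_leadingCoeff hf hpv
  have h1 := le_degreeOf_of_chain hf hs
  have h2 := minDeg_le hbc hc A hA hAp
  have h3 := minDeg_succ_lt m
  omega

end MinDeg

/-! ### Link patterns as functions on the natural numbers -/

/-- The transposition of `j` and `j + 1`. -/
def sN (j k : ℕ) : ℕ := if k = j then j + 1 else if k = j + 1 then j else k

@[simp] theorem sN_left (j : ℕ) : sN j j = j + 1 := by simp [sN]
@[simp] theorem sN_right (j : ℕ) : sN j (j + 1) = j := by simp [sN]
theorem sN_of_ne {j k : ℕ} (h1 : k ≠ j) (h2 : k ≠ j + 1) : sN j k = k := by simp [sN, h1, h2]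

theorem sN_lt {j k n : ℕ} (hj : j + 1 < n) (hk : k < n) : sN j k < n := by
  unfold sN; split_ifs <;> omega

theorem sN_sN (j k : ℕ) : sN j (sN j k) = k := by
  unfold sN; split_ifs <;> omega

theorem sN_comm {j k : ℕ} (h : j + 2 ≤ k ∨ k + 2 ≤ j) (y : ℕ) : sN k (sN j y) = sN j (sN k y) := by
  by_cases h1 : y = j
  · rw [h1, sN_left, sN_of_ne (j := k) (k := j + 1) (by omega) (by omega),
      sN_of_ne (j := k) (k := j) (by omega) (by omega), sN_left]
  by_cases h2 : y = j + 1
  · rw [h2, sN_right, sN_of_ne (j := k) (k := j + 1) (by omega) (by omega),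
      sN_of_ne (j := k) (k := j) (by omega) (by omega), sN_right]
  rw [sN_of_ne h1 h2, sN_of_ne (j := j)] <;> unfold sN <;> split_ifs <;> omega

theorem sN_braid (j y : ℕ) :
    sN j (sN (j + 1) (sN j y)) = sN (j + 1) (sN j (sN (j + 1) y)) := by
  have e1 : sN j (j + 2) = j + 2 := sN_of_ne (by omega) (by omega)
  have e2 : sN (j + 1) j = j := sN_of_ne (by omega) (by omega)
  have e3 : sN (j + 1) (j + 1) = j + 2 := sN_left _
  have e4 : sN (j + 1) (j + 2) = j + 1 := sN_right _
  by_cases h1 : y = j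
  · rw [h1, sN_left, e3, e1, e2, sN_left, e3]
  by_cases h2 : y = j + 1
  · rw [h2, sN_right, e2, sN_left, e3, e1, e4]
  by_cases h3 : y = j + 2
  · rw [h3, e1, e4, sN_right, e2]
  rw [sN_of_ne h1 h2, sN_of_ne (j := j + 1) h2 h3, sN_of_ne h1 h2, sN_of_ne h2 h3]

namespace Pattern
variable {m : ℕ}

/-- The partner of the point `k`; the numbers beyond the last point are fixed. -/
def nv (π : Pattern m) (k : ℕ) : ℕ := if h : k < 2 * m then (π.1 ⟨k, h⟩).val else k

theorem nv_of_lt (π : Pattern m) {k : ℕ} (h : k < 2 * m) : π.nv k = (π.1 ⟨k, h⟩).val := dif_pos h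

theorem nv_fin (π : Pattern m) (x : Fin (2 * m)) : π.nv x.val = (π.1 x).val := π.nv_of_lt x.2

theorem nv_lt (π : Pattern m) {k : ℕ} (h : k < 2 * m) : π.nv k < 2 * m := by
  rw [nv_of_lt π h]; exact Fin.isLt _

theorem nv_nv (π : Pattern m) (k : ℕ) : π.nv (π.nv k) = k := by
  by_cases h : k < 2 * m
  · rw [nv_of_lt π h, nv_fin, π.2.1]
  · simp [nv, h]

theorem nv_ne (π : Pattern m) {k : ℕ} (h : k < 2 * m) : π.nv k ≠ k := by
  rw [nv_of_lt π h]
  intro h'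
  exact π.2.2 ⟨k, h⟩ (Fin.ext h')

theorem nv_inj (π : Pattern m) {k l : ℕ} (h : π.nv k = π.nv l) : k = l := by
  rw [← π.nv_nv k, h, π.nv_nv]

theorem ext_nv {π σ : Pattern m} (h : ∀ k < 2 * m, π.nv k = σ.nv k) : π = σ := by
  apply Subtype.ext
  funext x
  apply Fin.ext
  rw [← nv_fin, ← nv_fin, h _ x.2]

theorem nv_eq_iff (π : Pattern m) (x y : Fin (2 * m)) : π.1 x = y ↔ π.nv x = y := by
  rw [nv_fin, Fin.ext_iff]

theorem linked_iff (π : Pattern m) (j : Fin (2 * m - 1)) :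
    π.1 (lo j) = hi j ↔ π.nv j = j + 1 := π.nv_eq_iff (lo j) (hi j)

/-- A link pattern from an involution of the natural numbers. -/
def ofNat (p : ℕ → ℕ) (h1 : ∀ k < 2 * m, p k < 2 * m) (h2 : ∀ k < 2 * m, p (p k) = k)
    (h3 : ∀ k < 2 * m, p k ≠ k) : Pattern m :=
  ⟨fun x => ⟨p x, h1 x x.2⟩, fun x => Fin.ext (h2 x x.2), fun x h =>
    h3 x x.2 (congrArg Fin.val h)⟩

theorem nv_ofNat (p : ℕ → ℕ) (h1 : ∀ k < 2 * m, p k < 2 * m) (h2 : ∀ k < 2 * m, p (p k) = k)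
    (h3 : ∀ k < 2 * m, p k ≠ k) {k : ℕ} (hk : k < 2 * m) : (ofNat p h1 h2 h3).nv k = p k := by
  rw [nv_of_lt _ hk]; rfl

theorem swap_val (j : Fin (2 * m - 1)) (x : Fin (2 * m)) :
    (Equiv.swap (lo j) (hi j) x).val = sN j x := by
  rw [Equiv.swap_apply_def, sN]
  simp only [lo, hi, Fin.ext_iff]
  split_ifs <;> rfl

theorem nv_actT (π : Pattern m) (j : Fin (2 * m - 1)) {k : ℕ} (hk : k < 2 * m) :
    (π.actT j).nv k = sN j (π.nv (sN j k)) := by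
  have h := swap_val j ⟨k, hk⟩
  simp only at h
  rw [nv_of_lt _ hk, ← h, nv_fin, ← swap_val]
  rfl

theorem actT_actT (π : Pattern m) (j : Fin (2 * m - 1)) : (π.actT j).actT j = π := by
  apply Subtype.ext
  funext x
  simp [actT, conj]

theorem actT_of_linked (π : Pattern m) (j : Fin (2 * m - 1)) (h : π.1 (lo j) = hi j) :
    π.actT j = π := by
  rw [linked_iff] at h
  have hj := j.2
  apply ext_nv
  intro k hk
  rw [nv_actT _ _ hk]
  have h1 := π.nv_nv j
  have h2 := π.nv_nv k
  unfold sN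
  rw [h] at h1
  split_ifs <;> grind

theorem actT_comm (π : Pattern m) {j k : Fin (2 * m - 1)} (h : Far j k) :
    (π.actT j).actT k = (π.actT k).actT j := by
  apply ext_nv
  intro x hx
  have hj := j.2
  have hk := k.2
  have hs1 : sN k x < 2 * m := by unfold sN; split_ifs <;> omega
  have hs2 : sN j x < 2 * m := by unfold sN; split_ifs <;> omega
  rw [nv_actT _ _ hx, nv_actT _ _ hx, nv_actT _ _ hs1, nv_actT _ _ hs2]
  rw [sN_comm h, sN_comm h]

theorem actT_braid (π : Pattern m) {j k : Fin (2 * m - 1)} (h : Adj j k) :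
    ((π.actT j).actT k).actT j = ((π.actT k).actT j).actT k := by
  apply ext_nv
  intro x hx
  have hj := j.2
  have hk := k.2
  have hs : ∀ (i : Fin (2 * m - 1)) y, y < 2 * m → sN i y < 2 * m := by
    intro i y hy; unfold sN; have := i.2; split_ifs <;> omega
  rw [nv_actT _ _ hx, nv_actT _ _ hx, nv_actT _ _ (hs _ _ hx), nv_actT _ _ (hs _ _ hx),
    nv_actT _ _ (hs _ _ (hs _ _ hx)), nv_actT _ _ (hs _ _ (hs _ _ hx))]
  rcases h with h | h <;> rw [← h]
  · rw [sN_braid, sN_braid]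
  · rw [← sN_braid, ← sN_braid]

/-- The partner of `k`, moved by one period if it is to the left of `k`. -/
def lift (π : Pattern m) (k : ℕ) : ℕ := if k < π.nv k then π.nv k else π.nv k + 2 * m

/-- The links at `j` and `j + 1` are different and do not cross. -/
def Desc (π : Pattern m) (j : ℕ) : Prop := π.lift (j + 1) < π.lift j

theorem Desc.unlinked {π : Pattern m} {j : ℕ} (hj : j + 1 < 2 * m) (h : π.Desc j) :
    π.nv j ≠ j + 1 := by
  intro h'
  have h1 := π.nv_nv j
  rw [h'] at h1
  unfold Desc lift at h
  rw [h', h1] at h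
  split_ifs at h <;> omega

section lift
variable (π : Pattern m) (j : Fin (2 * m - 1)) (h : π.nv j ≠ j + 1)
include h

/-- The exchange of two unlinked neighbours leaves their partners in place, so their forward
endpoints merely trade owners. -/
theorem lift_actT_left : (π.actT j).lift j = π.lift (j + 1) := by
  have hj := j.2
  unfold lift
  rw [nv_actT _ _ (by omega)]
  have h1 := π.nv_nv (j + 1)
  have h2 := π.nv_ne (k := j + 1) (by omega)
  have h3 : π.nv (j + 1) ≠ j := fun h' => by rw [h'] at h1; exact h h1
  have e : sN j j = j + 1 := by simp [sN]
  rw [e]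
  unfold sN
  split_ifs <;> omega

theorem lift_actT_right : (π.actT j).lift (j + 1) = π.lift j := by
  have hj := j.2
  unfold lift
  rw [nv_actT _ _ (by omega)]
  have h2 := π.nv_ne (k := j) (by omega)
  have e : sN j (j + 1) = j := by simp [sN]
  rw [e]
  unfold sN
  split_ifs <;> omega

omit h in
theorem lift_actT_other {k : ℕ} (hk : k < 2 * m) (h1 : k ≠ j) (h2 : k ≠ j + 1) :
    (π.actT j).lift k = if π.nv k = j then π.lift k + 1 else
      if π.nv k = j + 1 then π.lift k - 1 else π.lift k := by
  have hj := j.2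
  unfold lift
  rw [nv_actT _ _ hk]
  have h2 := π.nv_ne hk
  have e : sN j k = k := by exact sN_of_ne h1 (by omega)
  rw [e]
  unfold sN
  split_ifs <;> omega

end lift

theorem rho_nv {k : ℕ} (hk : k < 2 * m) : (rho m).nv k = if k < m then k + m else k - m := by
  rw [nv_of_lt _ hk]
  simp only [rho]
  split_ifs with hkm
  · exact Nat.mod_eq_of_lt (by omega)
  · rw [show k + m = (k - m) + 2 * m by omega, Nat.add_mod_right, Nat.mod_eq_of_lt (by omega)]

/-- Without descents `lift` is strictly increasing. With `a` the partner of `0`, the points before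
`a` are linked to the right and the points from `a` on to the left. Monotonicity bounds the partners
from below on both sides, the involution turns these bounds into equalities, and counting gives `a =
m`. -/
theorem lift_eq_rho {π : Pattern m} (h : ∀ j, j + 1 < 2 * m → ¬ π.Desc j) : π = rho m := by
  rcases Nat.eq_zero_or_pos m with rfl | hm
  · exact ext_nv fun k hk => by omega
  have inc1 : ∀ x, x + 1 < 2 * m → π.lift x < π.lift (x + 1) := by
    intro x hx
    have h1 := h x hx
    have h4 := π.nv_lt (k := x) (by omega)
    have h5 := π.nv_lt hx
    unfold Desc at h1
    rcases Nat.lt_or_ge (π.lift x) (π.lift (x + 1)) with h6 | h6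
    · exact h6
    · exfalso
      have h7 : π.nv x = π.nv (x + 1) := by
        unfold lift at h1 h6
        split_ifs at h1 h6 <;> omega
      have := π.nv_inj h7
      omega
  have inc : ∀ x y, x < y → y < 2 * m → π.lift x < π.lift y := by
    intro x y hxy
    induction y, hxy using Nat.le_induction with
    | base => exact inc1 x
    | succ y hy ih => intro hy'; exact (ih (by omega)).trans (inc1 y hy')
  obtain ⟨a, ha⟩ : ∃ a, π.nv 0 = a := ⟨_, rfl⟩
  have ha0 : a ≠ 0 := fun h' => π.nv_ne (k := 0) (by omega) (by omega)
  have han : a < 2 * m := ha ▸ π.nv_lt (by omega)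
  have hpa : π.nv a = 0 := by rw [← ha, π.nv_nv]
  have hLa : π.lift a = 2 * m := by unfold lift; rw [hpa]; simp
  have op : ∀ x < a, x < π.nv x := by
    intro x hx
    have h1 := inc x a hx han
    rw [hLa] at h1
    unfold lift at h1
    split_ifs at h1 <;> omega
  have cl : ∀ y, a ≤ y → y < 2 * m → π.nv y < y := by
    intro y hy hyn
    have h1 := π.nv_ne hyn
    rcases Nat.eq_or_lt_of_le hy with rfl | hlt
    · omega
    have h2 := inc a y hlt hyn
    rw [hLa] at h2
    have h3 := π.nv_lt hyn
    unfold lift at h2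
    split_ifs at h2 <;> omega
  have lb : ∀ x < a, a + x ≤ π.nv x := by
    intro x
    induction x with
    | zero => intro _; omega
    | succ x ih =>
      intro hx
      have h1 := ih (by omega)
      have h2 := inc x (x + 1) (by omega) (by omega)
      have h3 := op x (by omega)
      have h4 := op (x + 1) hx
      unfold lift at h2
      rw [if_pos h3, if_pos h4] at h2
      omega
  have lb' : ∀ y, a ≤ y → y < 2 * m → y - a ≤ π.nv y := by
    intro y hy
    induction y, hy using Nat.le_induction with
    | base => intro _; omega
    | succ y hy ih =>
      intro hy'
      have h1 := ih (by omega)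
      have h2 := inc y (y + 1) (by omega) hy'
      have h3 := cl y hy (by omega)
      have h4 := cl (y + 1) (by omega) hy'
      unfold lift at h2
      rw [if_neg (by omega), if_neg (by omega)] at h2
      omega
  have ex : ∀ x < a, π.nv x = a + x := by
    intro x hx
    have h1 := lb x hx
    have h2 := lb' (π.nv x) (by omega) (π.nv_lt (by omega))
    rw [π.nv_nv] at h2
    omega
  have cla : ∀ y, a ≤ y → y < 2 * m → π.nv y < a := by
    intro y hy hyn
    have h1 := cl y hy hyn
    by_contra h2
    have h3 := cl (π.nv y) (by omega) (by omega)
    rw [π.nv_nv] at h3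
    omega
  have ham : a = m := by
    have h1 := ex (a - 1) (by omega)
    have h2 := π.nv_lt (k := a - 1) (by omega)
    have h3 := lb' (2 * m - 1) (by omega) (by omega)
    have h4 := cla (2 * m - 1) (by omega) (by omega)
    omega
  subst ham
  apply ext_nv
  intro k hk
  rw [rho_nv hk]
  split_ifs with hka
  · rw [ex k hka]; omega
  · have h1 := cla k (by omega) hk
    have h2 := ex _ h1
    rw [π.nv_nv] at h2
    omega

/-- A measure of the distance from the maximally crossed pattern. -/
def spread (π : Pattern m) : ℕ := ∑ k ∈ Finset.range (2 * m), (π.lift k - k) ^ 2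

/-- Two links change. At a descent the longer forward length drops by one and the shorter one grows
by one, so with unchanged sum the squares decrease; the complementary lengths, measured from the
other ends, behave in the same way. -/
theorem spread_actT_lt {π : Pattern m} {j : Fin (2 * m - 1)} (h : π.Desc j) :
    (π.actT j).spread < π.spread := by
  have hj := j.2
  have hu := h.unlinked (by omega)
  obtain ⟨x₁, hx₁⟩ : ∃ x, x = π.nv j := ⟨_, rfl⟩
  obtain ⟨x₂, hx₂⟩ : ∃ x, x = π.nv (j + 1) := ⟨_, rfl⟩
  have e1 : π.nv x₁ = j := by rw [hx₁, π.nv_nv]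
  have e2 : π.nv x₂ = j + 1 := by rw [hx₂, π.nv_nv]
  have l1 : x₁ < 2 * m := hx₁ ▸ π.nv_lt (by omega)
  have l2 : x₂ < 2 * m := hx₂ ▸ π.nv_lt (by omega)
  have n1 : x₁ ≠ j := hx₁ ▸ π.nv_ne (by omega)
  have n2 : x₂ ≠ j + 1 := hx₂ ▸ π.nv_ne (by omega)
  have n3 : x₂ ≠ j := fun h' => by rw [h'] at e2; exact hu e2
  have n4 : x₁ ≠ x₂ := fun h' => by rw [h', e2] at e1; omega
  have f1 := lift_actT_left π j hu
  have f2 := lift_actT_right π j hu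
  have f3 := lift_actT_other π j l1 n1 (hx₁ ▸ hu)
  have f4 := lift_actT_other π j l2 n3 n2
  rw [if_pos e1] at f3
  rw [if_neg (by omega), if_pos e2] at f4
  obtain ⟨T, hT⟩ : ∃ T : Finset ℕ, T = {j.val, j.val + 1, x₁, x₂} := ⟨_, rfl⟩
  have hTs : T ⊆ Finset.range (2 * m) := by
    intro y hy
    simp only [hT, Finset.mem_insert, Finset.mem_singleton] at hy
    rw [Finset.mem_range]
    rcases hy with rfl | rfl | rfl | rfl <;> omega
  have sumT : ∀ g : ℕ → ℕ, ∑ y ∈ T, g y = g j + (g (j + 1) + (g x₁ + g x₂)) := by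
    intro g
    rw [hT, Finset.sum_insert, Finset.sum_insert, Finset.sum_insert, Finset.sum_singleton]
    · simpa using n4
    · simp only [Finset.mem_insert, Finset.mem_singleton]; omega
    · simp only [Finset.mem_insert, Finset.mem_singleton]; omega
  unfold spread
  rw [← Finset.sum_sdiff hTs, ← Finset.sum_sdiff hTs (f := fun k => (π.lift k - k) ^ 2)]
  have rest : ∑ k ∈ Finset.range (2 * m) \ T, ((π.actT j).lift k - k) ^ 2 =
      ∑ k ∈ Finset.range (2 * m) \ T, (π.lift k - k) ^ 2 := by
    refine Finset.sum_congr rfl fun k hk => ?_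
    simp only [hT, Finset.mem_sdiff, Finset.mem_range, Finset.mem_insert, Finset.mem_singleton,
      not_or] at hk
    rw [lift_actT_other π j hk.1 hk.2.1 hk.2.2.1, if_neg, if_neg]
    · intro h'
      exact hk.2.2.2.2 (by rw [hx₂, ← h', π.nv_nv])
    · intro h'
      exact hk.2.2.2.1 (by rw [hx₁, ← h', π.nv_nv])
  rw [rest, sumT, sumT, f1, f2, f3, f4]
  have g1 : π.lift j = if j < x₁ then x₁ else x₁ + 2 * m := by rw [hx₁]; rfl
  have g2 : π.lift (j + 1) = if j + 1 < x₂ then x₂ else x₂ + 2 * m := by rw [hx₂]; rfl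
  have g3 : π.lift x₁ = if x₁ < j then j.val else j + 2 * m := by unfold lift; rw [e1]
  have g4 : π.lift x₂ = if x₂ < j + 1 then j.val + 1 else j + 1 + 2 * m := by unfold lift; rw [e2]
  unfold Desc at h
  -- Forward lengths are counted from `j + 2`: `P` for the link at `j`, `R` for the one at `j + 1`.
  -- The lengths `A` and `B + 1` are the complementary ones seen from the partners. A descent means
  -- `R < P`, hence `A < B`.
  obtain ⟨P, hP⟩ : ∃ P, π.lift j = j + 2 + P := ⟨π.lift j - j - 2, by split_ifs at g1 g2 <;> omega⟩
  obtain ⟨R, hR⟩ : ∃ R, π.lift (j + 1) = j + 2 + R :=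
    ⟨π.lift (j + 1) - j - 2, by split_ifs at g1 g2 <;> omega⟩
  obtain ⟨A, hA⟩ : ∃ A, π.lift x₁ = x₁ + A ∧ A + P + 2 = 2 * m :=
    ⟨π.lift x₁ - x₁, by split_ifs at g1 g3 <;> omega⟩
  obtain ⟨B, hB⟩ : ∃ B, π.lift x₂ = x₂ + B + 1 ∧ B + R + 2 = 2 * m :=
    ⟨π.lift x₂ - x₂ - 1, by split_ifs at g2 g4 <;> omega⟩
  have hRP : R < P := by omega
  rw [hP, hR, hA.1, hB.1]
  have a1 : j.val + 2 + R - j = R + 2 := by omega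
  have a2 : j.val + 2 + P - (j + 1) = P + 1 := by omega
  have a3 : x₁ + A + 1 - x₁ = A + 1 := by omega
  have a4 : x₂ + B + 1 - 1 - x₂ = B := by omega
  have a5 : j.val + 2 + P - j = P + 2 := by omega
  have a6 : j.val + 2 + R - (j + 1) = R + 1 := by omega
  have a7 : x₁ + A - x₁ = A := by omega
  have a8 : x₂ + B + 1 - x₂ = B + 1 := by omega
  rw [a1, a2, a3, a4, a5, a6, a7, a8]
  have hAB : A < B := by omega
  apply Nat.add_lt_add_left
  linarith [sq (R + 2)]

theorem exists_desc {π : Pattern m} (h : π ≠ rho m) : ∃ j : Fin (2 * m - 1), π.Desc j := by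
  by_contra! hcon
  exact h (lift_eq_rho fun j hj => hcon ⟨j, by omega⟩)

theorem not_desc_rho {j : ℕ} (hj : j + 1 < 2 * m) : ¬ (rho m).Desc j := by
  unfold Desc lift
  rw [rho_nv (k := j) (by omega), rho_nv hj]
  split_ifs <;> omega

/-- Two descents at distance at least two: the second one persists, or the links at the two places
connect them. -/
theorem Desc.actT_far {π : Pattern m} {j : Fin (2 * m - 1)} {k : ℕ} (hk : k + 1 < 2 * m)
    (hjk : j.val + 2 ≤ k ∨ k + 2 ≤ j) (h : π.Desc k)
    (hn : ¬ (π.nv k = j + 1 ∧ π.nv (k + 1) = j)) : (π.actT j).Desc k := by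
  unfold Desc at *
  rw [lift_actT_other π j (k := k) (by omega) (by omega) (by omega),
    lift_actT_other π j hk (by omega) (by omega)]
  have h1 := π.nv_nv k
  have h2 := π.nv_nv (k + 1)
  have h3 : π.nv k ≠ π.nv (k + 1) := fun h' => by have := π.nv_inj h'; omega
  have h4 := π.nv_lt (k := k) (by omega)
  have h5 := π.nv_lt hk
  unfold lift at *
  split_ifs at * <;> omega

/-- Induction over the link patterns, starting from the maximally crossed one. -/
theorem spread_induction {P : Pattern m → Prop} (h0 : P (rho m))
    (h1 : ∀ (π : Pattern m) (j : Fin (2 * m - 1)), π.1 (lo j) ≠ hi j → P π → P (π.actT j))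
    (π : Pattern m) : P π := by
  induction h : π.spread using Nat.strong_induction_on generalizing π with
  | _ s ih =>
    by_cases hπ : π = rho m
    · rw [hπ]; exact h0
    obtain ⟨j, hj⟩ := exists_desc hπ
    have h2 := ih _ (h ▸ spread_actT_lt hj) (π.actT j) rfl
    have h3 := h1 (π.actT j) j ?_ h2
    · rwa [actT_actT] at h3
    · rw [ne_eq, linked_iff]
      have hu := hj.unlinked (by omega)
      have hjl := j.2
      intro h4
      rw [nv_actT _ _ (by omega)] at h4
      rw [sN_left] at h4
      have h5 := π.nv_nv (j + 1)
      have h6 := π.nv_ne (k := j + 1) (by omega)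
      unfold sN at h4
      split_ifs at h4 with a1
      · rw [a1] at h5; exact hu h5
      · omega

end Pattern

/-! ### The operators on rational functions -/

section Rational
variable {m : ℕ}

theorem toRat_injective : Function.Injective (toRat : Poly m → RatFun m) :=
  IsFractionRing.injective _ _

theorem toRat_ne_zero {f : Poly m} (hf : f ≠ 0) : toRat f ≠ 0 := by
  intro h
  exact hf (toRat_injective (h.trans (map_zero _).symm))

theorem lo_eq_lp (i : Fin (2 * m - 1)) : lo i = lp (N := 2 * m) i := rfl
theorem hi_eq_rp (i : Fin (2 * m - 1)) : hi i = rp (N := 2 * m) i := rfl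

theorem swapPoly_eq_sw (i : Fin (2 * m - 1)) (f : Poly m) :
    swapPoly i f = sw (N := 2 * m) i f := rfl

theorem bP_eq_lin (b : ℂ) (i : Fin (2 * m - 1)) :
    bP b i = lin (lp (N := 2 * m) i) (rp (N := 2 * m) i) b := rfl

theorem dP_ne_zero (i : Fin (2 * m - 1)) : dP i ≠ 0 := by
  have := lin_ne_zero (lp_ne_rp (N := 2 * m) i) 0
  rwa [lin, C_0, add_zero] at this

theorem bP_ne_zero (b : ℂ) (i : Fin (2 * m - 1)) : bP b i ≠ 0 := lin_ne_zero (lp_ne_rp _) b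

theorem bP'_eq_lin (b : ℂ) (i : Fin (2 * m - 1)) :
    bP' b i = lin (rp (N := 2 * m) i) (lp (N := 2 * m) i) b := by
  simp [bP', dP, lin, lo_eq_lp, hi_eq_rp]

theorem bP'_ne_zero (b : ℂ) (i : Fin (2 * m - 1)) : bP' b i ≠ 0 := by
  rw [bP'_eq_lin]; exact lin_ne_zero (lp_ne_rp _).symm b

theorem swapPoly_dP (i : Fin (2 * m - 1)) : swapPoly i (dP i) = -dP i := by
  simp [swapPoly, dP]

theorem swapPoly_C (i : Fin (2 * m - 1)) (r : ℂ) : swapPoly i (C r) = C r :=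
  (swapPoly i).commutes r

theorem swapPoly_swapPoly (i : Fin (2 * m - 1)) (f : Poly m) : swapPoly i (swapPoly i f) = f :=
  sw_sw (N := 2 * m) i f

theorem swapRat_toRat (i : Fin (2 * m - 1)) (f : Poly m) :
    swapRat i (toRat f) = toRat (swapPoly i f) := by
  unfold swapRat toRat
  exact IsFractionRing.ringEquivOfRingEquiv_algebraMap _ f

theorem ratFun_hom_ext {φ ψ : RatFun m →+* RatFun m} (h : ∀ f : Poly m, φ (toRat f) = ψ (toRat f))
    (x : RatFun m) : φ x = ψ x := by
  exact RingHom.congr_fun (IsLocalization.ringHom_ext (nonZeroDivisors (Poly m))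
    (RingHom.ext h)) x

theorem swapRat_swapRat (i : Fin (2 * m - 1)) (f : RatFun m) : swapRat i (swapRat i f) = f :=
  ratFun_hom_ext (φ := (swapRat i : RatFun m →+* RatFun m).comp (swapRat i))
    (ψ := RingHom.id _) (fun f => by simp [swapRat_toRat, swapPoly_swapPoly]) f

theorem swapPoly_eq_rename (i : Fin (2 * m - 1)) (f : Poly m) :
    swapPoly i f = rename (Equiv.swap (lo i) (hi i)) f := rfl

/-- A word of exchanges renames variables along a map of indices, so identities between words need
only be checked for `sN` on natural numbers. -/
theorem poly_swap_ext {w w' : List (Fin (2 * m - 1))}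
    (h : ∀ x : Fin (2 * m), w.foldr (fun (i : Fin (2 * m - 1)) (y : ℕ) => sN i.val y) x.val = w'.foldr (fun (i : Fin (2 * m - 1)) (y : ℕ) => sN i.val y) x.val)
    (f : Poly m) : w.foldr (fun i g => swapPoly i g) f = w'.foldr (fun i g => swapPoly i g) f := by
  have key : ∀ (w : List (Fin (2 * m - 1))) (f : Poly m), ∃ p : Fin (2 * m) → Fin (2 * m),
      (∀ f, w.foldr (fun i g => swapPoly i g) f = rename p f) ∧
      ∀ x, (p x).val = w.foldr (fun (i : Fin (2 * m - 1)) (y : ℕ) => sN i.val y) x.val := by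
    intro w f
    induction w with
    | nil => exact ⟨id, by simp, by simp⟩
    | cons i w ih =>
      obtain ⟨p, h1, h2⟩ := ih
      refine ⟨Equiv.swap (lo i) (hi i) ∘ p, fun f => ?_, fun x => ?_⟩
      · rw [List.foldr_cons, h1, swapPoly_eq_rename, rename_rename]
      · rw [List.foldr_cons, ← h2, Function.comp_apply, Pattern.swap_val]
  obtain ⟨p, h1, h2⟩ := key w f
  obtain ⟨p', h1', h2'⟩ := key w' f
  have : p = p' := by
    funext x
    exact Fin.ext (by rw [h2, h2', h])
  rw [h1, h1', this]

theorem swapRat_braid {i j : Fin (2 * m - 1)} (h : j.val = i + 1) (f : RatFun m) :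
    swapRat i (swapRat j (swapRat i f)) = swapRat j (swapRat i (swapRat j f)) :=
  ratFun_hom_ext (φ := (swapRat i : RatFun m →+* RatFun m).comp
      ((swapRat j : RatFun m →+* RatFun m).comp (swapRat i)))
    (ψ := (swapRat j : RatFun m →+* RatFun m).comp
      ((swapRat i : RatFun m →+* RatFun m).comp (swapRat j)))
    (fun f => by
      simp only [RingHom.comp_apply, RingHom.coe_coe, swapRat_toRat]
      congr 1
      exact poly_swap_ext (w := [i, j, i]) (w' := [j, i, j])
        (fun x => by simp only [List.foldr_cons, List.foldr_nil, h]; exact sN_braid _ _) f) f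

theorem swapRat_comm {i j : Fin (2 * m - 1)} (h : Far i j) (f : RatFun m) :
    swapRat i (swapRat j f) = swapRat j (swapRat i f) :=
  ratFun_hom_ext (φ := (swapRat i : RatFun m →+* RatFun m).comp (swapRat j))
    (ψ := (swapRat j : RatFun m →+* RatFun m).comp (swapRat i))
    (fun f => by
      simp only [RingHom.comp_apply, RingHom.coe_coe, swapRat_toRat]
      congr 1
      exact poly_swap_ext (w := [i, j]) (w' := [j, i])
        (fun x => (sN_comm h _).symm) f) f

/-- `u_i - u_{i+1}` as a rational function. -/
abbrev dR (i : Fin (2 * m - 1)) : RatFun m := toRat (dP i)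

/-- A constant as a rational function. -/
abbrev cR (m : ℕ) (r : ℂ) : RatFun m := toRat (C r)

variable {b c : ℂ} {i j : Fin (2 * m - 1)}

theorem toRat_bP (b : ℂ) (i : Fin (2 * m - 1)) : toRat (bP b i) = dR i + cR m b := map_add _ _ _
theorem toRat_cP (b : ℂ) (i : Fin (2 * m - 1)) : toRat (cP b i) = dR i + cR m b := map_add _ _ _
theorem toRat_bP' (b : ℂ) (i : Fin (2 * m - 1)) : toRat (bP' b i) = -dR i + cR m b := by
  rw [bP', toRat, map_add, map_neg]
theorem toRat_cP' (b : ℂ) (i : Fin (2 * m - 1)) : toRat (cP' b i) = -dR i + cR m b :=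
  toRat_bP' b i

theorem swapRat_dR (i : Fin (2 * m - 1)) : swapRat i (dR i) = -dR i := by
  rw [dR, swapRat_toRat, swapPoly_dP, toRat, map_neg]

theorem swapRat_cR (i : Fin (2 * m - 1)) (r : ℂ) : swapRat i (cR m r) = cR m r := by
  rw [cR, swapRat_toRat, swapPoly_C]

theorem dR_ne_zero (i : Fin (2 * m - 1)) : dR i ≠ 0 := toRat_ne_zero (dP_ne_zero i)

theorem dR_add_ne_zero (b : ℂ) (i : Fin (2 * m - 1)) : dR i + cR m b ≠ 0 := by
  rw [← toRat_bP]; exact toRat_ne_zero (bP_ne_zero b i)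

theorem neg_dR_add_ne_zero (b : ℂ) (i : Fin (2 * m - 1)) : -dR i + cR m b ≠ 0 := by
  rw [← toRat_bP']; exact toRat_ne_zero (bP'_ne_zero b i)

theorem smul_eq_cR_mul (r : ℂ) (f : RatFun m) : r • f = cR m r * f := by
  rw [Algebra.smul_def, cR, toRat, IsScalarTower.algebraMap_apply ℂ (Poly m) (RatFun m)]
  rfl

theorem cR_inv (c : ℂ) (hc : c ≠ 0) : cR m c⁻¹ * cR m c = 1 := by
  rw [cR, cR, ← map_mul, ← C_mul, inv_mul_cancel₀ hc, C_1, map_one]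

/-- The operator `t̄_i` in terms of the exchange. -/
theorem tBar_eq (f : RatFun m) : tBar b c i f = cR m c / dR i * f -
    (dR i + cR m c) * (dR i + cR m b) / (dR i * (-dR i + cR m b)) * swapRat i f := by
  unfold tBar tPlus
  rw [map_div₀, toRat_bP, toRat_cP, map_add, swapRat_dR, swapRat_cR]
  have h1 := dR_ne_zero i
  have h2 := dR_add_ne_zero b i
  have h3 := neg_dR_add_ne_zero b i
  field_simp
  ring

/-- A factor `Φ` of this kind, such as b_{i i+1} times a symmetric function, absorbs all dependence
on `b`; on the cofactor there remains an operator that involves only `c`. -/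
theorem tBar_mul_of_swap {Φ : RatFun m} (hΦ : Φ * (-dR i + cR m b) =
    swapRat i Φ * (dR i + cR m b)) (g : RatFun m) : tBar b c i (Φ * g) =
    Φ * (cR m c / dR i * g - (1 + cR m c / dR i) * swapRat i g) := by
  rw [tBar_eq, map_mul]
  have h1 := dR_ne_zero i
  have h3 := neg_dR_add_ne_zero b i
  field_simp
  linear_combination (dR i + cR m c) * swapRat i g * hΦ

theorem tBar_add (f g : RatFun m) : tBar b c i (f + g) = tBar b c i f + tBar b c i g := by
  rw [tBar_eq, tBar_eq, tBar_eq, map_add]; ring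

theorem tBar_zero : tBar b c i (0 : RatFun m) = 0 := by
  rw [tBar_eq, map_zero]; ring

theorem tBar_tBar (f : RatFun m) : tBar b c i (tBar b c i f) = f := by
  rw [tBar_eq (tBar b c i f), tBar_eq f]
  simp only [map_sub, map_mul, map_div₀, map_add, map_neg, swapRat_dR, swapRat_cR,
    swapRat_swapRat]
  have h1 := dR_ne_zero i
  have h2 := dR_add_ne_zero b i
  have h3 := neg_dR_add_ne_zero b i
  have h4 : - -dR i + cR m b ≠ 0 := by rwa [neg_neg]
  field_simp
  ring

/-- A variable as a rational function. -/
abbrev uR (m k : ℕ) : RatFun m := toRat (uSeq m k)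

theorem uSeq_of_lt {k : ℕ} (h : k < 2 * m) : uSeq m k = X ⟨k, h⟩ := dif_pos h

theorem swapPoly_uSeq (i : Fin (2 * m - 1)) {k : ℕ} (h : k < 2 * m) :
    swapPoly i (uSeq m k) = uSeq m (sN i k) := by
  have hs : sN i k < 2 * m := sN_lt (by have := i.2; omega) h
  rw [uSeq_of_lt h, uSeq_of_lt hs, swapPoly_eq_rename, rename_X]
  congr 1
  exact Fin.ext (Pattern.swap_val i ⟨k, h⟩)

theorem swapRat_uR (i : Fin (2 * m - 1)) {k : ℕ} (h : k < 2 * m) :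
    swapRat i (uR m k) = uR m (sN i k) := by
  rw [uR, swapRat_toRat, swapPoly_uSeq i h]

theorem dP_eq (i : Fin (2 * m - 1)) : dP i = uSeq m i - uSeq m (i + 1) := by
  have := i.2
  rw [uSeq_of_lt (by omega), uSeq_of_lt (by omega)]; rfl

theorem dR_eq (i : Fin (2 * m - 1)) : dR i = uR m i - uR m (i + 1) := by
  rw [dR, dP_eq, toRat, map_sub]

theorem uR_sub_add_ne_zero {k l : ℕ} (hk : k < 2 * m) (hl : l < 2 * m) (hkl : k ≠ l) (b : ℂ) :
    uR m k - uR m l + cR m b ≠ 0 := by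
  have : uR m k - uR m l + cR m b = toRat (lin (⟨k, hk⟩ : Fin (2 * m)) ⟨l, hl⟩ b) := by
    rw [lin, toRat, map_add, map_sub, uR, uR, uSeq_of_lt hk, uSeq_of_lt hl]
  rw [this]
  exact toRat_ne_zero (lin_ne_zero (by simpa [Fin.ext_iff] using hkl) b)

theorem tBar_comm (h : Far i j) (f : RatFun m) :
    tBar b c i (tBar b c j f) = tBar b c j (tBar b c i f) := by
  have hi := i.2
  have hj := j.2
  have e1 : swapRat i (dR j) = dR j := by
    rw [dR_eq, map_sub, swapRat_uR i (by omega), swapRat_uR i (by omega), sN_of_ne, sN_of_ne] <;>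
      rcases h with h | h <;> omega
  have e2 : swapRat j (dR i) = dR i := by
    rw [dR_eq, map_sub, swapRat_uR j (by omega), swapRat_uR j (by omega), sN_of_ne, sN_of_ne] <;>
      rcases h with h | h <;> omega
  simp only [tBar_eq, map_sub, map_mul, map_div₀, map_add, map_neg, e1, e2, swapRat_cR,
    swapRat_comm h]
  ring

theorem div_neg_sub {K : Type*} [Field K] (x y k : K) : k / (y - x) = -(k / (x - y)) := by
  rw [← neg_sub x y, div_neg]

/-- Conjugation by the product of b_{xy}, b_{xz}, b_{yz} removes `b` from both operators at once.
The braid relation of what remains rests on the partial fraction identity 1/((x-y)(y-z)) =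
(1/(x-z))(1/(x-y) + 1/(y-z)). -/
theorem tBar_braid (h : j.val = i + 1) (f : RatFun m) :
    tBar b c i (tBar b c j (tBar b c i f)) = tBar b c j (tBar b c i (tBar b c j f)) := by
  have hi := i.2
  have hj := j.2
  set x := uR m i
  set y := uR m (i + 1)
  set z := uR m (i + 2)
  set B := cR m b with hB
  set K := cR m c with hK
  have dI : dR i = x - y := dR_eq i
  have dJ : dR j = y - z := by rw [dR_eq, h]
  have six : swapRat i x = y := by rw [swapRat_uR i (by omega), sN_left]
  have siy : swapRat i y = x := by rw [swapRat_uR i (by omega), sN_right]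
  have siz : swapRat i z = z := by
    rw [swapRat_uR i (by omega), sN_of_ne (by omega) (by omega)]
  have sjx : swapRat j x = x := by
    rw [swapRat_uR j (by omega), sN_of_ne (by omega) (by omega)]
  have sjy : swapRat j y = z := by
    rw [swapRat_uR j (by omega), h, sN_left]
  have sjz : swapRat j z = y := by
    rw [swapRat_uR j (by omega), h, show i.val + 2 = i + 1 + 1 by rfl, sN_right]
  have hxy : x - y + B ≠ 0 := uR_sub_add_ne_zero (by omega) (by omega) (by omega) b
  have hxz : x - z + B ≠ 0 := uR_sub_add_ne_zero (by omega) (by omega) (by omega) b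
  have hyz : y - z + B ≠ 0 := uR_sub_add_ne_zero (by omega) (by omega) (by omega) b
  have nz0 : cR m 0 = 0 := by rw [cR, C_0]; exact map_zero _
  have kxy : x - y ≠ 0 := by
    have := uR_sub_add_ne_zero (m := m) (k := i) (l := i + 1) (by omega) (by omega) (by omega) 0
    rwa [nz0, add_zero] at this
  have kxz : x - z ≠ 0 := by
    have := uR_sub_add_ne_zero (m := m) (k := i) (l := i + 2) (by omega) (by omega) (by omega) 0
    rwa [nz0, add_zero] at this
  have kyz : y - z ≠ 0 := by
    have := uR_sub_add_ne_zero (m := m) (k := i + 1) (l := i + 2) (by omega) (by omega)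
      (by omega) 0
    rwa [nz0, add_zero] at this
  set Φ := (x - y + B) * (x - z + B) * (y - z + B) with hΦ
  have hΦ0 : Φ ≠ 0 := mul_ne_zero (mul_ne_zero hxy hxz) hyz
  have ΦI : ∀ g, tBar b c i (Φ * g) = Φ * (K / (x - y) * g - (1 + K / (x - y)) * swapRat i g) := by
    intro g
    rw [tBar_mul_of_swap, dI]
    rw [hΦ, dI]
    simp only [map_mul, map_add, map_sub, six, siy, siz]
    rw [hB, swapRat_cR]
    ring
  have ΦJ : ∀ g, tBar b c j (Φ * g) = Φ * (K / (y - z) * g - (1 + K / (y - z)) * swapRat j g) := by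
    intro g
    rw [tBar_mul_of_swap, dJ]
    rw [hΦ, dJ]
    simp only [map_mul, map_add, map_sub, sjx, sjy, sjz]
    rw [hB, swapRat_cR]
    ring
  obtain ⟨g, rfl⟩ : ∃ g, f = Φ * g := ⟨f / Φ, by field_simp⟩
  rw [ΦI, ΦJ, ΦI, ΦJ, ΦI, ΦJ]
  have KI : swapRat i K = K := swapRat_cR i c
  have KJ : swapRat j K = K := swapRat_cR j c
  set α := K / (x - y) with hα
  set β := K / (y - z) with hβ
  set γ := K / (x - z) with hγ
  have iα : swapRat i α = -α := by
    rw [hα, map_div₀, map_sub, six, siy, KI, div_neg_sub x y K]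
  have iβ : swapRat i β = γ := by rw [hβ, map_div₀, map_sub, siy, siz, KI]
  have iγ : swapRat i γ = β := by rw [hγ, map_div₀, map_sub, six, siz, KI]
  have jβ : swapRat j β = -β := by
    rw [hβ, map_div₀, map_sub, sjy, sjz, KJ, div_neg_sub y z K]
  have jα : swapRat j α = γ := by rw [hα, map_div₀, map_sub, sjx, sjy, KJ]
  have jγ : swapRat j γ = α := by rw [hγ, map_div₀, map_sub, sjx, sjz, KJ]
  have rel : α * β = γ * (α + β) := by
    rw [hα, hβ, hγ]; field_simp; ring
  simp only [map_sub, map_mul, map_add, map_one, iα, iβ, iγ, jα, jβ, jγ, swapRat_swapRat,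
    swapRat_braid h]
  linear_combination Φ * ((α - β) * g - (1 + α) * swapRat i g + (1 + β) * swapRat j g) * rel

theorem toRat_mul (f g : Poly m) : toRat (f * g) = toRat f * toRat g := map_mul _ _ _
theorem toRat_add (f g : Poly m) : toRat (f + g) = toRat f + toRat g := map_add _ _ _
theorem toRat_sub (f g : Poly m) : toRat (f - g) = toRat f - toRat g := map_sub _ _ _

/-- The link between the relation without denominators and the operator on rational functions: one
is used for degrees and vanishing, the other for the braid relations. -/
theorem Step.tBar_eq {f f' : Poly m} (s : Step (N := 2 * m) b c i f f') :
    tBar b c i (toRat f) = toRat f' := by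
  obtain ⟨g, g', rfl, rfl, e⟩ := s
  have e1 : (dl (N := 2 * m) i : Poly m) = dP i := by
    rw [dl, lin, C_0, add_zero]; rfl
  have e' := congrArg toRat e
  rw [e1, toRat_sub, toRat_mul, toRat_mul, toRat_mul, toRat_add, ← swapPoly_eq_sw,
    ← swapRat_toRat] at e'
  rw [← bP_eq_lin, toRat_mul, toRat_mul, tBar_mul_of_swap]
  · congr 1
    have h1 := dR_ne_zero i
    field_simp
    linear_combination -e'
  · rw [toRat_bP, map_add, swapRat_dR, swapRat_cR]; ring

theorem step_of_tBar_eq {f f' : Poly m} (hf : bP b i ∣ f)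
    (h : tBar b c i (toRat f) = toRat f') : Step (N := 2 * m) b c i f f' := by
  obtain ⟨f'', s⟩ := Step.exists_of_dvd (N := 2 * m) c hf
  have := toRat_injective (h.symm.trans s.tBar_eq)
  rwa [this]

end Rational

/-! ### Products over pairs of points -/

section PairProducts
variable {m : ℕ}

/-- The pairs `i < j < N`. -/
def pairs (N : ℕ) : Finset (ℕ × ℕ) :=
  ((Finset.range N) ×ˢ (Finset.range N)).filter fun e => e.1 < e.2

theorem mem_pairs {N : ℕ} {e : ℕ × ℕ} : e ∈ pairs N ↔ e.1 < e.2 ∧ e.2 < N := by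
  simp only [pairs, Finset.mem_filter, Finset.mem_product, Finset.mem_range]
  omega

/-- The factor of type `t` of a pair: `b_{ij}` for `t = 1`, `b_{j i+n}` for `t = 2`,
otherwise `1`. -/
def pairFactor (b c : ℂ) (x : ℕ → Poly m) (t : ℕ) (e : ℕ × ℕ) : Poly m :=
  if t = 1 then x e.1 - x e.2 + C b else if t = 2 then x e.2 - x e.1 - C (b + c) else 1

/-- The types of the pairs in the maximally crossed polynomial. -/
def crossType (N : ℕ) (e : ℕ × ℕ) : ℕ :=
  if e.2 < e.1 + N then 1 else if e.2 = e.1 + N then 0 else 2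

variable (b c : ℂ)

theorem addExt_of_lt {R : Type*} [Ring R] {n : ℕ} (s : R) (x : ℕ → R) {k : ℕ} (h : k < n) :
    addExt n s x k = x k := by
  have h1 : ((k : ℤ) % (n : ℤ)).toNat = k := by
    rw [Int.emod_eq_of_lt (by omega) (by omega)]; rfl
  have h2 : (k : ℤ) / (n : ℤ) = 0 := Int.ediv_eq_zero_of_lt (by omega) (by omega)
  rw [addExt, h1, h2]
  simp

theorem addExt_add {R : Type*} [Ring R] {n : ℕ} (s : R) (x : ℕ → R) {k : ℕ} (h : k < n) :
    addExt n s x ((k : ℤ) + n) = x k + s := by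
  have h1 : (((k : ℤ) + n) % (n : ℤ)).toNat = k := by
    rw [Int.add_emod_right, Int.emod_eq_of_lt (by omega) (by omega)]; rfl
  have h2 : ((k : ℤ) + n) / (n : ℤ) = 1 := by
    rw [Int.add_ediv_of_dvd_right (dvd_refl _), Int.ediv_eq_zero_of_lt (by omega) (by omega),
      Int.ediv_self (by omega), zero_add]
  rw [addExt, h1, h2]
  simp

/-- A cyclic pair `(i, i + k)` with `0 < k < N` either stays below `2 N`, and is then a pair at
distance less than `N`, or wraps around, and is then a pair at distance more than `N` in which the
smaller point is shifted by the period. Opposite points do not occur. -/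
theorem crossed_eq (N : ℕ) (x : ℕ → Poly m) :
    crossed N b c x = ∏ e ∈ pairs (2 * N), pairFactor b c x (crossType N e) e := by
  unfold crossed
  rw [← Finset.prod_product']
  have hsub : (pairs (2 * N)).filter (fun e => crossType N e ≠ 0) ⊆ pairs (2 * N) :=
    Finset.filter_subset _ _
  rw [← Finset.prod_subset hsub (f := fun e => pairFactor b c x (crossType N e) e)]
  · refine Finset.prod_bij' (fun e _ => if e.1 + e.2 < 2 * N then (e.1, e.1 + e.2)
        else (e.1 + e.2 - 2 * N, e.1))
      (fun e _ => if e.2 < e.1 + N then (e.1, e.2 - e.1) else (e.2, 2 * N - (e.2 - e.1)))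
      ?_ ?_ ?_ ?_ ?_
    · rintro ⟨i, k⟩ h
      simp only [Finset.mem_product, Finset.mem_range, Finset.mem_Ico] at h
      by_cases hik : i + k < 2 * N
      · simp only [if_pos hik]
        rw [Finset.mem_filter, mem_pairs]
        simp only [crossType]
        rw [if_pos (by omega)]
        omega
      · simp only [if_neg hik]
        rw [Finset.mem_filter, mem_pairs]
        simp only [crossType]
        rw [if_neg (by omega), if_neg (by omega)]
        omega
    · rintro ⟨i, k⟩ h
      rw [Finset.mem_filter, mem_pairs] at h
      simp only [crossType] at h
      by_cases hik : k < i + N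
      · simp only [if_pos hik, Finset.mem_product, Finset.mem_range, Finset.mem_Ico]
        omega
      · have : k ≠ i + N := fun h1 => h.2 (by rw [if_neg hik, if_pos h1])
        simp only [if_neg hik, Finset.mem_product, Finset.mem_range, Finset.mem_Ico]
        omega
    · rintro ⟨i, k⟩ h
      simp only [Finset.mem_product, Finset.mem_range, Finset.mem_Ico] at h
      by_cases hik : i + k < 2 * N
      · simp only [if_pos hik]
        rw [if_pos (by omega), Prod.mk.injEq]
        omega
      · simp only [if_neg hik]
        rw [if_neg (by omega), Prod.mk.injEq]
        omega
    · rintro ⟨i, k⟩ h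
      rw [Finset.mem_filter, mem_pairs] at h
      simp only [crossType] at h
      by_cases hik : k < i + N
      · simp only [if_pos hik]
        rw [if_pos (by omega), Prod.mk.injEq]
        omega
      · simp only [if_neg hik]
        rw [if_neg (by omega), Prod.mk.injEq]
        omega
    · rintro ⟨i, k⟩ h
      simp only [Finset.mem_product, Finset.mem_range, Finset.mem_Ico] at h
      unfold bExt
      simp only
      rw [addExt_of_lt _ _ h.1]
      by_cases hik : i + k < 2 * N
      · simp only [if_pos hik, pairFactor, crossType]
        rw [← Nat.cast_add, addExt_of_lt _ _ hik, if_pos (show i + k < i + N by omega), if_pos rfl]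
      · simp only [if_neg hik, pairFactor, crossType]
        rw [show (i : ℤ) + k = ((i + k - 2 * N : ℕ) : ℤ) + (2 * N : ℕ) by omega,
          addExt_add _ _ (by omega)]
        rw [if_neg (show ¬ i < i + k - 2 * N + N by omega),
          if_neg (show ¬ i = i + k - 2 * N + N by omega), if_neg (by omega), if_pos rfl]
        simp only [C_add, C_mul]
        have : (C 2 : Poly m) = 2 := map_ofNat C 2
        rw [this]
        ring
  · intro e he he'
    have : crossType N e = 0 := by
      by_contra h
      exact he' (Finset.mem_filter.2 ⟨he, h⟩)
    simp [pairFactor, this]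

theorem swapPoly_pairFactor (i : Fin (2 * m - 1)) (t : ℕ) {e : ℕ × ℕ} (he : e.1 < 2 * m)
    (he' : e.2 < 2 * m) : swapPoly i (pairFactor b c (uSeq m) t e) =
      pairFactor b c (uSeq m) t (sN i e.1, sN i e.2) := by
  unfold pairFactor
  split_ifs <;> simp [swapPoly_uSeq i he, swapPoly_uSeq i he', swapPoly_C]

/-- A product over pairs of points that is invariant under an exchange of neighbours. -/
theorem swapPoly_prod_pairs (i : Fin (2 * m - 1)) (X : Finset (ℕ × ℕ)) (θ : ℕ × ℕ → ℕ)
    (hi : (i.val, i.val + 1) ∈ X)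
    (hX : ∀ e ∈ X, e = (i.val, i.val + 1) ∨ (sN i e.1, sN i e.2) ∈ X)
    (hθ : ∀ e ∈ pairs (2 * m), e ∉ X → θ (sN i e.1, sN i e.2) = θ e) :
    swapPoly i (∏ e ∈ pairs (2 * m) \ X, pairFactor b c (uSeq m) (θ e) e) =
      ∏ e ∈ pairs (2 * m) \ X, pairFactor b c (uSeq m) (θ e) e := by
  rw [map_prod]
  have hs : ∀ e ∈ pairs (2 * m) \ X, (sN i e.1, sN i e.2) ∈ pairs (2 * m) \ X := by
    intro e he
    rw [Finset.mem_sdiff, mem_pairs] at *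
    have hil := i.2
    refine ⟨⟨?_, sN_lt (by omega) he.1.2⟩, fun h => ?_⟩
    · have h1 : ¬ (e.1 = i ∧ e.2 = i + 1) := by
        rintro ⟨h1, h2⟩
        exact he.2 (by rw [show e = (i.val, i.val + 1) from Prod.ext h1 h2]; exact hi)
      simp only [sN]
      split_ifs <;> omega
    · rcases hX _ h with h1 | h1
      · have h2 := congrArg (fun p => sN i p.1) h1
        have h3 := congrArg (fun p => sN i p.2) h1
        simp only [sN_sN, sN_left, sN_right] at h2 h3
        omega
      · simp only [sN_sN] at h1
        exact he.2 h1
  refine Finset.prod_bij' (fun e _ => (sN i e.1, sN i e.2)) (fun e _ => (sN i e.1, sN i e.2))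
    hs hs ?_ ?_ ?_
  · intro e _; simp [sN_sN]
  · intro e _; simp [sN_sN]
  · intro e he
    rw [Finset.mem_sdiff] at he
    have h := mem_pairs.1 he.1
    rw [swapPoly_pairFactor b c i _ (by omega) h.2, hθ e he.1 he.2]

theorem rhoBar_eq : rhoBar m b c =
    ∏ e ∈ pairs (2 * m), pairFactor b c (uSeq m) (crossType m e) e := crossed_eq b c m _

variable {b c}

/-- The image under `t̄_i` of `b_{i i+1} A P`, where `A` is symmetric. -/
theorem step_mul_of_swap {i : Fin (2 * m - 1)} {A P Q : Poly m} (hA : swapPoly i A = A)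
    (h : dP i * Q = C c * P - (dP i + C c) * swapPoly i P) :
    Step (N := 2 * m) b c i (bP b i * (A * P)) (bP b i * (A * Q)) := by
  refine ⟨A * P, A * Q, rfl, rfl, ?_⟩
  have e1 : (dl (N := 2 * m) i : Poly m) = dP i := by
    rw [dl, lin, C_0, add_zero]; rfl
  rw [e1, ← swapPoly_eq_sw, map_mul, hA]
  linear_combination A * h

/-- The exchanges at two opposite places act in the same way on the maximally crossed
polynomial. -/
theorem exists_step_rhoBar {j k : Fin (2 * m - 1)} (hk : k.val = j + m) (hm : 2 ≤ m) :
    ∃ f, Step (N := 2 * m) b c j (rhoBar m b c) f ∧ Step (N := 2 * m) b c k (rhoBar m b c) f := by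
  have hkl := k.2
  set x := uSeq m j with hx
  set y := uSeq m (j + 1) with hy
  set v := uSeq m k with hv
  set w := uSeq m (k + 1) with hw
  -- The six pairs among the four points concerned; the product over all other pairs is invariant
  -- under both exchanges.
  set X : Finset (ℕ × ℕ) := {(j.val, j.val + 1), (k.val, k.val + 1), (j.val, k.val),
    (j.val + 1, k.val + 1), (j.val + 1, k.val), (j.val, k.val + 1)} with hXdef
  set A := ∏ e ∈ pairs (2 * m) \ X, pairFactor b c (uSeq m) (crossType m e) e with hA
  have hXs : X ⊆ pairs (2 * m) := by
    intro e he
    simp only [hXdef, Finset.mem_insert, Finset.mem_singleton] at he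
    rw [mem_pairs]
    rcases he with rfl | rfl | rfl | rfl | rfl | rfl <;> simp only <;> omega
  have hXp : ∏ e ∈ X, pairFactor b c (uSeq m) (crossType m e) e =
      (x - y + C b) * ((v - w + C b) * ((y - v + C b) * (w - x - C (b + c)))) := by
    have ne : ∀ {p q r s : ℕ}, (p ≠ r ∨ q ≠ s) → (p, q) ≠ (r, s) := by
      intro p q r s h h'
      rw [Prod.mk.injEq] at h'
      omega
    rw [hXdef]
    iterate 5 rw [Finset.prod_insert (by
      simp only [Finset.mem_insert, Finset.mem_singleton, Prod.mk.injEq]; omega)]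
    rw [Finset.prod_singleton]
    simp only [pairFactor, crossType, ← hx, ← hy, ← hv, ← hw]
    rw [if_pos (show j.val + 1 < j + m by omega), if_pos (show k.val + 1 < k + m by omega),
      if_neg (show ¬ k.val < j + m by omega), if_pos hk,
      if_neg (show ¬ k.val + 1 < j + 1 + m by omega),
      if_pos (show k.val + 1 = j + 1 + m by omega), if_pos (show k.val < j + 1 + m by omega),
      if_neg (show ¬ k.val + 1 < j + m by omega), if_neg (show ¬ k.val + 1 = j + m by omega)]
    simp
  have hrho : rhoBar m b c = A *
      ((x - y + C b) * ((v - w + C b) * ((y - v + C b) * (w - x - C (b + c))))) := by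
    rw [rhoBar_eq, ← Finset.prod_sdiff hXs, hXp]
  have inv : ∀ i, (i = j ∨ i = k) → swapPoly i A = A := by
    intro i hi
    apply swapPoly_prod_pairs
    · simp only [hXdef, Finset.mem_insert, Finset.mem_singleton, Prod.mk.injEq]
      rcases hi with rfl | rfl <;> simp
    · intro e he
      simp only [hXdef, Finset.mem_insert, Finset.mem_singleton] at he ⊢
      rcases hi with rfl | rfl <;> rcases he with rfl | rfl | rfl | rfl | rfl | rfl <;>
        simp only [sN, Prod.mk.injEq] <;> split_ifs <;> first | exact Or.inl trivial | omega
    · rintro ⟨p, q⟩ he he'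
      rw [mem_pairs] at he
      simp only at he
      simp only [hXdef, Finset.mem_insert, Finset.mem_singleton, not_or, Prod.mk.injEq] at he'
      simp only [crossType, sN]
      rcases hi with rfl | rfl <;> split_ifs <;> omega
  have sj : ∀ {l : ℕ}, l < 2 * m → swapPoly j (uSeq m l) = uSeq m (sN j l) :=
    fun h => swapPoly_uSeq j h
  have sk : ∀ {l : ℕ}, l < 2 * m → swapPoly k (uSeq m l) = uSeq m (sN k l) :=
    fun h => swapPoly_uSeq k h
  have jx : swapPoly j x = y := by rw [hx, sj (by omega), sN_left]
  have jy : swapPoly j y = x := by rw [hy, sj (by omega), sN_right]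
  have jv : swapPoly j v = v := by rw [hv, sj (by omega), sN_of_ne (by omega) (by omega)]
  have jw : swapPoly j w = w := by rw [hw, sj (by omega), sN_of_ne (by omega) (by omega)]
  have kx : swapPoly k x = x := by rw [hx, sk (by omega), sN_of_ne (by omega) (by omega)]
  have ky : swapPoly k y = y := by rw [hy, sk (by omega), sN_of_ne (by omega) (by omega)]
  have kv : swapPoly k v = w := by rw [hv, sk (by omega), sN_left]
  have kw : swapPoly k w = v := by rw [hw, sk (by omega), sN_right]
  have bj : bP b j = x - y + C b := by rw [bP, dP_eq]
  have bk : bP b k = v - w + C b := by rw [bP, dP_eq]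
  -- With `P` the product of the two factors that connect the neighbours, the quotient of `c P - (d
  -- + c) s P` by `d` is this same polynomial for both exchanges. That is the whole coincidence.
  set Q : Poly m := -((x - v + C b) * (w - y - C (b + c))) - C c * (w - v - C c) with hQ
  refine ⟨bP b j * (A * bP b k * Q), ?_, ?_⟩
  · have h1 : rhoBar m b c = bP b j * (A * bP b k * ((y - v + C b) * (w - x - C (b + c)))) := by
      rw [hrho, bj, bk]; ring
    rw [h1]
    apply step_mul_of_swap
    · rw [map_mul, inv j (Or.inl rfl), bk, map_add, map_sub, jv, jw, swapPoly_C]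
    · simp only [map_mul, map_add, map_sub, swapPoly_C, jx, jy, jv, jw, dP_eq j, hQ,
        ← hx, ← hy]
      ring
  · have h1 : rhoBar m b c = bP b k * (A * bP b j * ((y - v + C b) * (w - x - C (b + c)))) := by
      rw [hrho, bj, bk]; ring
    have h2 : bP b j * (A * bP b k * Q) = bP b k * (A * bP b j * Q) := by ring
    rw [h1, h2]
    apply step_mul_of_swap
    · rw [map_mul, inv k (Or.inr rfl), bj, map_add, map_sub, kx, ky, swapPoly_C]
    · simp only [map_mul, map_add, map_sub, swapPoly_C, kx, ky, kv, kw, dP_eq k, hQ,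
        ← hv, ← hw]
      ring

end PairProducts

/-! ### The dual family -/

namespace Pattern
variable {m : ℕ}

theorem lift_inj (π : Pattern m) {k l : ℕ} (hk : k < 2 * m) (hl : l < 2 * m)
    (h : π.lift k = π.lift l) : k = l := by
  have h1 := π.nv_lt hk
  have h2 := π.nv_lt hl
  apply π.nv_inj
  unfold lift at h
  split_ifs at h <;> omega

theorem desc_or_desc_actT (π : Pattern m) (j : Fin (2 * m - 1)) (h : π.nv j ≠ j + 1) :
    π.Desc j ∨ (π.actT j).Desc j := by
  have hj := j.2
  unfold Desc
  rw [lift_actT_left π j h, lift_actT_right π j h]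
  have : π.lift (j + 1) ≠ π.lift j := fun h' => by
    have := π.lift_inj (by omega) (by omega) h'
    omega
  omega

/-- The links at `j` and `j + 1` end at the neighbouring points `k` and `k + 1`. -/
def Parallel (π : Pattern m) (j k : ℕ) : Prop :=
  π.nv j = k ∧ π.nv (j + 1) = k + 1 ∧ (j + 2 ≤ k ∨ k + 2 ≤ j)

theorem Parallel.symm {π : Pattern m} {j k : ℕ} (h : π.Parallel j k) : π.Parallel k j :=
  ⟨by rw [← h.1, nv_nv], by rw [← h.2.1, nv_nv], h.2.2.symm⟩

theorem Parallel.lift_succ {π : Pattern m} {j k : ℕ} (h : π.Parallel j k) :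
    π.lift (j + 1) = π.lift j + 1 := by
  obtain ⟨h1, h2, h3⟩ := h
  unfold lift
  rw [h1, h2]
  split_ifs <;> omega

theorem Parallel.actT_far {π : Pattern m} {j k : ℕ} (h : π.Parallel j k)
    (hj : j + 1 < 2 * m) (hk : k + 1 < 2 * m) {i : Fin (2 * m - 1)}
    (hij : j + 2 ≤ i ∨ i + 2 ≤ j) (hik : k + 2 ≤ i ∨ i + 2 ≤ k) : (π.actT i).Parallel j k := by
  obtain ⟨h1, h2, h3⟩ := h
  refine ⟨?_, ?_, h3⟩
  · rw [nv_actT _ _ (by omega), sN_of_ne (k := j) (by omega) (by omega), h1,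
      sN_of_ne (by omega) (by omega)]
  · rw [nv_actT _ _ hj, sN_of_ne (k := j + 1) (by omega) (by omega), h2,
      sN_of_ne (by omega) (by omega)]

/-- A descent next to one end of a pair of parallel links is far from the other end, it can be
followed by another descent, and parallel links result. -/
theorem Parallel.desc_adj {π : Pattern m} {j i : Fin (2 * m - 1)} {k : ℕ} (h : π.Parallel j k)
    (hk : k + 1 < 2 * m) (hi : π.Desc i) (hij : Adj i j) :
    (k + 2 ≤ i ∨ i + 2 ≤ k) ∧ (π.actT i).Desc j ∧ ((π.actT i).actT j).Parallel i k := by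
  have hl := h.lift_succ
  have hl' := h.symm.lift_succ
  have hj2 := j.2
  have hi2 := i.2
  have hu := hi.unlinked (by omega)
  have hfar : k + 2 ≤ i ∨ i + 2 ≤ k := by
    have h1 := h.1
    have h2 := h.2.1
    have g1 := h.symm.1
    have g2 := h.symm.2.1
    have h3 := h.2.2
    by_contra hcon
    unfold Desc lift at hi
    rcases hij with hij | hij
    · have e : i.val = k + 1 := by omega
      rw [e, g2, show k + 1 + 1 = j.val by omega, h1] at hi
      split_ifs at hi <;> omega
    · have e : i.val = j + 1 := by omega
      rw [e, h2, show j.val + 1 + 1 = k by omega, g1] at hi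
      split_ifs at hi <;> omega
  obtain ⟨h1, h2, h3⟩ := h
  refine ⟨hfar, ?_, ?_, ?_, ?_⟩
  · unfold Desc at *
    rcases hij with hij | hij
    · have e1 := lift_actT_right π i hu
      have e2 := lift_actT_other π i (k := j + 1) (by omega) (by omega) (by omega)
      rw [h2, if_neg (by omega), if_neg (by omega)] at e2
      rw [hij] at e1 hi
      rw [e1, e2]
      have := mt (π.lift_inj (k := i) (l := j + 1) (by omega) (by omega)) (by omega)
      omega
    · have e1 := lift_actT_left π i hu
      have e2 := lift_actT_other π i (k := j) (by omega) (by omega) (by omega)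
      rw [h1, if_neg (by omega), if_neg (by omega)] at e2
      rw [hij, e1, e2]
      rw [hij] at hl
      have := mt (π.lift_inj (k := i + 1) (l := j) (by omega) (by omega)) (by omega)
      omega
  · rw [nv_actT _ _ (by omega), nv_actT _ _ (sN_lt (by omega) (by omega))]
    rcases hij with hij | hij
    · rw [sN_of_ne (j := j) (k := i) (by omega) (by omega), sN_left, hij, h1,
        sN_of_ne (j := i) (by omega) (by omega), sN_of_ne (by omega) (by omega)]
    · rw [← hij, sN_right, sN_of_ne (j := j + 1) (k := j) (by omega) (by omega), h1,
        sN_of_ne (j := j + 1) (by omega) (by omega), sN_of_ne (by omega) (by omega)]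
  · rw [nv_actT _ _ (by omega), nv_actT _ _ (sN_lt (by omega) (by omega))]
    rcases hij with hij | hij
    · rw [← hij, sN_left, sN_of_ne (j := i) (k := i + 1 + 1) (by omega) (by omega), hij, h2,
        sN_of_ne (j := i) (by omega) (by omega), sN_of_ne (by omega) (by omega)]
    · rw [sN_of_ne (j := j) (k := i + 1) (by omega) (by omega), sN_right, ← hij, h2,
        sN_of_ne (j := j + 1) (by omega) (by omega), sN_of_ne (by omega) (by omega)]
  · exact hfar.symm

theorem nv_actT_three (π : Pattern m) {j : Fin (2 * m - 1)} {p q r : ℕ} (hj : j.val + 2 < 2 * m)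
    (hp : π.nv j = p) (hq : π.nv (j + 1) = q) (hr : π.nv (j + 2) = r)
    (p0 : p < j ∨ j + 2 < p) (q0 : q < j ∨ j + 2 < q) (r0 : r < j ∨ j + 2 < r) :
    (π.actT j).nv j = q ∧ (π.actT j).nv (j + 1) = p ∧ (π.actT j).nv (j + 2) = r := by
  refine ⟨?_, ?_, ?_⟩
  · rw [nv_actT _ _ (by omega), sN_left, hq, sN_of_ne (by omega) (by omega)]
  · rw [nv_actT _ _ (by omega), sN_right, hp, sN_of_ne (by omega) (by omega)]
  · rw [nv_actT _ _ (by omega), sN_of_ne (k := j + 2) (by omega) (by omega), hr,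
      sN_of_ne (by omega) (by omega)]

theorem nv_actT_three' (π : Pattern m) {j : ℕ} {k : Fin (2 * m - 1)} (hk : k.val = j + 1)
    {p q r : ℕ} (hp : π.nv j = p) (hq : π.nv (j + 1) = q) (hr : π.nv (j + 2) = r)
    (p0 : p < j ∨ j + 2 < p) (q0 : q < j ∨ j + 2 < q) (r0 : r < j ∨ j + 2 < r) :
    (π.actT k).nv j = p ∧ (π.actT k).nv (j + 1) = r ∧ (π.actT k).nv (j + 2) = q := by
  have hk2 := k.2
  refine ⟨?_, ?_, ?_⟩
  · rw [nv_actT _ _ (by omega), sN_of_ne (k := j) (by omega) (by omega), hp,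
      sN_of_ne (by omega) (by omega)]
  · rw [nv_actT _ _ (by omega), ← hk, sN_left, hk, hr, sN_of_ne (by omega) (by omega)]
  · rw [nv_actT _ _ (by omega), show j + 2 = k.val + 1 by omega, sN_right, hk, hq,
      sN_of_ne (by omega) (by omega)]

/-- Two neighbouring descents make three consecutive lifts strictly decreasing, and then none of the
three points is linked to another. The exchanges permute the three outer partners freely, and both
ways of reversing them pass through descents: these are the two sides of the braid relation. -/
theorem desc_three {π : Pattern m} {j k : Fin (2 * m - 1)} (hjk : k.val = j + 1) (hj : π.Desc j)
    (hk : π.Desc k) : ((π.actT j).Desc k ∧ ((π.actT j).actT k).Desc j) ∧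
      (π.actT k).Desc j ∧ ((π.actT k).actT j).Desc k := by
  have hj2 := j.2
  have hk2 := k.2
  have uj := hj.unlinked (by omega)
  have uk := hk.unlinked (by omega)
  rw [hjk] at uk
  have v0 : π.nv j ≠ j + 2 := by
    intro h
    have h' := π.nv_nv j
    rw [h] at h'
    unfold Desc lift at hj hk
    rw [hjk] at hk
    rw [h] at hj
    rw [h'] at hk
    split_ifs at hj hk <;> omega
  have w1 := π.nv_nv (j + 1)
  have w2 := π.nv_nv (j + 2)
  have a1 : π.nv (j + 1) ≠ j := fun h => by rw [h] at w1; exact uj w1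
  have a2 : π.nv (j + 2) ≠ j := fun h => by rw [h] at w2; exact v0 w2
  have a3 : π.nv (j + 2) ≠ j + 1 := fun h => by rw [h] at w2; exact uk w2
  have n0 := π.nv_ne (k := j) (by omega)
  have n1 := π.nv_ne (k := j + 1) (by omega)
  have n2 := π.nv_ne (k := j + 2) (by omega)
  obtain ⟨p, hp⟩ : ∃ p, π.nv j = p := ⟨_, rfl⟩
  obtain ⟨q, hq⟩ : ∃ q, π.nv (j + 1) = q := ⟨_, rfl⟩
  obtain ⟨r, hr⟩ : ∃ r, π.nv (j + 2) = r := ⟨_, rfl⟩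
  rw [hp] at uj v0 n0
  rw [hq] at uk a1 n1
  rw [hr] at a2 a3 n2
  have p0 : p < j ∨ j + 2 < p := by omega
  have q0 : q < j ∨ j + 2 < q := by omega
  have r0 : r < j ∨ j + 2 < r := by omega
  obtain ⟨A1, A2, A3⟩ := π.nv_actT_three (by omega) hp hq hr p0 q0 r0
  obtain ⟨B1, B2, B3⟩ := nv_actT_three' (π.actT j) hjk A1 A2 A3 q0 p0 r0
  obtain ⟨C1, C2, C3⟩ := π.nv_actT_three' hjk hp hq hr p0 q0 r0
  obtain ⟨D1, D2, D3⟩ := nv_actT_three (π.actT k) (by omega) C1 C2 C3 p0 r0 q0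
  unfold Desc lift at *
  rw [hjk] at *
  rw [A2, A3, B1, B2, C1, C2, D2, D3]
  rw [hp, hq] at hj
  rw [hq, hr] at hk
  clear * - hj hk p0 q0 r0
  split_ifs at * <;> omega

/-- When two nested links join `{j, j + 1}` to `{k, k + 1}`, exchanging the ends at `j` or the ends
at `k` yields the same pair of crossing links. -/
theorem Parallel.eq_actT {π : Pattern m} {j k : Fin (2 * m - 1)}
    (h : π.nv k = j + 1 ∧ π.nv (k + 1) = j) (hjk : j.val + 2 ≤ k ∨ k.val + 2 ≤ j) :
    π.actT j = π.actT k ∧ (π.actT j).Parallel j k := by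
  have hj := j.2
  have hk := k.2
  have h1 : π.nv j = k + 1 := by rw [← h.2, nv_nv]
  have h2 : π.nv (j + 1) = k := by rw [← h.1, nv_nv]
  constructor
  · apply ext_nv
    intro x hx
    rw [nv_actT _ _ hx, nv_actT _ _ hx]
    have s1 : sN j k = k := sN_of_ne (by omega) (by omega)
    have s2 : sN j (k + 1) = k + 1 := sN_of_ne (by omega) (by omega)
    have s3 : sN k j = j := sN_of_ne (by omega) (by omega)
    have s4 : sN k (j + 1) = j + 1 := sN_of_ne (by omega) (by omega)
    by_cases c1 : x = j
    · rw [c1, sN_left, s3, h2, h1, sN_right, s1]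
    by_cases c2 : x = j + 1
    · rw [c2, sN_right, s4, h2, h1, sN_left, s2]
    by_cases c3 : x = k
    · rw [c3, s1, h.1, sN_right, sN_left, h.2, s3]
    by_cases c4 : x = k + 1
    · rw [c4, s2, h.2, sN_right, sN_left, h.1, s4]
    rw [sN_of_ne c1 c2, sN_of_ne c3 c4]
    have n1 : π.nv x ≠ j := fun h' => c4 (by rw [← h1, ← h', nv_nv])
    have n2 : π.nv x ≠ j + 1 := fun h' => c3 (by rw [← h2, ← h', nv_nv])
    have n3 : π.nv x ≠ k := fun h' => c2 (by rw [← h.1, ← h', nv_nv])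
    have n4 : π.nv x ≠ k + 1 := fun h' => c1 (by rw [← h.2, ← h', nv_nv])
    rw [sN_of_ne n1 n2, sN_of_ne n3 n4]
  · refine ⟨?_, ?_, hjk⟩
    · rw [nv_actT _ _ (by omega), sN_left, h2, sN_of_ne (by omega) (by omega)]
    · rw [nv_actT _ _ (by omega), sN_right, h1, sN_of_ne (by omega) (by omega)]

end Pattern

/-! ### Independence of the dual family from the chosen descents. -/

section Family
variable {m : ℕ} (b c : ℂ)

open Classical in
/-- The dual family, as rational functions: along a chosen sequence of descents. -/
def dualRat (π : Pattern m) : RatFun m :=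
  if h : π = Pattern.rho m then toRat (rhoBar m b c)
  else tBar b c (Pattern.exists_desc h).choose
    (dualRat (π.actT (Pattern.exists_desc h).choose))
termination_by π.spread
decreasing_by exact Pattern.spread_actT_lt (Pattern.exists_desc h).choose_spec

theorem dualRat_rho : dualRat b c (Pattern.rho m) = toRat (rhoBar m b c) := by
  rw [dualRat, dif_pos rfl]

theorem exists_dualRat_eq {π : Pattern m} (h : π ≠ Pattern.rho m) :
    ∃ j : Fin (2 * m - 1), π.Desc j ∧ dualRat b c π = tBar b c j (dualRat b c (π.actT j)) := by
  refine ⟨_, (Pattern.exists_desc h).choose_spec, ?_⟩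
  rw [dualRat, dif_neg h]

variable {b c}

/-- Induction along descents, down to ρ, where parallel places are opposite and the two images were
computed. A descent next to one end of the parallel pair is moved through by the braid relation and
leads to a smaller parallel pair; a descent far from both ends commutes; a descent at an end cannot
occur, since `lift` increases there. -/
theorem tBar_dualRat_of_parallel {s : ℕ} (hs : ∀ (π : Pattern m) (j : Fin (2 * m - 1)),
      π.spread < s → π.Desc j → dualRat b c π = tBar b c j (dualRat b c (π.actT j)))
    (σ : Pattern m) (hσ : σ.spread < s) (j k : Fin (2 * m - 1)) (h : σ.Parallel j k) :
    tBar b c j (dualRat b c σ) = tBar b c k (dualRat b c σ) := by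
  induction hn : σ.spread using Nat.strong_induction_on generalizing σ j k with
  | _ n ih =>
    subst hn
    have hj2 := j.2
    have hk2 := k.2
    by_cases hρ : σ = Pattern.rho m
    · subst hρ
      rw [dualRat_rho]
      have key : ∀ j k : Fin (2 * m - 1), j < k → (Pattern.rho m).Parallel j k →
          tBar b c j (toRat (rhoBar m b c)) = tBar b c k (toRat (rhoBar m b c)) := by
        intro j k hjk h
        have hk2 := k.2
        obtain ⟨h1, h2, h3⟩ := h
        rw [Pattern.rho_nv (by omega)] at h1 h2
        have h4 : k.val = j + m := by split_ifs at h1 <;> omega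
        obtain ⟨f, f1, f2⟩ := exists_step_rhoBar (b := b) (c := c) h4 (by omega)
        rw [f1.tBar_eq, f2.tBar_eq]
      rcases lt_trichotomy j k with hjk | hjk | hjk
      · exact key j k hjk h
      · rw [hjk]
      · exact (key k j hjk h.symm).symm
    obtain ⟨i, hi⟩ := Pattern.exists_desc hρ
    have hi2 := i.2
    have hlt := Pattern.spread_actT_lt hi
    have adj : ∀ j k : Fin (2 * m - 1), Adj i j → σ.Parallel j k →
        tBar b c j (dualRat b c σ) = tBar b c k (dualRat b c σ) := by
      intro j k hij h
      have hk2 := k.2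
      obtain ⟨a1, a2, a3⟩ := h.desc_adj (by omega) hi hij
      have hlt' := Pattern.spread_actT_lt a2
      rw [hs σ i hσ hi, hs _ j (hlt.trans hσ) a2]
      have e := ih _ (hlt'.trans hlt) _ ((hlt'.trans hlt).trans hσ) i k a3 rfl
      set g := dualRat b c ((σ.actT i).actT j)
      have e2 : tBar b c j (tBar b c i (tBar b c j g)) =
          tBar b c i (tBar b c j (tBar b c i g)) := by
        rcases hij with hij | hij
        · exact (tBar_braid hij.symm g).symm
        · exact tBar_braid hij.symm g
      have fjk : Far j k := h.2.2
      have fik : Far i k := a1.symm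
      rw [e2, e, tBar_comm fjk, tBar_comm fik]
    by_cases aj : Adj i j
    · exact adj j k aj h
    by_cases ak : Adj i k
    · exact (adj k j ak h.symm).symm
    have hnj : i.val ≠ j := fun h' => by
      have := h.lift_succ
      unfold Pattern.Desc at hi
      rw [h'] at hi
      omega
    have hnk : i.val ≠ k := fun h' => by
      have := h.symm.lift_succ
      unfold Pattern.Desc at hi
      rw [h'] at hi
      omega
    unfold Adj at aj ak
    have fj : Far i j := by unfold Far; omega
    have fk : Far i k := by unfold Far; omega
    rw [hs σ i hσ hi, ← tBar_comm fj, ← tBar_comm fk,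
      ih _ hlt _ (hlt.trans hσ) j k (h.actT_far (by omega) (by omega) fj.symm fk.symm) rfl]

/-- A diamond argument by induction on `spread`. Neighbouring descents are joined by the braid
relation, distant ones by commutation, except when their links connect the two places to each other;
that exception is what `tBar_dualRat_of_parallel` is for. -/
theorem dualRat_eq_of_desc {π : Pattern m} {j : Fin (2 * m - 1)} (h : π.Desc j) :
    dualRat b c π = tBar b c j (dualRat b c (π.actT j)) := by
  induction hn : π.spread using Nat.strong_induction_on generalizing π j with
  | _ n ih =>
    subst hn
    have hs : ∀ (σ : Pattern m) (j : Fin (2 * m - 1)), σ.spread < π.spread → σ.Desc j →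
        dualRat b c σ = tBar b c j (dualRat b c (σ.actT j)) := fun σ j h1 h2 => ih _ h1 h2 rfl
    have hρ : π ≠ Pattern.rho m := by
      rintro rfl
      exact Pattern.not_desc_rho (by have := j.2; omega) h
    obtain ⟨k, hk, e⟩ := exists_dualRat_eq b c hρ
    rw [e]
    have hj2 := j.2
    have hk2 := k.2
    have lj := Pattern.spread_actT_lt h
    have lk := Pattern.spread_actT_lt hk
    have adj : ∀ j k : Fin (2 * m - 1), k.val = j + 1 → π.Desc j → π.Desc k →
        tBar b c k (dualRat b c (π.actT k)) = tBar b c j (dualRat b c (π.actT j)) := by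
      intro j k hjk h hk
      obtain ⟨⟨a1, a2⟩, a3, a4⟩ := Pattern.desc_three hjk h hk
      have lj := Pattern.spread_actT_lt h
      have lk := Pattern.spread_actT_lt hk
      rw [hs _ k lj a1, hs _ j ((Pattern.spread_actT_lt a1).trans lj) a2, hs _ j lk a3,
        hs _ k ((Pattern.spread_actT_lt a3).trans lk) a4,
        Pattern.actT_braid π (j := j) (k := k) (Or.inl hjk.symm), tBar_braid hjk]
    rcases lt_trichotomy j k with hjk | hjk | hjk
    · by_cases hjk' : k.val = j + 1
      · exact adj j k hjk' h hk
      have far : j.val + 2 ≤ k := by omega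
      -- In the case of nested links joining the two places, the second descent is lost after the
      -- first exchange, so commutation is not available.
      by_cases hd : π.nv k = j + 1 ∧ π.nv (k + 1) = j
      · obtain ⟨e1, e2⟩ := Pattern.Parallel.eq_actT hd (Or.inl far)
        rw [← e1]
        exact (tBar_dualRat_of_parallel hs _ lj j k e2).symm
      · have d1 := Pattern.Desc.actT_far (by omega) (Or.inl far) hk hd
        have d2 := Pattern.Desc.actT_far (π := π) (j := k) (by omega) (Or.inr far) h fun hd' =>
          hd ⟨by rw [← hd'.2, π.nv_nv], by rw [← hd'.1, π.nv_nv]⟩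
        rw [hs _ k lj d1, hs _ j lk d2, Pattern.actT_comm π (j := j) (k := k) (Or.inl far),
          tBar_comm (Or.inl far)]
    · rw [hjk]
    · by_cases hjk' : j.val = k + 1
      · exact (adj k j hjk' hk h).symm
      have far : k.val + 2 ≤ j := by omega
      by_cases hd : π.nv k = j + 1 ∧ π.nv (k + 1) = j
      · obtain ⟨e1, e2⟩ := Pattern.Parallel.eq_actT hd (Or.inr far)
        rw [← e1]
        exact (tBar_dualRat_of_parallel hs _ lj j k e2).symm
      · have d1 := Pattern.Desc.actT_far (by omega) (Or.inr far) hk hd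
        have d2 := Pattern.Desc.actT_far (π := π) (j := k) (by omega) (Or.inl far) h fun hd' =>
          hd ⟨by rw [← hd'.2, π.nv_nv], by rw [← hd'.1, π.nv_nv]⟩
        rw [hs _ k lj d1, hs _ j lk d2, Pattern.actT_comm π (j := j) (k := k) (Or.inr far),
          tBar_comm (Or.inr far)]

/-- Of `π` and `t_j π`, one has a descent at `j`; the involution property of t̄_j covers the other
direction. -/
theorem dualRat_actT (π : Pattern m) (j : Fin (2 * m - 1)) (h : π.nv j ≠ j + 1) :
    dualRat b c (π.actT j) = tBar b c j (dualRat b c π) := by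
  rcases π.desc_or_desc_actT j h with hd | hd
  · rw [dualRat_eq_of_desc hd, tBar_tBar]
  · rw [dualRat_eq_of_desc hd, Pattern.actT_actT]

end Family

/-! ### Linear factors that persist under an exchange operator. -/

section Link
variable {N : ℕ} {b c : ℂ} {i : Fin (N - 1)} {f f' : MvPolynomial (Fin N) ℂ}

/-- On the hyperplane both terms in the evaluation of the image vanish. One exchanged coordinate is
different from `x` and `y` and can be moved, so the denominators are harmless. -/
theorem Step.lin_dvd (s : Step b c i f f') {x y : Fin N} (hxy : x < y)
    (hne : ¬ (x = lp i ∧ y = rp i)) (h1 : lin x y b ∣ f)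
    (h2 : lin (nswap i x) (nswap i y) b ∣ f) : lin x y b ∣ f' := by
  rw [lin_dvd_iff hxy.ne] at h1 ⊢
  rw [lin_dvd_iff (fun h => hxy.ne ((nswap i).injective h))] at h2
  intro z hz
  obtain ⟨v, hv, hvx, hvy⟩ : ∃ v, (v = lp i ∨ v = rp i) ∧ v ≠ x ∧ v ≠ y := by
    by_contra! hcon
    have h1 := hcon (lp i) (Or.inl rfl)
    have h2 := hcon (rp i) (Or.inr rfl)
    simp only [Fin.lt_def, Fin.ext_iff, lp_val, rp_val, ne_eq] at *
    omega
  obtain ⟨ε, hε, e1⟩ : ∃ ε : ℂ, ε ≠ 0 ∧ ∀ t, (Function.update z v (z v + t)) (lp i) -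
      (Function.update z v (z v + t)) (rp i) = ε * t + (z (lp i) - z (rp i)) := by
    rcases hv with rfl | rfl
    · exact ⟨1, one_ne_zero, fun t => by simp [(lp_ne_rp i).symm]; ring⟩
    · exact ⟨-1, by simp, fun t => by simp [lp_ne_rp i]; ring⟩
  have hfin := (finite_setOf_affine_eq_zero (β := z (lp i) - z (rp i)) hε).union
    (finite_setOf_affine_eq_zero (β := -(z (lp i) - z (rp i)) + b) (neg_ne_zero.2 hε))
  have := eq_of_eq_off_finite (continuous_eval_comp f' (continuous_update_add z v))
    (continuous_const (y := (0 : ℂ))) hfin (fun t ht => by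
      have h3 := s.eval_eq (Function.update z v (z v + t))
      rw [h1 _ (by simpa [hvx.symm, hvy.symm] using hz),
        h2 _ (by simpa [hvx.symm, hvy.symm] using hz), mul_zero, mul_zero, sub_zero,
        mul_eq_zero] at h3
      simp only [Set.mem_union, Set.mem_ofPred_eq, not_or] at ht
      refine h3.resolve_left (mul_ne_zero ?_ ?_)
      · rw [e1]; exact ht.1
      · intro h; apply ht.2; linear_combination h + e1 t)
  simpa using congrFun this 0

end Link

/-! ### The dual polynomials: divisibility, vanishing and degree. -/

section Family
variable {m : ℕ} {b c : ℂ}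

theorem pairFactor_eq (x y : Fin (2 * m)) (t : ℕ) :
    pairFactor b c (uSeq m) t (x.val, y.val) =
      if t = 1 then lin x y b else if t = 2 then lin y x (-(b + c)) else 1 := by
  unfold pairFactor lin
  simp only [uSeq_of_lt x.2, uSeq_of_lt y.2, Fin.eta, C_neg, sub_eq_add_neg]

theorem rhoBar_ne_zero : rhoBar m b c ≠ 0 := by
  rw [rhoBar_eq]
  refine Finset.prod_ne_zero_iff.2 ?_
  rintro ⟨x, y⟩ h
  rw [mem_pairs] at h
  simp only at h
  rw [pairFactor_eq ⟨x, by omega⟩ ⟨y, h.2⟩]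
  split_ifs
  · exact lin_ne_zero (by simp; omega) _
  · exact lin_ne_zero (by simp; omega) _
  · exact one_ne_zero

theorem lin_dvd_rhoBar {x y : Fin (2 * m)} (hxy : x < y) (h : y.val < x + m) :
    lin x y b ∣ rhoBar m b c := by
  rw [rhoBar_eq]
  have := Finset.dvd_prod_of_mem (fun e => pairFactor b c (uSeq m) (crossType m e) e)
    (mem_pairs.2 ⟨hxy, y.2⟩ : (x.val, y.val) ∈ pairs (2 * m))
  rwa [pairFactor_eq, crossType, if_pos h, if_pos rfl] at this

theorem lin_dvd_rhoBar' {x y : Fin (2 * m)} (h : x.val + m < y) :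
    lin y x (-(b + c)) ∣ rhoBar m b c := by
  rw [rhoBar_eq]
  have := Finset.dvd_prod_of_mem (fun e => pairFactor b c (uSeq m) (crossType m e) e)
    (mem_pairs.2 ⟨by simp only; omega, y.2⟩ : (x.val, y.val) ∈ pairs (2 * m))
  rw [pairFactor_eq, crossType, if_neg (show ¬ y.val < x.val + m by omega),
    if_neg (show ¬ y.val = x.val + m by omega)] at this
  simpa using this

/-- No wheel avoids the factors of ρ̄. Two successive gaps inside an interval of `2 m` points cannot
both be `m` or more; and if the outer entries differ by `b + c`, either they are more than `m`
apart, which gives a wrapped factor, or both gaps are shorter than `m`. -/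
theorem rhoBar_pv : PV b c (rhoBar m b c) := by
  rintro z ⟨i, j, k, hij, hjk, hz⟩
  have key : ∀ x y : Fin (2 * m), x < y → y.val < x + m → z x - z y + b = 0 →
      eval z (rhoBar m b c) = 0 := fun x y hxy h hz =>
    (lin_dvd_iff hxy.ne _ _).1 (lin_dvd_rhoBar hxy h) z hz
  have key' : ∀ x y : Fin (2 * m), x.val + m < y → z y - z x + -(b + c) = 0 →
      eval z (rhoBar m b c) = 0 := fun x y h hz =>
    (lin_dvd_iff (by intro h'; rw [h'] at h; omega) _ _).1 (lin_dvd_rhoBar' h) z hz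
  have hk := k.2
  rcases hz with ⟨h1, h2⟩ | ⟨h1, h2⟩ | ⟨h1, h2⟩
  · rcases lt_or_ge j.val (i + m) with h | h
    · exact key i j hij h (by rw [h1]; ring)
    · exact key j k hjk (by omega) (by rw [h1, h2]; ring)
  · rcases lt_or_ge (i.val + m) k with h | h
    · exact key' i k h (by rw [h2]; ring)
    · exact key j k hjk (by have := Fin.lt_def.1 hij; omega) (by rw [h1, h2]; ring)
  · rcases lt_or_ge (i.val + m) k with h | h
    · exact key' i k h (by rw [h2]; ring)
    · exact key i j hij (by have := Fin.lt_def.1 hjk; omega) (by rw [h1]; ring)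

theorem totalDegree_rhoBar_le : (rhoBar m b c).totalDegree ≤ 2 * m * (m - 1) := by
  have h1 : ∀ j : ℤ, (addExt (2 * m) (C (c + 2 * b)) (uSeq m) j).totalDegree ≤ 1 := by
    intro j
    refine (totalDegree_add _ _).trans (max_le ?_ ?_)
    · unfold uSeq toSeq
      split_ifs
      · rw [totalDegree_X]
      · simp
    · rw [show ((j / ((2 * m : ℕ) : ℤ) : ℤ) : Poly m) =
        C ((j / ((2 * m : ℕ) : ℤ) : ℤ) : ℂ) by simp, ← C_mul, totalDegree_C]
      exact zero_le_one
  unfold rhoBar crossed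
  refine (totalDegree_finsetProd _ _).trans ?_
  refine (Finset.sum_le_sum (g := fun _ => m - 1) fun i _ => ?_).trans ?_
  · refine (totalDegree_finsetProd _ _).trans ?_
    refine (Finset.sum_le_sum (g := fun _ => 1) fun k _ => ?_).trans ?_
    · refine (totalDegree_add _ _).trans (max_le ((totalDegree_sub _ _).trans
        (max_le (h1 _) (h1 _))) ?_)
      simp
    · simp
  · simp

/-- No two points of the interval from `k` to `l` are linked. -/
def Pattern.LinkFree (π : Pattern m) (k l : ℕ) : Prop :=
  ∀ x, k ≤ x → x ≤ l → π.nv x < k ∨ l < π.nv x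

theorem Pattern.LinkFree.actT {π : Pattern m} {k l : ℕ} (h : π.LinkFree k l) (hl : l < 2 * m)
    {j : Fin (2 * m - 1)} (hj : (k ≤ j ∧ j + 1 ≤ l) ∨ (j.val + 1 < k ∨ l < j)) :
    (π.actT j).LinkFree k l := by
  intro x hx hx'
  rw [Pattern.nv_actT _ _ (by omega)]
  have h1 : k ≤ sN j x ∧ sN j x ≤ l := by
    unfold sN; split_ifs <;> omega
  have h2 := h _ h1.1 h1.2
  unfold sN at *
  split_ifs at * <;> omega

/-- The exchange at `j` can disturb the interval only if the interval ends at `j` or begins at `j +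
1`. In these cases the descent at `j` prevents the adjacent outer point from being linked into the
interval, so this point may be added. -/
theorem Pattern.LinkFree.extend {π : Pattern m} {k l : ℕ} (h : π.LinkFree k l) (hkl : k < l)
    (hl : l < 2 * m) {j : Fin (2 * m - 1)} (hd : π.Desc j) : ∃ k' l', k' ≤ k ∧ l ≤ l' ∧
      l' < 2 * m ∧ π.LinkFree k' l' ∧
      ((k' ≤ j ∧ j + 1 ≤ l') ∨ (j.val + 1 < k' ∨ l' < j)) := by
  have hj := j.2
  have hu := hd.unlinked (by omega)
  by_cases h1 : l = j
  · refine ⟨k, l + 1, le_rfl, by omega, by omega, ?_, by omega⟩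
    have hn : π.nv (l + 1) < k ∨ l + 1 < π.nv (l + 1) := by
      by_contra! hcon
      have h2 := π.nv_ne (k := l + 1) (by omega)
      have h3 : π.nv (l + 1) ≠ l := fun h' => hu (by
        have := π.nv_nv (l + 1)
        rw [h'] at this
        rwa [← h1])
      have h5 := π.nv_lt hl
      have h4 := h l (by omega) le_rfl
      unfold Pattern.Desc Pattern.lift at hd
      rw [← h1] at hd
      split_ifs at hd <;> omega
    intro x hx hx'
    by_cases hxl : x = l + 1
    · rw [hxl]; exact hn
    · have h2 := h x hx (by omega)
      have h3 : π.nv x ≠ l + 1 := fun h' => by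
        rw [← h', π.nv_nv] at hn
        omega
      omega
  by_cases h2 : k = j + 1
  · refine ⟨j, l, by omega, le_rfl, hl, ?_, by omega⟩
    have hn : π.nv j < j ∨ l < π.nv j := by
      by_contra! hcon
      have h3 := π.nv_ne (k := j) (by omega)
      have h4 := h (j + 1) (by omega) (by omega)
      unfold Pattern.Desc Pattern.lift at hd
      split_ifs at hd <;> omega
    intro x hx hx'
    by_cases hxl : x = j
    · rw [hxl]; exact hn
    · have h3 := h x (by omega) hx'
      have h4 : π.nv x ≠ j := fun h' => by
        rw [← h', π.nv_nv] at hn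
        omega
      omega
  exact ⟨k, l, le_rfl, le_rfl, hl, h, by omega⟩

/-- Divisibility by b_{j j+1} alone does not propagate. What propagates is divisibility by b_{xy}
for all pairs in link-free intervals, because along a descent such an interval can be enlarged until
the exchange acts inside it or away from it. -/
theorem exists_dualPoly (π : Pattern m) : ∃ f : Poly m, dualRat b c π = toRat f ∧
    ∀ k l, l < 2 * m → π.LinkFree k l → ∀ x y : Fin (2 * m), k ≤ x → x < y → y ≤ l →
      lin x y b ∣ f := by
  induction hn : π.spread using Nat.strong_induction_on generalizing π with
  | _ n ih =>
    subst hn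
    by_cases hρ : π = Pattern.rho m
    · subst hρ
      refine ⟨_, dualRat_rho b c, fun k l hl h x y hx hxy hy => lin_dvd_rhoBar hxy ?_⟩
      by_contra! hcon
      have h1 := h x hx (by omega)
      rw [Pattern.rho_nv x.2] at h1
      have := y.2
      split_ifs at h1 <;> omega
    obtain ⟨j, hj, e⟩ := exists_dualRat_eq b c hρ
    have hj2 := j.2
    obtain ⟨g, hg, hg'⟩ := ih _ (Pattern.spread_actT_lt hj) (π.actT j) rfl
    have hu := hj.unlinked (by omega)
    have hu' : (π.actT j).LinkFree j (j + 1) := by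
      have : π.LinkFree j (j + 1) := by
        intro x hx hx'
        have h1 := π.nv_ne (k := x) (by omega)
        have h2 := π.nv_nv x
        rcases (by omega : x = j ∨ x = j + 1) with rfl | rfl
        · omega
        · have : π.nv (j + 1) ≠ j := fun h' => by rw [h'] at h2; exact hu h2
          omega
      exact this.actT (by omega) (by omega)
    have hdvd : bP b j ∣ g := hg' _ _ (by omega) hu' (lo j) (hi j) le_rfl
      (Fin.lt_def.2 (Nat.lt_succ_self _)) le_rfl
    obtain ⟨f, s⟩ := Step.exists_of_dvd (N := 2 * m) c hdvd
    refine ⟨f, by rw [e, hg, s.tBar_eq], fun k l hl h x y hx hxy hy => ?_⟩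
    obtain ⟨k', l', h1, h2, h3, h4, h5⟩ := h.extend (by omega) hl hj
    have h6 := h4.actT h3 h5
    by_cases hne : x = lp (N := 2 * m) j ∧ y = rp (N := 2 * m) j
    · rw [hne.1, hne.2]; exact s.dvd_right
    refine s.lin_dvd hxy hne (hg' _ _ h3 h6 x y (by omega) hxy (by omega))
      (hg' _ _ h3 h6 _ _ ?_ (nswap_lt_nswap hxy hne) ?_)
    · rw [show (nswap (N := 2 * m) j x).val = sN j x from Pattern.swap_val j x]
      unfold sN; split_ifs <;> omega
    · rw [show (nswap (N := 2 * m) j y).val = sN j y from Pattern.swap_val j y]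
      unfold sN; split_ifs <;> omega

variable (b c) in
/-- The dual polynomials. -/
def dualPoly (π : Pattern m) : Poly m := (exists_dualPoly (b := b) (c := c) π).choose

theorem toRat_dualPoly (π : Pattern m) : toRat (dualPoly b c π) = dualRat b c π :=
  (exists_dualPoly π).choose_spec.1.symm

theorem lin_dvd_dualPoly {π : Pattern m} {k l : ℕ} (hl : l < 2 * m) (h : π.LinkFree k l)
    {x y : Fin (2 * m)} (hx : k ≤ x) (hxy : x < y) (hy : y ≤ l) : lin x y b ∣ dualPoly b c π :=
  (exists_dualPoly π).choose_spec.2 k l hl h x y hx hxy hy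

theorem Pattern.linkFree_pair {π : Pattern m} {j : ℕ} (hj : j + 1 < 2 * m)
    (hu : π.nv j ≠ j + 1) : π.LinkFree j (j + 1) := by
  intro x hx hx'
  have h1 := π.nv_ne (k := x) (by omega)
  have h2 := π.nv_nv x
  rcases (by omega : x = j ∨ x = j + 1) with rfl | rfl
  · omega
  · have : π.nv (j + 1) ≠ j := fun h' => by rw [h'] at h2; exact hu h2
    omega

theorem bP_dvd_dualPoly {π : Pattern m} {j : Fin (2 * m - 1)} (hu : π.nv j ≠ j + 1) :
    bP b j ∣ dualPoly b c π := by
  have := j.2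
  exact lin_dvd_dualPoly (by omega) (Pattern.linkFree_pair (by omega) hu) (x := lo j) (y := hi j)
    le_rfl (Fin.lt_def.2 (Nat.lt_succ_self _)) le_rfl

theorem dualPoly_rho : dualPoly b c (Pattern.rho m) = rhoBar m b c :=
  toRat_injective (by rw [toRat_dualPoly, dualRat_rho])

theorem step_dualPoly {π : Pattern m} {j : Fin (2 * m - 1)} (hu : π.nv j ≠ j + 1) :
    Step (N := 2 * m) b c j (dualPoly b c π) (dualPoly b c (π.actT j)) := by
  refine step_of_tBar_eq (bP_dvd_dualPoly hu) ?_
  rw [toRat_dualPoly, toRat_dualPoly, dualRat_actT _ _ hu]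

theorem isDualFamily_dualPoly : IsDualFamily m b c (dualPoly b c) :=
  ⟨dualPoly_rho, fun i π h => (step_dualPoly (by rwa [ne_eq, ← π.linked_iff i])).tBar_eq⟩

theorem IsDualFamily.eq {F : Pattern m → Poly m} (h : IsDualFamily m b c F) :
    F = dualPoly b c := by
  funext π
  refine Pattern.spread_induction (P := fun π => F π = dualPoly b c π) ?_ ?_ π
  · rw [h.1, dualPoly_rho]
  · intro π j hj e
    apply toRat_injective
    rw [← h.2 j π hj, e, isDualFamily_dualPoly.2 j π hj]

theorem dualPoly_pv (hc : c ≠ 0) (π : Pattern m) : PV b c (dualPoly b c π) := by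
  refine Pattern.spread_induction (P := fun π => PV b c (dualPoly b c π)) ?_ ?_ π
  · rw [dualPoly_rho]; exact rhoBar_pv
  · intro π j hj e
    exact (step_dualPoly (by rwa [ne_eq, ← π.linked_iff j])).pv e hc

theorem totalDegree_dualPoly_le (π : Pattern m) :
    (dualPoly b c π).totalDegree ≤ minDeg (2 * m) := by
  refine Pattern.spread_induction
    (P := fun π => (dualPoly b c π).totalDegree ≤ minDeg (2 * m)) ?_ ?_ π
  · rw [dualPoly_rho, minDeg_even]; exact totalDegree_rhoBar_le
  · intro π j hj e
    exact (step_dualPoly (by rwa [ne_eq, ← π.linked_iff j])).totalDegree_le.trans e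

theorem dualPoly_ne_zero (π : Pattern m) : dualPoly b c π ≠ 0 := by
  refine Pattern.spread_induction (P := fun π => dualPoly b c π ≠ 0) ?_ ?_ π
  · rw [dualPoly_rho]; exact rhoBar_ne_zero
  · intro π j hj e
    exact (step_dualPoly (by rwa [ne_eq, ← π.linked_iff j])).ne_zero e

end Family

/-! ### Restrictions of polynomials related by the exchange operators. -/

section Restriction
variable {M : ℕ} (b c : ℂ)

/-- The restriction of `f` to `u_{i+1} = u_i + b` is `χ` up to the standard linear factors. -/
def Restr (i : Fin (M + 1)) (f : MvPolynomial (Fin (M + 2)) ℂ) (χ : MvPolynomial (Fin M) ℂ) :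
    Prop :=
  ∀ u y, eval (insPair i u (u + b) y) f = wheelFactor b c i u y * eval y χ

variable {b c}

theorem Restr.sum {ι : Type*} (S : Finset ι) (a : ι → ℂ) {i : Fin (M + 1)}
    {F : ι → MvPolynomial (Fin (M + 2)) ℂ} {G : ι → MvPolynomial (Fin M) ℂ}
    (h : ∀ k ∈ S, Restr b c i (F k) (G k)) :
    Restr b c i (∑ k ∈ S, a k • F k) (∑ k ∈ S, a k • G k) := by
  intro u y
  simp only [map_sum, smul_eval, Finset.mul_sum]
  refine Finset.sum_congr rfl fun k hk => ?_
  rw [h k hk u y]; ring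

theorem Restr.dvd_sub {i : Fin (M + 1)} {f g : MvPolynomial (Fin (M + 2)) ℂ}
    {χ : MvPolynomial (Fin M) ℂ} (hf : Restr b c i f χ) (hg : Restr b c i g χ) :
    lin (lp (N := M + 2) i) (rp (N := M + 2) i) b ∣ f - g := by
  rw [lin_dvd_iff_insPair]
  intro u y
  rw [map_sub, hf, hg, sub_self]

/-- For given `y` the forced factors vanish for finitely many `u` only, so they can be cancelled. -/
theorem Restr.eq_zero {i : Fin (M + 1)} {f : MvPolynomial (Fin (M + 2)) ℂ}
    {χ : MvPolynomial (Fin M) ℂ} (hf : Restr b c i f χ)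
    (h : lin (lp (N := M + 2) i) (rp (N := M + 2) i) b ∣ f) : χ = 0 := by
  rw [lin_dvd_iff_insPair] at h
  apply MvPolynomial.funext
  intro y
  obtain ⟨u, hu⟩ := (finite_wheelFactor_eq_zero b c i y).exists_notMem
  have := hf u y
  rw [h, eq_comm, mul_eq_zero] at this
  rw [map_zero]
  exact this.resolve_left hu

theorem insPair_of_lt {R : Type*} {i : Fin (M + 1)} {u v : R} {y : Fin M → R} {k : Fin (M + 2)}
    (h : k.val < i.val) : insPair i u v y k = y ⟨k.val, by omega⟩ := by
  simp [insPair, h]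

theorem insPair_of_gt {R : Type*} {i : Fin (M + 1)} {u v : R} {y : Fin M → R} {k : Fin (M + 2)}
    (h : i.val + 1 < k.val) : insPair i u v y k = y ⟨k.val - 2, by omega⟩ := by
  have h1 : ¬ k.val < i.val := by omega
  have h2 : ¬ k.val = i.val := by omega
  have h3 : ¬ k.val = i.val + 1 := by omega
  simp [insPair, h1, h2, h3]

/-- Moving the place of a restriction by one. -/
theorem Restr.move {i j : Fin (M + 1)} (hij : j.val = i + 1)
    {f f' f'' : MvPolynomial (Fin (M + 2)) ℂ} {χ : MvPolynomial (Fin M) ℂ}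
    (s : Step (N := M + 2) b c j f f') (s' : Step (N := M + 2) b c i f' f'')
    (h : Restr b c i f χ) : Restr b c j f'' χ := by
  intro u y
  have hj := j.2
  set k₀ : Fin M := ⟨i.val, by omega⟩ with hk₀
  set v := y k₀ with hv
  -- The two wheel factors differ only in the variable that passes from the right of the pair to its
  -- left.
  obtain ⟨W, hW⟩ : ∃ W : ℂ → ℂ, ∀ u, wheelFactor b c i u y =
        (y k₀ - u - 2 * b) * (y k₀ - u - (b + c)) * W u ∧
      wheelFactor b c j u y = (y k₀ - u + b) * (y k₀ - u + c) * W u := by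
    refine ⟨fun u => ∏ k ∈ {k₀}ᶜ, if k.val < i.val then (y k - u + b) * (y k - u + c)
      else (y k - u - 2 * b) * (y k - u - (b + c)), fun u => ⟨?_, ?_⟩⟩
    · rw [wheelFactor, Fintype.prod_eq_mul_prod_compl k₀, if_neg (by simp [hk₀])]
    · rw [wheelFactor, Fintype.prod_eq_mul_prod_compl k₀, if_pos (by simp [hk₀, hij])]
      congr 1
      refine Finset.prod_congr rfl fun k hk => ?_
      rw [Finset.mem_compl, Finset.mem_singleton, Fin.ext_iff] at hk
      have : k.val < j.val ↔ k.val < i.val := by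
        simp only [hk₀] at hk
        omega
      simp only [this]
  have key : (fun u => eval (insPair j u (u + b) y) f'') =
      fun u => wheelFactor b c j u y * eval y χ := by
    have hcont : ∀ (i : Fin (M + 1)), Continuous fun u : ℂ => insPair i u (u + b) y := by
      intro i
      refine continuous_pi fun k => ?_
      unfold insPair
      split_ifs <;> fun_prop
    refine eq_of_eq_off_finite (continuous_eval_comp f'' (hcont j)) ?_
      (S := {v, v - b, v - 2 * b, v - (b + c)}) (by simp) fun u hu => ?_
    · refine Continuous.mul ?_ continuous_const
      unfold wheelFactor
      refine continuous_finsetProd _ fun k _ => ?_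
      split_ifs <;> fun_prop
    · simp only [Set.mem_insert_iff, Set.mem_singleton_iff, not_or] at hu
      obtain ⟨u1, u2, u3, u4⟩ := hu
      have w1 : v - u ≠ 0 := fun h => u1 (by linear_combination -h)
      have w2 : b - (v - u) ≠ 0 := fun h => u2 (by linear_combination h)
      have w3 : 2 * b - (v - u) ≠ 0 := fun h => u3 (by linear_combination h)
      have w4 : b + c - (v - u) ≠ 0 := fun h => u4 (by linear_combination h)
      -- the point with the entries `u, v, u + b`
      set p : Fin (M + 2) → ℂ := insPair i u (u + b) y ∘ nswap (N := M + 2) j with hp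
      have hp' : p = insPair j u (u + b) y ∘ nswap (N := M + 2) i := by
        ext k
        simp only [hp, Function.comp_apply, Equiv.swap_apply_def, Fin.ext_iff, lp_val, rp_val]
        by_cases k1 : k.val < i.val
        · rw [if_neg (by omega), if_neg (by omega), if_neg (by omega), if_neg (by omega),
            insPair_of_lt k1, insPair_of_lt (by omega)]
        by_cases k2 : k.val = i.val
        · rw [if_neg (by omega), if_neg (by omega), if_pos k2,
            show k = lp (N := M + 2) i from Fin.ext k2,
            show rp (N := M + 2) i = lp (N := M + 2) j from Fin.ext hij.symm,
            insPair_lp, insPair_lp]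
        by_cases k3 : k.val = i.val + 1
        · rw [if_pos (by omega), if_neg k2, if_pos k3, insPair_of_gt (by simp; omega),
            insPair_of_lt (by simp; omega)]
          congr 1
          exact Fin.ext (by simp; omega)
        by_cases k4 : k.val = i.val + 2
        · rw [if_neg (by omega), if_pos (by omega), if_neg k2, if_neg k3,
            show k = rp (N := M + 2) j from Fin.ext (by simp; omega),
            show lp (N := M + 2) j = rp (N := M + 2) i from Fin.ext (by simp; omega),
            insPair_rp, insPair_rp]
        · rw [if_neg (by omega), if_neg (by omega), if_neg (by omega), if_neg (by omega),
            insPair_of_gt (by omega), insPair_of_gt (by omega)]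
      have hswap : p ∘ nswap (N := M + 2) j = insPair i u (u + b) y := by
        ext k; simp [hp]
      -- As `f'` is divisible by the linear factors of both places, one term drops out of each
      -- evaluation identity; the values of `f` and of `f''` are thereby both expressed by the value
      -- of `f'` at `p`.
      have hzi : eval (insPair i u (u + b) y) f' = 0 :=
        (lin_dvd_iff_insPair (b := b)).1 s'.dvd_left u y
      have hzj : eval (insPair j u (u + b) y) f' = 0 :=
        (lin_dvd_iff_insPair (b := b)).1 s.dvd_right u y
      have a1 := s.symm.eval_eq (insPair i u (u + b) y)
      have a2 := s'.eval_eq (insPair j u (u + b) y)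
      rw [← hp, hzi, h] at a1
      rw [← hp', hzj] at a2
      have e1 : insPair i u (u + b) y (lp (N := M + 2) j) = u + b := by
        rw [show lp (N := M + 2) j = rp (N := M + 2) i from Fin.ext (by simp; omega), insPair_rp]
      have e2 : insPair i u (u + b) y (rp (N := M + 2) j) = v := by
        rw [insPair_of_gt (by simp; omega), hv]
        congr 1
        refine Fin.ext (?_ : j.val + 1 - 2 = i.val)
        omega
      have e3 : insPair j u (u + b) y (lp (N := M + 2) i) = v := by
        rw [insPair_of_lt (by simp; omega), hv]
        rfl
      have e4 : insPair j u (u + b) y (rp (N := M + 2) i) = u := by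
        rw [show rp (N := M + 2) i = lp (N := M + 2) j from Fin.ext (by simp; omega), insPair_lp]
      rw [e1, e2, (hW u).1] at a1
      rw [e3, e4] at a2
      rw [(hW u).2]
      rw [← hv] at *
      apply mul_left_cancel₀ (mul_ne_zero (mul_ne_zero w1 w2) (mul_ne_zero w3 w4))
      linear_combination (2 * b - (v - u)) * (b + c - (v - u)) * a2 -
        (v - u + c) * (v - u + b) * a1
  exact congrFun key u

end Restriction

section RestrictionZero
variable {M : ℕ} {b c : ℂ}

/-- Exchanges away from the place of the restriction are compatible with it. -/
theorem Restr.step {f f' : MvPolynomial (Fin (M + 2)) ℂ} {χ χ' : MvPolynomial (Fin M) ℂ}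
    {j : Fin (M - 1)} {k : Fin (M + 1)} (hk : k.val = j + 2) (h : Restr b c 0 f χ)
    (s : Step (N := M + 2) b c k f f') (s' : Step b c j χ χ') : Restr b c 0 f' χ' := by
  intro u y
  have hj := j.2
  have hW : ∀ y : Fin M → ℂ, wheelFactor b c 0 u (y ∘ nswap j) = wheelFactor b c 0 u y := by
    intro y
    unfold wheelFactor
    simp only [Fin.val_zero, Nat.not_lt_zero, if_false, Function.comp_apply]
    exact Equiv.prod_comp (nswap j) fun k => (y k - u - 2 * b) * (y k - u - (b + c))
  have hins : ∀ y : Fin M → ℂ, insPair 0 u (u + b) y ∘ nswap (N := M + 2) k =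
      insPair 0 u (u + b) (y ∘ nswap j) := by
    intro y
    ext l
    by_cases l1 : l = lpi (0 : Fin (M + 1))
    · subst l1
      rw [Function.comp_apply, Equiv.swap_apply_of_ne_of_ne, insPair_lp, insPair_lp] <;>
        simp [Fin.ext_iff, hk]
    by_cases l2 : l = rpi (0 : Fin (M + 1))
    · subst l2
      rw [Function.comp_apply, Equiv.swap_apply_of_ne_of_ne, insPair_rp, insPair_rp] <;>
        simp [Fin.ext_iff, hk]
    obtain ⟨x, rfl⟩ := eq_other_of_ne l1 l2
    rw [insPair_other, Function.comp_apply, Function.comp_apply]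
    have : nswap (N := M + 2) k (other 0 x) = other 0 (nswap j x) := by
      apply Fin.ext
      rw [other_val]
      simp only [Equiv.swap_apply_def, Fin.ext_iff, lp_val, rp_val, other_val]
      simp only [Fin.val_zero, Nat.not_lt_zero, if_false]
      split_ifs <;> simp_all [other_val]
    rw [this, insPair_other]
  -- One of the exchanged coordinates is moved by `t`, away from the zeros of the denominators; the
  -- claim is the value at `t = 0`.
  have key : (fun t : ℂ => eval (insPair 0 u (u + b)
      (Function.update y (lp j) (y (lp j) + t))) f') =
      fun t => wheelFactor b c 0 u (Function.update y (lp j) (y (lp j) + t)) *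
        eval (Function.update y (lp j) (y (lp j) + t)) χ' := by
    have hcont := continuous_update_add y (lp j)
    refine eq_of_eq_off_finite (S := {t | 1 * t + (y (lp j) - y (rp j)) = 0} ∪
        {t | -1 * t + (-(y (lp j) - y (rp j)) + b) = 0}) ?_ ?_
        ((finite_setOf_affine_eq_zero one_ne_zero).union
          (finite_setOf_affine_eq_zero (by simp))) fun t ht => ?_
    · refine continuous_eval_comp f' (continuous_pi fun l => ?_)
      unfold insPair
      split_ifs <;> fun_prop
    · refine Continuous.mul ?_ (continuous_eval_comp χ' hcont)
      unfold wheelFactor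
      refine continuous_finsetProd _ fun l _ => ?_
      have := (continuous_apply l).comp hcont
      simp only [Function.comp_def] at this
      split_ifs <;> fun_prop
    · simp only [Set.mem_union, Set.mem_ofPred_eq, not_or] at ht
      set z := Function.update y (lp j) (y (lp j) + t) with hz
      have z1 : z (lp j) = y (lp j) + t := by simp [hz]
      have z2 : z (rp j) = y (rp j) := by simp [hz, (lp_ne_rp j).symm]
      have a1 := s.eval_eq (insPair 0 u (u + b) z)
      have a2 := s'.eval_eq z
      have e1 : insPair 0 u (u + b) z (lp (N := M + 2) k) = z (lp j) := by
        rw [insPair_of_gt (by simp [hk])]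
        congr 1
        exact Fin.ext (by simp [hk])
      have e2 : insPair 0 u (u + b) z (rp (N := M + 2) k) = z (rp j) := by
        rw [insPair_of_gt (by simp [hk])]
        congr 1
        exact Fin.ext (by simp [hk])
      rw [hins, h, h, hW, e1, e2] at a1
      have n1 : z (lp j) - z (rp j) ≠ 0 := fun h' => ht.1 (by
        rw [z1, z2] at h'; linear_combination h')
      have n2 : z (rp j) - z (lp j) + b ≠ 0 := fun h' => ht.2 (by
        rw [z1, z2] at h'; linear_combination h')
      apply mul_left_cancel₀ (mul_ne_zero n1 n2)
      linear_combination a1 - wheelFactor b c 0 u z * a2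
  simpa using congrFun key 0

end RestrictionZero

/-! ### Insertion of small links, and the hooks between ρ and a pattern with a small link. -/

namespace Pattern
variable {m : ℕ}

/-- The point `k` after a pair of points is inserted at the place `i`. -/
def up (i k : ℕ) : ℕ := if k < i then k else k + 2

/-- The point `k` after the points `i` and `i + 1` are removed. -/
def down (i k : ℕ) : ℕ := if k < i then k else k - 2

theorem down_up (i k : ℕ) : down i (up i k) = k := by
  unfold down up; split_ifs <;> omega

theorem up_down {i k : ℕ} (h1 : k ≠ i) (h2 : k ≠ i + 1) : up i (down i k) = k := by
  unfold down up; split_ifs <;> omega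

theorem up_ne (i k : ℕ) : up i k ≠ i ∧ up i k ≠ i + 1 := by
  unfold up; split_ifs <;> omega

/-- Insertion of a link between two new neighbouring points. -/
def ins (i : Fin (2 * m + 1)) (π : Pattern m) : Pattern (m + 1) :=
  ofNat (fun k => if k = i then i + 1 else if k = i + 1 then i else up i (π.nv (down i k)))
    (fun k hk => by
      have hi := i.2
      split_ifs with h1 h2
      · omega
      · omega
      · have : π.nv (down i k) < 2 * m := π.nv_lt (by unfold down; split_ifs <;> omega)
        unfold up; split_ifs <;> omega)
    (fun k hk => by
      by_cases h1 : k = i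
      · simp [h1]
      by_cases h2 : k = i + 1
      · simp [h2]
      · rw [if_neg h1, if_neg h2, if_neg (up_ne _ _).1, if_neg (up_ne _ _).2, down_up, nv_nv,
          up_down h1 h2])
    (fun k hk => by
      have hi := i.2
      split_ifs with h1 h2
      · omega
      · omega
      · intro h
        have h3 := congrArg (down i) h
        rw [down_up] at h3
        exact π.nv_ne (by unfold down; split_ifs <;> omega) h3)

theorem nv_ins (i : Fin (2 * m + 1)) (π : Pattern m) {k : ℕ} (hk : k < 2 * m + 2) :
    (ins i π).nv k =
      if k = i then i.val + 1 else if k = i + 1 then i.val else up i (π.nv (down i k)) :=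
  nv_ofNat _ _ _ _ hk

theorem exists_eq_ins {i : Fin (2 * m + 1)} {π : Pattern (m + 1)} (h : π.nv i = i + 1) :
    ∃ σ, π = ins i σ := by
  have hi := i.2
  have h' : π.nv (i + 1) = i := by rw [← h, nv_nv]
  have hne : ∀ x, π.nv (up i x) ≠ i ∧ π.nv (up i x) ≠ i + 1 := fun x =>
    ⟨fun h1 => (up_ne i x).2 (by have := π.nv_nv (up i x); rw [h1, h] at this; exact this.symm),
      fun h1 => (up_ne i x).1 (by have := π.nv_nv (up i x); rw [h1, h'] at this; exact this.symm)⟩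
  have hlt : ∀ x < 2 * m, up i x < 2 * (m + 1) := fun x hx => by unfold up; split_ifs <;> omega
  refine ⟨ofNat (fun x => down i (π.nv (up i x))) (fun x hx => ?_) (fun x hx => ?_)
    (fun x hx h1 => ?_), ?_⟩
  · have := π.nv_lt (hlt x hx)
    unfold down
    split_ifs <;> omega
  · rw [up_down (hne x).1 (hne x).2, nv_nv, down_up]
  · have h2 := congrArg (up i) h1
    rw [up_down (hne x).1 (hne x).2] at h2
    exact π.nv_ne (hlt x hx) h2
  · apply ext_nv
    intro k hk
    rw [nv_ins _ _ hk]
    by_cases h1 : k = i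
    · rw [if_pos h1, h1, h]
    by_cases h2 : k = i + 1
    · rw [if_neg h1, if_pos h2, h2, h']
    rw [if_neg h1, if_neg h2, nv_ofNat _ _ _ _ (by unfold down; split_ifs <;> omega),
      up_down h1 h2, up_down]
    · intro h3
      have := π.nv_nv k
      rw [h3, h] at this
      exact h2 this.symm
    · intro h3
      have := π.nv_nv k
      rw [h3, h'] at this
      exact h1 this.symm

theorem actT_ins_zero (π : Pattern m) {j : Fin (2 * m - 1)} {k : Fin (2 * (m + 1) - 1)}
    (hk : k.val = j + 2) : (ins 0 π).actT k = ins 0 (π.actT j) := by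
  have hj := j.2
  apply ext_nv
  intro x hx
  have e : sN k x < 2 * m + 2 := sN_lt (by omega) hx
  rw [nv_actT _ _ hx, nv_ins _ _ e, nv_ins _ _ hx, hk]
  simp only [Fin.val_zero, zero_add]
  by_cases h0 : x = 0
  · rw [h0, sN_of_ne (j := j + 2) (k := 0) (by omega) (by omega)]
    simp [sN]
  by_cases h1 : x = 1
  · rw [h1, sN_of_ne (j := j + 2) (k := 1) (by omega) (by omega)]
    simp [sN]
  have e2 : ∀ z, sN (j + 2) (z + 2) = sN j z + 2 := by
    intro z; unfold sN; split_ifs <;> omega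
  obtain ⟨z, rfl⟩ : ∃ z, x = z + 2 := ⟨x - 2, by omega⟩
  simp only [e2, up, down, Nat.not_lt_zero, if_false, Nat.add_sub_cancel]
  rw [if_neg (by omega), if_neg (by omega), if_neg (by omega), if_neg (by omega), e2,
    nv_actT _ _ (by omega)]

/-- The two exchanges carry the point to the right of the small link over the link, which thereby
moves one place to the right. -/
theorem actT_actT_ins (π : Pattern m) {i j : Fin (2 * m + 1)} (hij : j.val = i + 1) :
    ((ins i π).actT (m := m + 1) j).actT (m := m + 1) i = ins j π := by
  have hj := j.2
  apply ext_nv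
  intro x hx
  have e1 : sN i x < 2 * m + 2 := sN_lt (by omega) hx
  have e2 : sN j (sN i x) < 2 * m + 2 := sN_lt (by omega) e1
  rw [nv_actT _ _ hx, nv_actT _ _ e1, nv_ins _ _ e2, nv_ins _ _ hx, hij]
  by_cases h0 : x = i
  · have : sN (i + 1) (sN i x) = i + 2 := by rw [h0, sN_left, sN_left]
    rw [this, h0, if_neg (by omega), if_neg (by omega), if_neg (by omega), if_neg (by omega)]
    have d1 : down i (i + 2) = i := by unfold down; split_ifs <;> omega
    have d2 : down (i + 1) i = i := by unfold down; split_ifs <;> omega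
    have h3 := π.nv_ne (k := i) (by omega)
    rw [d1, d2]
    unfold up sN
    split_ifs <;> omega
  by_cases h1 : x = i + 1
  · have : sN (i + 1) (sN i x) = i := by
      rw [h1, sN_right, sN_of_ne (by omega) (by omega)]
    rw [this, h1, if_pos rfl, if_pos rfl, sN_left, sN_of_ne (by omega) (by omega)]
  by_cases h2 : x = i + 2
  · have : sN (i + 1) (sN i x) = i + 1 := by
      rw [h2, sN_of_ne (j := i) (by omega) (by omega), sN_right]
    rw [this, h2, if_neg (by omega), if_pos rfl, if_neg (by omega), if_pos (by omega)]
    unfold sN; split_ifs <;> omega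
  have : sN (i + 1) (sN i x) = x := by
    rw [sN_of_ne (j := i) (k := x) (by omega) (by omega), sN_of_ne (by omega) (by omega)]
  rw [this, if_neg h0, if_neg h1, if_neg (by omega), if_neg (by omega)]
  have d : down (i + 1) x = down i x := by unfold down; split_ifs <;> omega
  rw [d]
  unfold up sN
  split_ifs <;> omega

/-- The pattern in which `0` is linked to `r`, and the other points in the maximally crossed way. -/
def hook (m r : ℕ) (hr : 0 < r) (hrm : r ≤ m) : Pattern m :=
  ofNat (fun k => if k = 0 then r else if k < r then k + m else if k = r then 0 else
      if k ≤ m then k + m - 1 else if k < m + r then k - m else k - m + 1)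
    (fun k hk => by split_ifs <;> omega)
    (fun k hk => by
      by_cases h0 : k = 0
      · rw [if_pos h0, if_neg (by omega), if_neg (by omega), if_pos rfl, h0]
      rw [if_neg h0]
      by_cases h1 : k < r
      · rw [if_pos h1, if_neg (by omega), if_neg (by omega), if_neg (by omega), if_neg (by omega),
          if_pos (by omega)]
        omega
      rw [if_neg h1]
      by_cases h2 : k = r
      · rw [if_pos h2, if_pos rfl, h2]
      rw [if_neg h2]
      by_cases h3 : k ≤ m
      · rw [if_pos h3, if_neg (by omega), if_neg (by omega), if_neg (by omega), if_neg (by omega),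
          if_neg (by omega)]
        omega
      rw [if_neg h3]
      by_cases h4 : k < m + r
      · rw [if_pos h4, if_neg (by omega), if_pos (by omega)]
        omega
      rw [if_neg h4, if_neg (by omega), if_neg (by omega), if_neg (by omega), if_pos (by omega)]
      omega)
    (fun k hk => by split_ifs <;> omega)

theorem nv_hook {r k : ℕ} (hr : 0 < r) (hrm : r ≤ m) (hk : k < 2 * m) :
    (hook m r hr hrm).nv k = if k = 0 then r else if k < r then k + m else if k = r then 0 else
      if k ≤ m then k + m - 1 else if k < m + r then k - m else k - m + 1 :=
  nv_ofNat _ _ _ _ hk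

theorem hook_self (hm : 0 < m) : hook m m hm le_rfl = rho m := by
  apply ext_nv
  intro k hk
  rw [nv_hook hm le_rfl hk, rho_nv hk]
  split_ifs <;> omega

theorem actT_hook {r : ℕ} (hr : 0 < r) (hrm : r + 1 ≤ m) {j : Fin (2 * m - 1)} (hj : j.val = r) :
    (hook m (r + 1) (by omega) hrm).actT j = hook m r hr (by omega) := by
  apply ext_nv
  intro k hk
  have e : sN r k < 2 * m := sN_lt (by omega) hk
  rw [nv_actT _ _ hk, hj, nv_hook _ _ e, nv_hook _ _ hk]
  by_cases h1 : k = r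
  · rw [h1, sN_left, if_neg (by omega), if_neg (by omega), if_pos rfl, if_neg (by omega),
      if_neg (by omega), if_pos rfl, sN_of_ne (by omega) (by omega)]
  by_cases h2 : k = r + 1
  · rw [h2, sN_right, if_neg (by omega), if_pos (by omega), if_neg (by omega),
      if_neg (by omega), if_neg (by omega), if_pos (by omega), sN_of_ne (by omega) (by omega)]
    omega
  rw [sN_of_ne h1 h2]
  by_cases h3 : k = 0
  · simp [h3, sN_right]
  by_cases h4 : k < r
  · rw [if_neg h3, if_neg h3, if_pos (by omega), if_pos h4, sN_of_ne (by omega) (by omega)]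
  rw [if_neg h3, if_neg h3, if_neg (by omega), if_neg (by omega), if_neg h4, if_neg h1]
  by_cases h5 : k ≤ m
  · rw [if_pos h5, if_pos h5, sN_of_ne (by omega) (by omega)]
  rw [if_neg h5, if_neg h5]
  by_cases h6 : k < m + r
  · rw [if_pos (by omega), if_pos h6, sN_of_ne (by omega) (by omega)]
  rw [if_neg h6]
  by_cases h7 : k < m + (r + 1)
  · rw [if_pos h7, show k - m = r by omega, sN_left]
  · rw [if_neg h7, sN_of_ne (by omega) (by omega)]

theorem hook_one (hm : 0 < m + 1) : hook (m + 1) 1 one_pos hm = ins 0 (rho m) := by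
  apply ext_nv
  intro k hk
  rw [nv_hook _ _ hk, nv_ins _ _ hk]
  simp only [Fin.val_zero, zero_add]
  by_cases h0 : k = 0
  · simp [h0]
  by_cases h1 : k = 1
  · simp [h1]
  rw [if_neg h0, if_neg (by omega), if_neg h1, if_neg h0, if_neg h1]
  have e : down 0 k = k - 2 := by simp [down]
  rw [e, rho_nv (by omega)]
  simp only [up, Nat.not_lt_zero, if_false]
  split_ifs <;> omega

theorem hook_linkFree {r : ℕ} (hr : 0 < r) (hrm : r + 1 ≤ m) :
    (hook m (r + 1) (by omega) hrm).LinkFree 0 r := by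
  intro x hx hx'
  right
  rw [nv_hook _ _ (by omega)]
  split_ifs <;> omega

end Pattern

/-! ### Products over pairs, separated by the pairs through one or two given points. -/

section PairSplit

/-- The number `k` after a new place `r` is inserted. -/
def shiftAt (r k : ℕ) : ℕ := if k < r then k else k + 1

/-- The pairs that contain `r`, and the others. -/
theorem prod_pairs_succ {A : Type*} [CommMonoid A] (M r : ℕ) (hr : r ≤ M) (φ : ℕ × ℕ → A) :
    ∏ e ∈ pairs (M + 1), φ e =
      (∏ k ∈ Finset.range M, if k < r then φ (k, r) else φ (r, k + 1)) *
        ∏ e ∈ pairs M, φ (shiftAt r e.1, shiftAt r e.2) := by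
  rw [← Finset.prod_filter_mul_prod_filter_not (pairs (M + 1)) (fun e => e.1 = r ∨ e.2 = r)]
  congr 1
  · symm
    refine Finset.prod_bij' (fun k _ => if k < r then (k, r) else (r, k + 1))
      (fun e _ => if e.1 = r then e.2 - 1 else e.1) ?_ ?_ ?_ ?_ ?_
    · intro k hk
      rw [Finset.mem_range] at hk
      rw [Finset.mem_filter, mem_pairs]
      by_cases h : k < r
      · rw [if_pos h]; dsimp only; omega
      · rw [if_neg h]; dsimp only; omega
    · rintro ⟨x, y⟩ h
      rw [Finset.mem_filter, mem_pairs] at h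
      rw [Finset.mem_range]
      simp only at *
      split_ifs <;> omega
    · intro k hk
      by_cases h : k < r
      · simp only [if_pos h]
        rw [if_neg (by omega)]
      · simp only [if_neg h, if_true]
        omega
    · rintro ⟨x, y⟩ h
      rw [Finset.mem_filter, mem_pairs] at h
      simp only at *
      by_cases hx : x = r
      · rw [if_pos hx, if_neg (by omega), Prod.mk.injEq]; omega
      · rw [if_neg hx, if_pos (by omega), Prod.mk.injEq]; omega
    · intro k hk
      by_cases h : k < r
      · simp only [if_pos h]
      · simp only [if_neg h]
  · symm
    refine Finset.prod_bij' (fun e _ => (shiftAt r e.1, shiftAt r e.2))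
      (fun e _ => (if e.1 < r then e.1 else e.1 - 1, if e.2 < r then e.2 else e.2 - 1))
      ?_ ?_ ?_ ?_ ?_
    · rintro ⟨x, y⟩ h
      rw [mem_pairs] at h
      rw [Finset.mem_filter, mem_pairs]
      simp only [shiftAt] at *
      split_ifs <;> omega
    · rintro ⟨x, y⟩ h
      rw [Finset.mem_filter, mem_pairs] at h
      rw [mem_pairs]
      simp only at *
      split_ifs <;> omega
    · rintro ⟨x, y⟩ h
      simp only [shiftAt, Prod.mk.injEq]
      split_ifs <;> omega
    · rintro ⟨x, y⟩ h
      rw [Finset.mem_filter, mem_pairs] at h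
      simp only [shiftAt, Prod.mk.injEq] at *
      split_ifs <;> omega
    · intro e _; rfl

/-- The pairs that contain `0`, those that contain `r + 1`, and the others. -/
theorem prod_pairs_add_two {A : Type*} [CommMonoid A] (M r : ℕ) (hr : r ≤ M) (φ : ℕ × ℕ → A) :
    ∏ e ∈ pairs (M + 2), φ e = φ (0, r + 1) *
      (∏ k ∈ Finset.range M, φ (0, shiftAt r k + 1) *
        if k < r then φ (k + 1, r + 1) else φ (r + 1, k + 2)) *
      ∏ e ∈ pairs M, φ (shiftAt r e.1 + 1, shiftAt r e.2 + 1) := by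
  rw [show M + 2 = M + 1 + 1 from rfl, prod_pairs_succ (M + 1) 0 (by omega)]
  simp only [Nat.not_lt_zero, if_false, shiftAt]
  rw [prod_pairs_succ M r hr, Finset.prod_mul_distrib, ← mul_assoc, ← mul_assoc]
  congr 1
  congr 1
  have h : ∏ k ∈ Finset.range (M + 1), φ (0, k + 1) =
      φ (0, r + 1) * ∏ k ∈ Finset.range M, φ (0, (if k < r then k else k + 1) + 1) := by
    rw [← Finset.mul_prod_erase _ _ (Finset.mem_range.2 (by omega : r < M + 1))]
    congr 1
    refine Finset.prod_bij' (fun k _ => if k < r then k else k - 1)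
      (fun k _ => if k < r then k else k + 1) ?_ ?_ ?_ ?_ ?_
    · intro k hk
      rw [Finset.mem_erase, Finset.mem_range] at hk
      rw [Finset.mem_range]
      split_ifs <;> omega
    · intro k hk
      rw [Finset.mem_range] at hk
      rw [Finset.mem_erase, Finset.mem_range]
      split_ifs <;> omega
    · intro k hk
      rw [Finset.mem_erase, Finset.mem_range] at hk
      split_ifs <;> omega
    · intro k hk
      split_ifs <;> omega
    · intro k hk
      rw [Finset.mem_erase, Finset.mem_range] at hk
      congr 2
      split_ifs <;> omega
  rw [h]

end PairSplit

/-! ### Restriction of the dual polynomials and removal of small links. -/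

section Base
variable {m : ℕ} {b c : ℂ}

theorem eval_pairFactor (x : Fin (2 * m) → ℂ) (t : ℕ) {e : ℕ × ℕ} (he : e.1 < 2 * m)
    (he' : e.2 < 2 * m) : eval x (pairFactor b c (uSeq m) t e) =
      if t = 1 then toSeq x e.1 - toSeq x e.2 + b else
        if t = 2 then toSeq x e.2 - toSeq x e.1 - (b + c) else 1 := by
  unfold pairFactor
  rw [uSeq_of_lt he, uSeq_of_lt he', toSeq, toSeq, dif_pos he, dif_pos he']
  split_ifs <;> simp

theorem eval_rhoBar (x : Fin (2 * m) → ℂ) : eval x (rhoBar m b c) =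
    ∏ e ∈ pairs (2 * m), if crossType m e = 1 then toSeq x e.1 - toSeq x e.2 + b else
        if crossType m e = 2 then toSeq x e.2 - toSeq x e.1 - (b + c) else 1 := by
  rw [rhoBar_eq, map_prod]
  refine Finset.prod_congr rfl fun e he => ?_
  rw [mem_pairs] at he
  exact eval_pairFactor x _ (by omega) he.2

/-- The point with `u` at the place `0`, `v` at the place `r` and the given other entries. -/
def hookPoint (r : ℕ) (u v : ℂ) (z : ℕ → ℂ) (k : Fin (2 * m + 2)) : ℂ :=
  if k.val = 0 then u else if k.val < r then z (k - 1) else if k.val = r then v else z (k - 2)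

/-- The linear factors of the dual polynomial of a hook at a point with `u_r = u_0 + b`. -/
def hookFactor (M : ℕ) (b c : ℂ) (r : ℕ) (u : ℂ) (z : ℕ → ℂ) : ℂ :=
  ∏ k ∈ Finset.range M, if k + 1 < r then (b - (z k - u)) * (z k - u)
    else (z k - u - (b + c)) * (2 * b - (z k - u))

/-- The points `0` and `m + 1` are opposite, and deleting them preserves the types of all other
pairs; these give ρ̄ with two variables fewer, and the pairs through the deleted points give the
extra factor. -/
theorem eval_rhoBar_hookPoint (u : ℂ) (z : Fin (2 * m) → ℂ) :
    eval (hookPoint (m := m) (m + 1) u (u + b) (toSeq z) : Fin (2 * (m + 1)) → ℂ)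
      (rhoBar (m + 1) b c) = hookFactor (2 * m) b c (m + 1) u (toSeq z) *
        eval z (rhoBar m b c) := by
  set p : Fin (2 * (m + 1)) → ℂ := hookPoint (m := m) (m + 1) u (u + b) (toSeq z) with hp
  have hv : ∀ k, k < 2 * m + 2 → toSeq p k = if k = 0 then u else if k < m + 1 then
      toSeq z (k - 1) else if k = m + 1 then u + b else toSeq z (k - 2) := by
    intro k hk
    rw [toSeq, dif_pos (show k < 2 * (m + 1) from hk)]
    rfl
  have v0 : toSeq p 0 = u := by rw [hv _ (by omega), if_pos rfl]
  have vm : toSeq p (m + 1) = u + b := by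
    rw [hv _ (by omega), if_neg (by omega), if_neg (by omega), if_pos rfl]
  have vk : ∀ k < 2 * m, toSeq p (shiftAt m k + 1) = toSeq z k := by
    intro k hk
    unfold shiftAt
    split_ifs with h
    · rw [hv _ (by omega), if_neg (by omega), if_pos (by omega), Nat.add_sub_cancel]
    · rw [hv _ (by omega), if_neg (by omega), if_neg (by omega), if_neg (by omega)]
      congr 1
  rw [eval_rhoBar, eval_rhoBar]
  refine (prod_pairs_add_two (2 * m) m (by omega) _).trans ?_
  have t0 : crossType (m + 1) (0, m + 1) = 0 := by simp [crossType]
  simp only [t0, zero_ne_one, if_false, OfNat.zero_ne_ofNat, one_mul]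
  congr 1
  · refine Finset.prod_congr rfl fun k hk => ?_
    rw [Finset.mem_range] at hk
    have e := vk k hk
    rw [v0, e, vm]
    by_cases h : k < m
    · have e1 : shiftAt m k + 1 = k + 1 := by simp [shiftAt, h]
      rw [e1] at e ⊢
      have c1 : crossType (m + 1) (0, k + 1) = 1 := if_pos (by simp only; omega)
      have c2 : crossType (m + 1) (k + 1, m + 1) = 1 := if_pos (by simp only; omega)
      rw [c1, c2, e, if_pos rfl, if_pos h, if_pos rfl, if_pos (by omega)]
      ring
    · have e1 : shiftAt m k + 1 = k + 2 := by simp [shiftAt, h]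
      rw [e1] at e ⊢
      have c1 : crossType (m + 1) (0, k + 2) = 2 := by
        rw [crossType, if_neg (by simp only; omega), if_neg (by simp only; omega)]
      have c2 : crossType (m + 1) (m + 1, k + 2) = 1 := if_pos (by simp only; omega)
      rw [c1, c2, e, if_neg (by omega), if_pos rfl, if_neg h, if_pos rfl, if_neg (by omega)]
      ring
  · refine Finset.prod_congr rfl fun e he => ?_
    rw [mem_pairs] at he
    have e1 : crossType (m + 1) (shiftAt m e.1 + 1, shiftAt m e.2 + 1) = crossType m e := by
      simp only [crossType, shiftAt]
      split_ifs <;> omega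
    rw [e1, vk _ (by omega), vk _ he.2]

/-- Passage from the hook `r + 1` to the hook `r` by t̄_r. The points `0, …, r` are link-free in the
larger hook, so its polynomial vanishes where `u_r = u_0 + b` and only the exchanged term
contributes. This replaces the factors of the one variable that the hook passes. -/
theorem eval_dualPoly_hook (z : Fin (2 * m) → ℂ) (d : ℕ) (hd : d ≤ m) (u : ℂ) :
    eval (hookPoint (m := m) (m + 1 - d) u (u + b) (toSeq z) : Fin (2 * (m + 1)) → ℂ)
      (dualPoly b c (Pattern.hook (m + 1) (m + 1 - d) (by omega) (by omega))) =
        hookFactor (2 * m) b c (m + 1 - d) u (toSeq z) * eval z (rhoBar m b c) := by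
  induction d generalizing u with
  | zero =>
    have := eval_rhoBar_hookPoint (b := b) (c := c) u z
    rw [← dualPoly_rho, ← Pattern.hook_self (by omega)] at this
    exact this
  | succ d ih =>
    obtain ⟨r, hr⟩ : ∃ r, r = m + 1 - (d + 1) := ⟨_, rfl⟩
    obtain ⟨j, hj⟩ : ∃ j : Fin (2 * (m + 1) - 1), j.val = r := ⟨⟨r, by omega⟩, rfl⟩
    simp only [show m + 1 - d = r + 1 by omega] at ih
    simp only [← hr]
    have r0 : 0 < r := by omega
    have rm : r + 1 ≤ m + 1 := by omega
    have s : Step (N := 2 * (m + 1)) b c j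
        (dualPoly b c (Pattern.hook (m + 1) (r + 1) (by omega) rm))
        (dualPoly b c (Pattern.hook (m + 1) r r0 (by omega))) := by
      rw [← Pattern.actT_hook r0 rm hj]
      apply step_dualPoly
      rw [hj, Pattern.nv_hook _ _ (by omega)]
      split_ifs <;> omega
    set y := toSeq z (r - 1) with hy
    have key : (fun u : ℂ => eval (hookPoint (m := m) r u (u + b) (toSeq z))
        (dualPoly b c (Pattern.hook (m + 1) r r0 (by omega)))) =
        fun u => hookFactor (2 * m) b c r u (toSeq z) * eval z (rhoBar m b c) := by
      refine eq_of_eq_off_finite (S := {y, y - b}) ?_ ?_ (by simp) fun u hu => ?_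
      · refine continuous_eval_comp _ (continuous_pi fun k => ?_)
        unfold hookPoint
        split_ifs <;> fun_prop
      · refine Continuous.mul ?_ continuous_const
        unfold hookFactor
        refine continuous_finsetProd _ fun k _ => ?_
        split_ifs <;> fun_prop
      · simp only [Set.mem_insert_iff, Set.mem_singleton_iff, not_or] at hu
        have w1 : y - u ≠ 0 := fun h => hu.1 (by linear_combination -h)
        have w2 : b - (y - u) ≠ 0 := fun h => hu.2 (by linear_combination h)
        obtain ⟨W, hW, hW'⟩ : ∃ W, hookFactor (2 * m) b c (r + 1) u (toSeq z) =
              (b - (y - u)) * (y - u) * W ∧ hookFactor (2 * m) b c r u (toSeq z) =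
              (y - u - (b + c)) * (2 * b - (y - u)) * W := by
          have hmem : r - 1 ∈ Finset.range (2 * m) := Finset.mem_range.2 (by omega)
          refine ⟨∏ k ∈ (Finset.range (2 * m)).erase (r - 1), if k + 1 < r then
            (b - (toSeq z k - u)) * (toSeq z k - u)
            else (toSeq z k - u - (b + c)) * (2 * b - (toSeq z k - u)), ?_, ?_⟩
          · unfold hookFactor
            rw [← Finset.mul_prod_erase _ _ hmem, if_pos (by omega)]
            congr 1
            refine Finset.prod_congr rfl fun k hk => ?_
            have := (Finset.mem_erase.1 hk).1
            have e : k + 1 < r + 1 ↔ k + 1 < r := by omega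
            simp only [e]
          · unfold hookFactor
            rw [← Finset.mul_prod_erase _ _ hmem, if_neg (by omega)]
        have hz : eval (hookPoint (m := m) r u (u + b) (toSeq z))
            (dualPoly b c (Pattern.hook (m + 1) (r + 1) (by omega) rm)) = 0 := by
          have h1 := lin_dvd_dualPoly (b := b) (c := c) (by omega)
            (Pattern.hook_linkFree r0 rm) (x := ⟨0, by omega⟩) (y := ⟨r, by omega⟩)
            le_rfl (Fin.lt_def.2 r0) le_rfl
          rw [lin_dvd_iff (by simp [Fin.ext_iff]; omega)] at h1
          apply h1
          simp [hookPoint, r0.ne']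
        have hsw : (hookPoint (m := m) r u (u + b) (toSeq z) : Fin (2 * (m + 1)) → ℂ) ∘
            nswap (N := 2 * (m + 1)) j = hookPoint (m := m) (r + 1) u (u + b) (toSeq z) := by
          ext k
          have h1 : (nswap (N := 2 * (m + 1)) j k).val = sN j k := Pattern.swap_val j k
          rw [Function.comp_apply, hookPoint, hookPoint, h1, hj]
          by_cases k1 : k.val = r
          · rw [k1, sN_left, if_neg (by omega), if_neg (by omega), if_neg (by omega),
              if_neg (by omega), if_pos (by omega)]
            congr 1
          by_cases k2 : k.val = r + 1
          · rw [k2, sN_right, if_neg (by omega), if_neg (by omega), if_pos rfl,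
              if_neg (by omega), if_neg (by omega), if_pos rfl]
          rw [sN_of_ne k1 k2]
          have e : k.val < r + 1 ↔ k.val < r := by omega
          simp only [e, k1, k2, if_false]
        have hs := s.eval_eq (hookPoint (m := m) r u (u + b) (toSeq z))
        have x1 : hookPoint (m := m) r u (u + b) (toSeq z) (lp (N := 2 * (m + 1)) j) = u + b := by
          rw [hookPoint, lp_val, hj, if_neg (by omega), if_neg (by omega), if_pos rfl]
        have x2 : hookPoint (m := m) r u (u + b) (toSeq z) (rp (N := 2 * (m + 1)) j) = y := by
          rw [hookPoint, rp_val, hj, if_neg (by omega), if_neg (by omega), if_neg (by omega), hy]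
          congr 1
        rw [hz, hsw, ih (by omega), x1, x2, hW] at hs
        rw [hW']
        apply mul_left_cancel₀ (mul_ne_zero w1 w2)
        linear_combination hs
    exact congrFun key u

theorem restr_dualPoly_ins_rho : Restr (M := 2 * m) b c 0
    (dualPoly b c (Pattern.ins 0 (Pattern.rho m))) (dualPoly b c (Pattern.rho m)) := by
  intro u y
  have h := eval_dualPoly_hook (b := b) (c := c) y m le_rfl u
  simp only [show m + 1 - m = 1 by omega] at h
  rw [Pattern.hook_one] at h
  rw [dualPoly_rho]
  have e1 : (hookPoint (m := m) 1 u (u + b) (toSeq y) : Fin (2 * m + 2) → ℂ) =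
      insPair 0 u (u + b) y := by
    ext k
    have hk := k.2
    unfold hookPoint
    by_cases k0 : k.val = 0
    · rw [if_pos k0, show k = lpi (0 : Fin (2 * m + 1)) from Fin.ext k0, insPair_lp]
    by_cases k1 : k.val = 1
    · rw [if_neg k0, if_neg (by omega), if_pos k1,
        show k = rpi (0 : Fin (2 * m + 1)) from Fin.ext k1, insPair_rp]
    · rw [if_neg k0, if_neg (by omega), if_neg k1,
        insPair_of_gt (by rw [Fin.val_zero]; omega), toSeq, dif_pos (by omega)]
  have e2 : hookFactor (2 * m) b c 1 u (toSeq y) = wheelFactor b c (0 : Fin (2 * m + 1)) u y := by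
    -- The two products differ by one sign per variable, and the number of variables is even.
    have h1 : ∏ k ∈ Finset.range (2 * m), (-1 : ℂ) = 1 := by
      rw [Finset.prod_const, Finset.card_range, pow_mul]; simp
    unfold hookFactor wheelFactor
    rw [← one_mul (∏ k ∈ _, _), ← h1, ← Finset.prod_mul_distrib, Finset.prod_range]
    refine Finset.prod_congr rfl fun k _ => ?_
    rw [if_neg (by omega), if_neg (by simp), toSeq, dif_pos k.2]
    simp only [Fin.eta]
    ring
  rw [e1, e2] at h
  exact h

/-- Exchanges beyond the inserted link are compatible with the restriction, so the case of ρ spreads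
to all patterns. -/
theorem restr_dualPoly_ins_zero (π : Pattern m) : Restr (M := 2 * m) b c 0
    (dualPoly b c (Pattern.ins 0 π)) (dualPoly b c π) := by
  refine Pattern.spread_induction (P := fun π => Restr (M := 2 * m) b c 0
    (dualPoly b c (Pattern.ins 0 π)) (dualPoly b c π)) restr_dualPoly_ins_rho ?_ π
  intro π j hj h
  have hj2 := j.2
  rw [ne_eq, π.linked_iff] at hj
  obtain ⟨k, hk⟩ : ∃ k : Fin (2 * (m + 1) - 1), k.val = j + 2 := ⟨⟨j + 2, by omega⟩, rfl⟩
  have s := step_dualPoly (b := b) (c := c) (π := Pattern.ins 0 π) (j := k) (by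
    rw [hk, Pattern.nv_ins _ _ (by omega)]
    simp only [Fin.val_zero, Pattern.up, Pattern.down, Nat.not_lt_zero, if_false,
      Nat.add_sub_cancel]
    split_ifs <;> omega)
  rw [Pattern.actT_ins_zero π hk] at s
  exact h.step (k := ⟨k, k.2⟩) hk s (step_dualPoly hj)

/-- The inserted link is moved from the first place to `i` by one place at a time, with
`Restr.move`. Restriction thus inverts insertion, which drives the inductions for the basis. -/
theorem restr_dualPoly_ins (i : Fin (2 * m + 1)) (π : Pattern m) : Restr (M := 2 * m) b c i
    (dualPoly b c (Pattern.ins i π)) (dualPoly b c π) := by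
  obtain ⟨i, hi⟩ := i
  induction i with
  | zero => exact restr_dualPoly_ins_zero π
  | succ i ih =>
    have h := ih (by omega)
    obtain ⟨p, hp⟩ : ∃ p : Fin (2 * (m + 1) - 1), p.val = i := ⟨⟨i, by omega⟩, rfl⟩
    obtain ⟨q, hq⟩ : ∃ q : Fin (2 * (m + 1) - 1), q.val = i + 1 := ⟨⟨i + 1, by omega⟩, rfl⟩
    have e := Pattern.actT_actT_ins π (i := p) (j := q) (by omega)
    have ep : (⟨i, by omega⟩ : Fin (2 * m + 1)) = p := Fin.ext hp.symm
    have eq : (⟨i + 1, hi⟩ : Fin (2 * m + 1)) = q := Fin.ext hq.symm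
    rw [ep] at h
    rw [eq]
    have s := step_dualPoly (b := b) (c := c) (π := Pattern.ins p π) (j := q) (by
      rw [Pattern.nv_ins _ _ (by omega), if_neg (by omega), if_pos (by omega)]
      omega)
    have s' := step_dualPoly (b := b) (c := c) (π := (Pattern.ins p π).actT (m := m + 1) q)
      (j := p) (by
        intro h'
        have h1 := Pattern.actT_of_linked _ p ((Pattern.linked_iff _ p).2 h')
        rw [e] at h1
        rw [← h1, Pattern.nv_ins _ _ (by omega)] at h'
        have h3 : (Pattern.ins q π).nv q = q + 1 := by
          rw [Pattern.nv_ins _ _ (by omega), if_pos rfl]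
        have h4 : (Pattern.ins q π).nv p = p + 1 := by
          rw [Pattern.nv_ins _ _ (by omega)]; exact h'
        have h2 := Pattern.nv_nv (Pattern.ins q π) p
        rw [h4, show p.val + 1 = q.val by omega, h3] at h2
        omega)
    rw [e] at s'
    exact h.move (by omega) s s'

end Base

theorem _root_.LinearIndependent.coeff_eq_zero_of_injOn {ι κ V : Type*} [AddCommGroup V]
    [Module ℂ V] {v : κ → V} (hv : LinearIndependent ℂ v) {S : Finset ι} {d : ι → κ}
    (hd : Set.InjOn d S) (g : ι → ℂ) (h : ∑ i ∈ S, g i • v (d i) = 0) : ∀ i ∈ S, g i = 0 := by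
  have h1 : LinearIndependent ℂ fun i : S => v (d i) :=
    hv.comp (fun i : S => d i) fun i j h => Subtype.ext (hd i.2 j.2 h)
  rw [← Finset.sum_coe_sort] at h
  intro i hi
  exact (Fintype.linearIndependent_iff.1 h1) (fun i => g i) h ⟨i, hi⟩

/-! ### Spanning and linear independence of the dual polynomials. -/

section Basis
variable {m : ℕ} {b c : ℂ}

/-- The pattern `t_{k-1} ⋯ t_1 t_0 π`. -/
def Pattern.rot : ℕ → Pattern m → Pattern m
  | 0, π => π
  | k + 1, π => if h : k < 2 * m - 1 then (rot k π).actT ⟨k, h⟩ else rot k π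

theorem Pattern.rot_injective (k : ℕ) : Function.Injective (Pattern.rot (m := m) k) := by
  induction k with
  | zero => exact fun _ _ h => h
  | succ k ih =>
    intro π σ h
    rw [Pattern.rot, Pattern.rot] at h
    split_ifs at h with hk
    · apply ih
      rw [← Pattern.actT_actT (Pattern.rot k π) ⟨k, hk⟩, h, Pattern.actT_actT]
    · exact ih h

variable (b c) in
/-- The dual polynomials for a positive number of links, in variables of the normal form. -/
def dualSucc (π : Pattern (m + 1)) : MvPolynomial (Fin (2 * m + 2)) ℂ := dualPoly b c π

theorem step_dualSucc {π : Pattern (m + 1)} {j : Fin (2 * m + 1)} (hu : π.nv j ≠ j + 1) :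
    Step (N := 2 * m + 2) b c j (dualSucc b c π) (dualSucc b c (π.actT (m := m + 1) j)) :=
  step_dualPoly hu

/-- The first point keeps its partner while it is moved, as long as it has not become a neighbour of
this partner; until then no exchange meets a linked pair. -/
theorem chain_rot (k : ℕ) (σ : Pattern (m + 1)) (h : k < σ.nv 0) (hk : k ≤ 2 * m + 1) :
    (σ.rot k).nv k = σ.nv 0 ∧ Chain b c k (dualSucc b c σ) (dualSucc b c (σ.rot k)) := by
  induction k with
  | zero => exact ⟨rfl, rfl⟩
  | succ k ih =>
    obtain ⟨h1, h2⟩ := ih (by omega) (by omega)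
    have hk' : k < 2 * (m + 1) - 1 := by omega
    have e : σ.rot (k + 1) = (σ.rot k).actT ⟨k, hk'⟩ := by rw [Pattern.rot, dif_pos hk']
    rw [e]
    refine ⟨?_, by omega, _, h2, step_dualSucc (j := ⟨k, hk'⟩)
      (by rw [h1]; exact h.ne')⟩
    rw [Pattern.nv_actT _ _ (by omega)]
    simp only [sN_right]
    rw [h1, sN_of_ne (by omega) (by omega)]

/-- The point at place `k`, being linked to the right, can be carried back to the first place. This
is used to realize a prescribed restriction at place `k` by a dual polynomial before transport. -/
theorem exists_chain_dualSucc (k : ℕ) (π : Pattern (m + 1)) (h : k < π.nv k)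
    (hk : k ≤ 2 * m + 1) :
    ∃ σ : Pattern (m + 1), Chain b c k (dualSucc b c σ) (dualSucc b c π) := by
  induction k generalizing π with
  | zero => exact ⟨π, rfl⟩
  | succ k ih =>
    have hk' : k < 2 * (m + 1) - 1 := by omega
    have h3 : (π.actT ⟨k, hk'⟩).nv k = π.nv (k + 1) := by
      rw [Pattern.nv_actT _ _ (by omega)]
      simp only [sN_left]
      rw [sN_of_ne (by omega) (by omega)]
    obtain ⟨σ, hσ⟩ := ih (π.actT ⟨k, hk'⟩) (by omega) (by omega)
    refine ⟨σ, by omega, _, hσ, ?_⟩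
    have := step_dualSucc (b := b) (c := c) (π := π.actT ⟨k, hk'⟩) (j := ⟨k, hk'⟩)
      (by rw [h3]; exact h.ne')
    rwa [Pattern.actT_actT] at this

theorem Chain.exists_dvd {M : ℕ} {k l : ℕ} {f φ : MvPolynomial (Fin (M + 1)) ℂ}
    (s : Chain b c l f φ) (hkl : k < l) (hk : k < M) : ∃ χ, Chain b c k f χ ∧
      lin (lp (N := M + 1) ⟨k, hk⟩) (rp (N := M + 1) ⟨k, hk⟩) b ∣ χ := by
  induction l generalizing φ with
  | zero => omega
  | succ l ih =>
    obtain ⟨h, φ', s1, s2⟩ := s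
    by_cases h' : k < l
    · exact ih s1 h'
    · obtain rfl : k = l := by omega
      exact ⟨φ', s1, s2.dvd_left⟩

theorem rhoBar_zero : rhoBar 0 b c = 1 := by
  simp [rhoBar, crossed]

theorem dualSucc_pv (hc : c ≠ 0) (π : Pattern (m + 1)) : PV b c (dualSucc b c π) :=
  dualPoly_pv hc π

theorem totalDegree_dualSucc_le (π : Pattern (m + 1)) :
    (dualSucc b c π).totalDegree ≤ minDeg (2 * m + 2) := totalDegree_dualPoly_le π

theorem restr_dualSucc (i : Fin (2 * m + 1)) (π : Pattern m) :
    Restr b c i (dualSucc b c (Pattern.ins i π)) (dualPoly b c π) := restr_dualPoly_ins i π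

/-- Wherever the transport of `f` would stop, a combination of dual polynomials with the same
obstruction is subtracted. What can finally be moved all the way is zero by `eq_zero_of_chain`. -/
theorem mem_span_dualSucc (hbc : b ≠ c) (hc : c ≠ 0)
    (ih : ∀ χ : MvPolynomial (Fin (2 * m)) ℂ, PV b c χ → χ.totalDegree ≤ minDeg (2 * m) →
      χ ∈ Submodule.span ℂ (Set.range (dualPoly (m := m) b c)))
    {f : MvPolynomial (Fin (2 * m + 2)) ℂ} (hf : PV b c f)
    (hd : f.totalDegree ≤ minDeg (2 * m + 2)) :
    f ∈ Submodule.span ℂ (Set.range (dualSucc (m := m) b c)) := by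
  have key : ∀ k ≤ 2 * m + 1, ∃ g ∈ Submodule.span ℂ (Set.range (dualSucc (m := m) b c)),
      PV b c g ∧ g.totalDegree ≤ minDeg (2 * m + 2) ∧ ∃ φ, Chain b c k (f - g) φ := by
    intro k
    induction k with
    | zero => exact fun _ => ⟨0, Submodule.zero_mem _, fun x _ => by simp, by simp, _, rfl⟩
    | succ k ihk =>
      intro hk
      obtain ⟨g, hg, hgv, hgd, φ, hφ⟩ := ihk (by omega)
      have hv : PV b c (f - g) := fun x hx => by rw [map_sub, hf x hx, hgv x hx, sub_zero]
      have hdd : (f - g).totalDegree ≤ minDeg (2 * m + 2) :=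
        (totalDegree_sub _ _).trans (max_le hd hgd)
      set i : Fin (2 * m + 1) := ⟨k, by omega⟩ with hi
      -- The obstruction to divisibility at place `k` is an element of the minimal space with two
      -- variables fewer, known by induction.
      obtain ⟨χ, c1, c2, c3⟩ := exists_restriction hbc hc i
        (hφ.pv hv hc) (hφ.totalDegree_le.trans hdd)
      obtain ⟨a, ha⟩ := (Submodule.mem_span_range_iff_exists_fun ℂ).1 (ih χ c1 c2)
      have hlink : ∀ π : Pattern m, (Pattern.ins i π).nv k = k + 1 := fun π => by
        rw [Pattern.nv_ins _ _ (by omega), if_pos rfl]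
      -- Patterns whose transport to place `k` ends with a small link there; their restrictions at
      -- `k` are the dual polynomials with two variables fewer.
      choose σ hσ using fun π : Pattern m => exists_chain_dualSucc (b := b) (c := c) k
        (Pattern.ins i π) (by rw [hlink]; omega) (by omega)
      have hc' := Chain.sum (b := b) (c := c) Finset.univ (by omega)
        fun π _ => (hσ π).smul (a π)
      have hR := Restr.sum (b := b) (c := c) Finset.univ a (F := fun π => dualSucc b c
        (Pattern.ins i π)) (G := dualPoly b c) fun π _ => restr_dualSucc i π
      rw [ha] at hR
      set g' := ∑ π, a π • dualSucc b c (σ π)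
      have hg'v : PV b c g' := fun x hx => by
        rw [map_sum]
        refine Finset.sum_eq_zero fun π _ => ?_
        rw [smul_eval, dualSucc_pv hc _ x hx, mul_zero]
      have hg'd : g'.totalDegree ≤ minDeg (2 * m + 2) :=
        totalDegree_finsetSum_le fun π _ =>
          (totalDegree_smul_le _ _).trans (totalDegree_dualSucc_le _)
      -- The obstructions agree, so the difference is divisible by the next linear factor and the
      -- transport continues.
      have hdvd := Restr.dvd_sub c3 hR
      obtain ⟨φ', s⟩ := Step.exists_of_dvd (N := 2 * m + 2) c hdvd
      refine ⟨g + g', Submodule.add_mem _ hg (Submodule.sum_mem _ fun π _ =>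
          Submodule.smul_mem _ _ (Submodule.subset_span ⟨_, rfl⟩)),
        fun x hx => by rw [map_add, hgv x hx, hg'v x hx, add_zero],
        (totalDegree_add _ _).trans (max_le hgd hg'd), φ', by omega, _, ?_, s⟩
      rw [← sub_sub]
      exact hφ.sub hc'
  obtain ⟨g, hg, hgv, hgd, φ, hφ⟩ := key (2 * m + 1) le_rfl
  have h0 : f - g = 0 := by
    refine eq_zero_of_chain hbc hc
      (fun x hx => by rw [map_sub, hf x hx, hgv x hx, sub_zero])
      ((totalDegree_sub _ _).trans (max_le hd hgd)) fun k hk => hφ.exists_dvd hk hk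
  rw [sub_eq_zero] at h0
  rwa [h0]

/-- The dual polynomials span the polynomials of minimal degree with the vanishing property. -/
theorem mem_span_dualPoly (hbc : b ≠ c) (hc : c ≠ 0) (f : Poly m) (hf : PV b c f)
    (hd : f.totalDegree ≤ minDeg (2 * m)) :
    f ∈ Submodule.span ℂ (Set.range (dualPoly (m := m) b c)) := by
  induction m with
  | zero =>
    have : f = (coeff 0 f) • dualPoly b c (Pattern.rho 0) := by
      rw [dualPoly_rho, rhoBar_zero, smul_eq_C_mul, mul_one]
      have : IsEmpty (Fin (2 * 0)) := inferInstanceAs (IsEmpty (Fin 0))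
      exact eq_C_of_isEmpty f
    rw [this]
    exact Submodule.smul_mem _ _ (Submodule.subset_span ⟨_, rfl⟩)
  | succ m ih => exact mem_span_dualSucc hbc hc ih hf hd

/-- A relation is transported step by step. When the first variable reaches place `k`, precisely the
patterns in which the first point is linked to `k + 1` have acquired a small link at `k`; the
restriction isolates them, and the induction hypothesis for two points fewer removes them from the
relation. -/
theorem linearIndependent_dualSucc (ih : LinearIndependent ℂ (dualPoly (m := m) b c)) :
    LinearIndependent ℂ (dualSucc (m := m) b c) := by
  rw [Fintype.linearIndependent_iff]
  intro g hg
  have key : ∀ k, ∀ σ : Pattern (m + 1), σ.nv 0 = k + 1 → g σ = 0 := by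
    intro k
    induction k using Nat.strong_induction_on with
    | _ k ihk =>
      intro σ₀ hσ₀
      have hk : k < 2 * m + 1 := by
        have := σ₀.nv_lt (k := 0) (by omega)
        omega
      set i : Fin (2 * m + 1) := ⟨k, hk⟩ with hi
      -- The coefficients of patterns whose first point has its partner at `k` or before are already
      -- known to vanish.
      set S := Finset.univ.filter fun σ : Pattern (m + 1) => k < σ.nv 0 with hS
      have h1 : ∑ σ ∈ S, g σ • dualSucc b c σ = 0 := by
        rw [← hg]
        refine Finset.sum_subset (Finset.filter_subset _ _) fun σ _ hσ => ?_
        rw [hS, Finset.mem_filter, not_and] at hσ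
        have h2 := hσ (Finset.mem_univ _)
        have h3 := σ.nv_ne (k := 0) (by omega)
        rw [ihk (σ.nv 0 - 1) (by omega) σ (by omega), zero_smul]
      have h2 := Chain.sum (b := b) (c := c) S hk.le fun σ hσ =>
        ((chain_rot k σ (Finset.mem_filter.1 hσ).2 hk.le).2).smul (g σ)
      rw [h1] at h2
      have h3 := h2.unique (Chain.zero hk.le)
      rw [← Finset.sum_filter_add_sum_filter_not S (fun σ => σ.nv 0 = k + 1)] at h3
      -- The remaining terms belong to patterns that are still unlinked at `k`, hence they are
      -- divisible; so the part with a small link at `k` is divisible as well.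
      have h4 : lin (lp (N := 2 * m + 2) i) (rp (N := 2 * m + 2) i) b ∣
          ∑ σ ∈ S with σ.nv 0 = k + 1, g σ • dualSucc b c (σ.rot k) := by
        rw [eq_neg_of_add_eq_zero_left h3, dvd_neg]
        refine Finset.dvd_sum fun σ hσ => ?_
        rw [Finset.mem_filter, hS, Finset.mem_filter] at hσ
        rw [smul_eq_C_mul]
        refine Dvd.dvd.mul_left ?_ _
        refine bP_dvd_dualPoly (m := m + 1) (j := i) ?_
        rw [(chain_rot (b := b) (c := c) k σ hσ.1.2 hk.le).1]
        exact hσ.2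
      have h5 : ∀ σ : Pattern (m + 1), ∃ d : Pattern m,
          σ.nv 0 = k + 1 → σ.rot k = Pattern.ins i d := by
        intro σ
        by_cases h : σ.nv 0 = k + 1
        · obtain ⟨d, hd⟩ := Pattern.exists_eq_ins (i := i) (π := σ.rot k)
            (((chain_rot (b := b) (c := c) k σ (by omega) hk.le).1).trans h)
          exact ⟨d, fun _ => hd⟩
        · exact ⟨Pattern.rho m, fun h' => absurd h' h⟩
      choose d hd using h5
      have h6 := Restr.sum (b := b) (c := c) (i := i)
        (S.filter fun σ => σ.nv 0 = k + 1) g (F := fun σ => dualSucc b c (σ.rot k))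
        (G := fun σ => dualPoly b c (d σ)) fun σ hσ => by
          rw [hd σ (Finset.mem_filter.1 hσ).2]
          exact restr_dualSucc i (d σ)
      have h7 := h6.eq_zero h4
      refine ih.coeff_eq_zero_of_injOn (S := S.filter fun σ => σ.nv 0 = k + 1) (d := d)
        (fun σ hσ σ' hσ' h => ?_) g h7 σ₀ ?_
      · apply Pattern.rot_injective k
        rw [hd σ (Finset.mem_filter.1 hσ).2, hd σ' (Finset.mem_filter.1 hσ').2, h]
      · rw [Finset.mem_filter, hS, Finset.mem_filter]
        exact ⟨⟨Finset.mem_univ _, by omega⟩, hσ₀⟩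
  intro σ
  have h3 := σ.nv_ne (k := 0) (by omega)
  exact key (σ.nv 0 - 1) σ (by omega)

/-- The dual polynomials are linearly independent. -/
theorem linearIndependent_dualPoly : LinearIndependent ℂ (dualPoly (m := m) b c) := by
  induction m with
  | zero =>
    have : IsEmpty (Fin (2 * 0)) := inferInstanceAs (IsEmpty (Fin 0))
    have : Subsingleton (Pattern 0) := ⟨fun π σ => Subtype.ext (Subsingleton.elim _ _)⟩
    rw [Fintype.linearIndependent_iff]
    intro g hg π
    rw [Fintype.sum_subsingleton _ π] at hg
    exact (smul_eq_zero.1 hg).resolve_right (dualPoly_ne_zero π)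
  | succ m ih => exact linearIndependent_dualSucc ih

end Basis

/-! ### Top homogeneous parts of the dual polynomials. -/

section TopPart
variable {m : ℕ} {b c : ℂ}

theorem homogeneousComponent_prod {σ ι : Type*} (s : Finset ι) (p : ι → MvPolynomial σ ℂ)
    (d : ι → ℕ) (h : ∀ k ∈ s, (p k).totalDegree ≤ d k) :
    (∏ k ∈ s, p k).totalDegree ≤ ∑ k ∈ s, d k ∧
      homogeneousComponent (∑ k ∈ s, d k) (∏ k ∈ s, p k) =
        ∏ k ∈ s, homogeneousComponent (d k) (p k) := by
  classical
  induction s using Finset.induction_on with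
  | empty =>
    simp only [Finset.sum_empty, Finset.prod_empty]
    exact ⟨by simp, homogeneousComponent_of_mem (isHomogeneous_one σ ℂ) |>.trans (if_pos rfl)⟩
  | insert a s ha ih =>
    obtain ⟨h1, h2⟩ := ih fun k hk => h k (Finset.mem_insert_of_mem hk)
    have h3 := h a (Finset.mem_insert_self a s)
    rw [Finset.prod_insert ha, Finset.sum_insert ha, Finset.prod_insert ha,
      homogeneousComponent_mul_of_le h3 h1, h2]
    exact ⟨(totalDegree_mul _ _).trans (Nat.add_le_add h3 h1), rfl⟩

theorem homogeneousComponent_C_of_pos {σ : Type*} {n : ℕ} (hn : 0 < n) (r : ℂ) :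
    homogeneousComponent n (C r : MvPolynomial σ ℂ) = 0 := by
  rw [homogeneousComponent_of_mem (isHomogeneous_C σ r)]
  exact if_neg hn.ne'

/-- The top part of `ρ̄` is given by the same product, with `b = c = 0`. -/
theorem homogeneousComponent_rhoBar :
    homogeneousComponent (2 * m * (m - 1)) (rhoBar m b c) = rhoBar m 0 0 := by
  have h0 : ∀ k : ℕ, (uSeq m k).totalDegree ≤ 1 ∧
      homogeneousComponent 1 (uSeq m k) = uSeq m k := by
    intro k
    by_cases hk : k < 2 * m
    · rw [uSeq_of_lt hk]
      exact ⟨by rw [totalDegree_X], by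
        rw [homogeneousComponent_of_mem (isHomogeneous_X ℂ _), if_pos rfl]⟩
    · have : uSeq m k = 0 := dif_neg hk
      rw [this]
      simp
  have hC : ∀ (b c : ℂ) (j : ℤ), ∃ r : ℂ, addExt (2 * m) (C (c + 2 * b)) (uSeq m) j =
      uSeq m (j % ((2 * m : ℕ) : ℤ)).toNat + C r := by
    intro b c j
    refine ⟨((j / ((2 * m : ℕ) : ℤ) : ℤ) : ℂ) * (c + 2 * b), ?_⟩
    rw [addExt, C_mul]
    congr 2
  have h2 : ∀ i j : ℤ, (bExt m b c (uSeq m) i j).totalDegree ≤ 1 ∧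
      homogeneousComponent 1 (bExt m b c (uSeq m) i j) = bExt m 0 0 (uSeq m) i j := by
    intro i j
    unfold bExt
    obtain ⟨r, hr⟩ := hC b c i
    obtain ⟨s, hs⟩ := hC b c j
    rw [hr, hs]
    constructor
    · refine (totalDegree_add _ _).trans (max_le ((totalDegree_sub _ _).trans (max_le ?_ ?_)) ?_)
      · exact (totalDegree_add _ _).trans (max_le (h0 _).1 (by simp))
      · exact (totalDegree_add _ _).trans (max_le (h0 _).1 (by simp))
      · simp
    · simp only [map_add, map_sub, homogeneousComponent_C_of_pos one_pos, (h0 _).2, addExt]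
      simp
  unfold rhoBar crossed
  have h3 := fun i : ℕ => homogeneousComponent_prod (Finset.Ico 1 m)
    (fun k => bExt m b c (uSeq m) i (i + k)) (fun _ => 1) fun k _ => (h2 _ _).1
  have h4 := (homogeneousComponent_prod (Finset.range (2 * m))
    (fun i => ∏ k ∈ Finset.Ico 1 m, bExt m b c (uSeq m) i (i + k)) (fun _ => m - 1)
    fun i _ => by simpa using (h3 i).1).2
  rw [Finset.sum_const, Finset.card_range, smul_eq_mul] at h4
  rw [h4]
  refine Finset.prod_congr rfl fun i _ => ?_
  have h5 := (h3 i).2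
  rw [Finset.sum_const, Nat.card_Ico, smul_eq_mul, mul_one] at h5
  rw [h5]
  exact Finset.prod_congr rfl fun k _ => (h2 _ _).2

/-- The product of the differences of the variables over all ordered pairs of different points that
are not linked. -/
def unlinkedProd (π : Pattern m) : Poly m :=
  ∏ x ∈ Finset.range (2 * m), ∏ y ∈ Finset.range (2 * m),
    if x = y ∨ π.nv x = y then 1 else uSeq m x - uSeq m y

theorem swapPoly_unlinkedProd (π : Pattern m) (j : Fin (2 * m - 1)) :
    swapPoly j (unlinkedProd π) = unlinkedProd (π.actT j) := by
  have hj := j.2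
  have hbij : ∀ g : ℕ → Poly m, ∏ x ∈ Finset.range (2 * m), g (sN j x) =
      ∏ x ∈ Finset.range (2 * m), g x := fun g =>
    Finset.prod_bij' (fun x _ => sN j x) (fun x _ => sN j x)
      (fun x hx => Finset.mem_range.2 (sN_lt (by omega) (Finset.mem_range.1 hx)))
      (fun x hx => Finset.mem_range.2 (sN_lt (by omega) (Finset.mem_range.1 hx)))
      (fun x _ => sN_sN _ _) (fun x _ => sN_sN _ _) fun x _ => rfl
  unfold unlinkedProd
  rw [map_prod, ← hbij]
  refine Finset.prod_congr rfl fun x hx => ?_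
  rw [map_prod, ← hbij]
  refine Finset.prod_congr rfl fun y hy => ?_
  rw [Finset.mem_range] at hx hy
  have hx' : sN j x < 2 * m := sN_lt (by omega) hx
  have hy' : sN j y < 2 * m := sN_lt (by omega) hy
  have e1 : sN j x = sN j y ↔ x = y :=
    ⟨fun h => by rw [← sN_sN j x, h, sN_sN], fun h => by rw [h]⟩
  have e2 : π.nv (sN j x) = sN j y ↔ (π.actT j).nv x = y := by
    rw [Pattern.nv_actT _ _ hx]
    exact ⟨fun h => by rw [h, sN_sN], fun h => by rw [← h, sN_sN]⟩
  simp only [e1, e2]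
  split_ifs
  · rw [map_one]
  · rw [map_sub, swapPoly_uSeq j hx', swapPoly_uSeq j hy', sN_sN, sN_sN]

theorem prod_range_prod_range {A : Type*} [CommMonoid A] (N : ℕ) (g : ℕ → ℕ → A)
    (hg : ∀ x, g x x = 1) : ∏ x ∈ Finset.range N, ∏ y ∈ Finset.range N, g x y =
      ∏ e ∈ pairs N, g e.1 e.2 * g e.2 e.1 := by
  rw [Finset.prod_mul_distrib, ← Finset.prod_product',
    ← Finset.prod_filter_mul_prod_filter_not _ (fun e : ℕ × ℕ => e.1 < e.2)]
  congr 1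
  rw [← Finset.prod_filter_mul_prod_filter_not _ (fun e : ℕ × ℕ => e.1 = e.2),
    Finset.prod_eq_one, one_mul]
  · refine Finset.prod_bij' (fun e _ => (e.2, e.1)) (fun e _ => (e.2, e.1)) ?_ ?_ ?_ ?_ ?_
    · rintro ⟨x, y⟩ h
      simp only [Finset.mem_filter, Finset.mem_product, Finset.mem_range] at h
      rw [mem_pairs]
      dsimp only
      omega
    · rintro ⟨x, y⟩ h
      rw [mem_pairs] at h
      simp only [Finset.mem_filter, Finset.mem_product, Finset.mem_range]
      dsimp only at h
      omega
    · intro e _; rfl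
    · intro e _; rfl
    · intro e _; rfl
  · rintro ⟨x, y⟩ h
    simp only [Finset.mem_filter] at h
    rw [h.2]
    exact hg y

/-- On top parts the operators are plain exchanges, and these permute the products over unlinked
pairs accordingly; so the identity needs checking at ρ only. The square removes the signs that
depend on the orientation of the pairs, up to the constant. -/
theorem sq_topPart (π : Pattern m) : ∃ κ : ℂ, κ ≠ 0 ∧
    homogeneousComponent (2 * m * (m - 1)) (dualPoly b c π) ^ 2 = C κ * unlinkedProd π := by
  refine Pattern.spread_induction (P := fun π => ∃ κ : ℂ, κ ≠ 0 ∧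
    homogeneousComponent (2 * m * (m - 1)) (dualPoly b c π) ^ 2 = C κ * unlinkedProd π) ?_ ?_ π
  · rw [dualPoly_rho, homogeneousComponent_rhoBar, rhoBar_eq, unlinkedProd,
      prod_range_prod_range (2 * m) (fun x y => if x = y ∨ (Pattern.rho m).nv x = y then
        (1 : Poly m) else uSeq m x - uSeq m y) fun x => if_pos (Or.inl rfl)]
    refine ⟨∏ e ∈ pairs (2 * m), if crossType m e = 0 then 1 else -1,
      Finset.prod_ne_zero_iff.2 fun e _ => by split_ifs <;> simp, ?_⟩
    rw [← Finset.prod_pow, map_prod, ← Finset.prod_mul_distrib]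
    refine Finset.prod_congr rfl ?_
    rintro ⟨x, y⟩ he
    rw [mem_pairs] at he
    dsimp only at he
    rw [Pattern.rho_nv (by omega), Pattern.rho_nv (by omega)]
    simp only [pairFactor, crossType]
    by_cases h : y = x + m
    · have e0 : ¬ y < x + m := by omega
      have e1 : x = y ∨ (if x < m then x + m else x - m) = y := by
        right; rw [if_pos (by omega)]; omega
      have e2 : y = x ∨ (if y < m then y + m else y - m) = x := by
        right; rw [if_neg (by omega)]; omega
      rw [if_pos e1, if_pos e2]
      simp only [if_neg e0, if_pos h]
      simp
    · have e1 : ¬ (x = y ∨ (if x < m then x + m else x - m) = y) := by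
        split_ifs <;> omega
      have e2 : ¬ (y = x ∨ (if y < m then y + m else y - m) = x) := by
        split_ifs <;> omega
      rw [if_neg e1, if_neg e2]
      by_cases h2 : y < x + m
      · simp only [if_pos h2]
        simp
        ring
      · simp only [if_neg h2, if_neg h]
        simp
        ring
  · rintro π j hj ⟨κ, hκ, h⟩
    have hu : π.nv j ≠ j + 1 := by rwa [ne_eq, ← π.linked_iff j]
    refine ⟨κ, hκ, ?_⟩
    rw [(step_dualPoly (b := b) (c := c) hu).homogeneousComponent_eq
      (by rw [← minDeg_even]; exact totalDegree_dualPoly_le π), ← swapPoly_eq_sw, ← map_pow, h,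
      map_mul, swapPoly_C, swapPoly_unlinkedProd]

/-- The top part of a dual polynomial is invariant under the exchange of two neighbours that are
linked. -/
theorem swapPoly_topPart {π : Pattern m} {j : Fin (2 * m - 1)} (h : π.1 (lo j) = hi j) :
    swapPoly j (homogeneousComponent (2 * m * (m - 1)) (dualPoly b c π)) =
      homogeneousComponent (2 * m * (m - 1)) (dualPoly b c π) := by
  have hj := j.2
  obtain ⟨κ, hκ, e⟩ := sq_topPart (b := b) (c := c) π
  set P := homogeneousComponent (2 * m * (m - 1)) (dualPoly b c π)
  have h1 : swapPoly j P ^ 2 = P ^ 2 := by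
    rw [← map_pow, e, map_mul, swapPoly_C, swapPoly_unlinkedProd, Pattern.actT_of_linked _ _ h]
  rcases sq_eq_sq_iff_eq_or_eq_neg.1 h1 with h2 | h2
  · exact h2
  · exfalso
    -- A point with `u_j = u_{j+1}` and no other coincidence. An antisymmetric top part would vanish
    -- there, but its square does not, since the linked pair does not occur in `unlinkedProd`.
    set z : Fin (2 * m) → ℂ := fun k => if k = hi j then (j.val : ℂ) else (k.val : ℂ) with hz
    have h3 : z ∘ nswap (N := 2 * m) j = z := by
      ext k
      change z (Equiv.swap (lo j) (hi j) k) = z k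
      have : lo j ≠ hi j := by simp [lo, hi, Fin.ext_iff]
      by_cases k1 : k = lo j
      · rw [k1, Equiv.swap_apply_left]; simp [hz, this]; simp [lo]
      by_cases k2 : k = hi j
      · rw [k2, Equiv.swap_apply_right]; simp [hz, this]; simp [lo]
      · rw [Equiv.swap_apply_of_ne_of_ne k1 k2]
    have h4 : eval z P = 0 := by
      have h5 := congrArg (eval z) h2
      rw [swapPoly_eq_sw, eval_sw, h3, map_neg] at h5
      linear_combination h5 / 2
    have h6 := congrArg (eval z) e
    rw [map_pow, h4, map_mul, eval_C, unlinkedProd] at h6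
    have h7 : eval z (∏ x ∈ Finset.range (2 * m), ∏ y ∈ Finset.range (2 * m),
        if x = y ∨ π.nv x = y then (1 : Poly m) else uSeq m x - uSeq m y) ≠ 0 := by
      rw [map_prod]
      refine Finset.prod_ne_zero_iff.2 fun x hx => ?_
      rw [map_prod]
      refine Finset.prod_ne_zero_iff.2 fun y hy => ?_
      rw [Finset.mem_range] at hx hy
      by_cases hxy : x = y ∨ π.nv x = y
      · rw [if_pos hxy, map_one]; exact one_ne_zero
      · rw [if_neg hxy, map_sub, uSeq_of_lt hx, uSeq_of_lt hy, eval_X, eval_X, sub_ne_zero]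
        rw [Pattern.linked_iff] at h
        have h' := π.nv_nv j
        rw [h] at h'
        have e1 : ∀ k (hk : k < 2 * m), z ⟨k, hk⟩ = ((if k = j + 1 then j.val else k : ℕ) : ℂ) := by
          intro k hk
          simp only [hz, hi, Fin.mk.injEq]
          split_ifs <;> rfl
        rw [e1, e1, ne_eq, Nat.cast_inj]
        intro h8
        apply hxy
        split_ifs at h8 with k1 k2 k2
        · left; omega
        · right; rw [k1, h', h8]
        · right; rw [h8, k2, h]
        · left; exact h8
    simp only [ne_eq, OfNat.ofNat_ne_zero, not_false_eq_true, zero_pow] at h6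
    exact mul_ne_zero hκ h7 h6.symm

end TopPart

/-! ### The vanishing conditions (P) and (P') compared. -/

section Wheels
variable {n : ℕ} {b c : ℂ}

theorem Int.ediv_eq_or_of_lt_add {i j N : ℤ} (hN : 0 < N) (h1 : i ≤ j) (h2 : j < i + N) :
    j / N = i / N ∨ j / N = i / N + 1 := by
  have h3 := Int.ediv_le_ediv hN h1
  have h4 := Int.ediv_le_ediv hN h2.le
  rw [Int.add_ediv_of_dvd_right (dvd_refl N), Int.ediv_self hN.ne'] at h4
  omega

theorem addExt_toSeq (hn : 0 < n) (s : ℂ) (x : Fin n → ℂ) (j : ℤ) :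
    ∃ r : Fin n, (r.val : ℤ) + n * (j / n) = j ∧
      addExt n s (toSeq x) j = x r + ((j / n : ℤ) : ℂ) * s := by
  have hN : (0 : ℤ) < n := by exact_mod_cast hn
  have h1 := Int.emod_nonneg j hN.ne'
  have h2 := Int.emod_lt_of_pos j hN
  have h3 := Int.emod_add_mul_ediv j n
  refine ⟨⟨(j % n).toNat, by omega⟩, ?_, ?_⟩
  · simp only [Int.toNat_of_nonneg h1]
    exact h3
  · rw [addExt, toSeq, dif_pos]

theorem addExt_toSeq_natCast (s : ℂ) (x : Fin n → ℂ) (r : Fin n) :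
    addExt n s (toSeq x) r.val = x r := by
  have hr : (r.val : ℤ) < n := by exact_mod_cast r.2
  rw [addExt, Int.emod_eq_of_lt (by omega) hr, Int.ediv_eq_zero_of_lt (by omega) hr]
  simp [toSeq]

theorem addExt_add_mul (hn : 0 < n) (s : ℂ) (x : ℕ → ℂ) (j q : ℤ) :
    addExt n s x (j + n * q) = addExt n s x j + q * s := by
  have hN : (n : ℤ) ≠ 0 := by exact_mod_cast hn.ne'
  rw [addExt, addExt, Int.add_mul_emod_self_left, Int.add_mul_ediv_left _ _ hN]
  push_cast
  ring

/-- The three forms correspond to the number of indices that lie one period beyond `i`: none, only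
`k`, or both `j` and `k`. -/
theorem isAddWheel_iff (hn : 0 < n) (x : Fin n → ℂ) : IsAddWheel n b c x ↔ Wheel b c x := by
  have hN : (0 : ℤ) < n := by exact_mod_cast hn
  constructor
  · rintro ⟨i, j, k, hij, hjk, hki, h1, h2⟩
    obtain ⟨ri, ei, vi⟩ := addExt_toSeq hn (c + 2 * b) x i
    obtain ⟨rj, ej, vj⟩ := addExt_toSeq hn (c + 2 * b) x j
    obtain ⟨rk, ek, vk⟩ := addExt_toSeq hn (c + 2 * b) x k
    rw [vi, vj] at h1
    rw [vi, vk] at h2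
    have bi := ri.2
    have bj := rj.2
    have bk := rk.2
    have hjk' := Int.ediv_le_ediv hN hjk.le
    have e1 : (n : ℤ) * (i / n + 1) = n * (i / n) + n := by ring
    rcases Int.ediv_eq_or_of_lt_add hN hij.le (by omega) with qj | qj <;>
      rcases Int.ediv_eq_or_of_lt_add hN (hij.trans hjk).le hki with qk | qk <;>
      rw [qj] at ej h1 <;> rw [qk] at ek h2
    · refine ⟨ri, rj, rk, Fin.lt_def.2 (by omega), Fin.lt_def.2 (by omega), Or.inl ⟨?_, ?_⟩⟩
      · linear_combination h1
      · linear_combination h2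
    · push_cast at h2
      refine ⟨rk, ri, rj, Fin.lt_def.2 (by omega), Fin.lt_def.2 (by omega),
        Or.inr (Or.inl ⟨?_, ?_⟩)⟩
      · linear_combination -h2
      · linear_combination h1 - h2
    · omega
    · push_cast at h1 h2
      refine ⟨rj, rk, ri, Fin.lt_def.2 (by omega), Fin.lt_def.2 (by omega),
        Or.inr (Or.inr ⟨?_, ?_⟩)⟩
      · linear_combination h2 - h1
      · linear_combination -h1
  · rintro ⟨i, j, k, hij, hjk, h⟩
    rw [Fin.lt_def] at hij hjk
    have bk := k.2
    have sh : ∀ r : Fin n, addExt n (c + 2 * b) (toSeq x) (r.val + n) = x r + (c + 2 * b) := by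
      intro r
      have := addExt_add_mul hn (c + 2 * b) (toSeq x) r.val 1
      rw [mul_one, addExt_toSeq_natCast] at this
      rw [this]
      push_cast
      ring
    rcases h with ⟨h1, h2⟩ | ⟨h1, h2⟩ | ⟨h1, h2⟩
    · refine ⟨i.val, j.val, k.val, by omega, by omega, by omega, ?_, ?_⟩ <;>
        simp only [addExt_toSeq_natCast]
      · exact h1
      · exact h2
    · refine ⟨j.val, k.val, i.val + n, by omega, by omega, by omega, ?_, ?_⟩ <;>
        simp only [addExt_toSeq_natCast, sh]
      · rw [h1, h2]
      · rw [h1]; ring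
    · refine ⟨k.val, i.val + n, j.val + n, by omega, by omega, by omega, ?_, ?_⟩ <;>
        simp only [addExt_toSeq_natCast, sh]
      · rw [h2]; ring
      · rw [h1, h2]; ring

theorem mulExt_exp (hn : 0 < n) (h : ℂ) (x : Fin n → ℂ) (j : ℤ) :
    mulExt n ((parA (Complex.exp (h * b)) (Complex.exp (h * c)) ^ 2)⁻¹)
      (toSeq fun i => Complex.exp (2 * h * x i)) j =
      Complex.exp (2 * h * addExt n (c + 2 * b) (toSeq x) j) := by
  have hN : (0 : ℤ) < n := by exact_mod_cast hn
  have h1 := Int.emod_nonneg j hN.ne'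
  have h2 := Int.emod_lt_of_pos j hN
  have hs : (parA (Complex.exp (h * b)) (Complex.exp (h * c)) ^ 2)⁻¹ =
      Complex.exp (2 * h * (c + 2 * b)) := by
    rw [parA, ← Complex.exp_neg, ← Complex.exp_nat_mul, ← Complex.exp_neg, ← Complex.exp_add,
      ← Complex.exp_nat_mul, ← Complex.exp_neg]
    congr 1
    push_cast
    ring
  rw [mulExt, hs, ← Complex.exp_int_mul, addExt, toSeq, toSeq, dif_pos (by omega),
    dif_pos (by omega), ← Complex.exp_add]
  congr 1
  ring

theorem isMulWheel_exp_iff (hn : 0 < n) (h : ℂ) (x : Fin n → ℂ) :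
    IsMulWheel n (Complex.exp (h * b)) (Complex.exp (h * c)) (fun i => Complex.exp (2 * h * x i)) ↔
      ∃ i j k : ℤ, i < j ∧ j < k ∧ k < i + n ∧
        Complex.exp (h * (2 * (addExt n (c + 2 * b) (toSeq x) j -
          (addExt n (c + 2 * b) (toSeq x) i + b)))) = 1 ∧
        Complex.exp (h * (2 * (addExt n (c + 2 * b) (toSeq x) k -
          (addExt n (c + 2 * b) (toSeq x) i + 2 * b)))) = 1 := by
  have key : ∀ w v : ℂ, Complex.exp w = Complex.exp v ↔ Complex.exp (w - v) = 1 := fun w v => by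
    rw [Complex.exp_sub, div_eq_one_iff_eq (Complex.exp_ne_zero _)]
  unfold IsMulWheel
  simp only [mulExt_exp hn]
  refine exists_congr fun i => exists_congr fun j => exists_congr fun k => ?_
  rw [← Complex.exp_nat_mul, ← Complex.exp_nat_mul, ← Complex.exp_add, ← Complex.exp_add, key, key]
  have e1 : ∀ w v : ℂ, 2 * h * w - ((2 : ℕ) * (h * b) + 2 * h * v) = h * (2 * (w - (v + b))) := by
    intro w v; push_cast; ring
  have e2 : ∀ w v : ℂ, 2 * h * w - ((4 : ℕ) * (h * b) + 2 * h * v) =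
      h * (2 * (w - (v + 2 * b))) := by
    intro w v; push_cast; ring
  rw [e1, e2]

/-- For small `h` the exponent is smaller than 1 in modulus, hence smaller than 2π, and the
exponential is 1 only at exponent 0; there `h ≠ 0` gives the claim. -/
theorem eventually_exp_mul_eq_one (w : ℂ) :
    ∀ᶠ h in 𝓝[≠] (0 : ℂ), Complex.exp (h * (2 * w)) = 1 → w = 0 := by
  have h1 : Tendsto (fun h : ℂ => h * (2 * w)) (𝓝[≠] 0) (𝓝 0) := by
    have : Tendsto (fun h : ℂ => h * (2 * w)) (𝓝 0) (𝓝 (0 * (2 * w))) :=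
      (continuous_id.mul continuous_const).tendsto 0
    rw [zero_mul] at this
    exact this.mono_left nhdsWithin_le_nhds
  have h2 : ∀ᶠ h in 𝓝[≠] (0 : ℂ), ‖h * (2 * w)‖ < 1 := by
    have := h1.eventually (Metric.ball_mem_nhds (0 : ℂ) one_pos)
    filter_upwards [this] with h hh
    simpa using hh
  filter_upwards [h2, self_mem_nhdsWithin] with h hh h0 he
  obtain ⟨k, hk⟩ := Complex.exp_eq_one_iff.1 he
  rcases eq_or_ne k 0 with rfl | hk0
  · rw [Int.cast_zero, zero_mul] at hk
    rcases mul_eq_zero.1 hk with e | e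
    · exact absurd e h0
    · simpa using e
  · exfalso
    rw [hk, norm_mul] at hh
    have h3 : ‖(2 * Real.pi * Complex.I : ℂ)‖ = 2 * Real.pi := by
      simp [abs_of_pos Real.pi_pos]
    have h4 : (1 : ℝ) ≤ ‖(k : ℂ)‖ := by
      rw [Complex.norm_intCast]
      exact_mod_cast Int.one_le_abs hk0
    rw [h3] at hh
    nlinarith [Real.pi_gt_three]

/-- The indices of a multiplicative wheel may depend on `h`. Up to a shift by periods there are only
finitely many candidates, so a single small `h` excludes all accidental coincidences at once. -/
theorem isAddWheel_iff_eventually (hn : 0 < n) (x : Fin n → ℂ) :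
    IsAddWheel n b c x ↔ ∀ᶠ h in 𝓝[≠] (0 : ℂ),
      IsMulWheel n (Complex.exp (h * b)) (Complex.exp (h * c))
        fun i => Complex.exp (2 * h * x i) := by
  have hN : (0 : ℤ) < n := by exact_mod_cast hn
  constructor
  · rintro ⟨i, j, k, hij, hjk, hki, h1, h2⟩
    refine Eventually.of_forall fun h => (isMulWheel_exp_iff hn h x).2
      ⟨i, j, k, hij, hjk, hki, ?_, ?_⟩
    · rw [h1]; simp
    · rw [h2]; simp
  · intro H
    have h1 : ∀ᶠ h in 𝓝[≠] (0 : ℂ), ∀ e ∈ Finset.Icc (0 : ℤ) (2 * n) ×ˢ Finset.Icc (0 : ℤ) (2 * n),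
        (Complex.exp (h * (2 * (addExt n (c + 2 * b) (toSeq x) e.2 -
          (addExt n (c + 2 * b) (toSeq x) e.1 + b)))) = 1 →
          addExt n (c + 2 * b) (toSeq x) e.2 - (addExt n (c + 2 * b) (toSeq x) e.1 + b) = 0) ∧
        (Complex.exp (h * (2 * (addExt n (c + 2 * b) (toSeq x) e.2 -
          (addExt n (c + 2 * b) (toSeq x) e.1 + 2 * b)))) = 1 →
          addExt n (c + 2 * b) (toSeq x) e.2 -
            (addExt n (c + 2 * b) (toSeq x) e.1 + 2 * b) = 0) := by
      rw [Filter.eventually_all_finset]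
      exact fun e _ => (eventually_exp_mul_eq_one _).and (eventually_exp_mul_eq_one _)
    obtain ⟨h, hh, hw⟩ := (h1.and H).exists
    obtain ⟨i, j, k, hij, hjk, hki, e1, e2⟩ := (isMulWheel_exp_iff hn h x).1 hw
    have m1 := Int.emod_nonneg i hN.ne'
    have m2 := Int.emod_lt_of_pos i hN
    have m3 := Int.emod_add_mul_ediv i n
    have m4 : (n : ℤ) * (-(i / n)) = -(n * (i / n)) := by ring
    have hs : ∀ p t : ℤ, addExt n (c + 2 * b) (toSeq x) t =
        addExt n (c + 2 * b) (toSeq x) (t + n * p) - p * (c + 2 * b) := fun p t => by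
      rw [addExt_add_mul hn]; ring
    -- A shift by whole periods puts `i` into the first period and all three indices into the finite
    -- range considered; both sides of each equation change by the same constant.
    refine ⟨i + n * (-(i / n)), j + n * (-(i / n)), k + n * (-(i / n)), by omega, by omega,
      by omega, ?_, ?_⟩
    · rw [← sub_eq_zero]
      refine (hh (_, _) (Finset.mem_product.2 ⟨Finset.mem_Icc.2 ?_, Finset.mem_Icc.2 ?_⟩)).1 ?_
      · dsimp only; omega
      · dsimp only; omega
      · rw [hs (-(i / n)) i, hs (-(i / n)) j] at e1
        rw [← e1]
        ring_nf
    · rw [← sub_eq_zero]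
      refine (hh (_, _) (Finset.mem_product.2 ⟨Finset.mem_Icc.2 ?_, Finset.mem_Icc.2 ?_⟩)).2 ?_
      · dsimp only; omega
      · dsimp only; omega
      · rw [hs (-(i / n)) i, hs (-(i / n)) k] at e2
        rw [← e2]
        ring_nf

theorem propP'_of_tendsto (hn : 0 < n) (ψ : ℂ → MvPolynomial (Fin n) ℂ) (g : ℂ → ℂ)
    (φ : MvPolynomial (Fin n) ℂ)
    (hP : ∀ᶠ h in 𝓝[≠] (0 : ℂ), PropP n (Complex.exp (h * b)) (Complex.exp (h * c)) (ψ h))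
    (hl : ∀ x : Fin n → ℂ,
      Tendsto (fun h => g h * eval (fun i => Complex.exp (2 * h * x i)) (ψ h))
        (𝓝[≠] 0) (𝓝 (eval x φ))) : PropP' n b c φ := by
  intro x hx
  refine tendsto_nhds_unique (hl x) (tendsto_const_nhds.congr' ?_)
  filter_upwards [hP, (isAddWheel_iff_eventually hn x).1 hx] with h h1 h2
  rw [h1 _ h2, mul_zero]

theorem propP'_iff (hn : 0 < n) (f : MvPolynomial (Fin n) ℂ) : PropP' n b c f ↔ PV b c f :=
  forall_congr' fun x => by rw [isAddWheel_iff hn]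

end Wheels

theorem totalDegree_lt_of_homogeneousComponent_eq_zero {σ : Type*} {f : MvPolynomial σ ℂ} {n : ℕ}
    (hd : f.totalDegree ≤ n) (h : homogeneousComponent n f = 0) (hf : f ≠ 0) :
    f.totalDegree < n := by
  refine lt_of_le_of_ne hd fun e => ?_
  obtain ⟨d, hd, hd'⟩ := Finset.exists_mem_eq_sup f.support
    (Finset.nonempty_of_ne_empty (by simpa using hf)) fun s => s.sum fun _ e => e
  have h1 : coeff d (homogeneousComponent n f) = coeff d f := by
    rw [coeff_homogeneousComponent, if_pos]
    rw [← e, totalDegree, hd']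
    rfl
  rw [h, coeff_zero] at h1
  exact mem_support_iff.1 hd h1.symm

/-! ### The decomposition of the space of minimal degree. -/

section Decomposition
variable {m : ℕ} {b c : ℂ} {i : Fin (2 * m - 1)}

theorem cP_eq_bP : (cP : ℂ → Fin (2 * m - 1) → Poly m) = bP := rfl

theorem dl_eq_dP (i : Fin (2 * m - 1)) : (dl (N := 2 * m) i : Poly m) = dP i := by
  rw [dl, lin, C_0, add_zero]; rfl

theorem swapPoly_bP (b : ℂ) (i : Fin (2 * m - 1)) : swapPoly i (bP b i) = bP' b i := by
  rw [bP, map_add, swapPoly_dP, swapPoly_C, bP']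

theorem swapPoly_cP (b : ℂ) (i : Fin (2 * m - 1)) : swapPoly i (cP b i) = bP' b i :=
  swapPoly_bP b i

theorem exists_sub_swapPoly_eq (i : Fin (2 * m - 1)) (f : Poly m) :
    ∃ d, f - swapPoly i f = dP i * d ∧ swapPoly i d = d := by
  obtain ⟨d, hd⟩ := dl_dvd_sub_sw (N := 2 * m) i f
  rw [← swapPoly_eq_sw, dl_eq_dP] at hd
  refine ⟨d, hd, ?_⟩
  have h := congrArg (swapPoly i) hd
  rw [map_sub, swapPoly_swapPoly, map_mul, swapPoly_dP] at h
  apply mul_left_cancel₀ (dP_ne_zero i)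
  linear_combination h + hd

theorem isLeast_degrees (hm : 0 < m) (hc : c ≠ 0) (hbc : b ≠ c) :
    IsLeast (degrees (2 * m) b c) (2 * m * (m - 1)) := by
  rw [← minDeg_even]
  have h1 : ∀ f : Poly m, PropP' (2 * m) b c f → f ≠ 0 → minDeg (2 * m) ≤ f.totalDegree :=
    fun f h h0 => minDeg_le hbc hc f h0 ((propP'_iff (by omega) f).1 h)
  constructor
  · have h2 := (propP'_iff (by omega) _).2 (dualPoly_pv (b := b) hc (Pattern.rho m))
    exact ⟨_, h2, dualPoly_ne_zero _,
      le_antisymm (totalDegree_dualPoly_le _) (h1 _ h2 (dualPoly_ne_zero _))⟩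
  · rintro d ⟨f, hf, h0, rfl⟩
    exact h1 f hf h0

theorem mem_spaceM_iff (hm : 0 < m) (hc : c ≠ 0) (hbc : b ≠ c) (f : Poly m) :
    f ∈ spaceM (2 * m) b c ↔ PV b c f ∧ f.totalDegree ≤ minDeg (2 * m) := by
  change PropP' (2 * m) b c f ∧ f.totalDegree ≤ sInf (degrees (2 * m) b c) ↔ _
  rw [(isLeast_degrees hm hc hbc).csInf_eq, propP'_iff (by omega), minDeg_even]

theorem span_dualPoly (hm : 0 < m) (hc : c ≠ 0) (hbc : b ≠ c) :
    Submodule.span ℂ (Set.range (dualPoly (m := m) b c)) = spaceM (2 * m) b c := by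
  apply le_antisymm
  · rw [Submodule.span_le]
    rintro _ ⟨π, rfl⟩
    exact (mem_spaceM_iff hm hc hbc _).2 ⟨dualPoly_pv hc π, totalDegree_dualPoly_le π⟩
  · intro f hf
    obtain ⟨h1, h2⟩ := (mem_spaceM_iff hm hc hbc f).1 hf
    exact mem_span_dualPoly hbc hc f h1 h2

/-- The decomposition of the elements divisible by `b_{i i+1}`. -/
theorem exists_decomposition_of_dvd (hm : 0 < m) (hc : c ≠ 0) (hbc : b ≠ c) {f : Poly m}
    (hf : f ∈ spaceM (2 * m) b c) (hd : bP b i ∣ f) :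
    (∃ S₁ S₂ : Poly m, swapPoly i S₁ = S₁ ∧ swapPoly i S₂ = S₂ ∧
      bP b i * S₁ ∈ spaceM (2 * m) b c ∧ bP b i * (cP c i * S₂) ∈ spaceM (2 * m) b c ∧
      f = bP b i * (S₁ + cP c i * S₂)) ∧
    ∃ χ ∈ spaceM (2 * m) b c, bP b i ∣ χ ∧ tBar b c i (toRat f) = toRat χ := by
  obtain ⟨f', s⟩ := Step.exists_of_dvd (N := 2 * m) c hd
  have hf' : f' ∈ spaceM (2 * m) b c := by
    rw [mem_spaceM_iff hm hc hbc] at hf ⊢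
    exact ⟨s.pv hf.1 hc, s.totalDegree_le.trans hf.2⟩
  refine ⟨?_, f', hf', s.dvd_right, s.tBar_eq⟩
  obtain ⟨g, g', e1, e2, e3⟩ := s
  rw [← bP_eq_lin] at e1 e2
  rw [← swapPoly_eq_sw, dl_eq_dP] at e3
  obtain ⟨d, hd1, hd2⟩ := exists_sub_swapPoly_eq i g
  have hC : (C (1 / 2) : Poly m) * 2 = 1 := by
    have h2 : (C 2 : Poly m) = 2 := map_ofNat C 2
    rw [← h2, ← C_mul]; norm_num
  -- Half the sum and half the difference of `f` and its image under t̄_i are the two eigenparts;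
  -- the cofactors `d` and `g - g'` turn out to be symmetric.
  have h1 : g + g' = cP c i * d := by
    apply mul_left_cancel₀ (dP_ne_zero i)
    rw [cP]
    linear_combination e3 + (dP i + C c) * hd1
  have h2 : swapPoly i (g - g') = g - g' := by
    have h3 : g' = cP c i * d - g := by linear_combination h1
    rw [h3]
    simp only [map_sub, map_mul, swapPoly_cP, hd2]
    rw [cP, bP']
    linear_combination -2 * hd1
  refine ⟨C (1 / 2) * (g - g'), C (1 / 2) * d, ?_, ?_, ?_, ?_, ?_⟩
  · rw [map_mul, swapPoly_C, h2]
  · rw [map_mul, swapPoly_C, hd2]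
  · have : bP b i * (C (1 / 2) * (g - g')) = (1 / 2 : ℂ) • (f - f') := by
      rw [smul_eq_C_mul, e1, e2]; ring
    rw [this]
    exact Submodule.smul_mem _ _ (Submodule.sub_mem _ hf hf')
  · have : bP b i * (cP c i * (C (1 / 2) * d)) = (1 / 2 : ℂ) • (f + f') := by
      rw [smul_eq_C_mul, e1, e2]
      linear_combination -C (1 / 2) * bP b i * h1
    rw [this]
    exact Submodule.smul_mem _ _ (Submodule.add_mem _ hf hf')
  · rw [e1]
    linear_combination bP b i * C (1 / 2) * h1 - bP b i * g * hC

/-- The decomposition of the elements with a symmetric top part. -/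
theorem exists_decomposition_of_top (hm : 0 < m) (hc : c ≠ 0) (hbc : b ≠ c) (hb : b + c ≠ 0)
    {f : Poly m} (hf : f ∈ spaceM (2 * m) b c)
    (hs : swapPoly i (homogeneousComponent (minDeg (2 * m)) f) =
      homogeneousComponent (minDeg (2 * m)) f) :
    ∃ S₀ S₂ : Poly m, swapPoly i S₀ = S₀ ∧ swapPoly i S₂ = S₂ ∧
      S₀ ∈ spaceM (2 * m) b c ∧ bP b i * (cP c i * S₂) ∈ spaceM (2 * m) b c ∧
      f = S₀ + bP b i * (cP c i * S₂) := by
  obtain ⟨d, hd1, hd2⟩ := exists_sub_swapPoly_eq i f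
  have hf' := (mem_spaceM_iff hm hc hbc f).1 hf
  -- The product of the factors `u_i - u_{i+1} + b` and `u_i - u_{i+1} + c`, minus its exchange, is
  -- `2 (b + c) (u_i - u_{i+1})`; this determines the constant in `S₂`.
  have hC : (C (1 / (2 * (b + c))) : Poly m) * (2 * (C b + C c)) = 1 := by
    have h2 : (C 2 : Poly m) = 2 := map_ofNat C 2
    rw [← h2, ← C_add, ← C_mul, ← C_mul, one_div, inv_mul_cancel₀ (mul_ne_zero two_ne_zero hb),
      C_1]
  -- The top parts of `f` and of its exchange cancel, so `d` has degree at least two below the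
  -- minimal degree when it is nonzero, which leaves room for two linear factors.
  have hM : bP b i * (cP c i * d) ∈ spaceM (2 * m) b c := by
    rw [mem_spaceM_iff hm hc hbc]
    constructor
    -- The vanishing property is obtained from one degree higher: the polynomial in question is the
    -- sum of b_{i i+1} f and its image under t̄_i.
    · have hpv : PV b c (bP b i * f) := fun x hx => by rw [map_mul, hf'.1 x hx, mul_zero]
      obtain ⟨f', s⟩ := Step.exists_of_dvd (N := 2 * m) c (Dvd.intro f rfl : bP b i ∣ bP b i * f)
      have hpv' := s.pv hpv hc
      obtain ⟨g, g', e1, rfl, e3⟩ := s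
      rw [← bP_eq_lin] at e1
      rw [← bP_eq_lin] at hpv'
      obtain rfl := mul_left_cancel₀ (bP_ne_zero b i) e1
      rw [← swapPoly_eq_sw, dl_eq_dP] at e3
      have h1 : f + g' = cP c i * d := by
        apply mul_left_cancel₀ (dP_ne_zero i)
        rw [cP]
        linear_combination e3 + (dP i + C c) * hd1
      intro x hx
      rw [← h1, mul_add, map_add, hpv x hx, hpv' x hx, add_zero]
    · rcases eq_or_ne d 0 with rfl | hd0
      · simp
      have h1 : (f - swapPoly i f).totalDegree < minDeg (2 * m) := by
        apply totalDegree_lt_of_homogeneousComponent_eq_zero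
        · exact (totalDegree_sub _ _).trans (max_le hf'.2 ((totalDegree_rename_le _ _).trans hf'.2))
        · rw [map_sub, swapPoly_eq_sw, homogeneousComponent_sw, ← swapPoly_eq_sw, hs, sub_self]
        · rw [hd1]; exact mul_ne_zero (dP_ne_zero i) hd0
      rw [hd1, ← dl_eq_dP, totalDegree_lin_mul (lp_ne_rp _) 0 hd0] at h1
      rw [cP_eq_bP, bP_eq_lin, bP_eq_lin,
        totalDegree_lin_mul (lp_ne_rp _) _ (mul_ne_zero (lin_ne_zero (lp_ne_rp _) _) hd0),
        totalDegree_lin_mul (lp_ne_rp _) _ hd0]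
      omega
  have hM' : bP b i * (cP c i * (C (1 / (2 * (b + c))) * d)) ∈ spaceM (2 * m) b c := by
    have : bP b i * (cP c i * (C (1 / (2 * (b + c))) * d)) =
        (1 / (2 * (b + c))) • (bP b i * (cP c i * d)) := by
      rw [smul_eq_C_mul]; ring
    rw [this]
    exact Submodule.smul_mem _ _ hM
  refine ⟨f - bP b i * (cP c i * (C (1 / (2 * (b + c))) * d)), C (1 / (2 * (b + c))) * d, ?_, ?_,
    Submodule.sub_mem _ hf hM', hM', by ring⟩
  · simp only [map_sub, map_mul, swapPoly_C, hd2, swapPoly_cP, swapPoly_bP]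
    rw [bP, cP, bP', bP']
    linear_combination -hd1 + dP i * d * hC
  · rw [map_mul, swapPoly_C, hd2]

theorem exists_decomposition_dualPoly (hm : 0 < m) (hc : c ≠ 0) (hbc : b ≠ c) (hb : b + c ≠ 0)
    {π : Pattern m} (hπ : π.1 (lo i) = hi i) :
    ∃ S₀ S₂ : Poly m, swapPoly i S₀ = S₀ ∧ swapPoly i S₂ = S₂ ∧
      S₀ ∈ spaceM (2 * m) b c ∧ bP b i * (cP c i * S₂) ∈ spaceM (2 * m) b c ∧
      dualPoly b c π = S₀ + bP b i * (cP c i * S₂) := by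
  refine exists_decomposition_of_top hm hc hbc hb ?_ ?_
  · exact (mem_spaceM_iff hm hc hbc _).2 ⟨dualPoly_pv hc π, totalDegree_dualPoly_le π⟩
  · rw [minDeg_even]; exact swapPoly_topPart hπ

/-- By linearity only dual polynomials matter: either the two points are unlinked and b_{i i+1}
divides, or they are linked and the top part is symmetric. -/
theorem exists_decomposition (hm : 0 < m) (hc : c ≠ 0) (hbc : b ≠ c) (hb : b + c ≠ 0)
    (i : Fin (2 * m - 1)) {f : Poly m} (hf : f ∈ spaceM (2 * m) b c) :
    ∃ S₀ S₁ S₂ : Poly m, (swapPoly i S₀ = S₀ ∧ swapPoly i S₁ = S₁ ∧ swapPoly i S₂ = S₂) ∧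
      (S₀ ∈ spaceM (2 * m) b c ∧ bP b i * S₁ ∈ spaceM (2 * m) b c ∧
        bP b i * (cP c i * S₂) ∈ spaceM (2 * m) b c) ∧
      f = S₀ + bP b i * (S₁ + cP c i * S₂) := by
  rw [← span_dualPoly hm hc hbc] at hf
  induction hf using Submodule.span_induction with
  | mem f hf =>
    obtain ⟨π, rfl⟩ := hf
    by_cases hπ : π.1 (lo i) = hi i
    · obtain ⟨S₀, S₂, h1, h2, h3, h4, h5⟩ := exists_decomposition_dualPoly hm hc hbc hb hπ
      exact ⟨S₀, 0, S₂, ⟨h1, map_zero _, h2⟩, ⟨h3, by simp, h4⟩, by rw [h5, zero_add]⟩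
    · obtain ⟨⟨S₁, S₂, h1, h2, h3, h4, h5⟩, _⟩ := exists_decomposition_of_dvd hm hc hbc
        ((mem_spaceM_iff hm hc hbc _).2 ⟨dualPoly_pv hc π, totalDegree_dualPoly_le π⟩)
        (bP_dvd_dualPoly (by rwa [ne_eq, ← π.linked_iff i]))
      exact ⟨0, S₁, S₂, ⟨map_zero _, h1, h2⟩, ⟨Submodule.zero_mem _, h3, h4⟩, by rw [h5, zero_add]⟩
  | zero => exact ⟨0, 0, 0, by simp, by simp, by simp⟩
  | add f g _ _ hf hg =>
    obtain ⟨S₀, S₁, S₂, ⟨h1, h2, h3⟩, ⟨h4, h5, h6⟩, rfl⟩ := hf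
    obtain ⟨T₀, T₁, T₂, ⟨k1, k2, k3⟩, ⟨k4, k5, k6⟩, rfl⟩ := hg
    refine ⟨S₀ + T₀, S₁ + T₁, S₂ + T₂, by simp [*], ⟨Submodule.add_mem _ h4 k4, ?_, ?_⟩, by ring⟩
    · rw [mul_add]; exact Submodule.add_mem _ h5 k5
    · rw [mul_add, mul_add]; exact Submodule.add_mem _ h6 k6
  | smul r f _ hf =>
    obtain ⟨S₀, S₁, S₂, ⟨h1, h2, h3⟩, ⟨h4, h5, h6⟩, rfl⟩ := hf
    refine ⟨r • S₀, r • S₁, r • S₂, by simp [*], ⟨Submodule.smul_mem _ r h4, ?_, ?_⟩, ?_⟩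
    · rw [mul_smul_comm]; exact Submodule.smul_mem _ r h5
    · rw [mul_smul_comm, mul_smul_comm]; exact Submodule.smul_mem _ r h6
    · simp only [smul_eq_C_mul]; ring

/-- A symmetric `S₀` divisible by b_{i i+1} is also divisible by b_{i+1 i}, which is coprime to it
as `b ≠ 0`. Comparing the relation with its exchange leaves the single possibility `S₁ = -(b + c)
S₂`, and this is excluded by the degree. -/
theorem eq_zero_of_decomposition (hm : 0 < m) (hc : c ≠ 0) (hb0 : b ≠ 0) (hbc : b ≠ c)
    (hb : b + c ≠ 0) {S₀ S₁ S₂ : Poly m} (h0 : swapPoly i S₀ = S₀) (h1 : swapPoly i S₁ = S₁)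
    (h2 : swapPoly i S₂ = S₂) (hM : bP b i * S₁ ∈ spaceM (2 * m) b c)
    (hM' : bP b i * (cP c i * S₂) ∈ spaceM (2 * m) b c)
    (he : S₀ + bP b i * (S₁ + cP c i * S₂) = 0) : S₀ = 0 ∧ S₁ = 0 ∧ S₂ = 0 := by
  have d1 : bP b i ∣ S₀ := ⟨-(S₁ + cP c i * S₂), by linear_combination he⟩
  have d2 : bP' b i ∣ S₀ := by
    have := map_dvd (swapPoly i) d1
    rwa [swapPoly_bP, h0] at this
  have hrel : IsRelPrime (bP b i) (bP' b i) := by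
    rw [bP_eq_lin, bP'_eq_lin]
    refine lin_isRelPrime (lp_ne_rp _) (fun k => if k = lp (N := 2 * m) i then -b else 0) ?_ ?_
    · rw [if_pos rfl, if_neg (lp_ne_rp _).symm]; ring
    · rw [if_pos rfl, if_neg (lp_ne_rp _).symm]
      intro h
      apply hb0
      linear_combination h / 2
  obtain ⟨T, hT⟩ := hrel.mul_dvd d1 d2
  have e1 : bP' b i * T + S₁ + cP c i * S₂ = 0 := by
    apply mul_left_cancel₀ (bP_ne_zero b i)
    linear_combination he - hT
  have hTs : swapPoly i T = T := by
    apply mul_left_cancel₀ (mul_ne_zero (bP_ne_zero b i) (bP'_ne_zero b i))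
    have := congrArg (swapPoly i) hT
    rw [h0, map_mul, map_mul, swapPoly_bP, ← swapPoly_bP, swapPoly_swapPoly, swapPoly_bP] at this
    linear_combination hT - this
  have e2 := congrArg (swapPoly i) e1
  rw [map_add, map_add, map_mul, map_mul, ← swapPoly_bP, swapPoly_swapPoly, hTs, h1, h2,
    swapPoly_cP, map_zero] at e2
  have e3 : S₂ = T := by
    apply mul_left_cancel₀ (mul_ne_zero two_ne_zero (dP_ne_zero i))
    rw [bP', cP] at e1
    rw [bP, bP'] at e2
    linear_combination e1 - e2
  subst e3
  have e4 : S₁ = -(C b + C c) * S₂ := by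
    rw [bP', cP] at e1
    linear_combination e1
  -- Otherwise b_{i i+1} S₂, a multiple of b_{i i+1} S₁ because `b + c ≠ 0`, would have the
  -- vanishing property in a degree below the minimum.
  have hS : S₂ = 0 := by
    by_contra hS
    have h3 : bP b i * S₂ ∈ spaceM (2 * m) b c := by
      have : bP b i * S₂ = (-(b + c))⁻¹ • (bP b i * S₁) := by
        rw [eq_inv_smul_iff₀ (neg_ne_zero.2 hb), smul_eq_C_mul, e4, C_neg, C_add]
        ring
      rw [this]
      exact Submodule.smul_mem _ _ hM
    have h4 := minDeg_le hbc hc _ (mul_ne_zero (bP_ne_zero b i) hS)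
      ((mem_spaceM_iff hm hc hbc _).1 h3).1
    have h5 := ((mem_spaceM_iff hm hc hbc _).1 hM').2
    rw [bP_eq_lin, totalDegree_lin_mul (lp_ne_rp _) _ hS] at h4
    rw [cP_eq_bP, bP_eq_lin, bP_eq_lin,
      totalDegree_lin_mul (lp_ne_rp _) _ (mul_ne_zero (lin_ne_zero (lp_ne_rp _) _) hS),
      totalDegree_lin_mul (lp_ne_rp _) _ hS] at h5
    omega
  subst hS
  refine ⟨by rw [hT, mul_zero], by rw [e4, mul_zero], rfl⟩

theorem existsUnique_decomposition (hm : 0 < m) (hc : c ≠ 0) (hb0 : b ≠ 0) (hbc : b ≠ c)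
    (hb : b + c ≠ 0) (i : Fin (2 * m - 1)) {f : Poly m} (hf : f ∈ spaceM (2 * m) b c) :
    ∃! S : Poly m × Poly m × Poly m,
      (swapPoly i S.1 = S.1 ∧ swapPoly i S.2.1 = S.2.1 ∧ swapPoly i S.2.2 = S.2.2) ∧
      (S.1 ∈ spaceM (2 * m) b c ∧ bP b i * S.2.1 ∈ spaceM (2 * m) b c ∧
        bP b i * (cP c i * S.2.2) ∈ spaceM (2 * m) b c) ∧
      f = S.1 + bP b i * (S.2.1 + cP c i * S.2.2) := by
  obtain ⟨S₀, S₁, S₂, ⟨h1, h2, h3⟩, ⟨h4, h5, h6⟩, e⟩ := exists_decomposition hm hc hbc hb i hf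
  refine ⟨(S₀, S₁, S₂), ⟨⟨h1, h2, h3⟩, ⟨h4, h5, h6⟩, e⟩, ?_⟩
  rintro ⟨T₀, T₁, T₂⟩ ⟨⟨k1, k2, k3⟩, ⟨k4, k5, k6⟩, e'⟩
  dsimp only at k1 k2 k3 k4 k5 k6 e'
  obtain ⟨z0, z1, z2⟩ := eq_zero_of_decomposition (S₀ := T₀ - S₀) (S₁ := T₁ - S₁)
    (S₂ := T₂ - S₂) hm hc hb0 hbc hb (by rw [map_sub, k1, h1]) (by rw [map_sub, k2, h2])
    (by rw [map_sub, k3, h3]) (by rw [mul_sub]; exact Submodule.sub_mem _ k5 h5)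
    (by rw [mul_sub, mul_sub]; exact Submodule.sub_mem _ k6 h6)
    (by linear_combination e - e')
  rw [sub_eq_zero.1 z0, sub_eq_zero.1 z1, sub_eq_zero.1 z2]

end Decomposition

/-! ### The operators t̄_i ± 1, ē_i and τ - ē_i as multiples of projectors. -/

section Projectors
variable {m : ℕ} {b c τ : ℂ} {i : Fin (2 * m - 1)}

theorem eBar_eq (f : RatFun m) : eBar b c i f = cR m c⁻¹ *
    (f * ((-dR i + cR m b) * (-dR i + cR m c) / -dR i) +
      swapRat i f * ((dR i + cR m b) * (dR i + cR m c) / dR i)) := by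
  unfold eBar
  rw [smul_eq_cR_mul, toRat_bP', toRat_cP', toRat, map_neg]
  simp only [map_mul, map_div₀, map_add, map_neg, swapRat_dR, swapRat_cR, neg_neg]
  ring

theorem eBarCompl_eq (f : RatFun m) : eBarCompl b c i f = cR m c⁻¹ *
    ((f - swapRat i f) * ((dR i + cR m b) * (dR i + cR m c) / dR i)) := by
  unfold eBarCompl
  rw [smul_eq_cR_mul, toRat_bP, toRat_cP]
  ring

theorem tPlus_eq (f : RatFun m) : tPlus b c i f = tBar b c i f + f := by
  rw [tBar, sub_add_cancel]

/-- `tPlus` and `tMinus` are defined by separate formulas; this shows that both belong to the same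
operator t̄_i. -/
theorem tPlus_sub_tMinus (f : RatFun m) : tPlus b c i f - tMinus b c i f = 2 * f := by
  rw [tPlus_eq, tBar_eq, tMinus, toRat_bP, toRat_cP', toRat, map_neg]
  simp only [map_mul, map_div₀, map_add, map_neg, swapRat_dR, swapRat_cR, neg_neg]
  have h1 := dR_ne_zero i
  have h2 := dR_add_ne_zero b i
  have h3 := neg_dR_add_ne_zero b i
  field_simp
  ring

theorem cR_tau (hc : c ≠ 0) (hτ : τ = 2 * (1 + b / c)) :
    cR m τ = cR m c⁻¹ * (2 * (cR m c + cR m b)) := by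
  have h2 : (cR m 2 : RatFun m) = 2 := by rw [cR, map_ofNat C 2]; exact map_ofNat _ 2
  rw [← h2, cR, cR, cR, cR, cR, ← map_add, ← map_mul, ← map_mul, ← C_add, ← C_mul, ← C_mul, hτ]
  congr 2
  field_simp

theorem swapRat_eBar (f : RatFun m) : swapRat i (eBar b c i f) = eBar b c i f := by
  rw [eBar_eq]
  simp only [map_mul, map_div₀, map_add, map_neg, swapRat_dR, swapRat_cR, neg_neg,
    swapRat_swapRat]
  ring

/-- The terms with the exchange cancel, and (d + b)(d + c)/d - (d - b)(d - c)/d = 2(b + c) is the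
origin of the value of τ. -/
theorem eBar_add_eBarCompl (hc : c ≠ 0) (hτ : τ = 2 * (1 + b / c)) (f : RatFun m) :
    eBar b c i f + eBarCompl b c i f = τ • f := by
  rw [eBar_eq, eBarCompl_eq, smul_eq_cR_mul, cR_tau hc hτ]
  have h1 := dR_ne_zero i
  field_simp
  ring

theorem eBarCompl_of_swap {f : RatFun m} (hf : swapRat i f = f) : eBarCompl b c i f = 0 := by
  rw [eBarCompl_eq, hf, sub_self, zero_mul, mul_zero]

theorem eBar_of_swap (hc : c ≠ 0) (hτ : τ = 2 * (1 + b / c)) {f : RatFun m}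
    (hf : swapRat i f = f) : eBar b c i f = τ • f := by
  rw [← eBar_add_eBarCompl hc hτ, eBarCompl_of_swap hf, add_zero]

theorem eBar_add (f g : RatFun m) : eBar b c i (f + g) = eBar b c i f + eBar b c i g := by
  rw [eBar_eq, eBar_eq, eBar_eq, map_add]; ring

theorem eBar_mul_of_swap {S : RatFun m} (hS : swapRat i S = S) :
    eBar b c i ((dR i + cR m b) * ((dR i + cR m c) * S)) = 0 := by
  rw [eBar_eq]
  simp only [map_mul, map_add, swapRat_dR, swapRat_cR, hS]
  have h1 := dR_ne_zero i
  field_simp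
  ring

theorem tBar_mul_add_of_swap {S₁ S₂ : RatFun m} (h1 : swapRat i S₁ = S₁) (h2 : swapRat i S₂ = S₂) :
    tBar b c i ((dR i + cR m b) * (S₁ + (dR i + cR m c) * S₂)) =
      (dR i + cR m b) * (-S₁ + (dR i + cR m c) * S₂) := by
  rw [tBar_eq]
  simp only [map_mul, map_add, swapRat_dR, swapRat_cR, h1, h2]
  have h3 := dR_ne_zero i
  have h4 := neg_dR_add_ne_zero b i
  field_simp
  ring

theorem toRat_two : toRat (2 : Poly m) = 2 := map_ofNat _ 2

theorem projectors (hc : c ≠ 0) (hτ : τ = 2 * (1 + b / c)) (i : Fin (2 * m - 1)) :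
    (∀ f : RatFun m, tPlus b c i f - tMinus b c i f = 2 * f ∧ tBar b c i (tBar b c i f) = f) ∧
    (∀ S₁ S₂ : Poly m, swapPoly i S₁ = S₁ → swapPoly i S₂ = S₂ →
      tPlus b c i (toRat (bP b i * (S₁ + cP c i * S₂))) = toRat (2 * (bP b i * (cP c i * S₂))) ∧
      tMinus b c i (toRat (bP b i * (S₁ + cP c i * S₂))) = toRat (-2 * (bP b i * S₁))) ∧
    (∀ f : RatFun m, eBar b c i f + eBarCompl b c i f = τ • f ∧
      eBar b c i (eBar b c i f) = τ • eBar b c i f ∧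
      swapRat i (eBar b c i f) = eBar b c i f) ∧
    ∀ S₀ S₂ : Poly m, swapPoly i S₀ = S₀ → swapPoly i S₂ = S₂ →
      eBar b c i (toRat (S₀ + bP b i * (cP c i * S₂))) = toRat (τ • S₀) ∧
      eBarCompl b c i (toRat (S₀ + bP b i * (cP c i * S₂))) =
        toRat (τ • (bP b i * (cP c i * S₂))) := by
  have hsm : ∀ f : Poly m, toRat (τ • f) = τ • toRat f := fun f => by
    rw [smul_eq_C_mul, smul_eq_cR_mul, toRat_mul]
  refine ⟨fun f => ⟨tPlus_sub_tMinus f, tBar_tBar f⟩, fun S₁ S₂ h1 h2 => ?_,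
    fun f => ⟨eBar_add_eBarCompl hc hτ f, eBar_of_swap hc hτ (swapRat_eBar f), swapRat_eBar f⟩,
    fun S₀ S₂ h0 h2 => ?_⟩
  · have h1' : swapRat i (toRat S₁) = toRat S₁ := by rw [swapRat_toRat, h1]
    have h2' : swapRat i (toRat S₂) = toRat S₂ := by rw [swapRat_toRat, h2]
    have hf : toRat (bP b i * (S₁ + cP c i * S₂)) =
        (dR i + cR m b) * (toRat S₁ + (dR i + cR m c) * toRat S₂) := by
      rw [toRat_mul, toRat_add, toRat_mul, toRat_bP, toRat_cP]
    have hp : tPlus b c i (toRat (bP b i * (S₁ + cP c i * S₂))) =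
        2 * ((dR i + cR m b) * ((dR i + cR m c) * toRat S₂)) := by
      rw [tPlus_eq, hf, tBar_mul_add_of_swap h1' h2']; ring
    constructor
    · rw [hp, toRat_mul, toRat_mul, toRat_mul, toRat_bP, toRat_cP, toRat_two]
    · have := tPlus_sub_tMinus (b := b) (c := c) (i := i) (toRat (bP b i * (S₁ + cP c i * S₂)))
      rw [hp, hf] at this
      rw [hf, toRat_mul, toRat_mul, toRat_bP]
      have h3 : toRat (-2 : Poly m) = -2 := by rw [toRat, map_neg, ← toRat, toRat_two]
      rw [h3]
      linear_combination -this
  · have h0' : swapRat i (toRat S₀) = toRat S₀ := by rw [swapRat_toRat, h0]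
    have h2' : swapRat i (toRat S₂) = toRat S₂ := by rw [swapRat_toRat, h2]
    have hf : toRat (S₀ + bP b i * (cP c i * S₂)) =
        toRat S₀ + (dR i + cR m b) * ((dR i + cR m c) * toRat S₂) := by
      rw [toRat_add, toRat_mul, toRat_mul, toRat_bP, toRat_cP]
    have he : eBar b c i (toRat (S₀ + bP b i * (cP c i * S₂))) = toRat (τ • S₀) := by
      rw [hf, eBar_add, eBar_mul_of_swap h2', add_zero, eBar_of_swap hc hτ h0', hsm]
    refine ⟨he, ?_⟩
    have := eBar_add_eBarCompl (i := i) hc hτ (toRat (S₀ + bP b i * (cP c i * S₂)))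
    rw [he, ← hsm, smul_add, toRat_add (τ • S₀)] at this
    exact add_left_cancel this

end Projectors

/-! ### The action of `e_i` on patterns -/

namespace Pattern
variable {m : ℕ}

theorem conj_conj (g h : Equiv.Perm (Fin (2 * m))) (π : Pattern m) :
    (π.conj g).conj h = π.conj (h * g) := by
  apply Subtype.ext
  funext x
  simp only [conj, Equiv.Perm.coe_mul, Function.comp_apply]
  rfl

theorem conj_one (π : Pattern m) : π.conj 1 = π := rfl

theorem nv_conj_swap (π : Pattern m) (x y : Fin (2 * m)) {k : ℕ} (hk : k < 2 * m) :
    (π.conj (Equiv.swap x y)).nv k =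
      let s : ℕ → ℕ := fun k => if k = x then y else if k = y then x else k
      s (π.nv (s k)) := by
  have hs : ∀ z : Fin (2 * m), (Equiv.swap x y z).val =
      if z.val = x then y.val else if z.val = y then x.val else z.val := by
    intro z
    rw [Equiv.swap_apply_def]
    simp only [Fin.ext_iff]
    split_ifs <;> rfl
  rw [nv_of_lt _ hk]
  simp only [conj, Equiv.symm_swap]
  rw [hs, ← nv_fin, hs]

theorem nv_actE (π : Pattern m) (i : Fin (2 * m - 1)) {k : ℕ} (hk : k < 2 * m) :
    (π.actE i).nv k = if k = i then i.val + 1 else if k = i.val + 1 then i.val else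
      if k = π.nv i then π.nv (i + 1) else if k = π.nv (i + 1) then π.nv i else π.nv k := by
  have hil := i.2
  have e1 : π.nv i = (π.1 (lo i)).val := π.nv_fin (lo i)
  have h2 := π.nv_nv (i + 1)
  have h3 := π.nv_ne (k := i) (by omega)
  have h4 := π.nv_ne (k := i + 1) (by omega)
  rw [actE, nv_conj_swap _ _ _ hk, ← e1]
  simp only [show (hi i : Fin (2 * m)).val = i.val + 1 from rfl]
  rcases eq_or_ne k i with rfl | k1
  · rw [if_pos rfl, if_neg (show ¬ i.val = i + 1 by omega), if_neg h3.symm]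
    by_cases h : π.nv i = i + 1
    · rw [if_pos h, h]
    · rw [if_neg h, if_pos rfl]
  rcases eq_or_ne k (i + 1) with rfl | k2
  · rw [if_pos rfl, if_neg k1, if_pos rfl, nv_nv, if_neg (show ¬ i.val = i + 1 by omega),
      if_neg h3.symm]
  rw [if_neg k2, if_neg k1, if_neg k2]
  rcases eq_or_ne k (π.nv i) with rfl | k3
  · rw [if_pos rfl, if_pos rfl, if_neg h4, if_neg fun h => by have := π.nv_inj h; omega]
  rw [if_neg k3, if_neg k3]
  rcases eq_or_ne k (π.nv (i + 1)) with rfl | k4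
  · rw [if_pos rfl, nv_nv, if_pos rfl]
  rw [if_neg k4, if_neg fun h => k4 (by rw [← h, nv_nv]), if_neg fun h => k1 (π.nv_inj h)]

theorem actE_linked (π : Pattern m) (i : Fin (2 * m - 1)) : (π.actE i).nv i = i + 1 := by
  have := i.2
  rw [nv_actE _ _ (by omega), if_pos rfl]

theorem actE_of_linked (π : Pattern m) (i : Fin (2 * m - 1)) (h : π.nv i = i + 1) :
    π.actE i = π := by
  have := i.2
  have h' : π.nv (i + 1) = i := by rw [← h, nv_nv]
  apply ext_nv
  intro k hk
  rw [nv_actE _ _ hk, h, h']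
  split_ifs with h1 h2
  · rw [h1, h]
  · rw [h2, h']
  · rfl

/-- The two former partners become linked to each other, no matter which of the two points each of
them was linked to. -/
theorem actE_actT (π : Pattern m) (i : Fin (2 * m - 1)) : (π.actT i).actE i = π.actE i := by
  have hil := i.2
  apply ext_nv
  intro k hk
  rw [nv_actE _ _ hk, nv_actE _ _ hk, nv_actT _ _ (by omega), nv_actT _ _ (by omega),
    nv_actT _ _ hk, sN_left, sN_right]
  rcases eq_or_ne k i with rfl | k1
  · rw [if_pos rfl, if_pos rfl]
  rcases eq_or_ne k (i + 1) with rfl | k2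
  · rw [if_neg k1, if_neg k1, if_pos rfl, if_pos rfl]
  rw [if_neg k1, if_neg k1, if_neg k2, if_neg k2, sN_of_ne k1 k2]
  have h3 := π.nv_ne (k := i) (by omega)
  have h4 := π.nv_ne (k := i + 1) (by omega)
  have h5 : π.nv i = i + 1 ↔ π.nv (i + 1) = i :=
    ⟨fun h => by rw [← h, nv_nv], fun h => by have := π.nv_nv (i + 1); rwa [h] at this⟩
  have h6 : π.nv k = i ↔ k = π.nv i := ⟨fun h => by rw [← h, nv_nv], fun h => by rw [h, nv_nv]⟩
  have h7 : π.nv k = i + 1 ↔ k = π.nv (i + 1) :=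
    ⟨fun h => by rw [← h, nv_nv], fun h => by rw [h, nv_nv]⟩
  have h8 : π.nv i ≠ π.nv (i + 1) := fun h => by have := π.nv_inj h; omega
  unfold sN
  split_ifs <;> omega

/-- The patterns that `e_i` takes to `σ`, up to a factor. -/
theorem eq_conj_of_actE_eq {π σ : Pattern m} {i : Fin (2 * m - 1)} (h : π.actE i = σ) :
    π = σ.conj (Equiv.swap (hi i) (π.1 (lo i))) := by
  rw [← h, actE, conj_conj, Equiv.swap_mul_self, conj_one]

theorem conj_swap_lo {σ : Pattern m} {i : Fin (2 * m - 1)} (h : σ.nv i = i + 1)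
    {x : Fin (2 * m)} (hx : x ≠ lo i) : (σ.conj (Equiv.swap (hi i) x)).nv i = x := by
  have hil := i.2
  have hx' : x.val ≠ i := fun e => hx (Fin.ext e)
  rw [nv_conj_swap _ _ _ (by omega)]
  simp only [show (hi i : Fin (2 * m)).val = i.val + 1 from rfl]
  rw [if_neg (show ¬ i.val = i + 1 by omega), if_neg hx'.symm, h, if_pos rfl]

theorem actE_conj_swap {σ : Pattern m} {i : Fin (2 * m - 1)} (h : σ.nv i = i + 1)
    {x : Fin (2 * m)} (hx : x ≠ lo i) : (σ.conj (Equiv.swap (hi i) x)).actE i = σ := by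
  have h1 : (σ.conj (Equiv.swap (hi i) x)).1 (lo i) = x :=
    Fin.ext (((nv_fin _ (lo i)).symm.trans (conj_swap_lo h hx)))
  rw [actE, h1, conj_conj, Equiv.swap_mul_self, conj_one]

/-- The patterns over `σ` are indexed by the partner `x` of the left point: a link of `σ` is cut
open and its ends are attached to the two points. The exchange interchanges the two ends of the cut
link. -/
theorem actT_conj_swap {σ : Pattern m} {i : Fin (2 * m - 1)} (h : σ.nv i = i + 1)
    {x : Fin (2 * m)} (hx : x ≠ lo i) (hx' : x ≠ hi i) :
    (σ.conj (Equiv.swap (hi i) x)).actT i = σ.conj (Equiv.swap (hi i) (σ.1 x)) := by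
  have hil := i.2
  have h1 : ((σ.conj (Equiv.swap (hi i) x)).actT i).actE i = σ := by
    rw [actE_actT, actE_conj_swap h hx]
  have h3 : x.val ≠ i := fun e => hx (Fin.ext e)
  have h4 : x.val ≠ i + 1 := fun e => hx' (Fin.ext e)
  have h2 : ((σ.conj (Equiv.swap (hi i) x)).actT i).1 (lo i) = σ.1 x := by
    apply Fin.ext
    refine (nv_fin _ (lo i)).symm.trans ((nv_actT _ _ (by exact (lo i).2)).trans ?_)
    rw [show ((lo i : Fin (2 * m)).val) = i.val from rfl, sN_left,
      nv_conj_swap _ _ _ (by omega)]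
    simp only [show (hi i : Fin (2 * m)).val = i.val + 1 from rfl]
    have h5 := σ.nv_ne x.2
    have h7 : σ.nv x ≠ i := fun e => h4 (by rw [← h, ← e, nv_nv])
    have h8 : σ.nv x ≠ i + 1 := fun e => h3 (by
      have := σ.nv_nv x; rw [e, ← h, nv_nv] at this; exact this.symm)
    simp only [if_true]
    rw [if_neg h8, if_neg h5, sN_of_ne h7 h8, nv_fin]
  rw [eq_conj_of_actE_eq h1, h2]

end Pattern

/-! ### Lists of generators -/

section Lists
variable {m : ℕ} {b c : ℂ}

/-- The generators with indices `m - 1, …, p`. -/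
def descFrom (m p : ℕ) : List (Fin (2 * m - 1)) :=
  (List.finRange (2 * m - 1)).reverse.filter fun j => p ≤ j.val ∧ j.val < m

theorem descList_eq : descList m = descFrom m 1 := rfl

theorem mem_descFrom {p : ℕ} {j : Fin (2 * m - 1)} : j ∈ descFrom m p ↔ p ≤ j.val ∧ j.val < m := by
  simp [descFrom]

theorem pairwise_descFrom (m p : ℕ) : (descFrom m p).Pairwise (fun a b => b < a) :=
  (List.pairwise_reverse.2 (List.pairwise_lt_finRange _)).filter _

theorem nodup_descFrom (m p : ℕ) : (descFrom m p).Nodup :=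
  (pairwise_descFrom m p).imp fun h => h.ne'

theorem descFrom_self : descFrom m m = [] := by
  rw [descFrom, List.filter_eq_nil_iff]
  intro a _
  simp

theorem descFrom_eq_append {j : Fin (2 * m - 1)} (hj : j.val < m) :
    descFrom m j = descFrom m (j + 1) ++ [j] := by
  have h1 : (descFrom m (j + 1) ++ [j]).Pairwise (fun a b => b < a) := by
    rw [List.pairwise_append]
    refine ⟨pairwise_descFrom _ _, List.pairwise_singleton _ _, ?_⟩
    intro a ha b hb
    rw [List.mem_singleton] at hb
    rw [mem_descFrom] at ha
    rw [hb, Fin.lt_def]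
    omega
  refine List.Perm.eq_of_pairwise (le := fun a b => b < a)
    (fun a b _ _ h h' => absurd h (lt_asymm h')) (pairwise_descFrom _ _) h1
    ((List.perm_ext_iff_of_nodup (nodup_descFrom _ _) (h1.imp fun h => h.ne')).2 fun a => ?_)
  rw [List.mem_append, List.mem_singleton, mem_descFrom, mem_descFrom, Fin.ext_iff]
  omega

theorem sum_map_descFrom {A : Type*} [AddCommMonoid A] (f : ℕ → A) {p k : ℕ} (hp : p + k = m) :
    ((descFrom m p).map fun j => f j.val).sum = ∑ j ∈ Finset.Ico p m, f j := by
  induction k generalizing p with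
  | zero =>
    obtain rfl : p = m := hp
    simp [descFrom_self]
  | succ k ih =>
    have hp1 : p < 2 * m - 1 ∨ m = 1 ∧ p = 0 := by omega
    have hj : p < 2 * m - 1 := by omega
    have := descFrom_eq_append (m := m) (j := ⟨p, hj⟩) (by dsimp only; omega)
    dsimp only at this
    rw [this, List.map_append, List.sum_append, ih (by omega), ← Finset.sum_Ico_consecutive _
      (Nat.le_succ p) (by omega : p + 1 ≤ m), add_comm]
    simp

/-- The words in which one generator is omitted. -/
def omitWords (b c : ℂ) (l : List (Fin (2 * m - 1))) (f : RatFun m) : RatFun m :=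
  (l.map fun i => tWord b c (l.erase i) f).sum

theorem tWord_append (l : List (Fin (2 * m - 1))) (j : Fin (2 * m - 1)) (f : RatFun m) :
    tWord b c (l ++ [j]) f = tBar b c j (tWord b c l f) := by
  rw [tWord, List.foldl_append]; rfl

theorem tBar_list_sum (j : Fin (2 * m - 1)) (l : List (RatFun m)) :
    tBar b c j l.sum = (l.map (tBar b c j)).sum := by
  induction l with
  | nil => exact tBar_zero
  | cons a l ih => rw [List.sum_cons, tBar_add, ih, List.map_cons, List.sum_cons]

/-- A Leibniz rule: the omitted letter is the last one or an earlier one. -/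
theorem omitWords_append {l : List (Fin (2 * m - 1))} {j : Fin (2 * m - 1)} (hj : j ∉ l)
    (f : RatFun m) :
    omitWords b c (l ++ [j]) f = tBar b c j (omitWords b c l f) + tWord b c l f := by
  have h1 : ∀ i ∈ l, tWord b c ((l ++ [j]).erase i) f = tBar b c j (tWord b c (l.erase i) f) :=
    fun i hi => by rw [List.erase_append_left _ hi, tWord_append]
  rw [omitWords, List.map_append, List.sum_append, List.map_congr_left h1, omitWords,
    tBar_list_sum, List.map_map, List.map_singleton, List.sum_singleton,
    List.erase_append_right _ hj, List.erase_cons_head, List.append_nil]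
  rfl

/-- The points 1, …, m stay without mutual links under these exchanges, so every letter acts at an
unlinked pair and the rule for dual polynomials applies. -/
theorem tWord_eq_dualPoly {l : List (Fin (2 * m - 1))} {π : Pattern m} (hm : 2 ≤ m)
    (hπ : π.LinkFree 1 m) (hl : ∀ j ∈ l, 1 ≤ j.val ∧ j.val < m) :
    tWord b c l (toRat (dualPoly b c π)) =
      toRat (dualPoly b c (l.foldl (fun π i => π.actT i) π)) := by
  induction l generalizing π with
  | nil => rfl
  | cons j l ih =>
    have hj := hl j (by simp)
    rw [tWord, List.foldl_cons, ← tWord, List.foldl_cons,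
      (step_dualPoly (b := b) (c := c) (π := π) (j := j) ?_).tBar_eq]
    · refine ih (hπ.actT (by omega) (Or.inl ⟨hj.1, hj.2⟩)) fun k hk => hl k (by simp [hk])
    · intro h
      rcases hπ j hj.1 (by omega) with h' | h' <;> omega

namespace Pattern

theorem foldl_descFrom (hm : 0 < m) {p k : ℕ} (hp : p + k = m) (hp0 : 0 < p) :
    (descFrom m p).foldl (fun π i => π.actT i) (rho m) = hook m p hp0 (by omega) := by
  induction k generalizing p with
  | zero =>
    obtain rfl : p = m := hp
    rw [descFrom_self, hook_self]; rfl
  | succ k ih =>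
    have := descFrom_eq_append (m := m) (j := ⟨p, by omega⟩) (by dsimp only; omega)
    dsimp only at this
    rw [this, List.foldl_append, ih (by omega) (by omega)]
    exact actT_hook hp0 (by omega) rfl

/-- Omitting `t_j` is the same as applying it twice; the later letters conjugate the additional
transposition of `j` and `j + 1` into that of `q` and `j + 1`. -/
theorem foldl_descFrom_erase {j : Fin (2 * m - 1)} (hj : j.val < m) {q k : ℕ} (hq : q + k = j)
    (hq0 : 0 < q) :
    ((descFrom m q).erase j).foldl (fun π i => π.actT i) (rho m) =
      (hook m q hq0 (by omega)).conj (Equiv.swap ⟨q, by omega⟩ ⟨j + 1, by omega⟩) := by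
  induction k generalizing q with
  | zero =>
    obtain rfl : q = j := hq
    rw [descFrom_eq_append hj, List.erase_append_right _ fun h => by
      rw [mem_descFrom] at h; omega]
    rw [List.erase_cons_head, List.append_nil, foldl_descFrom (k := m - (j + 1)) (by omega)
      (by omega) (by omega), ← actT_hook hq0 (by omega) (j := j) rfl]
    exact (actT_actT _ j).symm
  | succ k ih =>
    have := descFrom_eq_append (m := m) (j := ⟨q, by omega⟩) (by dsimp only; omega)
    dsimp only at this
    rw [this, List.erase_append_left _ (by rw [mem_descFrom]; omega), List.foldl_append,
      ih (by omega) (by omega), ← actT_hook hq0 (by omega) (j := ⟨q, by omega⟩) rfl]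
    simp only [List.foldl_cons, List.foldl_nil, actT]
    rw [conj_conj, conj_conj]
    congr 1
    have h1 : (⟨j + 1, by omega⟩ : Fin (2 * m)) ≠ lo ⟨q, by omega⟩ := by
      simp only [lo, ne_eq, Fin.mk.injEq]; omega
    have h2 : (⟨j + 1, by omega⟩ : Fin (2 * m)) ≠ hi ⟨q, by omega⟩ := by
      simp only [hi, ne_eq, Fin.mk.injEq]; omega
    refine (Equiv.mul_swap_eq_swap_mul _ _ _).trans ?_
    rw [Equiv.swap_apply_of_ne_of_ne h1 h2]
    congr 2
    exact Equiv.swap_apply_right _ _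

end Pattern
end Lists

/-! ### The factorization of S_n and the duality relation. -/

section Duality
variable {m : ℕ} {b c : ℂ}

/-- The types of the pairs in the intermediate products between `ρ̄` and the factorized
polynomial; the points `0` and `p` are linked. -/
def hookType (m p : ℕ) (e : ℕ × ℕ) : ℕ :=
  if e.1 = 0 then (if e.2 = p then 0 else if e.2 ≤ m then 1 else 2) else
  if e.1 = p then (if e.2 < m + p then 1 else 2) else
  if e.2 = p then 1 else
  crossType (m - 1) (if e.1 < p then e.1 - 1 else e.1 - 2, if e.2 < p then e.2 - 1 else e.2 - 2)

/-- The intermediate products between `ρ̄` and the factorized polynomial. -/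
def hookProd (m : ℕ) (b c : ℂ) (p : ℕ) : Poly m :=
  ∏ e ∈ pairs (2 * m), pairFactor b c (uSeq m) (hookType m p e) e

theorem hookProd_self : hookProd m b c m = rhoBar m b c := by
  rw [hookProd, rhoBar_eq]
  refine Finset.prod_congr rfl ?_
  rintro ⟨i, j⟩ he
  rw [mem_pairs] at he
  dsimp only at he
  congr 1
  simp only [hookType, crossType]
  split_ifs <;> omega

theorem bExt_of_lt {i j : ℕ} (hi : i < 2 * m) (hj : j < 2 * m) :
    bExt m b c (uSeq m) i j = pairFactor b c (uSeq m) 1 (i, j) := by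
  rw [bExt, addExt_of_lt _ _ hi, addExt_of_lt _ _ hj]
  simp [pairFactor]

theorem bExt_add {i j : ℕ} (hi : i < 2 * m) (hj : j < 2 * m) :
    bExt m b c (uSeq m) j (i + (2 * m : ℕ)) = pairFactor b c (uSeq m) 2 (i, j) := by
  rw [bExt, addExt_of_lt _ _ hj, addExt_add _ _ hi]
  have : (C 2 : Poly m) = 2 := map_ofNat C 2
  simp only [pairFactor, OfNat.ofNat_ne_one, if_false, if_true, C_add, C_mul, this]
  ring

/-- With `p = 1` the first two points have no factor between them and equal types towards every
other point; the remaining pairs form the crossed product in two variables fewer. -/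
theorem hookProd_one (hm : 0 < m) : hookProd m b c 1 = factS m b c := by
  obtain ⟨m, rfl⟩ : ∃ k, m = k + 1 := ⟨m - 1, by omega⟩
  have hprod := prod_pairs_add_two (2 * m) 0 (by omega)
    (fun e => pairFactor b c (uSeq (m + 1)) (hookType (m + 1) 1 e) e)
  have h0 : pairFactor b c (uSeq (m + 1)) (hookType (m + 1) 1 (0, 0 + 1)) (0, 0 + 1) = 1 := by
    simp [pairFactor, hookType]
  have hlast : ∀ e ∈ pairs (2 * m), pairFactor b c (uSeq (m + 1))
      (hookType (m + 1) 1 (shiftAt 0 e.1 + 1, shiftAt 0 e.2 + 1))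
        (shiftAt 0 e.1 + 1, shiftAt 0 e.2 + 1) =
      pairFactor b c (fun k => uSeq (m + 1) (k + 2)) (crossType m e) e := by
    rintro ⟨i, j⟩ _
    simp [pairFactor, hookType, shiftAt]
  refine Eq.trans hprod ?_
  rw [h0, one_mul, Finset.prod_congr rfl hlast, factS, crossed_eq, mul_comm, mul_assoc]
  refine congrArg₂ (· * ·) rfl ?_
  have hIcc : Finset.Icc 2 (m + 1) = Finset.Ico 2 (m + 1 + 1) := by
    ext k; simp only [Finset.mem_Icc, Finset.mem_Ico]; omega
  have hmid : ∀ k ∈ Finset.range (2 * m), (pairFactor b c (uSeq (m + 1))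
      (hookType (m + 1) 1 (0, shiftAt 0 k + 1)) (0, shiftAt 0 k + 1) *
        if k < 0 then pairFactor b c (uSeq (m + 1)) (hookType (m + 1) 1 (k + 1, 0 + 1)) (k + 1, 0 + 1)
        else pairFactor b c (uSeq (m + 1)) (hookType (m + 1) 1 (0 + 1, k + 2)) (0 + 1, k + 2)) =
      (fun k => pairFactor b c (uSeq (m + 1)) (if k ≤ m + 1 then 1 else 2) (0, k) *
        pairFactor b c (uSeq (m + 1)) (if k ≤ m + 1 then 1 else 2) (1, k)) (2 + k) := by
    intro k _
    have e1 : hookType (m + 1) 1 (0, k + 2) = if 2 + k ≤ m + 1 then 1 else 2 := by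
      simp only [hookType]; split_ifs <;> omega
    have e2 : hookType (m + 1) 1 (1, k + 2) = if 2 + k ≤ m + 1 then 1 else 2 := by
      simp only [hookType]; split_ifs <;> omega
    rw [if_neg (Nat.not_lt_zero k)]
    simp only [shiftAt, Nat.not_lt_zero, if_false, zero_add, Nat.add_assoc, Nat.reduceAdd, e1, e2]
    rw [add_comm k 2]
  rw [Finset.prod_congr rfl hmid]
  have h1 := (Finset.prod_Ico_eq_prod_range
    (fun k => pairFactor b c (uSeq (m + 1)) (if k ≤ m + 1 then 1 else 2) (0, k) *
        pairFactor b c (uSeq (m + 1)) (if k ≤ m + 1 then 1 else 2) (1, k)) 2 (2 * m + 2)).symm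
  rw [Nat.add_sub_cancel] at h1
  refine h1.trans ?_
  rw [hIcc, ← Finset.prod_Ico_consecutive _ (show 2 ≤ m + 1 + 1 by omega)
    (show m + 1 + 1 ≤ 2 * m + 2 by omega)]
  refine congrArg₂ (· * ·) (Finset.prod_congr rfl fun k hk => ?_)
    (Finset.prod_congr rfl fun k hk => ?_)
  · rw [Finset.mem_Ico] at hk
    rw [if_pos (by omega), ← bExt_of_lt (by omega) (by omega),
      ← bExt_of_lt (by omega) (by omega)]
    rfl
  · rw [Finset.mem_Ico] at hk
    rw [if_neg (by omega), ← bExt_add (by omega) (by omega), ← bExt_add (by omega) (by omega)]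
    congr 2 <;> push_cast <;> ring_nf

theorem hookType_zero (m p j : ℕ) :
    hookType m p (0, j) = if j = p then 0 else if j ≤ m then 1 else 2 := if_pos rfl

theorem hookType_left {p : ℕ} (hp : p ≠ 0) (j : ℕ) :
    hookType m p (p, j) = if j < m + p then 1 else 2 := (if_neg hp).trans (if_pos rfl)

theorem hookType_right {p i : ℕ} (h0 : i ≠ 0) (hp : i ≠ p) : hookType m p (i, p) = 1 :=
  (if_neg h0).trans ((if_neg hp).trans (if_pos rfl))

theorem hookType_other {p i j : ℕ} (h0 : i ≠ 0) (hp : i ≠ p) (hj : j ≠ p) :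
    hookType m p (i, j) = crossType (m - 1)
      (if i < p then i - 1 else i - 2, if j < p then j - 1 else j - 2) :=
  (if_neg h0).trans ((if_neg hp).trans (if_neg hj))

theorem hookType_of_notMem {p i j : ℕ} (hp0 : 0 < p) (hp : p < m) (hij : i < j) (hj : j < 2 * m)
    (h1 : ¬ (i = p ∧ j = p + 1)) (h2 : ¬ (i = 0 ∧ j = p)) (h3 : ¬ (i = 0 ∧ j = p + 1))
    (h4 : ¬ (i = p ∧ j = p + m)) (h5 : ¬ (i = p + 1 ∧ j = p + m)) :
    hookType m p (i, j) = hookType m (p + 1) (i, j) := by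
  rcases eq_or_ne i 0 with rfl | i0
  · simp only [hookType, if_true]
    split_ifs <;> omega
  rcases eq_or_ne i p with rfl | i1
  · simp only [hookType, crossType, if_neg i0, if_true]
    split_ifs <;> omega
  rcases eq_or_ne i (p + 1) with rfl | i2
  · simp only [hookType, crossType, if_neg i0, if_neg i1, if_true]
    split_ifs <;> omega
  simp only [hookType, crossType, if_neg i0, if_neg i1, if_neg i2]
  rcases lt_or_ge i p with h6 | h6
  · simp only [if_pos h6, if_pos (show i < p + 1 by omega)]
    split_ifs <;> omega
  · simp only [if_neg (show ¬ i < p by omega), if_neg (show ¬ i < p + 1 by omega),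
      if_neg (show ¬ j < p by omega), if_neg (show ¬ j < p + 1 by omega),
      if_neg (show ¬ j = p by omega), if_neg (show ¬ j = p + 1 by omega)]

theorem hookType_sN {p i j : ℕ} (hp0 : 0 < p) (hp : p < m) (hij : i < j) (hj : j < 2 * m)
    (h1 : ¬ (i = p ∧ j = p + 1)) (h2 : ¬ (i = 0 ∧ j = p)) (h3 : ¬ (i = 0 ∧ j = p + 1))
    (h4 : ¬ (i = p ∧ j = p + m)) (h5 : ¬ (i = p + 1 ∧ j = p + m)) :
    hookType m (p + 1) (sN p i, sN p j) = hookType m (p + 1) (i, j) := by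
  have hlow : ∀ i, i ≠ 0 → i < p → hookType m (p + 1) (i, p) = hookType m (p + 1) (i, p + 1) := by
    intro i h h'
    simp only [hookType, crossType]
    split_ifs <;> omega
  have hhigh : ∀ j, p + 1 < j → j ≠ p + m → j < 2 * m →
      hookType m (p + 1) (p, j) = hookType m (p + 1) (p + 1, j) := by
    intro j h h' h''
    rw [hookType_left (Nat.succ_ne_zero p), hookType_other hp0.ne' (by omega) (by omega),
      if_pos (Nat.lt_succ_self p), if_neg (show ¬ j < p + 1 by omega)]
    simp only [crossType]
    split_ifs <;> omega
  rcases eq_or_ne i p with rfl | i1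
  · rw [sN_left, sN_of_ne (by omega) (by omega)]
    exact (hhigh j (by omega) (by omega) hj).symm
  rcases eq_or_ne i (p + 1) with rfl | i2
  · rw [sN_right, sN_of_ne (by omega) (by omega)]
    exact hhigh j (by omega) (by omega) hj
  rw [sN_of_ne i1 i2]
  rcases eq_or_ne j p with rfl | j1
  · rw [sN_left]
    exact (hlow i (by omega) (by omega)).symm
  rcases eq_or_ne j (p + 1) with rfl | j2
  · rw [sN_right]
    exact hlow i (by omega) (by omega)
  rw [sN_of_ne j1 j2]

/-- The recursion of the intermediate products. -/
theorem hookProd_succ {p : Fin (2 * m - 1)} (hp0 : 0 < p.val) (hp : p.val < m) :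
    tBar b c p (toRat (hookProd m b c (p + 1))) +
      cR m c / (uR m 0 - uR m p + cR m b) * toRat (hookProd m b c (p + 1)) =
      toRat (hookProd m b c p) := by
  set x := uSeq m 0 with hx
  set y := uSeq m p with hy
  set z := uSeq m (p + 1) with hz
  set w := uSeq m (p + m) with hw
  -- Outside these five pairs the types for `p` and for `p + 1` agree and are invariant under the
  -- exchange at `p`.
  set X : Finset (ℕ × ℕ) := {(p.val, p.val + 1), (0, p.val), (0, p.val + 1),
    (p.val, p.val + m), (p.val + 1, p.val + m)} with hXdef
  set A := ∏ e ∈ pairs (2 * m) \ X, pairFactor b c (uSeq m) (hookType m (p + 1) e) e with hA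
  have hXs : X ⊆ pairs (2 * m) := by
    intro e he
    simp only [hXdef, Finset.mem_insert, Finset.mem_singleton] at he
    rw [mem_pairs]
    rcases he with rfl | rfl | rfl | rfl | rfl <;> simp only <;> omega
  have hA' : ∏ e ∈ pairs (2 * m) \ X, pairFactor b c (uSeq m) (hookType m p e) e = A := by
    refine Finset.prod_congr rfl ?_
    rintro ⟨i, j⟩ he
    rw [Finset.mem_sdiff, mem_pairs] at he
    simp only [hXdef, Finset.mem_insert, Finset.mem_singleton, not_or, Prod.mk.injEq] at he
    rw [hookType_of_notMem hp0 hp he.1.1 he.1.2 he.2.1 he.2.2.1 he.2.2.2.1 he.2.2.2.2.1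
      he.2.2.2.2.2]
  have hXp : ∀ θ : ℕ × ℕ → ℕ, ∏ e ∈ X, pairFactor b c (uSeq m) (θ e) e =
      pairFactor b c (uSeq m) (θ (p.val, p.val + 1)) (p.val, p.val + 1) *
      (pairFactor b c (uSeq m) (θ (0, p.val)) (0, p.val) *
      (pairFactor b c (uSeq m) (θ (0, p.val + 1)) (0, p.val + 1) *
      (pairFactor b c (uSeq m) (θ (p.val, p.val + m)) (p.val, p.val + m) *
      pairFactor b c (uSeq m) (θ (p.val + 1, p.val + m)) (p.val + 1, p.val + m)))) := by
    intro θ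
    rw [hXdef]
    iterate 4 rw [Finset.prod_insert (by
      simp only [Finset.mem_insert, Finset.mem_singleton, Prod.mk.injEq]; omega)]
    rw [Finset.prod_singleton]
  have e1 : hookProd m b c (p + 1) = bP b p * (A * ((x - y + C b) * (z - w + C b))) := by
    have t1 : hookType m (p + 1) (p.val, p.val + 1) = 1 := hookType_right (by omega) (by omega)
    have t2 : hookType m (p + 1) (0, p.val) = 1 := by
      rw [hookType_zero, if_neg (by omega), if_pos (by omega)]
    have t3 : hookType m (p + 1) (0, p.val + 1) = 0 := by rw [hookType_zero, if_pos rfl]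
    have t4 : hookType m (p + 1) (p.val, p.val + m) = 0 := by
      rw [hookType_other (by omega) (by omega) (by omega), if_pos (show p.val < p + 1 by omega),
        if_neg (show ¬ p.val + m < p + 1 by omega), crossType, if_neg (by dsimp only; omega),
        if_pos (by dsimp only; omega)]
    have t5 : hookType m (p + 1) (p.val + 1, p.val + m) = 1 := by
      rw [hookType_left (by omega), if_pos (by omega)]
    rw [hookProd, ← Finset.prod_sdiff hXs, hXp, ← hA, t1, t2, t3, t4, t5, bP, dP_eq]
    simp only [pairFactor, ← hx, ← hy, ← hz, ← hw]
    simp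
    ring
  have e2 : hookProd m b c p = bP b p * (A * ((x - z + C b) * (w - y - C (b + c)))) := by
    have t1 : hookType m p (p.val, p.val + 1) = 1 := by
      rw [hookType_left (by omega), if_pos (by omega)]
    have t2 : hookType m p (0, p.val) = 0 := by rw [hookType_zero, if_pos rfl]
    have t3 : hookType m p (0, p.val + 1) = 1 := by
      rw [hookType_zero, if_neg (by omega), if_pos (by omega)]
    have t4 : hookType m p (p.val, p.val + m) = 2 := by
      rw [hookType_left (by omega), if_neg (by omega)]
    have t5 : hookType m p (p.val + 1, p.val + m) = 0 := by
      rw [hookType_other (by omega) (by omega) (by omega),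
        if_neg (show ¬ p.val + 1 < p by omega), if_neg (show ¬ p.val + m < p by omega), crossType,
        if_neg (by dsimp only; omega), if_pos (by dsimp only; omega)]
    rw [hookProd, ← Finset.prod_sdiff hXs, hXp, hA', t1, t2, t3, t4, t5, bP, dP_eq]
    simp only [pairFactor, ← hx, ← hy, ← hz, ← hw]
    simp
    ring
  have hAs : swapPoly p A = A := by
    apply swapPoly_prod_pairs
    · simp [hXdef]
    · intro e he
      have s0 : sN p 0 = 0 := sN_of_ne (by omega) (by omega)
      have s1 : sN p (p + m) = p + m := sN_of_ne (by omega) (by omega)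
      simp only [hXdef, Finset.mem_insert, Finset.mem_singleton] at he ⊢
      rcases he with rfl | rfl | rfl | rfl | rfl <;> simp [s0, s1]
    · rintro ⟨i, j⟩ he he'
      rw [mem_pairs] at he
      simp only [hXdef, Finset.mem_insert, Finset.mem_singleton, not_or, Prod.mk.injEq] at he'
      exact hookType_sN hp0 hp he.1 he.2 he'.1 he'.2.1 he'.2.2.1 he'.2.2.2.1 he'.2.2.2.2
  have sx : swapPoly p x = x := by
    rw [hx, swapPoly_uSeq p (by omega), sN_of_ne (by omega) (by omega)]
  have sy : swapPoly p y = z := by rw [hy, swapPoly_uSeq p (by omega), sN_left]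
  have sz : swapPoly p z = y := by rw [hz, swapPoly_uSeq p (by omega), sN_right]
  have sw' : swapPoly p w = w := by
    rw [hw, swapPoly_uSeq p (by omega), sN_of_ne (by omega) (by omega)]
  -- The image contains the wanted product and the excess `- c (z - w + b)` in the cofactor; adding
  -- `c / b_{0p}` times the old product cancels the factor `x - y + b` and removes this excess.
  have st : Step (N := 2 * m) b c p (hookProd m b c (p + 1))
      (bP b p * (A * ((x - z + C b) * (w - y - C (b + c)) - C c * (z - w + C b)))) := by
    rw [e1]
    apply step_mul_of_swap hAs
    simp only [map_mul, map_add, map_sub, swapPoly_C, sx, sy, sz, sw', dP_eq p, ← hy, ← hz]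
    ring
  rw [st.tBar_eq, e1, e2]
  have h0 := uR_sub_add_ne_zero (m := m) (k := 0) (l := p) (by omega) (by omega) hp0.ne b
  have hxy : uR m 0 - uR m p + cR m b = toRat (x - y + C b) := by
    rw [toRat_add, toRat_sub]
  rw [hxy] at h0 ⊢
  rw [toRat_mul, toRat_mul, toRat_sub, toRat_mul (C c), toRat_mul (bP b p), toRat_mul A,
    toRat_mul (x - y + C b), toRat_mul (bP b p), toRat_mul A]
  field_simp
  ring

/-- The exchange turns `1 / b_{0 p+1}` into `1 / b_{0 p}`. The difference of these reciprocals
contains the factor `u_p - u_{p+1}`, which cancels the denominator of t̄_p and leaves the correction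
term. -/
theorem tBar_div {p : Fin (2 * m - 1)} (hp0 : 0 < p.val) (f : RatFun m) :
    tBar b c p (cR m c / (uR m 0 - uR m (p + 1) + cR m b) * f) +
      cR m c / (uR m 0 - uR m p + cR m b) * (cR m c / (uR m 0 - uR m (p + 1) + cR m b) * f) =
      cR m c / (uR m 0 - uR m p + cR m b) * tBar b c p f := by
  have hpl := p.2
  rw [tBar_eq, tBar_eq]
  simp only [map_mul, map_div₀, map_add, map_sub, swapRat_cR, swapRat_uR p (k := 0) (by omega),
    swapRat_uR p (k := p + 1) (by omega), sN_right, sN_of_ne (j := p) (k := 0) (by omega) (by omega)]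
  have h0 := uR_sub_add_ne_zero (m := m) (k := 0) (l := p) (by omega) (by omega) hp0.ne b
  have h1 := uR_sub_add_ne_zero (m := m) (k := 0) (l := p + 1) (by omega) (by omega) (by omega) b
  have h2 := dR_ne_zero p
  have h3 := neg_dR_add_ne_zero b p
  rw [dR_eq] at *
  field_simp
  ring

/-- Descending induction in `p`: the Leibniz rule for omitted words and `tBar_div` turn the left
side into the recursion `hookProd_succ`. At `p = 1` this is the formula for S_n. -/
theorem tWord_add_omitWords {p k : ℕ} (hp : p + k = m) (hp0 : 0 < p) :
    tWord b c (descFrom m p) (toRat (rhoBar m b c)) + cR m c / (uR m 0 - uR m p + cR m b) *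
      omitWords b c (descFrom m p) (toRat (rhoBar m b c)) = toRat (hookProd m b c p) := by
  induction k generalizing p with
  | zero =>
    obtain rfl : p = m := hp
    rw [descFrom_self, hookProd_self]
    simp [omitWords, tWord]
  | succ k ih =>
    have hj : p < 2 * m - 1 := by omega
    have h1 := descFrom_eq_append (m := m) (j := ⟨p, hj⟩) (by dsimp only; omega)
    have h2 : (⟨p, hj⟩ : Fin (2 * m - 1)) ∉ descFrom m (p + 1) := by rw [mem_descFrom]; simp
    have h3 := ih (p := p + 1) (by omega) (by omega)
    have h4 := hookProd_succ (b := b) (c := c) (p := ⟨p, hj⟩) hp0 (by dsimp only; omega)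
    have h5 := tBar_div (b := b) (c := c) (p := ⟨p, hj⟩) hp0
      (omitWords b c (descFrom m (p + 1)) (toRat (rhoBar m b c)))
    dsimp only at h1 h4 h5
    rw [← h3, tBar_add] at h4
    rw [h1, tWord_append, omitWords_append h2]
    linear_combination h4 - h5

/-- In the form `hookProd m b c 1`, the first two points have equal types towards all others and no
factor between them. -/
theorem swapPoly_factS (hm : 0 < m) (o : Fin (2 * m - 1)) (ho : o.val = 0) :
    swapPoly o (factS m b c) = factS m b c := by
  rw [← hookProd_one hm]
  have h1 : hookProd m b c 1 = ∏ e ∈ pairs (2 * m) \ {(o.val, o.val + 1)},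
      pairFactor b c (uSeq m) (hookType m 1 e) e := by
    rw [hookProd, ← Finset.prod_sdiff (s₁ := {(o.val, o.val + 1)})
      (by rw [Finset.singleton_subset_iff, mem_pairs]; dsimp only; omega), Finset.prod_singleton, ho]
    have : pairFactor b c (uSeq m) (hookType m 1 (0, 0 + 1)) (0, 0 + 1) = 1 := by
      simp [pairFactor, hookType]
    rw [this, mul_one]
  rw [h1]
  apply swapPoly_prod_pairs
  · simp
  · intro e he
    rw [Finset.mem_singleton] at he
    exact Or.inl he
  · rintro ⟨i, j⟩ he he'
    rw [mem_pairs] at he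
    dsimp only at he
    simp only [Finset.mem_singleton, Prod.mk.injEq, ho] at he'
    have h2 : ∀ j, 1 < j → hookType m 1 (0, j) = hookType m 1 (1, j) := by
      intro j hj
      simp only [hookType, one_ne_zero, if_true, if_false]
      split_ifs <;> omega
    dsimp only
    rw [ho, sN_of_ne (j := 0) (k := j) (by omega) (by omega)]
    rcases eq_or_ne i 0 with rfl | i0
    · rw [sN_left]; exact (h2 j (by omega)).symm
    rcases eq_or_ne i 1 with rfl | i1
    · rw [sN_right 0]; exact h2 j (by omega)
    rw [sN_of_ne i0 i1]

theorem fullWord_eq : fullWord m b c = tWord b c (descFrom m 1) (toRat (rhoBar m b c)) := rfl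

theorem omitSum_eq : omitSum m b c = omitWords b c (descFrom m 1) (toRat (rhoBar m b c)) := rfl

theorem polyS_eq (hm : 0 < m) (o : Fin (2 * m - 1)) (ho : o.val = 0) :
    polyS m b c o = toRat (factS m b c) := by
  rw [← hookProd_one hm, ← tWord_add_omitWords (k := m - 1) (by omega) one_pos, polyS, fullWord_eq,
    omitSum_eq, smul_eq_cR_mul, toRat_bP, dR_eq, ho]
  ring_nf

/-- The symmetry of S_n expresses `(1 - k) W`, for the full word `W`, by the antisymmetric part of
the sum of omitted words divided by b_{12}. Inserted into τ - ē_1, which starts with `1 - k`, it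
gives minus the image of this sum under 1 + t̄_1. -/
theorem duality (hm : 0 < m) (hc : c ≠ 0) (o : Fin (2 * m - 1)) (ho : o.val = 0) :
    eBarCompl b c o (fullWord m b c) + (omitSum m b c + tBar b c o (omitSum m b c)) = 0 := by
  have h1 := polyS_eq (b := b) (c := c) hm o ho
  have h2 : swapRat o (polyS m b c o) = polyS m b c o := by
    rw [h1, swapRat_toRat, swapPoly_factS hm o ho]
  rw [polyS, smul_eq_cR_mul, toRat_bP] at h2
  simp only [map_mul, map_div₀, map_add, swapRat_dR, swapRat_cR] at h2
  rw [eBarCompl_eq, tBar_eq]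
  have h3 := dR_ne_zero o
  have h4 := neg_dR_add_ne_zero b o
  have h5 := dR_add_ne_zero b o
  have h6 := cR_inv (m := m) c hc
  have h7 : fullWord m b c - swapRat o (fullWord m b c) = cR m c *
      (swapRat o (omitSum m b c) / (-dR o + cR m b) - omitSum m b c / (dR o + cR m b)) := by
    linear_combination -h2
  rw [h7]
  generalize cR m c⁻¹ = K at h6 ⊢
  field_simp
  linear_combination ((dR o + cR m b) * swapRat o (omitSum m b c) -
    (-dR o + cR m b) * omitSum m b c) * (dR o + cR m c) * h6

end Duality

/-! ### The line π_0 of the matrix of e_1. -/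

section Row
variable {m : ℕ} {b c τ : ℂ}

theorem piZero_eq (hm : 0 < m) : piZero m = Pattern.hook m 1 one_pos hm := by
  rw [piZero, descList_eq]
  exact Pattern.foldl_descFrom hm (k := m - 1) (by omega) one_pos

theorem linkFree_rho (hm : 2 ≤ m) : (Pattern.rho m).LinkFree 1 m ∨ m < 2 := by
  left
  intro x hx hx'
  rw [Pattern.rho_nv (by omega)]
  split_ifs <;> omega

theorem toRat_dualPoly_piZero (hm : 0 < m) : toRat (dualPoly b c (piZero m)) = fullWord m b c := by
  rcases (by omega : m = 1 ∨ 2 ≤ m) with rfl | hm2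
  · rw [piZero, fullWord, descList_eq, descFrom_self, tWord]
    simp only [List.foldl_nil, dualPoly_rho]
  · rw [piZero, fullWord, ← dualPoly_rho, tWord_eq_dualPoly hm2 ((linkFree_rho hm2).resolve_right
      (by omega)) fun j hj => by rw [descList_eq, mem_descFrom] at hj; exact hj]

/-- The pattern in which `0` is linked to `x`, and which `e_0` takes to the pattern `π_0`. -/
def preimage (m : ℕ) (hm : 0 < m) (x : ℕ) : Pattern m :=
  if h : x < 2 * m then
    (Pattern.hook m 1 one_pos hm).conj (Equiv.swap ⟨1, by omega⟩ ⟨x, h⟩) else Pattern.rho m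

theorem omitSum_eq_sum (hm : 0 < m) : omitSum m b c =
    ∑ j ∈ Finset.Ico 1 m, toRat (dualPoly b c (preimage m hm (j + 1))) := by
  rw [← sum_map_descFrom (fun j => toRat (dualPoly b c (preimage m hm (j + 1)))) (k := m - 1)
    (by omega), omitSum, descList_eq]
  congr 1
  refine List.map_congr_left fun j hj => ?_
  rw [mem_descFrom] at hj
  rw [← dualPoly_rho, tWord_eq_dualPoly (by omega) ((linkFree_rho (by omega)).resolve_right
      (by omega)) fun k hk => by have := List.mem_of_mem_erase hk; rwa [mem_descFrom] at this,
    Pattern.foldl_descFrom_erase hj.2 (k := j - 1) (by omega) one_pos, preimage,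
    dif_pos (by omega)]

theorem nv_hook_one {k : ℕ} (hm : 0 < m) (hk : k < 2 * m) : (Pattern.hook m 1 one_pos hm).nv k =
    if k = 0 then 1 else if k = 1 then 0 else if k ≤ m then k + m - 1 else k - m + 1 := by
  rw [Pattern.nv_hook _ _ hk]
  split_ifs <;> omega

variable {o : Fin (2 * m - 1)}

theorem preimage_eq (hm : 0 < m) (ho : o.val = 0) (x : Fin (2 * m)) : preimage m hm x =
    (Pattern.hook m 1 one_pos hm).conj (Equiv.swap (hi o) x) := by
  rw [preimage, dif_pos x.2]
  congr 2
  exact Fin.ext (by simp [hi, ho])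

theorem preimage_linked (hm : 0 < m) (ho : o.val = 0) {x : Fin (2 * m)} (hx : x.val ≠ 0) :
    (preimage m hm x).1 (lo o) = x := by
  apply Fin.ext
  rw [← Pattern.nv_fin, preimage_eq hm ho]
  exact Pattern.conj_swap_lo (by rw [ho, nv_hook_one hm (by omega), if_pos rfl])
    fun e => hx (by rw [e]; exact ho)

theorem preimage_one (hm : 0 < m) : preimage m hm 1 = Pattern.hook m 1 one_pos hm := by
  rw [preimage, dif_pos (by omega), Equiv.swap_self]; rfl

theorem preimage_actT (hm : 0 < m) (ho : o.val = 0) {x : ℕ} (hx : 2 ≤ x) (hx' : x ≤ m) :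
    (preimage m hm x).actT o = preimage m hm (x + m - 1) := by
  have h := preimage_eq hm ho ⟨x, by omega⟩
  have h' := preimage_eq hm ho ⟨x + m - 1, by omega⟩
  dsimp only at h h'
  rw [h, h', Pattern.actT_conj_swap (by rw [ho, nv_hook_one hm (by omega), if_pos rfl])
    (by simp only [lo, ne_eq, Fin.mk.injEq]; omega) (by simp only [hi, ne_eq, Fin.mk.injEq]; omega)]
  congr 2
  apply Fin.ext
  rw [← Pattern.nv_fin, nv_hook_one hm (by dsimp only; omega)]
  dsimp only
  rw [if_neg (by omega), if_neg (by omega), if_pos hx']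

/-- The line `π_0` of the matrix of `e_0`. -/
theorem sum_matE_smul {A : Type*} [AddCommMonoid A] [Module ℂ A] (hm : 0 < m) (ho : o.val = 0)
    (f : Pattern m → A) : ∑ π : Pattern m, matE τ o (piZero m) π • f π =
      τ • f (piZero m) + ∑ j ∈ Finset.Ico 1 m,
        (f (preimage m hm (j + 1)) + f ((preimage m hm (j + 1)).actT o)) := by
  have hl : (Pattern.hook m 1 one_pos hm).nv o = o + 1 := by
    rw [ho, nv_hook_one hm (by omega), if_pos rfl]
  -- The patterns that contribute are indexed by the partner `x` of the point `0`. The value `x = 1`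
  -- is π_0 itself, where a loop is closed; `x = 0` is impossible and is given the weight 0 so that
  -- the sum extends over all points.
  have h1 : ∑ π : Pattern m, matE τ o (piZero m) π • f π =
      ∑ x : Fin (2 * m), (fun k : ℕ => if k = 0 then (0 : ℂ) else if k = 1 then τ else 1) x •
        f (preimage m hm x) := by
    rw [← Finset.sum_filter_add_sum_filter_not _ (fun π : Pattern m => π.actE o = piZero m),
      Finset.sum_eq_zero (s := Finset.univ.filter fun π : Pattern m => ¬ π.actE o = piZero m),
      add_zero,
      ← Finset.sum_filter_add_sum_filter_not Finset.univ (fun x : Fin (2 * m) => x.val ≠ 0),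
      Finset.sum_eq_zero (s := Finset.univ.filter fun x : Fin (2 * m) => ¬ x.val ≠ 0), add_zero]
    · refine Finset.sum_bij' (fun π _ => π.1 (lo o)) (fun x _ => preimage m hm x) ?_ ?_ ?_ ?_ ?_
      · intro π _
        simp only [Finset.mem_filter, Finset.mem_univ, true_and]
        intro h
        exact π.2.2 (lo o) (Fin.ext (h.trans ho.symm))
      · intro x hx
        simp only [Finset.mem_filter, Finset.mem_univ, true_and] at hx ⊢
        rw [piZero_eq hm, preimage_eq hm ho]
        exact Pattern.actE_conj_swap hl fun e => hx (by rw [e]; exact ho)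
      · intro π h
        simp only [Finset.mem_filter, Finset.mem_univ, true_and] at h
        rw [piZero_eq hm] at h
        rw [preimage_eq hm ho]
        exact (Pattern.eq_conj_of_actE_eq h).symm
      · intro x hx
        simp only [Finset.mem_filter, Finset.mem_univ, true_and] at hx
        exact preimage_linked hm ho hx
      · intro π h
        simp only [Finset.mem_filter, Finset.mem_univ, true_and] at h
        have h0 : (π.1 (lo o)).val ≠ 0 := fun e => π.2.2 (lo o) (Fin.ext (e.trans ho.symm))
        have h2 : preimage m hm (π.1 (lo o)) = π := by
          rw [piZero_eq hm] at h
          rw [preimage_eq hm ho]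
          exact (Pattern.eq_conj_of_actE_eq h).symm
        have h3 : π.1 (lo o) = hi o ↔ (π.1 (lo o)).val = 1 := by
          rw [Fin.ext_iff]; simp [hi, ho]
        simp only [matE, Matrix.of_apply, h, if_true, h0, if_false, h2, h3]
    · intro x hx
      simp only [Finset.mem_filter, Finset.mem_univ, true_and, not_not] at hx
      simp [hx]
    · intro π h
      simp only [Finset.mem_filter, Finset.mem_univ, true_and] at h
      simp [matE, h]
  rw [h1, Fin.sum_univ_eq_sum_range (fun k => (fun k : ℕ => if k = 0 then (0 : ℂ) else
    if k = 1 then τ else 1) k • f (preimage m hm k)) (2 * m), Finset.sum_add_distrib,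
    Finset.range_eq_Ico, Finset.sum_eq_sum_Ico_succ_bot (by omega),
    Finset.sum_eq_sum_Ico_succ_bot (by omega), ← Finset.sum_Ico_consecutive _
      (show 0 + 1 + 1 ≤ m + 1 by omega) (show m + 1 ≤ 2 * m by omega)]
  simp only [if_true, zero_smul, zero_add, one_ne_zero, if_false, preimage_one, ← piZero_eq hm]
  congr 1
  congr 1
  · rw [Finset.sum_Ico_add' (fun j => f (preimage m hm j)) 1 m 1]
    refine Finset.sum_congr rfl fun k hk => ?_
    rw [Finset.mem_Ico] at hk
    rw [if_neg (by omega), if_neg (by omega), one_smul]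
  · have h2 : ∀ j ∈ Finset.Ico 1 m, f ((preimage m hm (j + 1)).actT o) =
        (fun k => f (preimage m hm k)) (j + m) := by
      intro j hj
      rw [Finset.mem_Ico] at hj
      rw [preimage_actT hm ho (by omega) (by omega)]
      congr 2
      omega
    rw [Finset.sum_congr rfl h2, Finset.sum_Ico_add' (fun j => f (preimage m hm j)) 1 m m]
    rw [add_comm 1 m, ← two_mul]
    refine Finset.sum_congr rfl fun k hk => ?_
    rw [Finset.mem_Ico] at hk
    rw [if_neg (by omega), if_neg (by omega), one_smul]

/-- The partners 2, …, m of the first point come from the words with one omitted letter and the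
partners beyond m from their exchange by t_1. The line of the matrix is thus τ times π_0 plus the
image of the omitted words under 1 + t_1, and the claim is `duality`. -/
theorem eBar_dualPoly_piZero (hm : 0 < m) (hc : c ≠ 0) (hτ : τ = 2 * (1 + b / c))
    (ho : o.val = 0) : eBar b c o (toRat (dualPoly b c (piZero m))) =
      ∑ π : Pattern m, matE τ o (piZero m) π • toRat (dualPoly b c π) := by
  rw [sum_matE_smul hm ho, Finset.sum_add_distrib, ← omitSum_eq_sum hm]
  have h1 : ∑ j ∈ Finset.Ico 1 m, toRat (dualPoly b c ((preimage m hm (j + 1)).actT o)) =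
      tBar b c o (omitSum m b c) := by
    have hsum : ∀ (s : Finset ℕ) (g : ℕ → RatFun m),
        tBar b c o (∑ j ∈ s, g j) = ∑ j ∈ s, tBar b c o (g j) := by
      intro s g
      induction s using Finset.induction_on with
      | empty => exact tBar_zero
      | insert a s ha ih => rw [Finset.sum_insert ha, tBar_add, ih, Finset.sum_insert ha]
    rw [omitSum_eq_sum hm, hsum]
    refine Finset.sum_congr rfl fun j hj => ?_
    rw [Finset.mem_Ico] at hj
    refine (step_dualPoly ?_).tBar_eq.symm
    have := preimage_linked hm ho (x := ⟨j + 1, by omega⟩) (Nat.succ_ne_zero j)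
    have h2 := congrArg Fin.val this
    rw [← Pattern.nv_fin] at h2
    change (preimage m hm (j + 1)).nv o = j + 1 at h2
    omega
  have h2 := duality (b := b) hm hc o ho
  have h3 := eBar_add_eBarCompl (i := o) hc hτ (fullWord m b c)
  rw [h1, toRat_dualPoly_piZero hm]
  linear_combination h3 - h2

theorem piZero_links (hm : 0 < m) (ho : o.val = 0) : (piZero m).1 (lo o) = hi o ∧
    ∀ k l : Fin (2 * m), 2 ≤ k.val → k.val ≤ m → l.val = k.val + m - 1 → (piZero m).1 k = l := by
  rw [piZero_eq hm]
  constructor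
  · rw [Pattern.linked_iff, ho, nv_hook_one hm (by omega), if_pos rfl]
  · intro k l h1 h2 h3
    rw [Pattern.nv_eq_iff, nv_hook_one hm k.2, if_neg (by omega), if_neg (by omega), if_pos h2, h3]

end Row

/-! ### Representations of the two algebras -/

/-- The relations of the Brauer algebra. -/
structure IsBrauerRep {n : ℕ} {A : Type*} [Ring A] [Algebra ℂ A] (τ : ℂ)
    (t e : Fin (n - 1) → A) : Prop where
  braid : ∀ i j, Adj i j → t i * t j * t i = t j * t i * t j
  tt_comm : ∀ i j, Far i j → t i * t j = t j * t i
  ee_comm : ∀ i j, Far i j → e i * e j = e j * e i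
  te_comm : ∀ i j, Far i j → t i * e j = e j * t i
  eee : ∀ i j, Adj i j → e i * e j * e i = e i
  t_sq : ∀ i, t i * t i = 1
  e_mul_t : ∀ i, e i * t i = e i
  t_mul_e : ∀ i, t i * e i = e i
  e_sq : ∀ i, e i * e i = τ • e i
  ete : ∀ i j, Adj i j → e i * t j * e i = e i
  tte : ∀ i j, Adj i j → t j * t i * e j = e i * e j
  ett : ∀ i j, Adj i j → e i * t j * t i = e i * e j

/-- The relations of the Birman-Wenzl-Murakami algebra. -/
structure IsBMWRep {n : ℕ} {A : Type*} [Ring A] [Algebra ℂ A] (a ε τ : ℂ)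
    (t t' e : Fin (n - 1) → A) : Prop where
  mul_inv : ∀ i, t i * t' i = 1
  inv_mul : ∀ i, t' i * t i = 1
  braid : ∀ i j, Adj i j → t i * t j * t i = t j * t i * t j
  tt_comm : ∀ i j, Far i j → t i * t j = t j * t i
  ee_comm : ∀ i j, Far i j → e i * e j = e j * e i
  te_comm : ∀ i j, Far i j → t i * e j = e j * t i
  eee : ∀ i j, Adj i j → e i * e j * e i = e i
  skein : ∀ i, t i - t' i = ε • (1 - e i)
  e_mul_t : ∀ i, e i * t i = a • e i
  t_mul_e : ∀ i, t i * e i = a • e i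
  e_sq : ∀ i, e i * e i = τ • e i
  ete : ∀ i j, Adj i j → e i * t j * e i = a⁻¹ • e i
  tte : ∀ i j, Adj i j → t j * t i * e j = e i * e j
  ett : ∀ i j, Adj i j → e i * t j * t i = e i * e j

section Lift
variable {n : ℕ} {A : Type*} [Ring A] [Algebra ℂ A] {a ε τ : ℂ}

theorem IsBrauerRep.exists_hom {t e : Fin (n - 1) → A} (h : IsBrauerRep τ t e) :
    ∃ φ : Brauer n τ →ₐ[ℂ] A, (∀ i, φ (Brauer.t τ i) = t i) ∧ ∀ i, φ (Brauer.e τ i) = e i := by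
  set g : BrauerGen n → A := fun x => match x with
    | .t i => t i
    | .e i => e i
  refine ⟨RingQuot.liftAlgHom ℂ ⟨FreeAlgebra.lift ℂ g, ?_⟩, fun i => ?_, fun i => ?_⟩
  · intro x y hxy
    cases hxy <;>
      simp only [map_mul, map_one, map_smul, FreeAlgebra.lift_ι_apply, g]
    case braid i j hij => exact h.braid i j hij
    case tt_comm i j hij => exact h.tt_comm i j hij
    case ee_comm i j hij => exact h.ee_comm i j hij
    case te_comm i j hij => exact h.te_comm i j hij
    case eee i j hij => exact h.eee i j hij
    case t_sq i => exact h.t_sq i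
    case e_mul_t i => exact h.e_mul_t i
    case t_mul_e i => exact h.t_mul_e i
    case e_sq i => exact h.e_sq i
    case ete i j hij => exact h.ete i j hij
    case tte i j hij => exact h.tte i j hij
    case ett i j hij => exact h.ett i j hij
  · simp only [Brauer.t, RingQuot.liftAlgHom_mkAlgHom_apply, FreeAlgebra.lift_ι_apply, g]
  · simp only [Brauer.e, RingQuot.liftAlgHom_mkAlgHom_apply, FreeAlgebra.lift_ι_apply, g]

theorem IsBMWRep.exists_hom {t t' e : Fin (n - 1) → A} (h : IsBMWRep a ε τ t t' e) :
    ∃ φ : BMW n a ε τ →ₐ[ℂ] A, (∀ i, φ (BMW.t a ε τ i) = t i) ∧ ∀ i, φ (BMW.e a ε τ i) = e i := by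
  set g : BMWGen n → A := fun x => match x with
    | .t i => t i
    | .tinv i => t' i
    | .e i => e i
  refine ⟨RingQuot.liftAlgHom ℂ ⟨FreeAlgebra.lift ℂ g, ?_⟩, fun i => ?_, fun i => ?_⟩
  · intro x y hxy
    cases hxy <;>
      simp only [map_mul, map_one, map_smul, map_sub, FreeAlgebra.lift_ι_apply, g]
    case mul_inv i => exact h.mul_inv i
    case inv_mul i => exact h.inv_mul i
    case braid i j hij => exact h.braid i j hij
    case tt_comm i j hij => exact h.tt_comm i j hij
    case ee_comm i j hij => exact h.ee_comm i j hij
    case te_comm i j hij => exact h.te_comm i j hij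
    case eee i j hij => exact h.eee i j hij
    case skein i => exact h.skein i
    case e_mul_t i => exact h.e_mul_t i
    case t_mul_e i => exact h.t_mul_e i
    case e_sq i => exact h.e_sq i
    case ete i j hij => exact h.ete i j hij
    case tte i j hij => exact h.tte i j hij
    case ett i j hij => exact h.ett i j hij
  · simp only [BMW.t, RingQuot.liftAlgHom_mkAlgHom_apply, FreeAlgebra.lift_ι_apply, g]
  · simp only [BMW.e, RingQuot.liftAlgHom_mkAlgHom_apply, FreeAlgebra.lift_ι_apply, g]

theorem isBrauerRep_hom (φ : Brauer n τ →ₐ[ℂ] A) :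
    IsBrauerRep τ (fun i => φ (Brauer.t τ i)) (fun i => φ (Brauer.e τ i)) := by
  have key : ∀ {x y}, BrauerRel n τ x y → φ (RingQuot.mkAlgHom ℂ (BrauerRel n τ) x) =
      φ (RingQuot.mkAlgHom ℂ (BrauerRel n τ) y) := fun h => by
    rw [RingQuot.mkAlgHom_rel ℂ h]
  simp only [Brauer.t, Brauer.e]
  constructor
  · intro i j h; simpa using key (.braid i j h)
  · intro i j h; simpa using key (.tt_comm i j h)
  · intro i j h; simpa using key (.ee_comm i j h)
  · intro i j h; simpa using key (.te_comm i j h)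
  · intro i j h; simpa using key (.eee i j h)
  · intro i; simpa using key (.t_sq i)
  · intro i; simpa using key (.e_mul_t i)
  · intro i; simpa using key (.t_mul_e i)
  · intro i; simpa using key (.e_sq i)
  · intro i j h; simpa using key (.ete i j h)
  · intro i j h; simpa using key (.tte i j h)
  · intro i j h; simpa using key (.ett i j h)

theorem isBMWRep_hom (φ : BMW n a ε τ →ₐ[ℂ] A) : ∃ t', 
    IsBMWRep a ε τ (fun i => φ (BMW.t a ε τ i)) t' (fun i => φ (BMW.e a ε τ i)) := by
  have key : ∀ {x y}, BMWRel n a ε τ x y → φ (RingQuot.mkAlgHom ℂ (BMWRel n a ε τ) x) =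
      φ (RingQuot.mkAlgHom ℂ (BMWRel n a ε τ) y) := fun h => by
    rw [RingQuot.mkAlgHom_rel ℂ h]
  refine ⟨fun i => φ (RingQuot.mkAlgHom ℂ (BMWRel n a ε τ) (BMWGen.T' i)), ?_⟩
  simp only [BMW.t, BMW.e]
  constructor
  · intro i; simpa using key (.mul_inv i)
  · intro i; simpa using key (.inv_mul i)
  · intro i j h; simpa using key (.braid i j h)
  · intro i j h; simpa using key (.tt_comm i j h)
  · intro i j h; simpa using key (.ee_comm i j h)
  · intro i j h; simpa using key (.te_comm i j h)
  · intro i j h; simpa using key (.eee i j h)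
  · intro i; simpa using key (.skein i)
  · intro i; simpa using key (.e_mul_t i)
  · intro i; simpa using key (.t_mul_e i)
  · intro i; simpa using key (.e_sq i)
  · intro i j h; simpa using key (.ete i j h)
  · intro i j h; simpa using key (.tte i j h)
  · intro i j h; simpa using key (.ett i j h)

theorem Brauer.hom_ext {φ ψ : Brauer n τ →ₐ[ℂ] A} (ht : ∀ i, φ (Brauer.t τ i) = ψ (Brauer.t τ i))
    (he : ∀ i, φ (Brauer.e τ i) = ψ (Brauer.e τ i)) : φ = ψ := by
  apply RingQuot.ringQuot_ext'
  apply FreeAlgebra.hom_ext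
  funext x
  cases x with
  | t i => exact ht i
  | e i => exact he i

theorem IsBMWRep.isBrauerRep {t t' e : Fin (n - 1) → A} (h : IsBMWRep 1 0 τ t t' e) :
    IsBrauerRep τ t e ∧ t' = t := by
  have ht : ∀ i, t' i = t i := fun i => by
    have := h.skein i
    rw [zero_smul, sub_eq_zero] at this
    exact this.symm
  refine ⟨⟨h.braid, h.tt_comm, h.ee_comm, h.te_comm, h.eee, fun i => ?_, fun i => ?_, fun i => ?_,
    h.e_sq, fun i j hij => ?_, h.tte, h.ett⟩, funext ht⟩
  · have := h.mul_inv i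
    rwa [ht] at this
  · rw [h.e_mul_t, one_smul]
  · rw [h.t_mul_e, one_smul]
  · rw [h.ete i j hij, inv_one, one_smul]

theorem IsBrauerRep.isBMWRep {t e : Fin (n - 1) → A} (h : IsBrauerRep τ t e) :
    IsBMWRep 1 0 τ t t e :=
  ⟨h.t_sq, h.t_sq, h.braid, h.tt_comm, h.ee_comm, h.te_comm, h.eee, fun i => by simp,
    fun i => by rw [h.e_mul_t, one_smul], fun i => by rw [h.t_mul_e, one_smul], h.e_sq,
    fun i j hij => by rw [h.ete i j hij, inv_one, one_smul], h.tte, h.ett⟩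

/-- At ε = 0 the skein relation identifies t_i⁻¹ with t_i, so the inverse generators carry no
further information. -/
theorem BMW.hom_ext {φ ψ : BMW n 1 0 τ →ₐ[ℂ] A} (ht : ∀ i, φ (BMW.t 1 0 τ i) = ψ (BMW.t 1 0 τ i))
    (he : ∀ i, φ (BMW.e 1 0 τ i) = ψ (BMW.e 1 0 τ i)) : φ = ψ := by
  have hinv : RingQuot.mkAlgHom ℂ (BMWRel n 1 0 τ) ∘ BMWGen.T' =
      RingQuot.mkAlgHom ℂ (BMWRel n 1 0 τ) ∘ BMWGen.T := by
    funext i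
    have := RingQuot.mkAlgHom_rel ℂ (BMWRel.skein (n := n) (a := 1) (ε := 0) (τ := τ) i)
    rw [zero_smul, map_zero, map_sub, sub_eq_zero] at this
    exact this.symm
  apply RingQuot.ringQuot_ext'
  apply FreeAlgebra.hom_ext
  funext x
  cases x with
  | t i => exact ht i
  | tinv i =>
    have := congrFun hinv i
    simp only [Function.comp_apply] at this
    simp only [Function.comp_apply, AlgHom.comp_apply]
    exact (congrArg φ this).trans ((ht i).trans (congrArg ψ this).symm)
  | e i => exact he i

theorem exists_bmw_equiv_brauer (n : ℕ) (τ : ℂ) : ∃ Φ : BMW n 1 0 τ ≃ₐ[ℂ] Brauer n τ,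
    (∀ i, Φ (BMW.t 1 0 τ i) = Brauer.t τ i) ∧ ∀ i, Φ (BMW.e 1 0 τ i) = Brauer.e τ i := by
  obtain ⟨φ, h1, h2⟩ := (isBrauerRep_hom (AlgHom.id ℂ (Brauer n τ))).isBMWRep.exists_hom
  obtain ⟨t', ht'⟩ := isBMWRep_hom (AlgHom.id ℂ (BMW n 1 0 τ))
  obtain ⟨ψ, h3, h4⟩ := ht'.isBrauerRep.1.exists_hom
  simp only [AlgHom.id_apply] at h1 h2 h3 h4
  refine ⟨AlgEquiv.ofAlgHom φ ψ (Brauer.hom_ext (fun i => ?_) fun i => ?_)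
    (BMW.hom_ext (fun i => ?_) fun i => ?_), h1, h2⟩
  · rw [AlgHom.comp_apply, h3, h1, AlgHom.id_apply]
  · rw [AlgHom.comp_apply, h4, h2, AlgHom.id_apply]
  · rw [AlgHom.comp_apply, h1, h3, AlgHom.id_apply]
  · rw [AlgHom.comp_apply, h2, h4, AlgHom.id_apply]

end Lift

/-! ### The rational limit -/

section Limit
variable {b c τ : ℂ}

theorem parA_exp (h : ℂ) :
    parA (Complex.exp (h * b)) (Complex.exp (h * c)) = Complex.exp (h * -(c + 2 * b)) := by
  rw [parA, ← Complex.exp_neg, ← Complex.exp_nat_mul, ← Complex.exp_neg, ← Complex.exp_add]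
  congr 1
  push_cast
  ring

theorem tendsto_exp_mul (s : ℂ) :
    Tendsto (fun h : ℂ => Complex.exp (h * s)) (𝓝[≠] 0) (𝓝 1) := by
  have : Tendsto (fun h : ℂ => Complex.exp (h * s)) (𝓝 0) (𝓝 (Complex.exp (0 * s))) :=
    (Complex.continuous_exp.comp (continuous_id.mul continuous_const)).tendsto 0
  rw [zero_mul, Complex.exp_zero] at this
  exact this.mono_left nhdsWithin_le_nhds

theorem tendsto_parA :
    Tendsto (fun h : ℂ => parA (Complex.exp (h * b)) (Complex.exp (h * c))) (𝓝[≠] 0) (𝓝 1) := by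
  simp only [parA_exp]
  exact tendsto_exp_mul _

theorem parEps_exp (h : ℂ) :
    parEps (Complex.exp (h * c)) = Complex.exp (h * c) - Complex.exp (h * -c) := by
  rw [parEps, ← Complex.exp_neg, mul_neg]

theorem tendsto_parEps : Tendsto (fun h : ℂ => parEps (Complex.exp (h * c))) (𝓝[≠] 0) (𝓝 0) := by
  simp only [parEps_exp]
  have := (tendsto_exp_mul c).sub (tendsto_exp_mul (-c))
  rwa [sub_self] at this

theorem tendsto_exp_sub_exp (s : ℂ) :
    Tendsto (fun h : ℂ => h⁻¹ * (Complex.exp (h * s) - Complex.exp (h * -s))) (𝓝[≠] 0)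
      (𝓝 (2 * s)) := by
  have h1 : ∀ s : ℂ, HasDerivAt (fun h : ℂ => Complex.exp (h * s)) s 0 := by
    intro s
    have := ((hasDerivAt_id (0 : ℂ)).mul_const s).cexp
    simpa using this
  have h2 := hasDerivAt_iff_tendsto_slope.1 ((h1 s).sub (h1 (-s)))
  rw [sub_neg_eq_add, ← two_mul] at h2
  refine h2.congr fun h => ?_
  simp [slope_def_field, div_eq_inv_mul]

/-- The numerator `a - a⁻¹` and the denominator ε have the same form exp(hs) - exp(-hs); divided by
`h`, each tends to its derivative 2s, and the quotient of the limits is -(c + 2b)/c. -/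
theorem tendsto_parTau (hc : c ≠ 0) (hτ : τ = 2 * (1 + b / c)) :
    Tendsto (fun h : ℂ => parTau (Complex.exp (h * b)) (Complex.exp (h * c))) (𝓝[≠] 0) (𝓝 τ) := by
  have h1 := (tendsto_exp_sub_exp (c + 2 * b)).div (tendsto_exp_sub_exp c)
    (mul_ne_zero two_ne_zero hc)
  have h2 := (tendsto_const_nhds (x := (1 : ℂ))).add h1
  have e : 1 + 2 * (c + 2 * b) / (2 * c) = τ := by
    rw [hτ]; field_simp; ring
  rw [e] at h2
  refine h2.congr' ?_
  filter_upwards [self_mem_nhdsWithin] with h hh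
  have hh' : h⁻¹ ≠ 0 := inv_ne_zero hh
  rw [parTau, parA_exp, parEps_exp, ← Complex.exp_neg, Pi.div_apply, mul_div_mul_left _ _ hh']
  rw [show -(h * -(c + 2 * b)) = h * (c + 2 * b) by ring]
  ring

/-- Each relation is an equality of continuous expressions, so it survives in the limit because
limits are unique in a Hausdorff algebra. -/
theorem exists_hom_of_tendsto (hc : c ≠ 0) (hτ : τ = 2 * (1 + b / c)) {n : ℕ} {A : Type u} [Ring A]
    [Algebra ℂ A] [TopologicalSpace A] [IsTopologicalRing A] [ContinuousSMul ℂ A] [T2Space A]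
    {T E : ℂ → Fin (n - 1) → A} {t e : Fin (n - 1) → A}
    (hφ : ∀ᶠ h in 𝓝[≠] (0 : ℂ),
      ∃ φ : BMW n (parA (Complex.exp (h * b)) (Complex.exp (h * c)))
          (parEps (Complex.exp (h * c)))
          (parTau (Complex.exp (h * b)) (Complex.exp (h * c))) →ₐ[ℂ] A,
        (∀ i, φ (BMW.t _ _ _ i) = T h i) ∧ ∀ i, φ (BMW.e _ _ _ i) = E h i)
    (hT : ∀ i, Tendsto (fun h => T h i) (𝓝[≠] 0) (𝓝 (t i)))
    (hE : ∀ i, Tendsto (fun h => E h i) (𝓝[≠] 0) (𝓝 (e i))) :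
    ∃ φ : Brauer n τ →ₐ[ℂ] A,
      (∀ i, φ (Brauer.t τ i) = t i) ∧ ∀ i, φ (Brauer.e τ i) = e i := by
  have hrep : ∀ᶠ h in 𝓝[≠] (0 : ℂ), ∃ t',
      IsBMWRep (parA (Complex.exp (h * b)) (Complex.exp (h * c))) (parEps (Complex.exp (h * c)))
        (parTau (Complex.exp (h * b)) (Complex.exp (h * c))) (T h) t' (E h) := by
    filter_upwards [hφ] with h hh
    obtain ⟨φ, h1, h2⟩ := hh
    obtain ⟨t', h3⟩ := isBMWRep_hom φ
    simp only [h1, h2] at h3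
    exact ⟨t', h3⟩
  have lim : ∀ {f g : ℂ → A} {x y : A}, Tendsto f (𝓝[≠] 0) (𝓝 x) → Tendsto g (𝓝[≠] 0) (𝓝 y) →
      (∀ᶠ h in 𝓝[≠] (0 : ℂ), f h = g h) → x = y := fun hf hg hfg =>
    tendsto_nhds_unique hf (hg.congr' (hfg.mono fun _ h => h.symm))
  have ha := tendsto_parA (b := b) (c := c)
  have hε := tendsto_parEps (c := c)
  have hτ' := tendsto_parTau hc hτ
  have ha' := ha.inv₀ one_ne_zero
  rw [inv_one] at ha'
  -- This expression is t_i⁻¹ by the skein relation; it tends to the limit of t_i since ε tends to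
  -- 0, which yields t_i² = 1.
  have hT' : ∀ i, Tendsto (fun h => T h i - parEps (Complex.exp (h * c)) • (1 - E h i)) (𝓝[≠] 0)
      (𝓝 (t i)) := fun i => by
    have := (hT i).sub (hε.smul ((tendsto_const_nhds (x := (1 : A))).sub (hE i)))
    rwa [zero_smul, sub_zero] at this
  refine IsBrauerRep.exists_hom ⟨?_, ?_, ?_, ?_, ?_, ?_, ?_, ?_, ?_, ?_, ?_, ?_⟩
  · intro i j hij
    refine lim (((hT i).mul (hT j)).mul (hT i)) (((hT j).mul (hT i)).mul (hT j)) ?_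
    filter_upwards [hrep] with h ⟨t', hr⟩ using hr.braid i j hij
  · intro i j hij
    refine lim ((hT i).mul (hT j)) ((hT j).mul (hT i)) ?_
    filter_upwards [hrep] with h ⟨t', hr⟩ using hr.tt_comm i j hij
  · intro i j hij
    refine lim ((hE i).mul (hE j)) ((hE j).mul (hE i)) ?_
    filter_upwards [hrep] with h ⟨t', hr⟩ using hr.ee_comm i j hij
  · intro i j hij
    refine lim ((hT i).mul (hE j)) ((hE j).mul (hT i)) ?_
    filter_upwards [hrep] with h ⟨t', hr⟩ using hr.te_comm i j hij
  · intro i j hij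
    refine lim (((hE i).mul (hE j)).mul (hE i)) (hE i) ?_
    filter_upwards [hrep] with h ⟨t', hr⟩ using hr.eee i j hij
  · intro i
    refine lim ((hT i).mul (hT' i)) tendsto_const_nhds ?_
    filter_upwards [hrep] with h ⟨t', hr⟩
    rw [← hr.skein i, sub_sub_cancel, hr.mul_inv]
  · intro i
    refine lim ((hE i).mul (hT i)) (y := e i) (by simpa using ha.smul (hE i)) ?_
    filter_upwards [hrep] with h ⟨t', hr⟩ using hr.e_mul_t i
  · intro i
    refine lim ((hT i).mul (hE i)) (y := e i) (by simpa using ha.smul (hE i)) ?_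
    filter_upwards [hrep] with h ⟨t', hr⟩ using hr.t_mul_e i
  · intro i
    refine lim ((hE i).mul (hE i)) (hτ'.smul (hE i)) ?_
    filter_upwards [hrep] with h ⟨t', hr⟩ using hr.e_sq i
  · intro i j hij
    refine lim (((hE i).mul (hT j)).mul (hE i)) (y := e i) (by simpa using ha'.smul (hE i)) ?_
    filter_upwards [hrep] with h ⟨t', hr⟩ using hr.ete i j hij
  · intro i j hij
    refine lim (((hT j).mul (hT i)).mul (hE j)) ((hE i).mul (hE j)) ?_
    filter_upwards [hrep] with h ⟨t', hr⟩ using hr.tte i j hij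
  · intro i j hij
    refine lim (((hE i).mul (hT j)).mul (hT i)) ((hE i).mul (hE j)) ?_
    filter_upwards [hrep] with h ⟨t', hr⟩ using hr.ett i j hij

end Limit

/-! ### The representation on link patterns -/

namespace Pattern
variable {m : ℕ}

/-- The action of `e_i` refers only to the two marked points and their partners, so it is
equivariant under relabelling. The commutation of distant `t_i`, `e_j` and the transfer of `e_i` to
`e_j` by two exchanges are instances. -/
theorem conj_actE (π : Pattern m) (g : Equiv.Perm (Fin (2 * m))) {i j : Fin (2 * m - 1)}
    (h1 : g (lo i) = lo j) (h2 : g (hi i) = hi j) :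
    (π.actE i).conj g = (π.conj g).actE j := by
  have h3 : (π.conj g).1 (lo j) = g (π.1 (lo i)) := by
    rw [← h1]; simp [conj]
  rw [actE, actE, conj_conj, conj_conj, h3, ← h2, Equiv.mul_swap_eq_swap_mul]

theorem conj_linked (π : Pattern m) (g : Equiv.Perm (Fin (2 * m))) {i j : Fin (2 * m - 1)}
    (h1 : g (lo i) = lo j) (h2 : g (hi i) = hi j) :
    (π.conj g).1 (lo j) = hi j ↔ π.1 (lo i) = hi i := by
  have h3 : (π.conj g).1 (lo j) = g (π.1 (lo i)) := by
    rw [← h1]; simp [conj]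
  rw [h3, ← h2, g.injective.eq_iff]

theorem actT_actE (π : Pattern m) (i : Fin (2 * m - 1)) : (π.actE i).actT i = π.actE i :=
  actT_of_linked _ _ ((linked_iff _ _).2 (actE_linked _ _))

theorem actE_actE (π : Pattern m) (i : Fin (2 * m - 1)) : (π.actE i).actE i = π.actE i :=
  actE_of_linked _ _ (actE_linked _ _)

theorem swap_lo_hi_of_far {i j : Fin (2 * m - 1)} (h : Far i j) :
    Equiv.swap (lo i) (hi i) (lo j) = lo j ∧ Equiv.swap (lo i) (hi i) (hi j) = hi j := by
  have h' : i.val + 2 ≤ j.val ∨ j.val + 2 ≤ i.val := h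
  constructor <;> refine Equiv.swap_apply_of_ne_of_ne ?_ ?_ <;>
    simp only [lo, hi, ne_eq, Fin.mk.injEq] <;> omega

theorem actE_actT_of_far (π : Pattern m) {i j : Fin (2 * m - 1)} (h : Far i j) :
    (π.actE j).actT i = (π.actT i).actE j :=
  conj_actE _ _ (swap_lo_hi_of_far h).1 (swap_lo_hi_of_far h).2

theorem swap_mul_swap_of_adj {i j : Fin (2 * m - 1)} (h : Adj i j) :
    (Equiv.swap (lo i) (hi i) * Equiv.swap (lo j) (hi j)) (lo i) = lo j ∧
      (Equiv.swap (lo i) (hi i) * Equiv.swap (lo j) (hi j)) (hi i) = hi j := by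
  have h' : i.val + 1 = j.val ∨ j.val + 1 = i.val := h
  constructor <;> apply Fin.ext <;> rw [Equiv.Perm.mul_apply, swap_val, swap_val]
  · change sN i (sN j i) = j
    unfold sN; split_ifs <;> omega
  · change sN i (sN j (i + 1)) = j + 1
    unfold sN; split_ifs <;> omega

theorem actT_actT_actE (π : Pattern m) {i j : Fin (2 * m - 1)} (h : Adj i j) :
    ((π.actE i).actT j).actT i = ((π.actT j).actT i).actE j := by
  have := conj_actE π _ (swap_mul_swap_of_adj h).1 (swap_mul_swap_of_adj h).2
  rwa [← conj_conj, ← conj_conj] at this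

theorem actT_actT_linked (π : Pattern m) {i j : Fin (2 * m - 1)} (h : Adj i j) :
    ((π.actT j).actT i).1 (lo j) = hi j ↔ π.1 (lo i) = hi i := by
  have := conj_linked π _ (swap_mul_swap_of_adj h).1 (swap_mul_swap_of_adj h).2
  rwa [← conj_conj] at this

theorem not_linked_of_adj {π : Pattern m} {i j : Fin (2 * m - 1)} (h : Adj i j)
    (hi : π.nv i = i + 1) : π.nv j ≠ j + 1 := by
  have h' : i.val + 1 = j.val ∨ j.val + 1 = i.val := h
  intro hj
  have h1 := π.nv_nv i
  have h2 := π.nv_nv j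
  rw [hi] at h1
  rw [hj] at h2
  rcases h' with h' | h'
  · rw [h', hj] at h1; omega
  · rw [h', hi] at h2; omega

/-- Both sides slide the small link at `i` over the neighbouring point. -/
theorem actE_eq_actT_actT {π : Pattern m} {i j : Fin (2 * m - 1)} (h : Adj i j)
    (hi : π.nv i = i + 1) : π.actE j = (π.actT j).actT i := by
  have h' : i.val + 1 = j.val ∨ j.val + 1 = i.val := h
  have hil := i.2
  have hjl := j.2
  have h1 := π.nv_nv i
  rw [hi] at h1
  apply ext_nv
  intro k hk
  have hsk : sN i k < 2 * m := sN_lt (by omega) hk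
  rw [nv_actE _ _ hk, nv_actT _ _ hk, nv_actT _ _ hsk]
  have k0 := π.nv_nv k
  have inj : ∀ l, π.nv k = l ↔ k = π.nv l := fun l =>
    ⟨fun h => by rw [← h, nv_nv], fun h => by rw [h, nv_nv]⟩
  rcases h' with h' | h'
  · rw [← h', h1]
    have e2 := π.nv_ne (k := i + 1 + 1) (by omega)
    have e3 : π.nv (i + 1 + 1) ≠ i := fun e => by
      rw [← e, nv_nv] at hi; omega
    have e4 : π.nv (i + 1 + 1) ≠ i + 1 := fun e => by
      rw [← e, nv_nv] at h1; omega
    rcases eq_or_ne k i with rfl | k1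
    · rw [sN_left, sN_left, sN_of_ne (k := π.nv (i + 1 + 1)) e4 e2, sN_of_ne e3 e4,
        if_neg (by omega), if_neg (by omega), if_pos rfl]
    rcases eq_or_ne k (i + 1) with rfl | k2
    · rw [sN_right, sN_of_ne (k := i.val) (by omega) (by omega), hi, sN_left,
        sN_of_ne (by omega) (by omega), if_pos rfl]
    rw [sN_of_ne (k := k) k1 k2]
    rcases eq_or_ne k (i + 1 + 1) with rfl | k3
    · rw [sN_right, h1, sN_of_ne (k := i.val) (by omega) (by omega), sN_left, if_neg (by omega),
        if_pos rfl]
    rw [sN_of_ne (k := k) k2 k3, if_neg k2, if_neg k3, if_neg k1]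
    have f1 := inj i
    have f2 := inj (i + 1)
    have f3 := inj (i + 1 + 1)
    rw [hi] at f1
    rw [h1] at f2
    split_ifs with k4
    · rw [f3.2 k4, sN_right, sN_right]
    · rw [sN_of_ne (j := i + 1) (by omega) (by omega), sN_of_ne (by omega) (by omega)]
  · have hi' : π.nv (j + 1) = j + 1 + 1 := by rw [h', hi]
    have h1' : π.nv (j + 1 + 1) = j + 1 := by rw [h', h1]
    rw [← h', hi']
    have e2 := π.nv_ne (k := j) (by omega)
    have e3 : π.nv j ≠ j + 1 := fun e => by
      rw [← e, nv_nv] at hi'; omega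
    have e4 : π.nv j ≠ j + 1 + 1 := fun e => by
      rw [← e, nv_nv] at h1'; omega
    rcases eq_or_ne k (j + 1 + 1) with rfl | k1
    · rw [sN_right, sN_right, sN_of_ne (k := π.nv j) e2 e3, sN_of_ne e3 e4,
        if_neg (by omega), if_neg (by omega), if_neg (Ne.symm e4), if_pos rfl]
    rcases eq_or_ne k (j + 1) with rfl | k2
    · rw [sN_left, sN_of_ne (k := j.val + 1 + 1) (by omega) (by omega), h1', sN_right,
        sN_of_ne (by omega) (by omega), if_neg (by omega), if_pos rfl]
    rw [sN_of_ne (k := k) k2 k1]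
    rcases eq_or_ne k j with rfl | k3
    · rw [sN_left, hi', sN_of_ne (k := j.val + 1 + 1) (by omega) (by omega), sN_right, if_pos rfl]
    rw [sN_of_ne (k := k) k3 k2, if_neg k3, if_neg k2]
    have f1 := inj j
    have f2 := inj (j + 1)
    have f3 := inj (j + 1 + 1)
    rw [hi'] at f2
    rw [h1'] at f3
    split_ifs with k4
    · rw [f1.2 k4, sN_left, sN_left]
    · rw [sN_of_ne (j := j.val) (k := π.nv k) (by omega) (by omega),
        sN_of_ne (by omega) (by omega)]

theorem actE_linked_iff (π : Pattern m) {i j : Fin (2 * m - 1)} (h : Far i j) :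
    (π.actE j).nv i = i + 1 ↔ π.nv i = i + 1 ∨ (π.nv i = j ∧ π.nv (i + 1) = j + 1) ∨
      (π.nv i = j + 1 ∧ π.nv (i + 1) = j) := by
  have h' : i.val + 2 ≤ j.val ∨ j.val + 2 ≤ i.val := h
  have hil := i.2
  have hjl := j.2
  rw [nv_actE _ _ (by omega), if_neg (by omega), if_neg (by omega)]
  have f : ∀ k l, π.nv k = l ↔ k = π.nv l := fun k l =>
    ⟨fun h => by rw [← h, nv_nv], fun h => by rw [h, nv_nv]⟩
  have f1 := f i j
  have f2 := f i (j + 1)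
  have f3 := f (i + 1) j
  have f4 := f (i + 1) (j + 1)
  split_ifs <;> omega

theorem actE_comm_of_linked (π : Pattern m) {i j : Fin (2 * m - 1)} (h : Far i j)
    (hij : π.nv i = j) : (π.actE j).actE i = (π.actE i).actE j := by
  have h' : i.val + 2 ≤ j.val ∨ j.val + 2 ≤ i.val := h
  have hil := i.2
  have hjl := j.2
  have hji : π.nv j = i := by rw [← hij, nv_nv]
  have n2 := π.nv_ne (k := i + 1) (by omega)
  have n4 := π.nv_ne (k := j + 1) (by omega)
  have ne : ∀ {k l}, k ≠ l → π.nv k ≠ π.nv l := fun h h' => h (π.nv_inj h')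
  have v1 : π.nv (i + 1) ≠ i := hji ▸ ne (by omega)
  have v2 : π.nv (i + 1) ≠ j := hij ▸ ne (by omega)
  have w1 : π.nv (j + 1) ≠ i := hji ▸ ne (by omega)
  have w2 : π.nv (j + 1) ≠ j := hij ▸ ne (by omega)
  have vw : π.nv (i + 1) = j + 1 ↔ π.nv (j + 1) = i + 1 :=
    ⟨fun h => by rw [← h, nv_nv], fun h => by rw [← h, nv_nv]⟩
  have a0 : ∀ {k}, k < 2 * m → (π.actE j).nv k = if k = j then j.val + 1 else
      if k = j + 1 then j.val else
      if k = i then π.nv (j + 1) else if k = π.nv (j + 1) then i.val else π.nv k := by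
    intro k hk
    rw [nv_actE _ _ hk, hji]
  have b0 : ∀ {k}, k < 2 * m → (π.actE i).nv k = if k = i then i.val + 1 else
      if k = i + 1 then i.val else
      if k = j then π.nv (i + 1) else if k = π.nv (i + 1) then j.val else π.nv k := by
    intro k hk
    rw [nv_actE _ _ hk, hij]
  have ai : (π.actE j).nv i = π.nv (j + 1) := by
    rw [a0 (by omega), if_neg (by omega), if_neg (by omega), if_pos rfl]
  have bj : (π.actE i).nv j = π.nv (i + 1) := by
    rw [b0 (by omega), if_neg (by omega), if_neg (by omega), if_pos rfl]
  have ai' : (π.actE j).nv (i + 1) = if i + 1 = π.nv (j + 1) then i.val else π.nv (i + 1) := by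
    rw [a0 (by omega), if_neg (by omega), if_neg (by omega), if_neg (by omega)]
  have bj' : (π.actE i).nv (j + 1) = if j + 1 = π.nv (i + 1) then j.val else π.nv (j + 1) := by
    rw [b0 (by omega), if_neg (by omega), if_neg (by omega), if_neg (by omega)]
  apply ext_nv
  intro k hk
  rw [nv_actE (π.actE j) i hk, nv_actE (π.actE i) j hk, ai, ai', bj, bj', a0 hk, b0 hk]
  clear a0 b0 ai bj ai' bj'
  by_cases c1 : k = i
  · subst c1; rw [if_pos rfl, if_pos rfl, if_neg (by omega), if_neg (by omega)]; split_ifs <;> omega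
  by_cases c2 : k = i + 1
  · subst c2
    rw [if_neg c1, if_pos rfl, if_neg (by omega), if_neg (by omega), if_neg c1, if_pos rfl]
    split_ifs <;> omega
  by_cases c3 : k = j
  · subst c3
    rw [if_pos rfl, if_neg c1, if_neg c2, if_pos rfl]; split_ifs <;> omega
  by_cases c4 : k = j + 1
  · subst c4
    rw [if_neg c3, if_pos rfl, if_neg c1, if_neg c2, if_neg c3, if_pos rfl]; split_ifs <;> omega
  rw [if_neg c1, if_neg c2, if_neg c3, if_neg c4, if_neg c1, if_neg c2, if_neg c3, if_neg c4]
  split_ifs <;> omega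

theorem actE_comm_of_not_linked (π : Pattern m) {i j : Fin (2 * m - 1)} (h : Far i j)
    (h1 : π.nv i ≠ j) (h2 : π.nv i ≠ j + 1) (h3 : π.nv (i + 1) ≠ j) : (π.actE j).actE i = (π.actE i).actE j := by
  have h' : i.val + 2 ≤ j.val ∨ j.val + 2 ≤ i.val := h
  have hil := i.2
  have hjl := j.2
  have ne : ∀ {k l}, π.nv k ≠ l → k ≠ π.nv l := fun h h' => h (by rw [h', nv_nv])
  have e1 : (π.actE j).1 (lo i) = π.1 (lo i) := by
    apply Fin.ext
    rw [← nv_fin, ← nv_fin]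
    change (π.actE j).nv i = π.nv i
    rw [nv_actE _ _ (by omega), if_neg (by omega), if_neg (by omega), if_neg fun e => h1 (by rw [e, nv_nv]),
      if_neg fun e => h2 (by rw [e, nv_nv])]
  have e2 : (π.actE i).1 (lo j) = π.1 (lo j) := by
    apply Fin.ext
    rw [← nv_fin, ← nv_fin]
    change (π.actE i).nv j = π.nv j
    rw [nv_actE _ _ (by omega), if_neg (by omega), if_neg (by omega), if_neg h1.symm,
      if_neg h3.symm]
  have d1 : hi i ≠ hi j := by simp only [hi, ne_eq, Fin.mk.injEq]; omega
  have d2 : hi i ≠ π.1 (lo j) := fun e => ne h3 (by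
    have := congrArg Fin.val e
    rw [← nv_fin] at this
    exact this)
  have d3 : π.1 (lo i) ≠ hi j := fun e => h2 (by
    have := congrArg Fin.val e
    rw [← nv_fin] at this
    exact this)
  have d4 : π.1 (lo i) ≠ π.1 (lo j) := fun e => by
    have := congrArg Fin.val e
    rw [← nv_fin, ← nv_fin] at this
    have : i.val = j.val := π.nv_inj this
    omega
  have d : Equiv.Perm.Disjoint (Equiv.swap (hi i) (π.1 (lo i))) (Equiv.swap (hi j) (π.1 (lo j))) := by
    intro x
    by_cases x1 : x = hi i
    · exact Or.inr (by rw [x1]; exact Equiv.swap_apply_of_ne_of_ne d1 d2)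
    by_cases x2 : x = π.1 (lo i)
    · exact Or.inr (by rw [x2]; exact Equiv.swap_apply_of_ne_of_ne d3 d4)
    exact Or.inl (Equiv.swap_apply_of_ne_of_ne x1 x2)
  rw [actE, e1, actE, actE, e2, actE, conj_conj, conj_conj, d.commute.eq]

/-- Replacing `π` by `t_i π` or `t_j π` changes neither side, so a link between the two places may
be assumed to join `i` to `j` or `i + 1` to `j`, and again `i` to `j`. Without a link between the
places, the two relabelling transpositions are disjoint. -/
theorem actE_comm (π : Pattern m) {i j : Fin (2 * m - 1)} (h : Far i j) :
    (π.actE j).actE i = (π.actE i).actE j := by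
  have h' : i.val + 2 ≤ j.val ∨ j.val + 2 ≤ i.val := h
  have hil := i.2
  have hjl := j.2
  have ti : ∀ σ : Pattern m, ((σ.actT i).actE j).actE i = (σ.actE j).actE i := fun σ => by
    rw [← actE_actT_of_far _ h, actE_actT]
  have tj : ∀ σ : Pattern m, ((σ.actT j).actE i).actE j = (σ.actE i).actE j := fun σ => by
    rw [← actE_actT_of_far _ (Or.symm h), actE_actT]
  have key : ∀ σ : Pattern m, σ.nv i = j ∨ σ.nv (i + 1) = j →
      (σ.actE j).actE i = (σ.actE i).actE j := by
    rintro σ (h1 | h1)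
    · exact actE_comm_of_linked σ h h1
    · rw [← ti, actE_comm_of_linked _ h, actE_actT]
      rw [nv_actT _ _ (by omega), sN_left, h1, sN_of_ne (by omega) (by omega)]
  by_cases h1 : π.nv i = j ∨ π.nv (i + 1) = j
  · exact key π h1
  by_cases h2 : π.nv i = j + 1 ∨ π.nv (i + 1) = j + 1
  · rw [← tj, ← key, actE_actT]
    rw [nv_actT _ _ (by omega), nv_actT _ _ (by omega),
      sN_of_ne (j := j.val) (k := i.val) (by omega) (by omega),
      sN_of_ne (j := j.val) (k := i.val + 1) (by omega) (by omega)]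
    rcases h2 with h2 | h2
    · left; rw [h2, sN_right]
    · right; rw [h2, sN_right]
  · exact actE_comm_of_not_linked π h (by tauto) (by tauto) (by tauto)

end Pattern

/-- The matrix with the single nonzero entry `w x` in the row `φ x` of the column `x`. -/
def monoMat {α β : Type*} [DecidableEq β] (φ : α → β) (w : α → ℂ) : Matrix β α ℂ :=
  Matrix.of fun y x => if φ x = y then w x else 0

section monoMat
variable {α β γ : Type*} [DecidableEq β] [DecidableEq γ]

theorem monoMat_mul [Fintype β] (φ : β → γ) (ψ : α → β) (w : β → ℂ) (v : α → ℂ) :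
    monoMat φ w * monoMat ψ v = monoMat (fun x => φ (ψ x)) fun x => w (ψ x) * v x := by
  ext z x
  simp only [Matrix.mul_apply, monoMat, Matrix.of_apply, mul_ite, mul_zero]
  rw [Finset.sum_eq_single (ψ x) (fun y _ hy => if_neg (Ne.symm hy)) (by simp)]
  simp

theorem monoMat_mulVec_single [Fintype α] [DecidableEq α] (φ : α → β) (w : α → ℂ) (x : α) :
    (monoMat φ w).mulVec (Pi.single x 1) = w x • Pi.single (φ x) 1 := by
  ext y
  simp only [Matrix.mulVec_single_one, Matrix.col_apply, monoMat, Matrix.of_apply, Pi.smul_apply,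
    smul_eq_mul, Pi.single_apply, mul_ite, mul_one, mul_zero, eq_comm]

theorem monoMat_congr {φ ψ : α → β} {w v : α → ℂ} (h1 : ∀ x, φ x = ψ x) (h2 : ∀ x, w x = v x) :
    monoMat φ w = monoMat ψ v := by
  rw [funext h1, funext h2]

theorem monoMat_id : monoMat (fun x : β => x) (fun _ => 1) = 1 := by
  ext x y
  simp only [monoMat, Matrix.of_apply, Matrix.one_apply, eq_comm]

end monoMat

section rep
variable {m : ℕ}

/-- The weight of the loop in `e_i π`. -/
def loopWeight (τ : ℂ) (i : Fin (2 * m - 1)) (π : Pattern m) : ℂ :=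
  if π.1 (lo i) = hi i then τ else 1

theorem matT_eq (i : Fin (2 * m - 1)) :
    matT i = monoMat (fun π : Pattern m => π.actT i) fun _ => 1 := rfl

theorem matE_eq (τ : ℂ) (i : Fin (2 * m - 1)) :
    matE τ i = monoMat (fun π : Pattern m => π.actE i) (loopWeight τ i) := rfl

theorem loopWeight_congr {n : ℕ} {τ : ℂ} {i : Fin (2 * m - 1)} {j : Fin (2 * n - 1)}
    {π : Pattern m} {σ : Pattern n}
    (h : π.1 (lo i) = hi i ↔ σ.1 (lo j) = hi j) : loopWeight τ i π = loopWeight τ j σ :=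
  if_congr h rfl rfl

theorem loopWeight_actE {τ : ℂ} (i : Fin (2 * m - 1)) (π : Pattern m) :
    loopWeight τ i (π.actE i) = τ :=
  if_pos ((Pattern.linked_iff _ _).2 (π.actE_linked i))

theorem loopWeight_of_adj {τ : ℂ} {i j : Fin (2 * m - 1)} (h : Adj i j) (π : Pattern m) :
    loopWeight τ j (π.actE i) = 1 :=
  if_neg fun h' => Pattern.not_linked_of_adj h (π.actE_linked i) ((Pattern.linked_iff _ _).1 h')

/-- Both orders close the same number of loops: the second generator closes one if its points were
linked already, or if two links join the two places. -/
theorem loopWeight_actE_mul {τ : ℂ} {i j : Fin (2 * m - 1)} (h : Far i j) (π : Pattern m) :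
    loopWeight τ i (π.actE j) * loopWeight τ j π =
      loopWeight τ j (π.actE i) * loopWeight τ i π := by
  have f : ∀ k l, π.nv k = l ↔ π.nv l = k := fun k l =>
    ⟨fun h => by rw [← h, Pattern.nv_nv], fun h => by rw [← h, Pattern.nv_nv]⟩
  unfold loopWeight
  simp only [Pattern.linked_iff, Pattern.actE_linked_iff π h,
    Pattern.actE_linked_iff π (Or.symm h : Far j i), f i j, f i (j + 1), f (i + 1) j,
    f (i + 1) (j + 1)]
  have h' : i.val + 2 ≤ j.val ∨ j.val + 2 ≤ i.val := h
  by_cases a : π.nv i = i + 1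
  · by_cases b : π.nv j = j + 1
    · simp only [a, b, true_or, if_true]
    · have h1 := f i (i + 1)
      have : ¬ ((π.nv j = i ∧ π.nv (j + 1) = i + 1) ∨ π.nv j = i + 1 ∧ π.nv (j + 1) = i) := by
        have := f j i
        have := f j (i + 1)
        omega
      have h2 : (π.nv (j + 1) = i ∧ π.nv j = i + 1 ↔ π.nv j = i + 1 ∧ π.nv (j + 1) = i) := by tauto
      simp only [a, b, true_or, if_true, false_or, this, if_false, mul_one, one_mul]
  · by_cases b : π.nv j = j + 1
    · have : ¬ ((π.nv j = i ∧ π.nv (j + 1) = i + 1) ∨ π.nv (j + 1) = i ∧ π.nv j = i + 1) := by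
        omega
      simp only [a, b, true_or, if_true, false_or, if_false, mul_one]
      rw [if_neg (by rw [b] at this; omega)]
      ring
    · simp only [a, b, false_or, if_false, mul_one]
      exact if_congr (by tauto) rfl rfl

theorem matE_mul_matE_of_adj (τ : ℂ) {i j : Fin (2 * m - 1)} (h : Adj i j) :
    matE τ j * matE τ i = matT i * matT j * matE τ i := by
  simp only [matT_eq, matE_eq, monoMat_mul]
  refine monoMat_congr (fun π => Pattern.actE_eq_actT_actT h (π.actE_linked i)) fun π => ?_
  rw [loopWeight_of_adj h, one_mul, one_mul, one_mul]

theorem matE_mul_matT_mul_matT (τ : ℂ) {i j : Fin (2 * m - 1)} (h : Adj i j) :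
    matE τ j * matT i * matT j = matT i * matT j * matE τ i := by
  simp only [matT_eq, matE_eq, monoMat_mul]
  refine monoMat_congr (fun π => (Pattern.actT_actT_actE π h).symm) fun π => ?_
  rw [one_mul, one_mul, mul_one, mul_one]
  exact loopWeight_congr (Pattern.actT_actT_linked π h)

/-- The geometric content is in the relations between exchanges and in sliding a small link. The
relations e_i e_j e_i = e_i and e_i t_j e_i = e_i follow from these formally, with t_i² = 1 and e_i
t_i = e_i. -/
theorem isBrauerRep_pattern (m : ℕ) (τ : ℂ) :
    IsBrauerRep (n := 2 * m) τ (matT (m := m)) (matE τ) := by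
  have sq : ∀ i : Fin (2 * m - 1), matT i * matT i = (1 : Matrix (Pattern m) (Pattern m) ℂ) := by
    intro i
    rw [matT_eq, monoMat_mul, ← monoMat_id]
    exact monoMat_congr (fun π => π.actT_actT i) fun _ => mul_one _
  have et : ∀ i : Fin (2 * m - 1), matE τ i * matT i = matE τ i := by
    intro i
    rw [matT_eq, matE_eq, monoMat_mul]
    refine monoMat_congr (fun π => π.actE_actT i) fun π => ?_
    rw [mul_one]
    refine loopWeight_congr ⟨fun h => ?_, fun h => ?_⟩
    · have := Pattern.actT_of_linked _ _ h
      rw [Pattern.actT_actT] at this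
      rwa [this]
    · rwa [Pattern.actT_of_linked _ _ h]
  have tte : ∀ i j : Fin (2 * m - 1), Adj i j → matT j * matT i * matE τ j = matE τ i * matE τ j :=
    fun i j h => (matE_mul_matE_of_adj τ (Or.symm h)).symm
  have eee : ∀ i j : Fin (2 * m - 1), Adj i j → matE τ i * matE τ j * matE τ i = matE τ i := by
    intro i j h
    rw [← tte i j h, mul_assoc, ← tte j i (Or.symm h), mul_assoc (matT i), ← mul_assoc,
      mul_assoc (matT j), sq, mul_one, ← mul_assoc, sq, one_mul]
  refine ⟨?_, ?_, ?_, ?_, eee, sq, et, ?_, ?_, ?_, tte, ?_⟩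
  · intro i j h
    simp only [matT_eq, monoMat_mul]
    exact monoMat_congr (fun π => π.actT_braid h) fun _ => rfl
  · intro i j h
    simp only [matT_eq, monoMat_mul]
    exact monoMat_congr (fun π => π.actT_comm (Or.symm h)) fun _ => rfl
  · intro i j h
    simp only [matE_eq, monoMat_mul]
    exact monoMat_congr (fun π => π.actE_comm h) fun π => loopWeight_actE_mul h π
  · intro i j h
    simp only [matT_eq, matE_eq, monoMat_mul]
    refine monoMat_congr (fun π => π.actE_actT_of_far h) fun π => ?_
    rw [one_mul, mul_one]
    exact loopWeight_congr (Pattern.conj_linked π _ (Pattern.swap_lo_hi_of_far h).1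
      (Pattern.swap_lo_hi_of_far h).2).symm
  · intro i
    simp only [matT_eq, matE_eq, monoMat_mul]
    exact monoMat_congr (fun π => π.actT_actE i) fun _ => one_mul _
  · intro i
    simp only [matE_eq, monoMat_mul]
    ext σ π
    simp only [monoMat, Matrix.of_apply, Matrix.smul_apply, Pattern.actE_actE, loopWeight_actE,
      smul_eq_mul, mul_ite, mul_zero]
  · intro i j h
    calc matE τ i * matT j * matE τ i = matE τ i * matT i * matT j * matE τ i := by rw [et]
      _ = matE τ i * (matT i * matT j * matE τ i) := by simp only [mul_assoc]
      _ = matE τ i := by rw [tte j i (Or.symm h), ← mul_assoc, eee i j h]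
  · intro i j h
    rw [matE_mul_matT_mul_matT τ (Or.symm h), tte i j h]

end rep

/-! ### The generators of the Brauer algebra, numbered by the natural numbers -/

namespace Brauer

/-- The generator `t_i`, or `1` if the index is out of range. -/
def tN (n : ℕ) (τ : ℂ) (i : ℕ) : Brauer n τ := if h : i < n - 1 then Brauer.t τ ⟨i, h⟩ else 1

/-- The generator `e_i`, or `1` if the index is out of range. -/
def eN (n : ℕ) (τ : ℂ) (i : ℕ) : Brauer n τ := if h : i < n - 1 then Brauer.e τ ⟨i, h⟩ else 1

variable {n : ℕ} {τ : ℂ}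

theorem isBrauerRep (n : ℕ) (τ : ℂ) : IsBrauerRep (n := n) τ (Brauer.t τ) (Brauer.e τ) :=
  isBrauerRep_hom (AlgHom.id ℂ (Brauer n τ))

theorem tN_of_lt {i : ℕ} (h : i < n - 1) : tN n τ i = Brauer.t τ ⟨i, h⟩ := dif_pos h
theorem eN_of_lt {i : ℕ} (h : i < n - 1) : eN n τ i = Brauer.e τ ⟨i, h⟩ := dif_pos h

theorem commute_tN_tN {i j : ℕ} (h : i + 2 ≤ j ∨ j + 2 ≤ i) : Commute (tN n τ i) (tN n τ j) := by
  unfold tN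
  split_ifs with h1 h2
  · exact (isBrauerRep n τ).tt_comm _ _ h
  · exact Commute.one_right _
  all_goals exact Commute.one_left _

theorem commute_eN_tN {i j : ℕ} (h : i + 2 ≤ j ∨ j + 2 ≤ i) : Commute (eN n τ i) (tN n τ j) := by
  unfold tN eN
  split_ifs with h1 h2
  · exact ((isBrauerRep n τ).te_comm ⟨j, h2⟩ ⟨i, h1⟩ (Or.symm h)).symm
  · exact Commute.one_right _
  all_goals exact Commute.one_left _

theorem commute_eN_eN {i j : ℕ} (h : i + 2 ≤ j ∨ j + 2 ≤ i) : Commute (eN n τ i) (eN n τ j) := by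
  unfold eN
  split_ifs with h1 h2
  · exact (isBrauerRep n τ).ee_comm _ _ h
  · exact Commute.one_right _
  all_goals exact Commute.one_left _

theorem tN_sq (i : ℕ) : tN n τ i * tN n τ i = 1 := by
  unfold tN
  split_ifs with h
  · exact (isBrauerRep n τ).t_sq _
  · exact one_mul _

theorem tN_tN_mul (i : ℕ) (y : Brauer n τ) : tN n τ i * (tN n τ i * y) = y := by
  rw [← mul_assoc, tN_sq, one_mul]

theorem tN_mul_eN {i : ℕ} (h : i < n - 1) : tN n τ i * eN n τ i = eN n τ i := by
  rw [tN_of_lt h, eN_of_lt h, (isBrauerRep n τ).t_mul_e]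

theorem eN_sq {i : ℕ} (h : i < n - 1) : eN n τ i * eN n τ i = τ • eN n τ i := by
  rw [eN_of_lt h, (isBrauerRep n τ).e_sq]

section adj
variable {i : ℕ} (h : i + 1 < n - 1)
include h

theorem tN_braid : tN n τ i * tN n τ (i + 1) * tN n τ i =
    tN n τ (i + 1) * tN n τ i * tN n τ (i + 1) := by
  rw [tN_of_lt h, tN_of_lt (i := i) (by omega)]
  exact (isBrauerRep n τ).braid _ _ (Or.inl rfl)

theorem tN_tN_eN : tN n τ i * tN n τ (i + 1) * eN n τ i = eN n τ (i + 1) * eN n τ i := by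
  rw [tN_of_lt h, tN_of_lt (i := i) (by omega), eN_of_lt h, eN_of_lt (i := i) (by omega)]
  exact (isBrauerRep n τ).tte _ _ (Or.inr rfl)

theorem tN_tN_eN' : tN n τ (i + 1) * tN n τ i * eN n τ (i + 1) = eN n τ i * eN n τ (i + 1) := by
  rw [tN_of_lt h, tN_of_lt (i := i) (by omega), eN_of_lt h, eN_of_lt (i := i) (by omega)]
  exact (isBrauerRep n τ).tte _ _ (Or.inl rfl)

theorem eN_tN_eN : eN n τ i * tN n τ (i + 1) * eN n τ i = eN n τ i := by
  rw [tN_of_lt h, eN_of_lt (i := i) (by omega)]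
  exact (isBrauerRep n τ).ete _ _ (Or.inl rfl)

theorem eN_succ : eN n τ (i + 1) =
    tN n τ i * tN n τ (i + 1) * eN n τ i * tN n τ (i + 1) * tN n τ i := by
  have h1 : eN n τ (i + 1) * tN n τ i * tN n τ (i + 1) = eN n τ (i + 1) * eN n τ i := by
    rw [tN_of_lt h, tN_of_lt (i := i) (by omega), eN_of_lt h, eN_of_lt (i := i) (by omega)]
    exact (isBrauerRep n τ).ett _ _ (Or.inr rfl)
  rw [tN_tN_eN h, ← h1, mul_assoc _ (tN n τ (i + 1)) (tN n τ (i + 1)), tN_sq, mul_one, mul_assoc,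
    tN_sq, mul_one]

end adj

/-- The product `e_0 e_2 ⋯ e_{2 k - 2}`. -/
def alphaN (n : ℕ) (τ : ℂ) (k : ℕ) : Brauer n τ :=
  ((List.range k).map fun i => eN n τ (2 * i)).prod

theorem alphaN_succ (k : ℕ) : alphaN n τ (k + 1) = alphaN n τ k * eN n τ (2 * k) := by
  simp [alphaN, List.range_succ]

theorem alpha_eq (m : ℕ) : alpha (2 * m) τ = alphaN (2 * m) τ m := by
  have h : ((List.finRange (2 * m - 1)).filter fun i => i.val % 2 = 0).map Fin.val =
      (List.range m).map fun i => 2 * i := by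
    refine List.Perm.eq_of_pairwise (le := (· < ·)) (fun a b _ _ h1 h2 => ?_) ?_ ?_ ?_
    · exact absurd h1 (lt_asymm h2)
    · rw [List.pairwise_map]
      exact (List.pairwise_lt_finRange _).filter _
    · rw [List.pairwise_map]
      exact List.pairwise_lt_range.imp fun h => by omega
    · rw [List.perm_ext_iff_of_nodup]
      · intro a
        simp only [List.mem_map, List.mem_filter, List.mem_finRange, true_and, decide_eq_true_eq,
          List.mem_range]
        constructor
        · rintro ⟨i, hi, rfl⟩
          have := i.2
          exact ⟨i / 2, by omega, by omega⟩
        · rintro ⟨i, hi, rfl⟩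
          exact ⟨⟨2 * i, by omega⟩, by simp, rfl⟩
      · exact ((List.nodup_finRange _).filter _).map Fin.val_injective
      · exact List.nodup_range.map fun a b h => by simpa using h
  have h2 : (fun i : Fin (2 * m - 1) => Brauer.e τ i) = eN (2 * m) τ ∘ Fin.val := by
    funext i
    rw [Function.comp_apply, eN_of_lt i.2]
  rw [alpha, alphaN, show Brauer.e τ = _ from h2, ← List.map_map, h, List.map_map]
  rfl

theorem exists_alphaN_eq {k l : ℕ} (h : l < k) :
    ∃ y, alphaN n τ k = eN n τ (2 * l) * y := by
  induction k with
  | zero => omega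
  | succ k ih =>
    rw [alphaN_succ]
    rcases eq_or_ne l k with rfl | hne
    · refine ⟨alphaN n τ l, ?_⟩
      have : Commute (eN n τ (2 * l)) (alphaN n τ l) := by
        refine Commute.list_prod_right _ _ fun x hx => ?_
        obtain ⟨i, hi, rfl⟩ := List.mem_map.1 hx
        rw [List.mem_range] at hi
        exact commute_eN_eN (Or.inr (by omega))
      exact this.eq.symm
    · obtain ⟨y, hy⟩ := ih (by omega)
      exact ⟨y * eN n τ (2 * k), by rw [hy, mul_assoc]⟩

/-- The product `t_{a + d - 1} ⋯ t_{a + 1} t_a`. -/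
def tw (n : ℕ) (τ : ℂ) (a : ℕ) : ℕ → Brauer n τ
  | 0 => 1
  | d + 1 => tN n τ (a + d) * tw n τ a d

theorem commute_tw {x : Brauer n τ} {a d : ℕ}
    (h : ∀ k, a ≤ k → k < a + d → Commute x (tN n τ k)) : Commute x (tw n τ a d) := by
  induction d with
  | zero => exact Commute.one_right _
  | succ d ih =>
    exact (h _ (by omega) (by omega)).mul_right (ih fun k h1 h2 => h k h1 (by omega))

theorem tw_succ' (a d : ℕ) : tw n τ a (d + 1) = tw n τ (a + 1) d * tN n τ a := by
  induction d with
  | zero => simp [tw]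
  | succ d ih =>
    rw [tw, ih, tw, mul_assoc, show a + 1 + d = a + (d + 1) by omega]

/-- One braid relation inside the descending word lets the generator pass, with its index raised by
one; all other letters commute with it. -/
theorem tN_mul_tw {a d i : ℕ} (h1 : a ≤ i) (h2 : i + 1 < a + d) (h3 : a + d ≤ n - 1) :
    tN n τ i * tw n τ a d = tw n τ a d * tN n τ (i + 1) := by
  induction d with
  | zero => omega
  | succ d ih =>
    rcases lt_or_ge (i + 1) (a + d) with h | h
    · rw [tw, ← mul_assoc, (commute_tN_tN (i := i) (j := a + d) (by omega)).eq, mul_assoc,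
        ih h (by omega), mul_assoc]
    · obtain ⟨d, rfl⟩ : ∃ d', d = d' + 1 := ⟨d - 1, by omega⟩
      obtain rfl : i = a + d := by omega
      have hc : Commute (tN n τ (a + d + 1)) (tw n τ a d) :=
        commute_tw fun k _ h => commute_tN_tN (by omega)
      rw [tw, tw, show a + (d + 1) = a + d + 1 by omega, mul_assoc, mul_assoc, ← hc.eq,
        ← mul_assoc, ← mul_assoc, tN_braid (by omega), mul_assoc, mul_assoc]

/-! ### A finite spanning set of the left ideal -/

open Classical in
/-- Words in the `t_i`, applied to `α`, that give the link patterns in which the first points are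
linked as in `α`. -/
def basisWords (m : ℕ) (τ : ℂ) : ℕ → Finset (Brauer (2 * m) τ)
  | 0 => {alphaN (2 * m) τ m}
  | r + 1 => (Finset.range (2 * r + 1) ×ˢ basisWords m τ r).image fun p =>
      tw (2 * m) τ (2 * (m - (r + 1)) + 1) p.1 * p.2

/-- The span of `basisWords`. -/
def basisSpan (m : ℕ) (τ : ℂ) (r : ℕ) : Submodule ℂ (Brauer (2 * m) τ) :=
  Submodule.span ℂ (basisWords m τ r)

theorem card_basisWords_le (m : ℕ) (r : ℕ) :
    (basisWords m τ r).card ≤ ∏ k ∈ Finset.range r, (2 * k + 1) := by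
  classical
  induction r with
  | zero => simp [basisWords]
  | succ r ih =>
    rw [Finset.prod_range_succ, mul_comm (Finset.prod _ _), basisWords]
    refine Finset.card_image_le.trans ?_
    rw [Finset.card_product, Finset.card_range]
    exact Nat.mul_le_mul_left _ ih

section basisSpan
variable {m r : ℕ}

theorem tw_mul_mem_basisSpan {d : ℕ} (hd : d < 2 * r + 1) {y : Brauer (2 * m) τ}
    (hy : y ∈ basisSpan m τ r) :
    tw (2 * m) τ (2 * (m - (r + 1)) + 1) d * y ∈ basisSpan m τ (r + 1) := by
  classical
  induction hy using Submodule.span_induction with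
  | mem y hy =>
    refine Submodule.subset_span ?_
    rw [basisWords]
    exact Finset.mem_coe.2 (Finset.mem_image.2
      ⟨(d, y), Finset.mem_product.2 ⟨Finset.mem_range.2 hd, hy⟩, rfl⟩)
  | zero => rw [mul_zero]; exact zero_mem _
  | add x y _ _ hx hy => rw [mul_add]; exact add_mem hx hy
  | smul c x _ hx => rw [mul_smul_comm]; exact Submodule.smul_mem _ _ hx

theorem basisSpan_succ_le {V : Submodule ℂ (Brauer (2 * m) τ)}
    (h : ∀ d < 2 * r + 1, ∀ y ∈ basisSpan m τ r,
      tw (2 * m) τ (2 * (m - (r + 1)) + 1) d * y ∈ V) : basisSpan m τ (r + 1) ≤ V := by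
  classical
  refine Submodule.span_le.2 fun x hx => ?_
  rw [basisWords] at hx
  obtain ⟨⟨d, y⟩, hp, rfl⟩ := Finset.mem_image.1 (Finset.mem_coe.1 hx)
  rw [Finset.mem_product, Finset.mem_range] at hp
  exact h d hp.1 y (Submodule.subset_span hp.2)

theorem basisSpan_le_succ : basisSpan m τ r ≤ basisSpan m τ (r + 1) := fun y hy => by
  have := tw_mul_mem_basisSpan (d := 0) (by omega) hy
  rwa [tw, one_mul] at this

/-- `x V ⊆ V'`. -/
theorem mul_mem_of_basisSpan_succ {V : Submodule ℂ (Brauer (2 * m) τ)} (x : Brauer (2 * m) τ)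
    (h : ∀ d < 2 * r + 1, ∀ y ∈ basisSpan m τ r,
      x * (tw (2 * m) τ (2 * (m - (r + 1)) + 1) d * y) ∈ V) {y : Brauer (2 * m) τ}
    (hy : y ∈ basisSpan m τ (r + 1)) : x * y ∈ V :=
  basisSpan_succ_le (V := V.comap (LinearMap.mulLeft ℂ x)) h hy

/-- The letters in front of α have indices at least `2 (m - r) + 1` and commute with `e_{2l}`, which
can therefore be pulled out to the left. -/
theorem exists_eq_eN_mul {l : ℕ} (hl : l < m - r) {y : Brauer (2 * m) τ}
    (hy : y ∈ basisSpan m τ r) : ∃ z, y = eN (2 * m) τ (2 * l) * z := by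
  suffices H : basisSpan m τ r ≤ LinearMap.range (LinearMap.mulLeft ℂ (eN (2 * m) τ (2 * l))) by
    obtain ⟨z, hz⟩ := H hy
    exact ⟨z, hz.symm⟩
  clear hy
  induction r with
  | zero =>
    refine Submodule.span_le.2 fun x hx => ?_
    rw [basisWords, Finset.coe_singleton, Set.mem_singleton_iff] at hx
    obtain ⟨z, hz⟩ := exists_alphaN_eq (n := 2 * m) (τ := τ) (show l < m by omega)
    exact ⟨z, by rw [hx, hz]; rfl⟩
  | succ r ih =>
    refine basisSpan_succ_le fun d hd y hy => ?_
    obtain ⟨z, rfl⟩ := ih (by omega) hy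
    refine ⟨tw (2 * m) τ (2 * (m - (r + 1)) + 1) d * z, ?_⟩
    rw [LinearMap.mulLeft_apply, LinearMap.mulLeft_apply, ← mul_assoc, ← mul_assoc,
      (commute_tw fun k hk _ => commute_eN_tN (Or.inl (by omega))).eq]

theorem tw_mul_mem {V : Submodule ℂ (Brauer (2 * m) τ)} {a d : ℕ}
    (h : ∀ i, a ≤ i → i < a + d → ∀ y ∈ V, tN (2 * m) τ i * y ∈ V) {y : Brauer (2 * m) τ}
    (hy : y ∈ V) : tw (2 * m) τ a d * y ∈ V := by
  induction d with
  | zero => rwa [tw, one_mul]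
  | succ d ih =>
    rw [tw, mul_assoc]
    exact h _ (by omega) (by omega) _ (ih fun i h1 h2 => h i h1 (by omega))

/-- Stability under the generators with the indices `≥ a`. -/
def Stable (V : Submodule ℂ (Brauer (2 * m) τ)) (a : ℕ) : Prop :=
  ∀ i, a ≤ i → i < 2 * m - 1 → ∀ y ∈ V, tN (2 * m) τ i * y ∈ V ∧ eN (2 * m) τ i * y ∈ V

section step
variable (hr : r < m) (hS : Stable (basisSpan m τ r) (2 * (m - r)))
include hr hS

/-- Put `a = 2 (m - (r + 1))`. In front of t_{a+d} ⋯ t_{a+1} the generator passes through with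
raised index if `i < a + d`, cancels the leading letter if `i = a + d`, prolongs the word if `i = a
+ d + 1`, and commutes otherwise. After passing, its index is at least `a + 2`, where stability is
known. -/
theorem tN_mul_mem_of_lt {i : ℕ} (h1 : 2 * (m - (r + 1)) < i) (h2 : i < 2 * m - 1)
    {y : Brauer (2 * m) τ} (hy : y ∈ basisSpan m τ (r + 1)) :
    tN (2 * m) τ i * y ∈ basisSpan m τ (r + 1) := by
  refine mul_mem_of_basisSpan_succ _ (fun d hd y hy => ?_) hy
  set a := 2 * (m - (r + 1)) with ha
  have ha' : 2 * (m - r) = a + 2 := by omega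
  rw [ha'] at hS
  rcases lt_trichotomy i (a + d) with h | h | h
  · rw [← mul_assoc, tN_mul_tw (by omega) (by omega) (by omega), mul_assoc]
    exact tw_mul_mem_basisSpan hd (hS _ (by omega) (by omega) _ hy).1
  · obtain ⟨d, rfl⟩ : ∃ d', d = d' + 1 := ⟨d - 1, by omega⟩
    rw [tw, show a + 1 + d = i by omega, mul_assoc, tN_tN_mul]
    exact tw_mul_mem_basisSpan (by omega) hy
  rcases eq_or_ne i (a + d + 1) with rfl | h3
  · have := tw_mul_mem_basisSpan (d := d + 1) (by omega) hy
    rwa [tw, ← ha, mul_assoc, show a + 1 + d = a + d + 1 by omega] at this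
  · rw [← mul_assoc, (commute_tw fun k _ hk => commute_tN_tN (Or.inr (by omega))).eq, mul_assoc]
    exact tw_mul_mem_basisSpan hd (hS _ (by omega) (by omega) _ hy).1

/-- Put `a = 2 (m - (r + 1))`. The generator e_{a+1} commutes with the word of the level below and
meets e_{a+2}; there e_{a+1} e_{a+2} = t_{a+2} t_{a+1} e_{a+2} turns it into a word of the spanning
set. -/
theorem eN_succ_mul_mem (h0 : 0 < r) {y : Brauer (2 * m) τ} (hy : y ∈ basisSpan m τ r) :
    eN (2 * m) τ (2 * (m - (r + 1)) + 1) * y ∈ basisSpan m τ (r + 1) := by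
  have hT : ∀ i, 2 * (m - (r + 1)) < i → i < 2 * m - 1 → ∀ y ∈ basisSpan m τ (r + 1),
    tN (2 * m) τ i * y ∈ basisSpan m τ (r + 1) := fun i h1 h2 y => tN_mul_mem_of_lt hr hS h1 h2
  obtain ⟨r, rfl⟩ : ∃ r', r = r' + 1 := ⟨r - 1, by omega⟩
  refine mul_mem_of_basisSpan_succ _ (fun d hd y hy => ?_) hy
  have hy' := basisSpan_le_succ hy
  obtain ⟨z, hz⟩ := exists_eq_eN_mul (l := m - (r + 1)) (by omega) hy
  set a := 2 * (m - (r + 1 + 1)) with ha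
  have ha' : 2 * (m - (r + 1)) = a + 2 := by omega
  rw [ha'] at hz ⊢
  rw [← mul_assoc, (commute_tw fun k hk _ => commute_eN_tN (Or.inl (by omega))).eq, mul_assoc]
  refine tw_mul_mem (fun i h1 h2 => hT i (by omega) (by omega)) ?_
  have h3 : eN (2 * m) τ (a + 1) * y = tw (2 * m) τ (a + 1) 2 * y := by
    rw [hz, ← mul_assoc, ← tN_tN_eN' (by omega), tw, tw, tw, mul_one, mul_assoc _ _ z]
  rw [h3]
  exact tw_mul_mem_basisSpan (by omega) hy'

/-- With `a = 2 (m - (r + 1))`, what remains are the generators of index `a` and the `e_i`. A factor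
`e_a` stands behind the word, and t_a t_{a+1} e_a = e_{a+1} e_a and e_a t_{a+1} e_a = e_a reduce to
known cases. The other `e_i` are conjugates of `e_a` by exchanges under which the span is already
stable. -/
theorem stable_succ : Stable (basisSpan m τ (r + 1)) (2 * (m - (r + 1))) := by
  have hT : ∀ i, 2 * (m - (r + 1)) < i → i < 2 * m - 1 → ∀ y ∈ basisSpan m τ (r + 1),
    tN (2 * m) τ i * y ∈ basisSpan m τ (r + 1) := fun i h1 h2 y => tN_mul_mem_of_lt hr hS h1 h2
  have hQ := fun h0 y => eN_succ_mul_mem (y := y) hr hS h0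
  have hD := fun y => exists_eq_eN_mul (τ := τ) (m := m) (r := r) (y := y) (l := m - (r + 1)) (by omega)
  set a := 2 * (m - (r + 1)) with ha
  have ha' : 2 * (m - r) = a + 2 := by omega
  rw [ha'] at hS
  have hTa : ∀ y ∈ basisSpan m τ (r + 1), tN (2 * m) τ a * y ∈ basisSpan m τ (r + 1) := by
    intro y hy
    refine mul_mem_of_basisSpan_succ _ (fun d hd y hy => ?_) hy
    obtain ⟨z, hz⟩ := hD y hy
    rw [← ha]
    rcases d with _ | d
    · rw [tw, one_mul, hz, ← mul_assoc, tN_mul_eN (by omega), ← hz]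
      exact basisSpan_le_succ hy
    · rw [tw_succ', ← mul_assoc, ← mul_assoc,
        (commute_tw fun k hk _ => commute_tN_tN (Or.inl (by omega))).eq, mul_assoc, mul_assoc]
      refine tw_mul_mem (fun i h1 h2 => hT i (by omega) (by omega)) ?_
      have : tN (2 * m) τ a * (tN (2 * m) τ (a + 1) * y) = eN (2 * m) τ (a + 1) * y := by
        rw [hz, ← mul_assoc, ← mul_assoc, tN_tN_eN (by omega), mul_assoc]
      rw [this]
      exact hQ (by omega) y hy
  have hEa : ∀ y ∈ basisSpan m τ (r + 1), eN (2 * m) τ a * y ∈ basisSpan m τ (r + 1) := by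
    intro y hy
    refine mul_mem_of_basisSpan_succ _ (fun d hd y hy => ?_) hy
    obtain ⟨z, hz⟩ := hD y hy
    rw [← ha]
    rcases d with _ | d
    · rw [tw, one_mul, hz, ← mul_assoc, eN_sq (by omega), smul_mul_assoc, ← hz]
      exact Submodule.smul_mem _ _ (basisSpan_le_succ hy)
    · rw [tw_succ', ← mul_assoc, ← mul_assoc,
        (commute_tw fun k hk _ => commute_eN_tN (Or.inl (by omega))).eq, mul_assoc, mul_assoc]
      refine tw_mul_mem (fun i h1 h2 => hT i (by omega) (by omega)) ?_
      have : eN (2 * m) τ a * (tN (2 * m) τ (a + 1) * y) = y := by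
        rw [hz, ← mul_assoc, ← mul_assoc, eN_tN_eN (by omega)]
      rw [this]
      exact basisSpan_le_succ hy
  have hT' : ∀ i, a ≤ i → i < 2 * m - 1 → ∀ y ∈ basisSpan m τ (r + 1),
      tN (2 * m) τ i * y ∈ basisSpan m τ (r + 1) := by
    intro i h1 h2 y hy
    rcases eq_or_lt_of_le h1 with rfl | h1
    · exact hTa y hy
    · exact hT i h1 h2 y hy
  intro i h1 h2 y hy
  refine ⟨hT' i h1 h2 y hy, ?_⟩
  induction i, h1 using Nat.le_induction generalizing y with
  | base => exact hEa y hy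
  | succ i h1 ih =>
    rw [eN_succ h2, mul_assoc, mul_assoc, mul_assoc, mul_assoc]
    refine hT' _ h1 (by omega) _ (hT' _ (by omega) h2 _ (ih (by omega) _ ?_))
    exact hT' _ (by omega) h2 _ (hT' _ h1 (by omega) _ hy)

end step

theorem stable_basisSpan (hr : r ≤ m) : Stable (basisSpan m τ r) (2 * (m - r)) := by
  induction r with
  | zero => exact fun i h1 h2 => absurd h2 (by omega)
  | succ r ih => exact stable_succ (by omega) (ih (by omega))

theorem mul_mem_basisSpan (x : Brauer (2 * m) τ) {y : Brauer (2 * m) τ}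
    (hy : y ∈ basisSpan m τ m) : x * y ∈ basisSpan m τ m := by
  obtain ⟨x, rfl⟩ := RingQuot.mkAlgHom_surjective ℂ _ x
  have hS := stable_basisSpan (τ := τ) (le_refl m)
  induction x using FreeAlgebra.induction generalizing y with
  | grade0 c => rw [AlgHom.commutes, ← Algebra.smul_def]; exact Submodule.smul_mem _ _ hy
  | grade1 g =>
    rcases g with i | i
    · have := (hS i (by omega) i.2 y hy).1
      rwa [tN_of_lt i.2] at this
    · have := (hS i (by omega) i.2 y hy).2
      rwa [eN_of_lt i.2] at this
  | mul a b ha hb => rw [map_mul, mul_assoc]; exact ha (hb hy)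
  | add a b ha hb => rw [map_add, add_mul]; exact add_mem (ha hy) (hb hy)

theorem alpha_mem_basisSpan : alpha (2 * m) τ ∈ basisSpan m τ m := by
  have : ∀ r, alpha (2 * m) τ ∈ basisSpan m τ r := by
    intro r
    induction r with
    | zero => exact Submodule.subset_span (by rw [alpha_eq, basisWords]; simp)
    | succ r ih => exact basisSpan_le_succ ih
  exact this m

end basisSpan
end Brauer

/-! ### The number of link patterns -/

theorem factorial_two_mul (m : ℕ) :
    (2 * m).factorial = (∏ k ∈ Finset.range m, (2 * k + 1)) * (2 ^ m * m.factorial) := by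
  induction m with
  | zero => simp
  | succ m ih =>
    rw [Finset.prod_range_succ, show 2 * (m + 1) = 2 * m + 1 + 1 by ring, Nat.factorial_succ,
      Nat.factorial_succ, ih, Nat.factorial_succ]
    ring

/-- Permutations of cycle type 2^m are fixed-point-free involutions, and there are (2m)!/(2^m m!) of
them, which is the product of the odd numbers. The lower bound suffices, since it is compared with
the size of a spanning set. -/
theorem prod_odd_le_card_pattern (m : ℕ) :
    ∏ k ∈ Finset.range m, (2 * k + 1) ≤ Fintype.card (Pattern m) := by
  classical
  have h := Equiv.Perm.card_of_cycleType_mul_eq (Fin (2 * m)) (Multiset.replicate m 2)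
  have hcard : (Finset.univ.filter fun g : Equiv.Perm (Fin (2 * m)) =>
      g.cycleType = Multiset.replicate m 2).card ≤ Fintype.card (Pattern m) := by
    rw [← Finset.card_univ]
    have key : ∀ g : Equiv.Perm (Fin (2 * m)), g.cycleType = Multiset.replicate m 2 →
        (∀ x, g (g x) = x) ∧ ∀ x, g x ≠ x := by
      intro g hg
      have h1 : orderOf g ∣ 2 := by
        rw [← Equiv.Perm.lcm_cycleType, hg]
        exact Multiset.lcm_dvd.2 fun a ha => by rw [Multiset.eq_of_mem_replicate ha]
      have h2 : g.support.card = 2 * m := by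
        rw [← Equiv.Perm.sum_cycleType, hg, Multiset.sum_replicate, smul_eq_mul, mul_comm]
      have h3 : g.support = Finset.univ := by
        rw [← Finset.card_eq_iff_eq_univ, h2, Fintype.card_fin]
      refine ⟨fun x => ?_, fun x => ?_⟩
      · have := orderOf_dvd_iff_pow_eq_one.1 h1
        rw [pow_two] at this
        exact congrArg (fun f : Equiv.Perm (Fin (2 * m)) => f x) this
      · rw [← Equiv.Perm.mem_support, h3]
        exact Finset.mem_univ x
    refine Finset.card_le_card_of_injOn (fun g => if hg : (∀ x, g (g x) = x) ∧ ∀ x, g x ≠ x then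
      (⟨g, hg⟩ : Pattern m) else Pattern.rho m) (fun _ _ => Finset.mem_coe.2 (Finset.mem_univ _)) ?_
    intro g hg g' hg' e
    have hg := key g (Finset.mem_filter.1 (Finset.mem_coe.1 hg)).2
    have hg' := key g' (Finset.mem_filter.1 (Finset.mem_coe.1 hg')).2
    simp only [dif_pos hg, dif_pos hg', Subtype.mk.injEq] at e
    exact Equiv.coe_fn_injective e
  refine le_trans (le_of_eq ?_) hcard
  rw [if_pos ⟨by simp [mul_comm], fun a ha => (Multiset.eq_of_mem_replicate ha).ge⟩] at h
  simp only [Fintype.card_fin, Multiset.sum_replicate, smul_eq_mul, Multiset.prod_replicate] at h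
  rw [mul_comm m 2, Nat.sub_self, Nat.factorial_zero, one_mul] at h
  have h2 : ∏ n ∈ (Multiset.replicate m 2).toFinset, ((Multiset.replicate m 2).count n).factorial
      = m.factorial := by
    rcases m with _ | m
    · simp
    · rw [Multiset.toFinset_replicate]
      simp
  rw [h2, factorial_two_mul] at h
  exact (Nat.eq_of_mul_eq_mul_right (by positivity) h).symm

/-! ### Patterns with twice as many points -/

section extend
variable {m : ℕ}

/-- The generators act at the first half of the points. -/
def castGen (i : Fin (2 * m - 1)) : Fin (2 * (2 * m) - 1) := ⟨i.val, by have := i.2; omega⟩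

/-- The partner of `k` among the pairs `(0, 1), (2, 3), …`. -/
def pairN (k : ℕ) : ℕ := if k % 2 = 0 then k + 1 else k - 1

namespace Pattern

theorem nv_alpha {k : ℕ} (hk : k < 2 * m) : (alpha m).nv k = pairN k := by
  rw [nv_of_lt _ hk, pairN]
  simp only [alpha]
  split_ifs <;> rfl

/-- The points `2 m, …, 4 m - 1` are added to a link pattern and linked as in `α`. -/
def extend (π : Pattern m) : Pattern (2 * m) :=
  ofNat (fun k => if k < 2 * m then π.nv k else pairN k)
    (fun k hk => by
      split_ifs with h
      · have := π.nv_lt h; omega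
      · unfold pairN; split_ifs <;> omega)
    (fun k hk => by
      by_cases h : k < 2 * m
      · rw [if_pos h, if_pos (π.nv_lt h), nv_nv]
      · rw [if_neg h, if_neg (by unfold pairN; split_ifs <;> omega)]
        unfold pairN; split_ifs <;> omega)
    (fun k hk => by
      split_ifs with h
      · exact π.nv_ne h
      · unfold pairN; split_ifs <;> omega)

theorem nv_extend (π : Pattern m) {k : ℕ} (hk : k < 2 * (2 * m)) :
    π.extend.nv k = if k < 2 * m then π.nv k else pairN k := nv_ofNat _ _ _ _ hk

theorem nv_extend_of_lt (π : Pattern m) {k : ℕ} (hk : k < 2 * m) : π.extend.nv k = π.nv k := by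
  rw [nv_extend _ (by omega), if_pos hk]

theorem extend_injective : Function.Injective (extend (m := m)) := fun π σ h =>
  ext_nv fun k hk => by rw [← nv_extend_of_lt π hk, h, nv_extend_of_lt σ hk]

theorem extend_actT (π : Pattern m) (i : Fin (2 * m - 1)) :
    (π.actT i).extend = π.extend.actT (castGen i) := by
  have hi := i.2
  apply ext_nv
  intro k hk
  rw [nv_actT _ _ hk]
  change _ = sN i (π.extend.nv (sN i k))
  rw [nv_extend _ hk]
  by_cases h : k < 2 * m
  · rw [if_pos h, nv_actT _ _ h, nv_extend_of_lt _ (sN_lt (by omega) h)]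
  · have hp : 2 * m ≤ pairN k := by unfold pairN; split_ifs <;> omega
    rw [if_neg h, sN_of_ne (k := k) (by omega) (by omega), nv_extend _ hk, if_neg h,
      sN_of_ne (by omega) (by omega)]

theorem extend_actE (π : Pattern m) (i : Fin (2 * m - 1)) :
    (π.actE i).extend = π.extend.actE (castGen i) := by
  have hi := i.2
  apply ext_nv
  intro k hk
  rw [nv_actE _ _ hk]
  change _ = if k = i.val then i.val + 1 else if k = i.val + 1 then i.val else
      if k = π.extend.nv i then π.extend.nv (i + 1) else if k = π.extend.nv (i + 1) then
        π.extend.nv i else π.extend.nv k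
  rw [nv_extend _ hk, nv_extend_of_lt _ (by omega), nv_extend_of_lt _ (by omega), nv_extend _ hk]
  by_cases h : k < 2 * m
  · rw [if_pos h, nv_actE _ _ h, if_pos h]
  · have h1 := π.nv_lt (k := i) (by omega)
    have h2 := π.nv_lt (k := i + 1) (by omega)
    rw [if_neg h, if_neg (by omega), if_neg (by omega), if_neg (by omega), if_neg (by omega),
      if_neg h]

theorem extend_linked (π : Pattern m) (i : Fin (2 * m - 1)) :
    π.extend.1 (lo (castGen i)) = hi (castGen i) ↔ π.1 (lo i) = hi i := by
  have hi := i.2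
  rw [linked_iff, linked_iff]
  change π.extend.nv i = i + 1 ↔ _
  rw [nv_extend_of_lt _ (by omega)]

/-- The point `k` is linked to `k + 2 m` if `k < 2 s`; the other points are linked as in `α`. -/
def partialRho (m s : ℕ) (hs : s ≤ m) : Pattern (2 * m) :=
  ofNat (fun k => if k < 2 * s then k + 2 * m else if 2 * m ≤ k ∧ k < 2 * m + 2 * s then k - 2 * m
      else pairN k)
    (fun k hk => by unfold pairN; split_ifs <;> omega)
    (fun k hk => by
      by_cases h1 : k < 2 * s
      · rw [if_pos h1, if_neg (by omega), if_pos (by omega)]; omega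
      by_cases h2 : 2 * m ≤ k ∧ k < 2 * m + 2 * s
      · rw [if_neg h1, if_pos h2, if_pos (by omega)]; omega
      rw [if_neg h1, if_neg h2]
      have h3 : ¬ pairN k < 2 * s := by unfold pairN; split_ifs <;> omega
      have h4 : ¬ (2 * m ≤ pairN k ∧ pairN k < 2 * m + 2 * s) := by
        unfold pairN; split_ifs <;> omega
      rw [if_neg h3, if_neg h4]
      unfold pairN; split_ifs <;> omega)
    (fun k hk => by unfold pairN; split_ifs <;> omega)

theorem nv_partialRho {s : ℕ} (hs : s ≤ m) {k : ℕ} (hk : k < 2 * (2 * m)) :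
    (partialRho m s hs).nv k = if k < 2 * s then k + 2 * m else
      if 2 * m ≤ k ∧ k < 2 * m + 2 * s then k - 2 * m else pairN k := nv_ofNat _ _ _ _ hk

theorem partialRho_zero : partialRho m 0 (Nat.zero_le m) = (alpha m).extend := by
  apply ext_nv
  intro k hk
  rw [nv_partialRho _ hk, nv_extend _ hk, if_neg (by omega), if_neg (by omega)]
  split_ifs with h
  · rw [nv_alpha h]
  · rfl

/-- Two long links are replaced by two small ones and no loop is closed, so no power of τ appears.
-/
theorem actE_partialRho {s : ℕ} (hs : s + 1 ≤ m) (i : Fin (2 * (2 * m) - 1)) (hi : i.val = 2 * s) :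
    (partialRho m (s + 1) hs).actE i = partialRho m s (by omega) ∧
      (partialRho m (s + 1) hs).nv i ≠ i + 1 := by
  have e1 : (partialRho m (s + 1) hs).nv i = i + 2 * m := by
    rw [nv_partialRho _ (by omega), if_pos (by omega)]
  have e2 : (partialRho m (s + 1) hs).nv (i + 1) = i + 1 + 2 * m := by
    rw [nv_partialRho _ (by omega), if_pos (by omega)]
  refine ⟨?_, by omega⟩
  apply ext_nv
  intro k hk
  rw [nv_actE _ _ hk, e1, e2, nv_partialRho _ hk, nv_partialRho _ hk, hi]
  unfold pairN
  split_ifs <;> omega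

end Pattern

/-- The inclusion of the link patterns of `2 m` points into those of `4 m` points. -/
def extendMat (m : ℕ) : Matrix (Pattern (2 * m)) (Pattern m) ℂ := monoMat Pattern.extend fun _ => 1

theorem transpose_extendMat_mul : (extendMat m).transpose * extendMat m = 1 := by
  ext π σ
  simp only [Matrix.mul_apply, Matrix.transpose_apply, extendMat, monoMat, Matrix.of_apply,
    ite_mul, one_mul, zero_mul, Finset.sum_ite_eq, Finset.mem_univ, if_true, Matrix.one_apply]
  exact if_congr (by rw [Pattern.extend_injective.eq_iff, eq_comm]) rfl rfl

theorem extendMat_mul_matT (i : Fin (2 * m - 1)) :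
    matT (castGen i) * extendMat m = extendMat m * matT i := by
  simp only [matT_eq, extendMat, monoMat_mul]
  exact monoMat_congr (fun π => (π.extend_actT i).symm) fun _ => rfl

theorem extendMat_mul_matE (τ : ℂ) (i : Fin (2 * m - 1)) :
    matE τ (castGen i) * extendMat m = extendMat m * matE τ i := by
  simp only [matE_eq, extendMat, monoMat_mul]
  refine monoMat_congr (fun π => (π.extend_actE i).symm) fun π => ?_
  rw [mul_one, one_mul]
  exact loopWeight_congr (π.extend_linked i)

end extend

/-! ### The left ideal generated by `α` -/

section ideal
variable {m : ℕ} {τ : ℂ}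

theorem Brauer.induction {n : ℕ} {P : Brauer n τ → Prop} (h0 : ∀ c : ℂ, P (algebraMap ℂ _ c))
    (ht : ∀ i, P (Brauer.t τ i)) (he : ∀ i, P (Brauer.e τ i))
    (hm : ∀ x y, P x → P y → P (x * y)) (ha : ∀ x y, P x → P y → P (x + y)) (x : Brauer n τ) :
    P x := by
  obtain ⟨x, rfl⟩ := RingQuot.mkAlgHom_surjective ℂ _ x
  induction x using FreeAlgebra.induction with
  | grade0 c => rw [AlgHom.commutes]; exact h0 c
  | grade1 g =>
    rcases g with i | i
    · exact ht i
    · exact he i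
  | mul a b ha' hb => rw [map_mul]; exact hm _ _ ha' hb
  | add a b ha' hb => rw [map_add]; exact ha _ _ ha' hb

theorem exists_extend_rep (m : ℕ) (τ : ℂ) :
    ∃ R : Brauer (2 * m) τ →ₐ[ℂ] Matrix (Pattern (2 * m)) (Pattern (2 * m)) ℂ,
      (∀ i, R (Brauer.t τ i) = matT (castGen i)) ∧ ∀ i, R (Brauer.e τ i) = matE τ (castGen i) := by
  have h := isBrauerRep_pattern (2 * m) τ
  refine IsBrauerRep.exists_hom (t := fun i : Fin (2 * m - 1) => matT (castGen i))
    (e := fun i => matE τ (castGen i)) ⟨?_, ?_, ?_, ?_, ?_, ?_, ?_, ?_, ?_, ?_, ?_, ?_⟩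
  · exact fun i j hij => h.braid (castGen i) (castGen j) hij
  · exact fun i j hij => h.tt_comm (castGen i) (castGen j) hij
  · exact fun i j hij => h.ee_comm (castGen i) (castGen j) hij
  · exact fun i j hij => h.te_comm (castGen i) (castGen j) hij
  · exact fun i j hij => h.eee (castGen i) (castGen j) hij
  · exact fun i => h.t_sq (castGen i)
  · exact fun i => h.e_mul_t (castGen i)
  · exact fun i => h.t_mul_e (castGen i)
  · exact fun i => h.e_sq (castGen i)
  · exact fun i j hij => h.ete (castGen i) (castGen j) hij
  · exact fun i j hij => h.tte (castGen i) (castGen j) hij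
  · exact fun i j hij => h.ett (castGen i) (castGen j) hij

/-- On patterns of `2 m` points α acts on its own pattern by τ^m, which is of no use for τ = 0. With
`4 m` points and a starting pattern that joins the two halves, α gives the pattern of α in the first
half with weight 1; hence `x α ↦ x π_α` is induced by a linear map defined on the whole algebra. -/
theorem exists_linearMap (R : Brauer (2 * m) τ →ₐ[ℂ] Matrix (Pattern m) (Pattern m) ℂ)
    (hT : ∀ i, R (Brauer.t τ i) = matT i) (hE : ∀ i, R (Brauer.e τ i) = matE τ i) :
    ∃ L : Brauer (2 * m) τ →ₗ[ℂ] (Pattern m → ℂ), ∀ x,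
      L (x * Brauer.alpha (2 * m) τ) = (R x).mulVec (Pi.single (Pattern.alpha m) 1) := by
  obtain ⟨R', hT', hE'⟩ := exists_extend_rep m τ
  have comm : ∀ x, R' x * extendMat m = extendMat m * R x := by
    intro x
    induction x using Brauer.induction with
    | h0 c =>
      rw [AlgHom.commutes, AlgHom.commutes, Algebra.algebraMap_eq_smul_one,
        Algebra.algebraMap_eq_smul_one, Matrix.smul_mul, Matrix.one_mul, Matrix.mul_smul,
        Matrix.mul_one]
    | ht i => rw [hT', hT, extendMat_mul_matT]
    | he i => rw [hE', hE, extendMat_mul_matE]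
    | hm x y hx hy => rw [map_mul, map_mul, Matrix.mul_assoc, hy, ← Matrix.mul_assoc, hx, Matrix.mul_assoc]
    | ha x y hx hy => rw [map_add, map_add, Matrix.add_mul, hx, hy, Matrix.mul_add]
  have step : ∀ s (hs : s ≤ m), (R' (Brauer.alphaN (2 * m) τ s)).mulVec
      (Pi.single (Pattern.partialRho m s hs) 1) =
      Pi.single (Pattern.partialRho m 0 (Nat.zero_le m)) (1 : ℂ) := by
    intro s
    induction s with
    | zero => intro hs; rw [Brauer.alphaN, List.range_zero, List.map_nil, List.prod_nil, map_one,
        Matrix.one_mulVec]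
    | succ s ih =>
      intro hs
      have hlt : 2 * s < 2 * m - 1 := by omega
      obtain ⟨h1, h2⟩ := Pattern.actE_partialRho hs (castGen ⟨2 * s, hlt⟩) rfl
      rw [Brauer.alphaN_succ, map_mul, ← Matrix.mulVec_mulVec, Brauer.eN_of_lt hlt, hE', matE_eq,
        monoMat_mulVec_single, h1, loopWeight, if_neg ((Pattern.linked_iff _ _).not.2 h2), one_smul,
        ih]
  set v : Pattern (2 * m) → ℂ := Pi.single (Pattern.partialRho m m le_rfl) 1 with hv
  have hα : (R' (Brauer.alpha (2 * m) τ)).mulVec v =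
      (extendMat m).mulVec (Pi.single (Pattern.alpha m) 1) := by
    rw [Brauer.alpha_eq, step, extendMat, monoMat_mulVec_single, one_smul, Pattern.partialRho_zero]
  -- The transpose of the inclusion is a left inverse of it and brings the result back to patterns
  -- of `2 m` points.
  let L : Brauer (2 * m) τ →ₗ[ℂ] (Pattern m → ℂ) :=
    { toFun := fun y => (extendMat m).transpose.mulVec ((R' y).mulVec v)
      map_add' := fun x y => by rw [map_add, Matrix.add_mulVec, Matrix.mulVec_add]
      map_smul' := fun c x => by
        rw [map_smul, Matrix.smul_mulVec, Matrix.mulVec_smul, RingHom.id_apply] }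
  refine ⟨L, fun x => ?_⟩
  change (extendMat m).transpose.mulVec ((R' (x * _)).mulVec v) = _
  rw [map_mul, ← Matrix.mulVec_mulVec, hα, Matrix.mulVec_mulVec, Matrix.mulVec_mulVec, Matrix.mul_assoc,
    comm, ← Matrix.mul_assoc, transpose_extendMat_mul, Matrix.one_mul]

/-- A left ideal `B α` of at most the dimension of `V` that is mapped onto `V`. -/
theorem exists_ideal_equiv_of_surjective {B V : Type*} [Ring B] [Algebra ℂ B] [AddCommGroup V]
    [Module ℂ V] [Module.Finite ℂ V] (α : B) (S : Finset B)
    (hS : ∀ x, x * α ∈ Submodule.span ℂ (S : Set B)) (hcard : S.card ≤ Module.finrank ℂ V)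
    (L : B →ₗ[ℂ] V) (ρ : B → V → V) (v : V) (hL : ∀ x, L (x * α) = ρ x v)
    (hρ : ∀ x y w, ρ (x * y) w = ρ x (ρ y w)) (hone : ρ 1 v = v) (hv : ∀ w, ∃ x, ρ x v = w) :
    ∃ Λ : ↥(Submodule.span B {α}) ≃ₗ[ℂ] V,
      Λ ⟨α, Submodule.mem_span_singleton_self _⟩ = v ∧ ∀ x y, Λ (x • y) = ρ x (Λ y) := by
  have hmem : ∀ y : ↥(Submodule.span B {α}), ∃ x, x * α = y.1 := fun y =>
    Submodule.mem_span_singleton.1 y.2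
  let ι : ↥(Submodule.span B {α}) →ₗ[ℂ] B :=
    { toFun := fun y => y.1
      map_add' := fun _ _ => rfl
      map_smul' := fun _ _ => rfl }
  have hsurj : Function.Surjective (L ∘ₗ ι) := by
    intro w
    obtain ⟨x, hx⟩ := hv w
    exact ⟨⟨x * α, Submodule.mem_span_singleton.2 ⟨x, rfl⟩⟩, (hL x).trans hx⟩
  have hW : ∀ y, ι y ∈ Submodule.span ℂ (S : Set B) := by
    intro y
    obtain ⟨x, hx⟩ := hmem y
    change y.1 ∈ _
    rw [← hx]
    exact hS x
  have : Module.Finite ℂ (Submodule.span ℂ (S : Set B)) :=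
    FiniteDimensional.span_of_finite ℂ (Finset.finite_toSet _)
  have hκ : Function.Injective (LinearMap.codRestrict _ ι hW) := fun x y h =>
    Subtype.ext (congrArg (fun z : ↥(Submodule.span ℂ (S : Set B)) => z.1) h)
  have : Module.Finite ℂ ↥(Submodule.span B {α}) := Module.Finite.of_injective _ hκ
  -- The spanning set bounds the dimension of the ideal from above by that of `V`, the surjection
  -- bounds it from below; so the surjection is bijective.
  have hdim : Module.finrank ℂ ↥(Submodule.span B {α}) = Module.finrank ℂ V :=
    le_antisymm ((LinearMap.finrank_le_finrank_of_injective hκ).trans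
      ((finrank_span_finset_le_card _).trans hcard)) (LinearMap.finrank_le_finrank_of_surjective hsurj)
  have hinj := (LinearMap.injective_iff_surjective_of_finrank_eq_finrank hdim).2 hsurj
  refine ⟨LinearEquiv.ofBijective (L ∘ₗ ι) ⟨hinj, hsurj⟩, ?_, fun x y => ?_⟩
  · have := hL 1
    rw [one_mul, hone] at this
    exact this
  · obtain ⟨z, hz⟩ := hmem y
    change L (x * y.1) = ρ x (L y.1)
    rw [← hz, ← mul_assoc, hL, hL, hρ]

theorem exists_ideal_equiv (m : ℕ) (τ : ℂ) :
    ∃ R : Brauer (2 * m) τ →ₐ[ℂ] Matrix (Pattern m) (Pattern m) ℂ,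
      (∀ i, R (Brauer.t τ i) = matT i) ∧ (∀ i, R (Brauer.e τ i) = matE τ i) ∧
      ∃ L : ↥(Submodule.span (Brauer (2 * m) τ) {Brauer.alpha (2 * m) τ}) ≃ₗ[ℂ]
          (Pattern m → ℂ),
        L ⟨Brauer.alpha (2 * m) τ, Submodule.mem_span_singleton_self _⟩ =
          Pi.single (Pattern.alpha m) 1 ∧
        ∀ x y, L (x • y) = (R x).mulVec (L y) := by
  obtain ⟨R, hT, hE⟩ := (isBrauerRep_pattern m τ).exists_hom
  refine ⟨R, hT, hE, ?_⟩
  obtain ⟨L, hL⟩ := exists_linearMap R hT hE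
  refine exists_ideal_equiv_of_surjective _ (Brauer.basisWords m τ m)
    (fun x => Brauer.mul_mem_basisSpan x Brauer.alpha_mem_basisSpan) ?_ L
    (fun x => (R x).mulVec) _ hL (fun x y w => by rw [map_mul, Matrix.mulVec_mulVec])
    (by rw [map_one, Matrix.one_mulVec]) ?_
  · rw [Module.finrank_pi]
    exact (Brauer.card_basisWords_le m m).trans (prod_odd_le_card_pattern m)
  let Φ : Brauer (2 * m) τ →ₗ[ℂ] (Pattern m → ℂ) :=
    { toFun := fun x => (R x).mulVec (Pi.single (Pattern.alpha m) 1)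
      map_add' := fun x y => by rw [map_add, Matrix.add_mulVec]
      map_smul' := fun c x => by rw [map_smul, Matrix.smul_mulVec, RingHom.id_apply] }
  -- The exchanges connect any two patterns and act on the basis vectors without coefficients, so
  -- the submodule generated by the pattern of α contains every basis vector.
  have iff_rho : ∀ π, (Pi.single π 1 ∈ LinearMap.range Φ) ↔
      Pi.single (Pattern.rho m) 1 ∈ LinearMap.range Φ := by
    have stepT : ∀ π i, Pi.single π 1 ∈ LinearMap.range Φ →
        Pi.single (π.actT i) 1 ∈ LinearMap.range Φ := by
      rintro π i ⟨x, hx⟩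
      refine ⟨Brauer.t τ i * x, ?_⟩
      change (R (Brauer.t τ i * x)).mulVec _ = _
      change (R x).mulVec _ = _ at hx
      rw [map_mul, ← Matrix.mulVec_mulVec, hx, hT, matT_eq, monoMat_mulVec_single, one_smul]
    intro π
    induction π using Pattern.spread_induction with
    | h0 => rfl
    | h1 π j _ ih =>
      rw [← ih]
      exact ⟨fun h => by rw [← π.actT_actT j]; exact stepT _ j h, stepT π j⟩
  have hα : Pi.single (Pattern.alpha m) 1 ∈ LinearMap.range Φ :=
    ⟨1, by change (R 1).mulVec _ = _; rw [map_one, Matrix.one_mulVec]⟩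
  have htop : (⊤ : Submodule ℂ (Pattern m → ℂ)) ≤ LinearMap.range Φ := by
    rw [← (Pi.basisFun ℂ (Pattern m)).span_eq, Submodule.span_le]
    rintro _ ⟨π, rfl⟩
    rw [Pi.basisFun_apply, SetLike.mem_coe, iff_rho, ← iff_rho (Pattern.alpha m)]
    exact hα
  exact fun w => htop (Submodule.mem_top (x := w))

end ideal

end BrauerLimit

end

/-! ### The theorem, assembled from its parts. -/

open BrauerLimit in
theorem mainTheorem7 (m : ℕ) (hm : 0 < m) (b c τ : ℂ) (hc : c ≠ 0) (hτ : τ = 2 * (1 + b / c)) :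
    -- the parameters of the Birman-Wenzl-Murakami algebra in the rational limit
    (Tendsto (fun h : ℂ => parA (Complex.exp (h * b)) (Complex.exp (h * c))) (𝓝[≠] 0) (𝓝 1) ∧
      Tendsto (fun h : ℂ => parEps (Complex.exp (h * c))) (𝓝[≠] 0) (𝓝 0) ∧
      Tendsto (fun h : ℂ => parTau (Complex.exp (h * b)) (Complex.exp (h * c))) (𝓝[≠] 0) (𝓝 τ)) ∧
    -- at the limit parameters the algebra is the Brauer algebra
    (∀ n : ℕ, ∃ Φ : BMW n 1 0 τ ≃ₐ[ℂ] Brauer n τ,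
      (∀ i, Φ (BMW.t 1 0 τ i) = Brauer.t τ i) ∧ ∀ i, Φ (BMW.e 1 0 τ i) = Brauer.e τ i) ∧
    -- limits of representations are representations of the Brauer algebra
    (∀ (n : ℕ) (A : Type u) [Ring A] [Algebra ℂ A] [TopologicalSpace A] [IsTopologicalRing A]
      [ContinuousSMul ℂ A] [T2Space A] (T E : ℂ → Fin (n - 1) → A) (t e : Fin (n - 1) → A),
      (∀ᶠ h in 𝓝[≠] (0 : ℂ),
        ∃ φ : BMW n (parA (Complex.exp (h * b)) (Complex.exp (h * c)))
            (parEps (Complex.exp (h * c)))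
            (parTau (Complex.exp (h * b)) (Complex.exp (h * c))) →ₐ[ℂ] A,
          (∀ i, φ (BMW.t _ _ _ i) = T h i) ∧ ∀ i, φ (BMW.e _ _ _ i) = E h i) →
      (∀ i, Tendsto (fun h => T h i) (𝓝[≠] 0) (𝓝 (t i))) →
      (∀ i, Tendsto (fun h => E h i) (𝓝[≠] 0) (𝓝 (e i))) →
      ∃ φ : Brauer n τ →ₐ[ℂ] A,
        (∀ i, φ (Brauer.t τ i) = t i) ∧ ∀ i, φ (Brauer.e τ i) = e i) ∧
    -- the left ideal generated by `α` is the representation on link patterns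
    (∃ R : Brauer (2 * m) τ →ₐ[ℂ] Matrix (Pattern m) (Pattern m) ℂ,
      (∀ i, R (Brauer.t τ i) = matT i) ∧ (∀ i, R (Brauer.e τ i) = matE τ i) ∧
      ∃ L : ↥(Submodule.span (Brauer (2 * m) τ) {Brauer.alpha (2 * m) τ}) ≃ₗ[ℂ]
          (Pattern m → ℂ),
        L ⟨Brauer.alpha (2 * m) τ, Submodule.mem_span_singleton_self _⟩ =
          Pi.single (Pattern.alpha m) 1 ∧
        ∀ x y, L (x • y) = (R x).mulVec (L y)) ∧
    -- (P) becomes (P')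
    ((∀ x : Fin (2 * m) → ℂ, IsAddWheel (2 * m) b c x ↔
        ∀ᶠ h in 𝓝[≠] (0 : ℂ), IsMulWheel (2 * m) (Complex.exp (h * b)) (Complex.exp (h * c))
          fun i => Complex.exp (2 * h * x i)) ∧
      (∀ (ψ : ℂ → Poly m) (g : ℂ → ℂ) (φ : Poly m),
        (∀ᶠ h in 𝓝[≠] (0 : ℂ), PropP (2 * m) (Complex.exp (h * b)) (Complex.exp (h * c)) (ψ h)) →
        (∀ x : Fin (2 * m) → ℂ,
          Tendsto (fun h => g h * MvPolynomial.eval (fun i => Complex.exp (2 * h * x i)) (ψ h))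
            (𝓝[≠] 0) (𝓝 (MvPolynomial.eval x φ))) →
        PropP' (2 * m) b c φ) ∧
      ∀ x : Fin (2 * m) → ℂ, IsAddWheel (2 * m) b c x ↔
        ∃ i j k : Fin (2 * m), i < j ∧ j < k ∧
          ((x j = x i + b ∧ x k = x i + 2 * b) ∨ (x j = x i + c ∧ x k = x i + c + b) ∨
            (x j = x i + b ∧ x k = x i + c + b))) ∧
    -- the decomposition of `M_n`
    (b ≠ 0 → b ≠ c → b + c ≠ 0 →
      IsLeast (degrees (2 * m) b c) (2 * m * (m - 1)) ∧
      ∀ i : Fin (2 * m - 1),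
        (∀ ψ ∈ spaceM (2 * m) b c, ∃! S : Poly m × Poly m × Poly m,
          (swapPoly i S.1 = S.1 ∧ swapPoly i S.2.1 = S.2.1 ∧ swapPoly i S.2.2 = S.2.2) ∧
          (S.1 ∈ spaceM (2 * m) b c ∧ bP b i * S.2.1 ∈ spaceM (2 * m) b c ∧
            bP b i * (cP c i * S.2.2) ∈ spaceM (2 * m) b c) ∧
          ψ = S.1 + bP b i * (S.2.1 + cP c i * S.2.2)) ∧
        (∀ ψ ∈ spaceM (2 * m) b c, bP b i ∣ ψ →
          (∃ S₁ S₂ : Poly m, swapPoly i S₁ = S₁ ∧ swapPoly i S₂ = S₂ ∧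
            bP b i * S₁ ∈ spaceM (2 * m) b c ∧ bP b i * (cP c i * S₂) ∈ spaceM (2 * m) b c ∧
            ψ = bP b i * (S₁ + cP c i * S₂)) ∧
          ∃ χ ∈ spaceM (2 * m) b c, bP b i ∣ χ ∧ tBar b c i (toRat ψ) = toRat χ)) ∧
    -- the explicit projectors
    (∀ i : Fin (2 * m - 1),
      (∀ f : RatFun m, tPlus b c i f - tMinus b c i f = 2 * f ∧ tBar b c i (tBar b c i f) = f) ∧
      (∀ S₁ S₂ : Poly m, swapPoly i S₁ = S₁ → swapPoly i S₂ = S₂ →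
        tPlus b c i (toRat (bP b i * (S₁ + cP c i * S₂))) = toRat (2 * (bP b i * (cP c i * S₂))) ∧
        tMinus b c i (toRat (bP b i * (S₁ + cP c i * S₂))) = toRat (-2 * (bP b i * S₁))) ∧
      (∀ f : RatFun m, eBar b c i f + eBarCompl b c i f = τ • f ∧
        eBar b c i (eBar b c i f) = τ • eBar b c i f ∧
        swapRat i (eBar b c i f) = eBar b c i f) ∧
      ∀ S₀ S₂ : Poly m, swapPoly i S₀ = S₀ → swapPoly i S₂ = S₂ →
        eBar b c i (toRat (S₀ + bP b i * (cP c i * S₂))) = toRat (τ • S₀) ∧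
        eBarCompl b c i (toRat (S₀ + bP b i * (cP c i * S₂))) =
          toRat (τ • (bP b i * (cP c i * S₂)))) ∧
    -- the dual polynomials
    (∃! F : Pattern m → Poly m, IsDualFamily m b c F) ∧
    ∀ F : Pattern m → Poly m, IsDualFamily m b c F →
      (∀ (i : Fin (2 * m - 1)) (π : Pattern m), π.1 (lo i) ≠ hi i → bP b i ∣ F π) ∧
      (b ≠ 0 → b ≠ c → b + c ≠ 0 →
        LinearIndependent ℂ F ∧ Submodule.span ℂ (Set.range F) = spaceM (2 * m) b c ∧
        ∀ (i : Fin (2 * m - 1)) (π : Pattern m), π.1 (lo i) = hi i →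
          ∃ S₀ S₂ : Poly m, swapPoly i S₀ = S₀ ∧ swapPoly i S₂ = S₂ ∧
            S₀ ∈ spaceM (2 * m) b c ∧ bP b i * (cP c i * S₂) ∈ spaceM (2 * m) b c ∧
            F π = S₀ + bP b i * (cP c i * S₂)) ∧
      -- the duality relation on the line `π_0` of `e_1`
      ∀ o : Fin (2 * m - 1), o.val = 0 →
        ((piZero m).1 (lo o) = hi o ∧
          ∀ k l : Fin (2 * m), 2 ≤ k.val → k.val ≤ m → l.val = k.val + m - 1 →
            (piZero m).1 k = l) ∧
        toRat (F (piZero m)) = fullWord m b c ∧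
        eBar b c o (toRat (F (piZero m))) =
          ∑ π : Pattern m, matE τ o (piZero m) π • toRat (F π) ∧
        eBarCompl b c o (fullWord m b c) +
          (omitSum m b c + tBar b c o (omitSum m b c)) = 0 ∧
        polyS m b c o = toRat (factS m b c) ∧
        swapPoly o (factS m b c) = factS m b c := by
  refine ⟨⟨tendsto_parA, tendsto_parEps, tendsto_parTau hc hτ⟩,
    fun n => exists_bmw_equiv_brauer n τ, ?_, exists_ideal_equiv m τ,
    ⟨isAddWheel_iff_eventually (by omega), propP'_of_tendsto (by omega),
      isAddWheel_iff (by omega)⟩, ?_, projectors hc hτ, ?_, ?_⟩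
  · intro n A _ _ _ _ _ _ T E t e hφ hT hE
    exact exists_hom_of_tendsto hc hτ hφ hT hE
  · intro hb0 hbc hb
    exact ⟨isLeast_degrees hm hc hbc, fun i =>
      ⟨fun ψ hψ => existsUnique_decomposition hm hc hb0 hbc hb i hψ,
        fun ψ hψ hd => exists_decomposition_of_dvd hm hc hbc hψ hd⟩⟩
  · exact ⟨dualPoly b c, isDualFamily_dualPoly, fun F hF => hF.eq⟩
  · intro F hF
    obtain rfl := hF.eq
    refine ⟨fun i π h => bP_dvd_dualPoly fun h' => h ((Pattern.linked_iff _ _).2 h'), ?_, ?_⟩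
    · intro _ hbc hb
      exact ⟨linearIndependent_dualPoly, span_dualPoly hm hc hbc, fun i π h =>
        exists_decomposition_dualPoly hm hc hbc hb h⟩
    · intro o ho
      exact ⟨piZero_links hm ho, toRat_dualPoly_piZero hm, eBar_dualPoly_piZero hm hc hτ ho,
        duality hm hc o ho, polyS_eq hm o ho, swapPoly_factS hm o ho⟩
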